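/- **Setting.** Let $d\ge 4$, $\beta>0$, and let $\mathscr S$ be a finite-dimensional Hilbert space. Put $\mathscr H=\ell^2(\mathbb Z^d)\otimes\mathscr S$; let $\mathscr B_1,\mathscr B_2,\mathscr B$ be the trace-class, Hilbert–Schmidt and bounded operators on $\mathscr H$, with norms $\|\cdot\|_1,\|\cdot\|_2,\|\cdot\|_\infty$, and write $S(x,y)\in\mathscr B(\mathscr S)$ for the matrix elements of $S$. Let $Y=Y^*$ and $W=W^*$ act on $\mathscr S$, with $\|W\|\le1$. *Dispersion law.* $\varepsilon$ is a real function on $\mathbb T^d=\mathbb R^d/(2\pi\mathbb Z)^d$ with $\varepsilon(k)=\varepsilon(-k)$ and no smaller periodicity, which extends to a bounded analytic function in a neighbourhood of $(\mathbb R+i[-\delta_\varepsilon,\delta_\varepsilon])^d$, $\delta_\varepsilon>0$; for no $0\ne v\in\mathbb R^d$ does $v\cdot\nabla\varepsilon$ vanish identically. Put $q_\varepsilon(\gamma)=\sup_{|\Im p|\le\gamma}|\Im\varepsilon(p)|$; $\varepsilon(P)$ is multiplication by $\varepsilon$ in the momentum representation. *Reservoir.* $\omega(q)=|q|$ on $\mathbb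 R^d$, and $\phi(q)=\phi(|q|)\in L^2(\mathbb R^d)$. The function $\hat\psi(\omega)=|\omega|^{d-1}|\phi(|\omega|)|^2\cdot(1-e^{-\beta\omega})^{-1}$ for $\omega>0$, $\hat\psi(\omega)=|\omega|^{d-1}|\phi(|\omega|)|^2\cdot(e^{-\beta\omega}-1)^{-1}$ for $\omega<0$, extends to an analytic function in a neighbourhood of $\mathbb R+i[-\delta_R,\delta_R]$, $\delta_R>0$, that vanishes at $0$ and satisfies $\sup_{|\chi|\le\delta_R}\int_{\mathbb R+i\chi}|\hat\psi(\omega)|\,d\omega<\infty$. Let $a_q,a_q^*$ be bosonic annihilation and creation operators, $H_R=\int|q|\,a_q^*a_q\,dq$, $H_{SR}=\int dq\,\big(e^{iq\cdot X}\otimes W\otimes\phi(q)a_q+e^{-iq\cdot X}\otimes W\otimes\overline{\phi(q)}\,a_q^*\big)$ with $X$ the position operator, and let $\rho$ be the gauge-invariant quasi-free thermal state with $\rho[a^*(f)a(g)]=\langle g,(e^{\beta\omega}-1)^{-1}f\rangle$, $\rho[a(f)a^*(g)]=\langle f,(1+(e^{\beta\omega}-1)^{-1})g\rangle$, also regarded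 as the conditional expectation $S\otimes R\mapsto\rho(R)S$. *Operators.* For $S\in\mathscr B$ let $$\hat{\mathcal L}^\star(t)(S)=-\rho\big(\mathrm{ad}(H_{SR})\,e^{it\,\mathrm{ad}(Y+H_R)}\,\mathrm{ad}(H_{SR})(S\otimes1)\big),\qquad \mathcal L^\star(z)=\int_0^\infty e^{-tz}\hat{\mathcal L}^\star(t)\,dt\quad(\Re z>0),$$ and let $\mathcal L(z)$ be the operator on $\mathscr B_1$ with $\mathrm{Tr}[S\,\mathcal L^\star(z)(S')]=\mathrm{Tr}[\mathcal L(z)(S)\,S']$ for $S\in\mathscr B_1$, $S'\in\mathscr B$. For $\kappa=(\kappa_L,\kappa_R)\in\mathbb C^d\times\mathbb C^d$ put $(\mathcal J_\kappa S)(x,y)=e^{\frac i2\kappa_L\cdot x}S(x,y)e^{-\frac i2\kappa_R\cdot y}$, and $\Re\kappa=(\Re\kappa_L,\Re\kappa_R)$. Below, $\|\cdot\|$ is the norm of $\mathscr B(\mathscr B_2)$. **Proposition.** 1. $\varepsilon(P)$, $\hat{\mathcal L}^\star(t)$ and (for $\Re z>0$) $\mathcal L^\star(z)$, $\mathcal L(z)$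 are well-defined bounded operators on $\mathscr H$, $\mathscr B$, $\mathscr B$, $\mathscr B_1$, respectively. For $\Re z>0$, $\mathcal L(z)$ extends to a bounded operator on $\mathscr B_2$, and as an element of $\mathscr B(\mathscr B_2)$ it has a continuous extension to $\Re z\ge0$. For every $\kappa\in\mathbb C^d\times\mathbb C^d$ and $\Re z\ge 0$, $\mathcal J_\kappa\mathcal L(z)\mathcal J_{-\kappa}=\mathcal L(z)$, and $\sup_{\Re z\ge0}\|\mathcal J_\kappa\mathcal L(z)\mathcal J_{-\kappa}\|<\infty$. 2. The operator $$\mathcal M=-i\,\mathrm{ad}(\varepsilon(P))+\sum_{a\in\mathrm{sp}(\mathrm{ad}(Y))}1_a(\mathrm{ad}(Y))\,\mathcal L(-ia)\,1_a(\mathrm{ad}(Y))$$ is bounded on $\mathscr B_2$, and it maps $\mathscr B_1$ to $\mathscr B_1$, boundedly in $\|\cdot\|_1$. 3. If $|\Im\kappa_L|,|\Im\kappa_R|\le\delta_\varepsilon$, then $\mathcal J_\kappa\mathcal M\mathcal J_{-\kappa}$ and $\mathcal J_\kappa\mathrm{ad}(\varepsilon(P))\mathcal J_{-\kappa}$ are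 bounded on $\mathscr B_2$, $$\mathcal J_\kappa\mathcal M\mathcal J_{-\kappa}-\mathcal M=-i\big[\mathcal J_\kappa\,\mathrm{ad}(\varepsilon(P))\,\mathcal J_{-\kappa}-\mathrm{ad}(\varepsilon(P))\big],$$ $$\big\|\mathcal J_\kappa\mathcal M\mathcal J_{-\kappa}-\mathcal J_{\Re\kappa}\mathcal M\mathcal J_{-\Re\kappa}\big\|\le q_\varepsilon(|\Im\kappa_L|)+q_\varepsilon(|\Im\kappa_R|).$$ In particular $\|\mathcal J_\kappa\mathcal M\mathcal J_{-\kappa}-\mathcal M\|\le q_\varepsilon(|\Im\kappa_L|)+q_\varepsilon(|\Im\kappa_R|)$ when $\Re\kappa=0$. 4. For every $\lambda\in\mathbb R$ the operators $\Lambda_t=e^{t(-i\,\mathrm{ad}(Y)+\lambda^2\mathcal M)}$, $t\ge0$, satisfy $\Lambda_{t_1}\Lambda_{t_2}=\Lambda_{t_1+t_2}$ for $t_1,t_2\ge0$, they map $\mathscr B_1$ boundedly to $\mathscr B_1$, and for every $0\le\rho\in\mathscr B_1$ one has $\Lambda_t\rho\ge0$ and $\mathrm{Tr}\,\Lambda_t\rho=\mathrm{Tr}\,\rho$.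 -/

import Mathlib

open MeasureTheory
open scoped TensorProduct InnerProductSpace ENNReal NNReal

noncomputable section

/-! ### The particle space and its operators -/

/-- The particle Hilbert space `ℓ²(ℤᵈ, 𝒮) = ℓ²(ℤᵈ) ⊗ 𝒮`. -/
abbrev PSpace (d : ℕ) (𝒮 : Type*) [NormedAddCommGroup 𝒮] [InnerProductSpace ℂ 𝒮] : Type _ :=
  lp (fun _ : Fin d → ℤ => 𝒮) 2

/-- The bounded operators on the particle space. -/
abbrev POp (d : ℕ) (𝒮 : Type*) [NormedAddCommGroup 𝒮] [InnerProductSpace ℂ 𝒮] : Type _ :=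
  PSpace d 𝒮 →L[ℂ] PSpace d 𝒮

section Particle

variable {d : ℕ} {𝒮 : Type*} [NormedAddCommGroup 𝒮] [InnerProductSpace ℂ 𝒮]

/-- The matrix element `T(x,y) ∈ B(𝒮)` of a bounded operator `T` in the position representation. -/
def kernelOf (T : POp d 𝒮) (x y : Fin d → ℤ) : 𝒮 →L[ℂ] 𝒮 :=
  (lp.evalCLM ℂ (fun _ : Fin d → ℤ => 𝒮) 2 x).comp
    (T.comp (lp.singleContinuousLinearMap ℂ (fun _ : Fin d → ℤ => 𝒮) 2 y))

open Classical in
/-- The bounded operator with a given kernel, if there is one (it is then unique). -/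
def opOfKernel (K : (Fin d → ℤ) → (Fin d → ℤ) → (𝒮 →L[ℂ] 𝒮)) : POp d 𝒮 :=
  if h : ∃ T : POp d 𝒮, ∀ x y, kernelOf T x y = K x y then h.choose else 0

theorem memlp_onSites (B : 𝒮 →L[ℂ] 𝒮) (f : PSpace d 𝒮) : Memℓp (fun x => B (f x)) 2 := by
  refine (lp.memℓp ((‖B‖ : ℂ) • f)).mono' (fun x => ?_)
  have h := B.le_opNorm (f x)
  rw [lp.coeFn_smul, Pi.smul_apply, norm_smul, Complex.norm_real, norm_norm]
  exact h

theorem norm_onSites_le (B : 𝒮 →L[ℂ] 𝒮) (f : PSpace d 𝒮) :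
    ‖(⟨fun x => B (f x), memlp_onSites B f⟩ : PSpace d 𝒮)‖ ≤ ‖B‖ * ‖f‖ := by
  have h := lp.norm_mono (p := 2) (by norm_num)
    (x := (⟨fun x => B (f x), memlp_onSites B f⟩ : PSpace d 𝒮)) (y := ((‖B‖ : ℂ) • f))
    (fun x => by
      have h := B.le_opNorm (f x)
      rw [lp.coeFn_smul, Pi.smul_apply, norm_smul, Complex.norm_real, norm_norm]
      exact h)
  rwa [norm_smul, Complex.norm_real, norm_norm] at h

/-- `1 ⊗ B` on `ℓ²(ℤᵈ) ⊗ 𝒮`, for `B ∈ B(𝒮)`: it acts sitewise. -/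
def onSites (B : 𝒮 →L[ℂ] 𝒮) : POp d 𝒮 :=
  LinearMap.mkContinuous
    { toFun := fun f => ⟨fun x => B (f x), memlp_onSites B f⟩
      map_add' := fun f g => by
        apply lp.ext; funext x; exact map_add B (f x) (g x)
      map_smul' := fun c f => by
        apply lp.ext; funext x; exact map_smul B c (f x) }
    ‖B‖ (fun f => norm_onSites_le B f)

end Particle
theorem memlp_two_iff {ι E : Type*} [NormedAddCommGroup E] (f : ι → E) :
    Memℓp f 2 ↔ ∑' i, ENNReal.ofReal (‖f i‖ ^ 2) ≠ ⊤ := by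
  rw [memℓp_gen_iff (by norm_num)]
  constructor
  · intro h
    have h' : Summable fun i => ‖f i‖ ^ 2 := by simpa using h
    exact h'.tsum_ofReal_ne_top
  · intro h
    have h' := ENNReal.summable_toReal h
    simpa [ENNReal.toReal_ofReal (sq_nonneg _)] using h'

section HilbertSchmidtFacts

variable {ι E : Type*} [NormedAddCommGroup E] [InnerProductSpace ℂ E]

theorem HilbertBasis.ofReal_norm_sq (b : HilbertBasis ι ℂ E) (v : E) :
    ENNReal.ofReal (‖v‖ ^ 2) = ∑' j, ENNReal.ofReal (‖⟪b j, v⟫_ℂ‖ ^ 2) := by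
  have h := b.hasSum_inner_mul_inner v v
  have h' : HasSum (fun j => ‖⟪b j, v⟫_ℂ‖ ^ 2) (‖v‖ ^ 2) := by
    have h2 := Complex.hasSum_re h
    rw [inner_self_eq_norm_sq_to_K] at h2
    convert h2 using 1
    · funext j
      rw [← inner_conj_symm v (b j), Complex.conj_mul', ← Complex.ofReal_pow, Complex.ofReal_re]
    · norm_cast
  rw [← h'.tsum_eq, ENNReal.ofReal_tsum_of_nonneg (fun _ => by positivity) h'.summable]

theorem HilbertBasis.tsum_adjoint [CompleteSpace E] (b : HilbertBasis ι ℂ E) (T : E →L[ℂ] E) :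
    ∑' i, ENNReal.ofReal (‖T (b i)‖ ^ 2)
      = ∑' i, ENNReal.ofReal (‖ContinuousLinearMap.adjoint T (b i)‖ ^ 2) := by
  simp_rw [b.ofReal_norm_sq]
  rw [ENNReal.tsum_comm]
  refine tsum_congr fun i => tsum_congr fun j => ?_
  rw [ContinuousLinearMap.adjoint_inner_right, norm_inner_symm]

theorem HilbertBasis.tsum_lmul_le (b : HilbertBasis ι ℂ E) (A T : E →L[ℂ] E) :
    ∑' i, ENNReal.ofReal (‖(A * T) (b i)‖ ^ 2)
      ≤ ENNReal.ofReal (‖A‖ ^ 2) * ∑' i, ENNReal.ofReal (‖T (b i)‖ ^ 2) := by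
  rw [← ENNReal.tsum_mul_left]
  refine ENNReal.tsum_le_tsum fun i => ?_
  rw [← ENNReal.ofReal_mul (by positivity), ← mul_pow]
  exact ENNReal.ofReal_le_ofReal (pow_le_pow_left₀ (norm_nonneg _) (A.le_opNorm _) 2)

theorem HilbertBasis.tsum_rmul_le [CompleteSpace E] (b : HilbertBasis ι ℂ E) (A T : E →L[ℂ] E) :
    ∑' i, ENNReal.ofReal (‖(T * A) (b i)‖ ^ 2)
      ≤ ENNReal.ofReal (‖A‖ ^ 2) * ∑' i, ENNReal.ofReal (‖T (b i)‖ ^ 2) := by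
  have h := b.tsum_lmul_le (ContinuousLinearMap.adjoint A) (ContinuousLinearMap.adjoint T)
  rw [LinearIsometryEquiv.norm_map, ← b.tsum_adjoint T] at h
  rw [b.tsum_adjoint (T * A)]
  have e : ContinuousLinearMap.adjoint (T * A)
      = ContinuousLinearMap.adjoint A * ContinuousLinearMap.adjoint T :=
    ContinuousLinearMap.adjoint_comp T A
  rw [e]
  exact h

end HilbertSchmidtFacts

/-- The absolute value `|T| = (T* T)^(1/2)` of a bounded operator on a Hilbert space. -/
def opAbs {E : Type*} [NormedAddCommGroup E] [InnerProductSpace ℂ E] [CompleteSpace E]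
    (T : E →L[ℂ] E) : E →L[ℂ] E := CFC.abs T

section HilbertSchmidt

variable (d : ℕ) (𝒮 : Type*) [NormedAddCommGroup 𝒮] [InnerProductSpace ℂ 𝒮]
  [FiniteDimensional ℂ 𝒮]

/-- The index set of the standard orthonormal basis of `ℓ²(ℤᵈ, 𝒮)`. -/
abbrev SiteIdx : Type := (Fin d → ℤ) × Fin (Module.finrank ℂ 𝒮)

/-- The vector `δ_x ⊗ b_j`, where `b` is a fixed orthonormal basis of `𝒮`. -/
def siteVec (i : SiteIdx d 𝒮) : PSpace d 𝒮 := lp.single 2 i.1 (stdOrthonormalBasis ℂ 𝒮 i.2)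

theorem siteVec_orthonormal : Orthonormal ℂ (siteVec d 𝒮) := by
  classical
  rw [orthonormal_iff_ite]
  rintro ⟨x, j⟩ ⟨y, k⟩
  have h := orthonormal_iff_ite.mp (stdOrthonormalBasis ℂ 𝒮).orthonormal j k
  unfold siteVec
  rw [lp.inner_single_left]
  by_cases hxy : x = y
  · subst hxy
    simpa using h
  · simp [hxy]

theorem siteVec_span :
    (Submodule.span ℂ (Set.range (siteVec d 𝒮)))ᗮ = ⊥ := by
  classical
  rw [Submodule.eq_bot_iff]
  intro f hf
  apply lp.ext
  funext x
  refine InnerProductSpace.ext_inner_left_basis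
    (stdOrthonormalBasis ℂ 𝒮).toBasis (fun j => ?_)
  have h := (Submodule.mem_orthogonal _ f).mp hf (siteVec d 𝒮 (x, j))
    (Submodule.subset_span ⟨_, rfl⟩)
  unfold siteVec at h
  rw [lp.inner_single_left] at h
  simpa using h

variable [CompleteSpace 𝒮]

/-- The standard orthonormal basis `δ_x ⊗ b_j` of the particle space. -/
def siteBasis : HilbertBasis (SiteIdx d 𝒮) ℂ (PSpace d 𝒮) :=
  HilbertBasis.mkOfOrthogonalEqBot (siteVec_orthonormal d 𝒮) (siteVec_span d 𝒮)

/-- The Hilbert-Schmidt operators, `Tr (T* T) = ∑ᵢ ‖T eᵢ‖² < ∞`, as a space of bounded operators. -/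
def hsSubmodule : Submodule ℂ (POp d 𝒮) where
  carrier := {T | Memℓp (fun i => T (siteBasis d 𝒮 i)) 2}
  zero_mem' := by
    exact (zero_memℓp : Memℓp (0 : SiteIdx d 𝒮 → PSpace d 𝒮) 2)
  add_mem' := fun {_ _} hS hT => Memℓp.add hS hT
  smul_mem' := fun c _ hT => Memℓp.const_smul hT c

/-- The space `B₂` of Hilbert-Schmidt operators on the particle space. -/
def HSOp : Type _ := hsSubmodule d 𝒮

instance : AddCommGroup (HSOp d 𝒮) := inferInstanceAs (AddCommGroup (hsSubmodule d 𝒮))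
instance : Module ℂ (HSOp d 𝒮) := inferInstanceAs (Module ℂ (hsSubmodule d 𝒮))

variable {d 𝒮}

/-- A Hilbert-Schmidt operator as a bounded operator. -/
def HSOp.op : HSOp d 𝒮 →ₗ[ℂ] POp d 𝒮 := (hsSubmodule d 𝒮).subtype

theorem HSOp.op_injective : Function.Injective (HSOp.op : HSOp d 𝒮 → POp d 𝒮) :=
  Subtype.val_injective

/-- The map `S ↦ (S eᵢ)ᵢ`, used to define the Hilbert-Schmidt norm. -/
def HSOp.columns : HSOp d 𝒮 →ₗ[ℂ] lp (fun _ : SiteIdx d 𝒮 => PSpace d 𝒮) 2 where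
  toFun S := ⟨fun i => HSOp.op S (siteBasis d 𝒮 i), S.2⟩
  map_add' _ _ := rfl
  map_smul' _ _ := rfl

theorem HSOp.columns_injective :
    Function.Injective (HSOp.columns : HSOp d 𝒮 →ₗ[ℂ] _) := by
  intro S T h
  apply HSOp.op_injective
  refine ContinuousLinearMap.ext_on
    (Submodule.dense_iff_topologicalClosure_eq_top.mpr (siteBasis d 𝒮).dense_span) ?_
  rintro _ ⟨i, rfl⟩
  exact congrFun (congrArg Subtype.val h) i

/-- The Hilbert-Schmidt norm `‖S‖₂ = (∑ᵢ ‖S eᵢ‖²)^(1/2) = (Tr S* S)^(1/2)`. -/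
instance : NormedAddCommGroup (HSOp d 𝒮) :=
  NormedAddCommGroup.induced _ _ HSOp.columns HSOp.columns_injective

instance : NormedSpace ℂ (HSOp d 𝒮) :=
  NormedSpace.induced ℂ (HSOp d 𝒮) _ HSOp.columns

theorem HSOp.ofReal_norm_sq (S : HSOp d 𝒮) :
    ENNReal.ofReal (‖S‖ ^ 2) = ∑' i, ENNReal.ofReal (‖HSOp.op S (siteBasis d 𝒮 i)‖ ^ 2) := by
  have h : ‖S‖ = ‖HSOp.columns S‖ := rfl
  have h2 := lp.norm_rpow_eq_tsum (p := 2) (by norm_num) (HSOp.columns S)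
  have h3 := (lp.memℓp (HSOp.columns S)).summable (p := 2) (by norm_num)
  simp only [ENNReal.toReal_ofNat, Real.rpow_ofNat] at h2 h3
  rw [h, h2, ENNReal.ofReal_tsum_of_nonneg (fun _ => by positivity) h3]
  rfl

theorem HSOp.norm_le_of_tsum {S T : HSOp d 𝒮} {c : ℝ} (hc : 0 ≤ c)
    (h : ∑' i, ENNReal.ofReal (‖HSOp.op S (siteBasis d 𝒮 i)‖ ^ 2)
      ≤ ENNReal.ofReal (c ^ 2) * ∑' i, ENNReal.ofReal (‖HSOp.op T (siteBasis d 𝒮 i)‖ ^ 2)) :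
    ‖S‖ ≤ c * ‖T‖ := by
  rw [← HSOp.ofReal_norm_sq, ← HSOp.ofReal_norm_sq, ← ENNReal.ofReal_mul (by positivity),
    ← mul_pow, ENNReal.ofReal_le_ofReal_iff (by positivity)] at h
  exact le_of_sq_le_sq h (by positivity)

theorem hsSubmodule_lmul (A : POp d 𝒮) {T : POp d 𝒮} (hT : T ∈ hsSubmodule d 𝒮) :
    A * T ∈ hsSubmodule d 𝒮 :=
  (memlp_two_iff _).mpr (ne_top_of_le_ne_top
    (ENNReal.mul_ne_top ENNReal.ofReal_ne_top ((memlp_two_iff _).mp hT))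
    ((siteBasis d 𝒮).tsum_lmul_le A T))

theorem hsSubmodule_rmul (A : POp d 𝒮) {T : POp d 𝒮} (hT : T ∈ hsSubmodule d 𝒮) :
    T * A ∈ hsSubmodule d 𝒮 :=
  (memlp_two_iff _).mpr (ne_top_of_le_ne_top
    (ENNReal.mul_ne_top ENNReal.ofReal_ne_top ((memlp_two_iff _).mp hT))
    ((siteBasis d 𝒮).tsum_rmul_le A T))

/-- `S ↦ A S` on the Hilbert-Schmidt operators. -/
def hsLeft (A : POp d 𝒮) : HSOp d 𝒮 →L[ℂ] HSOp d 𝒮 :=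
  LinearMap.mkContinuous
    { toFun := fun S => ⟨A * HSOp.op S, hsSubmodule_lmul A S.2⟩
      map_add' := fun S T => HSOp.op_injective (mul_add A (HSOp.op S) (HSOp.op T))
      map_smul' := fun c S => HSOp.op_injective (mul_smul_comm c A (HSOp.op S)) }
    ‖A‖ (fun S => HSOp.norm_le_of_tsum (norm_nonneg A)
      ((siteBasis d 𝒮).tsum_lmul_le A (HSOp.op S)))

/-- `S ↦ S A` on the Hilbert-Schmidt operators. -/
def hsRight (A : POp d 𝒮) : HSOp d 𝒮 →L[ℂ] HSOp d 𝒮 :=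
  LinearMap.mkContinuous
    { toFun := fun S => ⟨HSOp.op S * A, hsSubmodule_rmul A S.2⟩
      map_add' := fun S T => HSOp.op_injective (add_mul (HSOp.op S) (HSOp.op T) A)
      map_smul' := fun c S => HSOp.op_injective (smul_mul_assoc c (HSOp.op S) A) }
    ‖A‖ (fun S => HSOp.norm_le_of_tsum (norm_nonneg A)
      ((siteBasis d 𝒮).tsum_rmul_le A (HSOp.op S)))

/-- `ad(A) S = A S - S A` on the Hilbert-Schmidt operators. -/
def hsAd (A : POp d 𝒮) : HSOp d 𝒮 →L[ℂ] HSOp d 𝒮 := hsLeft A - hsRight A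

/-- The trace `Tr T = ∑ᵢ ⟨eᵢ, T eᵢ⟩` (meaningful for trace-class `T`). -/
def opTrace (T : POp d 𝒮) : ℂ := ∑' i, ⟪siteBasis d 𝒮 i, T (siteBasis d 𝒮 i)⟫_ℂ

/-- The trace norm `‖T‖₁ = Tr |T| = Tr (T* T)^(1/2)`, with value `∞` if `T` is not trace-class. -/
def traceNorm (T : POp d 𝒮) : ℝ≥0∞ :=
  ∑' i, ENNReal.ofReal (⟪siteBasis d 𝒮 i, opAbs T (siteBasis d 𝒮 i)⟫_ℂ).re

/-- Membership in the space `B₁` of trace-class operators. -/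
def IsTraceClass (T : POp d 𝒮) : Prop := traceNorm T < ⊤

end HilbertSchmidt

/-! ### The reservoir: creation and annihilation operators and the thermal state -/

section Reservoir

/-- Square-integrable functions of the momentum `q ∈ ℝᵈ`, representing the vectors of the
one-particle reservoir space `L²(ℝᵈ)`. -/
abbrev OneParticle (d : ℕ) : Type :=
  {f : EuclideanSpace ℝ (Fin d) → ℂ // MemLp f 2 volume}

variable {d : ℕ}

/-- Multiplication of a one-particle vector by the phase `e^{iθ(q)}`. -/
def phaseMul (θ : EuclideanSpace ℝ (Fin d) → ℝ) (hθ : Continuous θ) (f : OneParticle d) :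
    OneParticle d :=
  ⟨fun q => Complex.exp (Complex.I * θ q) * f.1 q, by
    refine f.2.of_le ?_ (Filter.Eventually.of_forall fun q => ?_)
    · exact (Continuous.aestronglyMeasurable (by fun_prop)).mul f.2.1
    · rw [norm_mul, mul_comm Complex.I, Complex.norm_exp_ofReal_mul_I, one_mul]⟩

/-- The free one-particle evolution `e^{itω}` for the dispersion law `ω(q) = |q|`. -/
def freeEvolve (t : ℝ) (f : OneParticle d) : OneParticle d :=
  phaseMul (fun q => t * ‖q‖) (by fun_prop) f

/-- The vector `q ↦ e^{-iq·x} f(q)`, for a lattice site `x`. -/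
def planeWaveMul (x : Fin d → ℤ) (f : OneParticle d) : OneParticle d :=
  phaseMul (fun q => -∑ j, q j * (x j : ℝ)) (by fun_prop) f

variable (d) in
/-- The symbols `a(f)` and `a*(f)`. -/
inductive FieldSym : Type
  | ann (f : OneParticle d) : FieldSym
  | cre (f : OneParticle d) : FieldSym

variable (d) in
/-- Polynomials in the (non-commuting) creation and annihilation operators. The commutation
relations enter through the values of the thermal state. -/
abbrev FieldAlg : Type := FreeAlgebra ℂ (FieldSym d)

/-- The Heisenberg evolution `e^{it ad(H_R)}` of the free reservoir, the automorphism given by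
`a(f) ↦ a(e^{itω} f)` and `a*(f) ↦ a*(e^{itω} f)`. -/
def reservoirEvolve (t : ℝ) : FieldAlg d →ₐ[ℂ] FieldAlg d :=
  FreeAlgebra.lift ℂ (fun
    | FieldSym.ann f => FreeAlgebra.ι ℂ (FieldSym.ann (freeEvolve t f))
    | FieldSym.cre f => FreeAlgebra.ι ℂ (FieldSym.cre (freeEvolve t f)))

/-- The thermal density `(e^{βω(q)} - 1)⁻¹`, the multiplication operator `T_β`. -/
def thermalDensity (β : ℝ) (q : EuclideanSpace ℝ (Fin d)) : ℝ := (Real.exp (β * ‖q‖) - 1)⁻¹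

/-- The two-point function of the thermal state: `ρ[a*(f) a(g)] = ⟨g, T_β f⟩`,
`ρ[a(f) a*(g)] = ⟨f, (1 + T_β) g⟩`, and `ρ[a a] = ρ[a* a*] = 0`. -/
def twoPoint (β : ℝ) : FieldSym d → FieldSym d → ℂ
  | FieldSym.cre f, FieldSym.ann g =>
      ∫ q, (starRingEnd ℂ) (g.1 q) * (thermalDensity β q : ℂ) * f.1 q
  | FieldSym.ann f, FieldSym.cre g =>
      ∫ q, (starRingEnd ℂ) (f.1 q) * (1 + (thermalDensity β q : ℂ)) * g.1 q
  | FieldSym.ann _, FieldSym.ann _ => 0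
  | FieldSym.cre _, FieldSym.cre _ => 0

open Classical in
/-- Wick's rule on a monomial: the sum over all pairings of the letters of the product over the
pairs of the two-point functions, the letters of a pair being kept in their order. A pairing is a
fixed-point-free involution; there is none if the number of letters is odd. -/
def wickMonomial (β : ℝ) (w : List (FieldSym d)) : ℂ :=
  ∑ π : Equiv.Perm (Fin w.length) with (∀ i, π (π i) = i ∧ π i ≠ i),
    ∏ i with i < π i, twoPoint β (w.get i) (w.get (π i))

/-- The gauge-invariant quasi-free thermal state of the reservoir at inverse temperature `β`. -/
def thermalState (β : ℝ) : FieldAlg d →ₗ[ℂ] ℂ :=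
  (FreeAlgebra.basisFreeMonoid ℂ (FieldSym d)).constr ℂ (fun w => wickMonomial β w.toList)

end Reservoir

/-! ### The model -/

/-- The data of the model: a (complexified) dispersion law `disp` of the particle, the Hamiltonian
`Y` of the internal degrees of freedom, the coupling matrix `W`, the inverse temperature `β`, and
the radial profile `ff` of the form factor `φ(q) = ff |q|`, with `φ ∈ L²(ℝᵈ)`. -/
structure ParticleReservoir (d : ℕ) (𝒮 : Type*) [NormedAddCommGroup 𝒮] [InnerProductSpace ℂ 𝒮]
    [CompleteSpace 𝒮] where
  disp : (Fin d → ℂ) → ℂ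
  Y : 𝒮 →L[ℂ] 𝒮
  isSelfAdjoint_Y : IsSelfAdjoint Y
  W : 𝒮 →L[ℂ] 𝒮
  isSelfAdjoint_W : IsSelfAdjoint W
  norm_W_le : ‖W‖ ≤ 1
  β : ℝ
  β_pos : 0 < β
  ff : ℝ → ℂ
  memLp_ff : MemLp (fun q : EuclideanSpace ℝ (Fin d) => ff ‖q‖) 2 volume

/-- `|Im p| = (∑ⱼ (Im pⱼ)²)^(1/2)`, the Euclidean norm of the imaginary part of `p ∈ ℂᵈ`. -/
def imNorm {d : ℕ} (p : Fin d → ℂ) : ℝ := Real.sqrt (∑ j, (p j).im ^ 2)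

/-- A real vector as a complex vector. -/
def toComplexVec {d : ℕ} (k : Fin d → ℝ) : Fin d → ℂ := fun j => (k j : ℂ)

/-- The real part of a complex vector, as a complex vector. -/
def rePart {d : ℕ} (κ : Fin d → ℂ) : Fin d → ℂ := fun j => ((κ j).re : ℂ)

namespace ParticleReservoir

variable {d : ℕ} {𝒮 : Type*} [NormedAddCommGroup 𝒮] [InnerProductSpace ℂ 𝒮] [CompleteSpace 𝒮]

/-- The dispersion law is a real symmetric `(2πℤ)ᵈ`-periodic function on `ℝᵈ` which extends to an
analytic bounded function on a neighbourhood of `(ℝ + i[-δ, δ])ᵈ`; it is not constant in any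
direction and has no smaller periodicity. -/
structure AnalyticDispersion (m : ParticleReservoir d 𝒮) (δ : ℝ) : Prop where
  pos : 0 < δ
  analytic : AnalyticOnNhd ℂ m.disp {p | ∀ j, |(p j).im| ≤ δ}
  bounded : ∃ C : ℝ, ∀ p : Fin d → ℂ, (∀ j, |(p j).im| ≤ δ) → ‖m.disp p‖ ≤ C
  real : ∀ k : Fin d → ℝ, (m.disp (toComplexVec k)).im = 0
  symm : ∀ k : Fin d → ℝ, m.disp (toComplexVec (-k)) = m.disp (toComplexVec k)
  nondegenerate : ∀ v : Fin d → ℝ, v ≠ 0 →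
    ∃ k : Fin d → ℝ, fderiv ℂ m.disp (toComplexVec k) (toComplexVec v) ≠ 0
  period : ∀ z : Fin d → ℝ,
    (∀ k : Fin d → ℝ, m.disp (toComplexVec k) = m.disp (toComplexVec (z + k))) ↔
      ∃ n : Fin d → ℤ, ∀ j, z j = 2 * Real.pi * n j

/-- `q_ε(γ) = sup_{|Im p| ≤ γ} |Im ε(p)|`. -/
def qDisp (m : ParticleReservoir d 𝒮) (γ : ℝ) : ℝ :=
  sSup {r | ∃ p : Fin d → ℂ, imNorm p ≤ γ ∧ r = |(m.disp p).im|}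

/-- The effective squared form factor `ψ̂(ω)`. -/
def effFormFactor (m : ParticleReservoir d 𝒮) (ω : ℝ) : ℝ :=
  |ω| ^ (d - 1) * ((if 0 ≤ ω then 1 / (1 - Real.exp (-m.β * ω))
    else 1 / (Real.exp (-m.β * ω) - 1)) * ‖m.ff |ω|‖ ^ 2)

/-- `ψ̂` has an analytic extension `G` to a neighbourhood of the strip `ℝ + i[-δ, δ]`, vanishing at
`0`, whose `L¹` norms on the horizontal lines of the strip are uniformly bounded. (At `ω = 0` the
formula for `ψ̂` is undefined, so that `ψ̂(0) = 0` is a condition on the extension.) -/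
structure AnalyticFormFactor (m : ParticleReservoir d 𝒮) (δ : ℝ) : Prop where
  pos : 0 < δ
  extension : ∃ G : ℂ → ℂ, AnalyticOnNhd ℂ G {z | |z.im| ≤ δ} ∧
    (∀ ω : ℝ, ω ≠ 0 → G ω = m.effFormFactor ω) ∧ G 0 = 0 ∧
    ∃ C : ℝ≥0, ∀ χ : ℝ, |χ| ≤ δ → ∫⁻ ω : ℝ, ‖G (ω + χ * Complex.I)‖ₑ ≤ C

/-- The kernel `ε̂(x-y) = (2π)⁻ᵈ ∫_{[-π,π]ᵈ} ε(k) e^{ik·(x-y)} dk` of the kinetic energy. -/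
def kineticKernel (m : ParticleReservoir d 𝒮) (x y : Fin d → ℤ) : 𝒮 →L[ℂ] 𝒮 :=
  (((2 * Real.pi : ℂ) ^ d)⁻¹ *
    ∫ k in Set.Icc (fun _ : Fin d => -Real.pi) (fun _ => Real.pi),
      m.disp (toComplexVec k) * Complex.exp (Complex.I * ∑ j, (k j : ℂ) * ((x j - y j : ℤ) : ℂ))) •
    ContinuousLinearMap.id ℂ 𝒮

/-- The operator `ε(P) ⊗ 1`, multiplication by `ε(k)` in the momentum representation. -/
def kineticOp (m : ParticleReservoir d 𝒮) : POp d 𝒮 := opOfKernel m.kineticKernel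

/-- The vector `q ↦ conj(φ(q)) e^{-iq·x}` of `L²(ℝᵈ)`. -/
def siteFormFactor (m : ParticleReservoir d 𝒮) (x : Fin d → ℤ) : OneParticle d :=
  planeWaveMul x ⟨fun q => star (m.ff ‖q‖), m.memLp_ff.star⟩

/-- The field `∫ dq (φ(q) e^{iq·x} a_q + conj(φ(q)) e^{-iq·x} a*_q)` at the site `x`. -/
def siteField (m : ParticleReservoir d 𝒮) (x : Fin d → ℤ) : FieldAlg d :=
  FreeAlgebra.ι ℂ (FieldSym.ann (m.siteFormFactor x)) +
    FreeAlgebra.ι ℂ (FieldSym.cre (m.siteFormFactor x))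

/-! Operators on the particle space with coefficients in the field algebra are written through
their matrix elements, functions of two sites with values in `B(𝒮) ⊗ FieldAlg`. In this
representation `H_SR` is the diagonal matrix with entries `W ⊗ siteField x`. -/

/-- `ad(H_SR)` on matrices with entries in `B(𝒮) ⊗ FieldAlg`. -/
def adCoupling (m : ParticleReservoir d 𝒮)
    (K : (Fin d → ℤ) → (Fin d → ℤ) → (𝒮 →L[ℂ] 𝒮) ⊗[ℂ] FieldAlg d) (x y : Fin d → ℤ) :
    (𝒮 →L[ℂ] 𝒮) ⊗[ℂ] FieldAlg d :=
  (m.W ⊗ₜ[ℂ] m.siteField x) * K x y - K x y * (m.W ⊗ₜ[ℂ] m.siteField y)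

/-- `B ↦ e^{itY} B e^{-itY}` on `B(𝒮)`. -/
def internalEvolve (m : ParticleReservoir d 𝒮) (t : ℝ) : (𝒮 →L[ℂ] 𝒮) →ₗ[ℂ] (𝒮 →L[ℂ] 𝒮) :=
  LinearMap.mulLeft ℂ (NormedSpace.exp ((Complex.I * t) • m.Y)) ∘ₗ
    LinearMap.mulRight ℂ (NormedSpace.exp ((-(Complex.I * t)) • m.Y))

/-- `e^{it ad(Y + H_R)}`, entrywise. -/
def freeHeisenberg (m : ParticleReservoir d 𝒮) (t : ℝ)
    (K : (Fin d → ℤ) → (Fin d → ℤ) → (𝒮 →L[ℂ] 𝒮) ⊗[ℂ] FieldAlg d) (x y : Fin d → ℤ) :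
    (𝒮 →L[ℂ] 𝒮) ⊗[ℂ] FieldAlg d :=
  TensorProduct.map (m.internalEvolve t) (reservoirEvolve t).toLinearMap (K x y)

/-- The conditional expectation `S ⊗ R ↦ ρ(R) S` for the thermal state `ρ`. -/
def condExpect (m : ParticleReservoir d 𝒮) :
    (𝒮 →L[ℂ] 𝒮) ⊗[ℂ] FieldAlg d →ₗ[ℂ] (𝒮 →L[ℂ] 𝒮) :=
  (TensorProduct.rid ℂ (𝒮 →L[ℂ] 𝒮)).toLinearMap ∘ₗ
    LinearMap.lTensor (𝒮 →L[ℂ] 𝒮) (thermalState m.β)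

/-- The matrix elements of
`L̂⋆(t)(S) = - ρ( ad(H_SR) e^{it ad(Y + H_R)} ad(H_SR) (S ⊗ 1) )`. -/
def lHatKernel (m : ParticleReservoir d 𝒮) (t : ℝ) (S : POp d 𝒮) (x y : Fin d → ℤ) :
    𝒮 →L[ℂ] 𝒮 :=
  -m.condExpect (m.adCoupling (m.freeHeisenberg t
    (m.adCoupling (fun x y => kernelOf S x y ⊗ₜ[ℂ] (1 : FieldAlg d)))) x y)

variable [FiniteDimensional ℂ 𝒮]

/-- The eigenvalues of `Y`. -/
abbrev Level (m : ParticleReservoir d 𝒮) : Type :=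
  Module.End.Eigenvalues (m.Y : 𝒮 →ₗ[ℂ] 𝒮)

/-- The spectral projection `1_e(Y) ∈ B(𝒮)`. -/
def levelProj (m : ParticleReservoir d 𝒮) (e : m.Level) : 𝒮 →L[ℂ] 𝒮 :=
  (Module.End.eigenspace (m.Y : 𝒮 →ₗ[ℂ] 𝒮) e.val).starProjection

open Classical in
/-- The spectrum of `ad(Y)`: the differences of eigenvalues of `Y`. -/
def bohrFreqs (m : ParticleReservoir d 𝒮) : Finset ℂ :=
  Finset.univ.image (fun p : m.Level × m.Level => p.1.val - p.2.val)

open Classical in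
/-- The spectral projection `1_a(ad(Y))`, i.e. `S ↦ ∑_{e - e' = a} 1_e(Y) S 1_{e'}(Y)`, on the
Hilbert-Schmidt operators. -/
def bohrProj (m : ParticleReservoir d 𝒮) (a : ℂ) : HSOp d 𝒮 →L[ℂ] HSOp d 𝒮 :=
  ∑ p : m.Level × m.Level with p.1.val - p.2.val = a,
    (hsLeft (onSites (m.levelProj p.1))).comp (hsRight (onSites (m.levelProj p.2)))

/-- `M = -i ad(ε(P)) + ∑_{a ∈ sp(ad(Y))} 1_a(ad(Y)) L(-ia) 1_a(ad(Y))`. -/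
def generator (m : ParticleReservoir d 𝒮) (L : ℂ → (HSOp d 𝒮 →L[ℂ] HSOp d 𝒮)) :
    HSOp d 𝒮 →L[ℂ] HSOp d 𝒮 :=
  (-Complex.I) • hsAd m.kineticOp +
    ∑ a ∈ m.bohrFreqs, (m.bohrProj a).comp ((L (-Complex.I * a)).comp (m.bohrProj a))

/-- `Λ_t = e^{t(-i ad(Y) + λ² M)}`. -/
def markovSemigroup (m : ParticleReservoir d 𝒮) (L : ℂ → (HSOp d 𝒮 →L[ℂ] HSOp d 𝒮))
    (lam t : ℝ) : HSOp d 𝒮 →L[ℂ] HSOp d 𝒮 :=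
  NormedSpace.exp ((t : ℂ) • ((-Complex.I) • hsAd (onSites m.Y) +
    ((lam : ℂ) ^ 2) • m.generator L))

end ParticleReservoir

section Laplace

variable {F : Type*} [NormedAddCommGroup F] [NormedSpace ℂ F]

/-- The integral `∫₀^∞ e^{-tz} V(t) dt` converges absolutely. -/
def LaplaceIntegrable (V : ℝ → F) (z : ℂ) : Prop :=
  IntegrableOn (fun t : ℝ => Complex.exp (-(t * z)) • V t) (Set.Ioi 0)

/-- The Laplace transform `∫₀^∞ e^{-tz} V(t) dt`. -/
def laplaceTransform (V : ℝ → F) (z : ℂ) : F :=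
  ∫ t in Set.Ioi (0 : ℝ), Complex.exp (-(t * z)) • V t

end Laplace

section Duality

variable {d : ℕ} {𝒮 : Type*} [NormedAddCommGroup 𝒮] [InnerProductSpace ℂ 𝒮] [CompleteSpace 𝒮]

variable [FiniteDimensional ℂ 𝒮]

/-- `V` maps trace-class operators boundedly to trace-class operators, in the trace norm. -/
def IsTraceNormBounded (V : HSOp d 𝒮 →L[ℂ] HSOp d 𝒮) : Prop :=
  ∃ C : ℝ≥0, ∀ S : HSOp d 𝒮, IsTraceClass (HSOp.op S) →
    traceNorm (HSOp.op (V S)) ≤ C * traceNorm (HSOp.op S)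

/-- On trace-class operators `V` is the dual of the operator `Vstar` on bounded operators:
`Tr [S Vstar(S')] = Tr [V(S) S']`. -/
def IsDualOf (V : HSOp d 𝒮 →L[ℂ] HSOp d 𝒮) (Vstar : POp d 𝒮 →L[ℂ] POp d 𝒮) : Prop :=
  ∀ S : HSOp d 𝒮, IsTraceClass (HSOp.op S) → ∀ S' : POp d 𝒮,
    opTrace (HSOp.op S * Vstar S') = opTrace (HSOp.op (V S) * S')

/-- The factor `e^{(i/2) κ_L·x} e^{-(i/2) κ_R·y}` by which `J_κ` multiplies `S(x,y)`. -/
def jFactor (κL κR : Fin d → ℂ) (x y : Fin d → ℤ) : ℂ :=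
  Complex.exp (Complex.I / 2 * ∑ j, κL j * (x j : ℂ)) *
    Complex.exp (-(Complex.I / 2 * ∑ j, κR j * (y j : ℂ)))

/-- The bounded operator `A` is `J_κ V J_{-κ}`: whenever `S' = J_{-κ} S` is Hilbert-Schmidt,
`A S = J_κ (V S')`. The domain of `J_{-κ}` is dense (it contains the finite kernels), so this
determines `A`. -/
def IsJConj (κL κR : Fin d → ℂ) (V A : HSOp d 𝒮 →L[ℂ] HSOp d 𝒮) : Prop :=
  ∀ S S' : HSOp d 𝒮,
    (∀ x y, kernelOf (HSOp.op S') x y = jFactor (-κL) (-κR) x y • kernelOf (HSOp.op S) x y) →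
    ∀ x y, kernelOf (HSOp.op (A S)) x y = jFactor κL κR x y • kernelOf (HSOp.op (V S')) x y

end Duality

end

/-! Structure of the memory kernel. Wick's rule for two letters turns the double commutator into
four terms, each of which multiplies the entry `S(x,y)` on both sides by matrices on the internal
space and by a value of the field correlation function (`lHatKernel_eq`). When the two fields stand
on opposite sides of `S`, this value depends on `x - y`, and multiplication by it is an average of
the conjugations `e^{iq·X} S e^{-iq·X}` with an integrable weight (`waveAvg`). Such an average is
bounded on the bounded and on the trace-class operators by the `L¹` norm of the weight, and on
Hilbert-Schmidt operators by the supremum of its Fourier transform. The first bound does not decay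
in time, so it gives the Laplace transform and its predual only for `Re z > 0`. The second is
integrable in time, which gives the continuous extension to `Re z ≥ 0`.

Integrability in time, uniformly in the separation `v = x - y`, is `exists_decay_bound`. For `|v| ≤
t/2` a contour shift in the strip of analyticity of the form factor gives exponential decay
(`norm_integral_strip_mul_exp_le`). For `|v| > t/2` the Fourier transform of the sphere, which
decays at least like `|v|^{-3/2}` because `d ≥ 4` (`exists_abs_sphereCos_le`, an energy estimate for
Bessel's equation), gives a bound of order `t^{-3/2}`; the weight `|ω|^{-3/2}` is harmless since the
spectral density vanishes at `0`.

Exponential weights. `J_κ` multiplies every matrix element by a scalar, so it commutes with whatever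
acts entry by entry (`ActsEntrywise.isJConj`), in particular with `L(z)` and the whole dissipative
part of `M`. In the kinetic part it replaces `ε(k)` by `ε(k - κ/2)`, by a contour shift over the
Brillouin zone (`kernelOf_kineticShift`). The estimate by `q_ε` is a Schwarz lemma for functions
with values in a strip, applied on a complex line at half the radius of a disc
(`norm_sub_le_of_abs_im_le`, `norm_shiftedDisp_sub_le`).

Markov property. The projections on the Bohr frequencies reorganize the memory kernel, at each time,
into a gain term built from jump operators and a pair of adjoint one-sided loss terms
(`sum_bohrProj_memory`). After a Laplace transform at `ε > 0` the weights of the gain term are sums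
of nonnegative Lorentzians, so the regularized dissipator has the form `K S + S K* + Ψ(S)` with `Ψ`
positivity preserving (`dissipator_eq`). Chernoff's formula applied to `S ↦ (1 + sK) S (1 + sK)* +
sΨ(S)` shows that the semigroup preserves positivity, and the limit `ε → 0` is taken in the operator
norm on Hilbert-Schmidt operators.

Positivity also yields the trace-norm bound on `M`: the `L¹` norm of a nonnegative rate is its
Fourier transform at zero separation, which is bounded uniformly in `ε`
(`exists_integral_transitionRate_le`), and lower semicontinuity of the trace norm carries the bound
to `ε = 0` (`exists_traceBound_dissipator`). Trace preservation holds because the dissipator has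
vanishing internal trace at every site and commutators have trace zero; the exponential series is
then summed term by term (`TraceBound.exp_apply`). -/

set_option linter.unusedSectionVars false

noncomputable section

/-! ### Trace norms through finite diagonal sums. -/

section TraceBounds

/-- **Douglas' lemma**: an operator dominated by `A` factors through `A` by a contraction. -/
theorem exists_contraction_comp_eq {E F G : Type*} [NormedAddCommGroup E] [InnerProductSpace ℂ E]
    [NormedAddCommGroup F] [InnerProductSpace ℂ F] [CompleteSpace F]
    [NormedAddCommGroup G] [InnerProductSpace ℂ G] [CompleteSpace G]
    (A : E →L[ℂ] F) (T : E →L[ℂ] G) (h : ∀ x, ‖T x‖ ≤ ‖A x‖) :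
    ∃ C : F →L[ℂ] G, ‖C‖ ≤ 1 ∧ T = C.comp A := by
  -- The contraction is `A x ↦ T x` on the range of `A`, extended by continuity to its closure `K`
  -- and by zero to the orthogonal complement of `K`.
  let K : Submodule ℂ F := (LinearMap.range (A : E →ₗ[ℂ] F)).topologicalClosure
  have hK : ∀ x, A x ∈ K := fun x =>
    Submodule.le_topologicalClosure _ (LinearMap.mem_range_self _ x)
  let e : E →ₗ[ℂ] K := (A : E →ₗ[ℂ] F).codRestrict K hK
  have : CompleteSpace K :=
    (Submodule.isClosed_topologicalClosure _).completeSpace_coe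
  have hd : DenseRange e := by
    intro y
    rw [closure_subtype]
    have hy : (y : F) ∈ closure (Set.range A) := y.2
    convert hy using 2
    ext z
    constructor
    · rintro ⟨w, ⟨x, rfl⟩, rfl⟩
      exact ⟨x, rfl⟩
    · rintro ⟨x, rfl⟩
      exact ⟨e x, ⟨x, rfl⟩, rfl⟩
  have hn : ∀ x, ‖(T : E →ₗ[ℂ] G) x‖ ≤ 1 * ‖e x‖ := fun x => by
    rw [one_mul]; exact h x
  let g : K →L[ℂ] G := (T : E →ₗ[ℂ] G).extendOfNorm e
  refine ⟨g.comp K.orthogonalProjectionOnto, ?_, ?_⟩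
  · refine (ContinuousLinearMap.opNorm_comp_le _ _).trans ?_
    have h1 : ‖g‖ ≤ 1 := LinearMap.opNorm_extendOfNorm_le hd zero_le_one hn
    have h2 := K.orthogonalProjectionOnto_norm_le (𝕜 := ℂ)
    nlinarith [norm_nonneg g, norm_nonneg (K.orthogonalProjectionOnto)]
  · ext x
    have h1 : K.orthogonalProjectionOnto (A x) = e x :=
      K.orthogonalProjectionOnto_mem_subspace_eq_self (e x)
    simp only [ContinuousLinearMap.comp_apply, h1]
    exact (LinearMap.extendOfNorm_eq hd ⟨1, hn⟩ x).symm

variable {ι E : Type*} [NormedAddCommGroup E] [InnerProductSpace ℂ E] [CompleteSpace E]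

/-- Both squared norms are the quadratic form of `T* T = |T|²`. The equality provides the domination
in both directions that Douglas' lemma asks for. -/
theorem norm_opAbs_apply (T : E →L[ℂ] E) (x : E) : ‖opAbs T x‖ = ‖T x‖ := by
  have hs : IsSelfAdjoint (opAbs T) := (CFC.abs_nonneg T).isSelfAdjoint
  have h : ContinuousLinearMap.adjoint (opAbs T) * opAbs T = ContinuousLinearMap.adjoint T * T := by
    rw [← ContinuousLinearMap.star_eq_adjoint, hs.star_eq]
    exact CFC.abs_mul_abs T
  have h1 : ‖opAbs T x‖ ^ 2 = ‖T x‖ ^ 2 := by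
    rw [ContinuousLinearMap.apply_norm_sq_eq_inner_adjoint_left,
      ContinuousLinearMap.apply_norm_sq_eq_inner_adjoint_left]
    exact congrArg (fun S : E →L[ℂ] E => RCLike.re ⟪S x, x⟫_ℂ) h
  exact (pow_left_inj₀ (norm_nonneg _) (norm_nonneg _) two_ne_zero).mp h1

/-- Douglas' lemma in both directions. Two contractions are enough for the estimates; the partial
isometry of the polar decomposition is not needed. -/
theorem exists_polar (T : E →L[ℂ] E) : ∃ U V : E →L[ℂ] E, ‖U‖ ≤ 1 ∧ ‖V‖ ≤ 1 ∧
    T = U * opAbs T ∧ opAbs T = V * T := by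
  obtain ⟨U, hU, h1⟩ := exists_contraction_comp_eq (opAbs T) T
    (fun x => (norm_opAbs_apply T x).ge)
  obtain ⟨V, hV, h2⟩ := exists_contraction_comp_eq T (opAbs T)
    (fun x => (norm_opAbs_apply T x).le)
  exact ⟨U, V, hU, hV, h1, h2⟩

/-- A bound on the trace norm, expressed by absolute sums of diagonal matrix elements of the
products `B T A`. -/
def TraceBound (b : HilbertBasis ι ℂ E) (T : E →L[ℂ] E) (C : ℝ) : Prop :=
  ∀ (A B : E →L[ℂ] E) (F : Finset ι), ∑ i ∈ F, ‖⟪b i, B (T (A (b i)))⟫_ℂ‖ ≤ C * ‖A‖ * ‖B‖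

theorem sum_norm_sq_le_toReal (b : HilbertBasis ι ℂ E) (T : E →L[ℂ] E)
    (h : ∑' i, ENNReal.ofReal (‖T (b i)‖ ^ 2) ≠ ⊤) (F : Finset ι) :
    ∑ i ∈ F, ‖T (b i)‖ ^ 2 ≤ (∑' i, ENNReal.ofReal (‖T (b i)‖ ^ 2)).toReal := by
  rw [← ENNReal.ofReal_le_iff_le_toReal h, ENNReal.ofReal_sum_of_nonneg (fun _ _ => by positivity)]
  exact ENNReal.sum_le_tsum F

/-- Cauchy-Schwarz over `i` after moving `B X` to the left slot as `X* B*`: the Hilbert-Schmidt sum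
is invariant under the adjoint, and a bounded factor costs at most the square of its norm. -/
theorem traceBound_mul (b : HilbertBasis ι ℂ E) (X Y : E →L[ℂ] E) {C : ℝ} (hC : 0 ≤ C)
    (hX : ∑' i, ENNReal.ofReal (‖X (b i)‖ ^ 2) ≤ ENNReal.ofReal C)
    (hY : ∑' i, ENNReal.ofReal (‖Y (b i)‖ ^ 2) ≤ ENNReal.ofReal C) :
    TraceBound b (X * Y) C := by
  intro A B F
  have key : ∀ (Z D : E →L[ℂ] E), ∑' i, ENNReal.ofReal (‖Z (b i)‖ ^ 2) ≤ ENNReal.ofReal C →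
      ∑ i ∈ F, ‖(Z * D) (b i)‖ ^ 2 ≤ ‖D‖ ^ 2 * C := by
    intro Z D hZ
    have h1 := (b.tsum_rmul_le D Z).trans (mul_le_mul_right hZ _)
    rw [← ENNReal.ofReal_mul (by positivity)] at h1
    refine (sum_norm_sq_le_toReal b _ (ne_top_of_le_ne_top ENNReal.ofReal_ne_top h1) F).trans ?_
    exact ENNReal.toReal_le_of_le_ofReal (by positivity) h1
  have h1 := key (ContinuousLinearMap.adjoint X) (ContinuousLinearMap.adjoint B)
    (by rw [← b.tsum_adjoint]; exact hX)
  have h2 := key Y A hY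
  rw [LinearIsometryEquiv.norm_map] at h1
  calc ∑ i ∈ F, ‖⟪b i, B ((X * Y) (A (b i)))⟫_ℂ‖
      ≤ ∑ i ∈ F, ‖(ContinuousLinearMap.adjoint X * ContinuousLinearMap.adjoint B) (b i)‖ *
          ‖(Y * A) (b i)‖ := by
        refine Finset.sum_le_sum fun i _ => ?_
        have : ⟪b i, B ((X * Y) (A (b i)))⟫_ℂ =
          ⟪(ContinuousLinearMap.adjoint X * ContinuousLinearMap.adjoint B) (b i),
            (Y * A) (b i)⟫_ℂ := by
          simp [ContinuousLinearMap.adjoint_inner_left]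
        rw [this]
        exact norm_inner_le_norm _ _
    _ ≤ √(∑ i ∈ F, ‖(ContinuousLinearMap.adjoint X * ContinuousLinearMap.adjoint B) (b i)‖ ^ 2) *
          √(∑ i ∈ F, ‖(Y * A) (b i)‖ ^ 2) := Real.sum_mul_le_sqrt_mul_sqrt _ _ _
    _ ≤ √(‖B‖ ^ 2 * C) * √(‖A‖ ^ 2 * C) := by gcongr
    _ = C * ‖A‖ * ‖B‖ := by
        rw [Real.sqrt_mul (by positivity), Real.sqrt_mul (by positivity),
          Real.sqrt_sq (norm_nonneg _), Real.sqrt_sq (norm_nonneg _)]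
        linear_combination ‖A‖ * ‖B‖ * Real.mul_self_sqrt hC

/-- The factors are `U |T|^{1/2}` and `|T|^{1/2}`, where `T = U |T|` with a contraction `U`. -/
theorem exists_hs_factorization (b : HilbertBasis ι ℂ E) (T : E →L[ℂ] E) :
    ∃ X Y : E →L[ℂ] E, T = X * Y ∧
      ∑' i, ENNReal.ofReal (‖X (b i)‖ ^ 2) ≤
        ∑' i, ENNReal.ofReal (⟪b i, opAbs T (b i)⟫_ℂ).re ∧
      ∑' i, ENNReal.ofReal (‖Y (b i)‖ ^ 2) ≤
        ∑' i, ENNReal.ofReal (⟪b i, opAbs T (b i)⟫_ℂ).re := by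
  obtain ⟨U, -, hU, -, h1, -⟩ := exists_polar T
  have hnn : 0 ≤ opAbs T := CFC.abs_nonneg T
  set R := CFC.sqrt (opAbs T) with hR
  have hRR : R * R = opAbs T := CFC.sqrt_mul_sqrt_self (opAbs T) hnn
  have hRs : IsSelfAdjoint R := (CFC.sqrt_nonneg (opAbs T)).isSelfAdjoint
  have hn : ∀ x, ‖R x‖ ^ 2 = (⟪x, opAbs T x⟫_ℂ).re := by
    intro x
    rw [ContinuousLinearMap.apply_norm_sq_eq_inner_adjoint_right,
      ← ContinuousLinearMap.star_eq_adjoint, hRs.star_eq]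
    exact congrArg (fun S : E →L[ℂ] E => (⟪x, S x⟫_ℂ).re) hRR
  have hY : ∑' i, ENNReal.ofReal (‖R (b i)‖ ^ 2) ≤
        ∑' i, ENNReal.ofReal (⟪b i, opAbs T (b i)⟫_ℂ).re := by
    simp_rw [hn]; exact le_rfl
  refine ⟨U * R, R, ?_, ?_, hY⟩
  · rw [mul_assoc, hRR]; exact h1
  · refine (b.tsum_lmul_le U R).trans (le_trans ?_ hY)
    have : ENNReal.ofReal (‖U‖ ^ 2) ≤ 1 := by
      rw [ENNReal.ofReal_le_one]
      exact pow_le_one₀ (norm_nonneg _) hU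
    exact (mul_le_mul_left this _).trans (one_mul _).le

theorem traceBound_of_le (b : HilbertBasis ι ℂ E) (T : E →L[ℂ] E) {C : ℝ} (hC : 0 ≤ C)
    (h : ∑' i, ENNReal.ofReal (⟪b i, opAbs T (b i)⟫_ℂ).re ≤ ENNReal.ofReal C) :
    TraceBound b T C := by
  obtain ⟨X, Y, h1, hX, hY⟩ := exists_hs_factorization b T
  rw [h1]
  exact traceBound_mul b X Y hC (hX.trans h) (hY.trans h)

/-- Testing with `A = 1` and `B = V`, where `|T| = V T`, recovers the diagonal sums of `|T|`.
Together with `traceBound_of_le` this makes `TraceBound` equivalent to a bound on the trace norm, in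
a form that is visibly subadditive and stable under weak limits. -/
theorem TraceBound.tsum_le {b : HilbertBasis ι ℂ E} {T : E →L[ℂ] E} {C : ℝ} (hC : 0 ≤ C)
    (h : TraceBound b T C) :
    ∑' i, ENNReal.ofReal (⟪b i, opAbs T (b i)⟫_ℂ).re ≤ ENNReal.ofReal C := by
  obtain ⟨-, V, -, hV, -, h2⟩ := exists_polar T
  rw [ENNReal.tsum_eq_iSup_sum]
  refine iSup_le fun F => ?_
  have hn : ∀ x, 0 ≤ (⟪x, opAbs T x⟫_ℂ).re := fun x =>
    ((ContinuousLinearMap.nonneg_iff_isPositive _).mp (CFC.abs_nonneg T)).re_inner_nonneg_right x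
  rw [← ENNReal.ofReal_sum_of_nonneg (fun _ _ => hn _)]
  refine ENNReal.ofReal_le_ofReal ?_
  have h3 := h 1 V F
  calc ∑ i ∈ F, (⟪b i, opAbs T (b i)⟫_ℂ).re ≤ ∑ i ∈ F, ‖⟪b i, V (T ((1 : E →L[ℂ] E) (b i)))⟫_ℂ‖ := by
        refine Finset.sum_le_sum fun i _ => ?_
        have : opAbs T (b i) = V (T ((1 : E →L[ℂ] E) (b i))) :=
          congrArg (fun S : E →L[ℂ] E => S (b i)) h2
        rw [this]
        exact Complex.re_le_norm _
    _ ≤ C * ‖(1 : E →L[ℂ] E)‖ * ‖V‖ := h3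
    _ ≤ C * 1 * 1 := by
        have : ‖(1 : E →L[ℂ] E)‖ ≤ 1 := ContinuousLinearMap.norm_id_le
        gcongr
    _ = C := by ring

section Closure

variable {b : HilbertBasis ι ℂ E} {T T' : E →L[ℂ] E} {C C' : ℝ}

theorem TraceBound.mono (h : TraceBound b T C) (hC : C ≤ C') : TraceBound b T C' :=
  fun A B F => (h A B F).trans (by gcongr)

theorem TraceBound.add (h : TraceBound b T C) (h' : TraceBound b T' C') :
    TraceBound b (T + T') (C + C') := by
  intro A B F
  calc _ ≤ ∑ i ∈ F, (‖⟪b i, B (T (A (b i)))⟫_ℂ‖ + ‖⟪b i, B (T' (A (b i)))⟫_ℂ‖) := by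
        refine Finset.sum_le_sum fun i _ => ?_
        rw [add_apply, map_add, inner_add_right]
        exact norm_add_le _ _
    _ ≤ _ := by
        rw [Finset.sum_add_distrib]
        linarith [h A B F, h' A B F]

theorem TraceBound.zero : TraceBound b 0 0 := by
  intro A B F; simp

theorem TraceBound.smul (h : TraceBound b T C) (c : ℂ) : TraceBound b (c • T) (‖c‖ * C) := by
  intro A B F
  have := h A B F
  simp only [smul_apply, map_smul, inner_smul_right, norm_mul]
  rw [← Finset.mul_sum]
  calc _ ≤ ‖c‖ * (C * ‖A‖ * ‖B‖) := by gcongr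
    _ = _ := by ring

theorem TraceBound.neg (h : TraceBound b T C) : TraceBound b (-T) C := by
  simpa using h.smul (-1)

theorem TraceBound.sub (h : TraceBound b T C) (h' : TraceBound b T' C') :
    TraceBound b (T - T') (C + C') := by
  rw [sub_eq_add_neg]; exact h.add h'.neg

theorem TraceBound.sum {κ : Type*} (s : Finset κ) {T : κ → E →L[ℂ] E} {C : κ → ℝ}
    (h : ∀ k ∈ s, TraceBound b (T k) (C k)) : TraceBound b (∑ k ∈ s, T k) (∑ k ∈ s, C k) := by
  classical
  induction s using Finset.induction_on with
  | empty => simpa using TraceBound.zero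
  | insert a s ha ih =>
    rw [Finset.sum_insert ha, Finset.sum_insert ha]
    exact (h a (by simp)).add (ih fun k hk => h k (by simp [hk]))

theorem TraceBound.conj (hC : 0 ≤ C) (h : TraceBound b T C) (X Y : E →L[ℂ] E) :
    TraceBound b (X * T * Y) (C * ‖X‖ * ‖Y‖) := by
  intro A B F
  refine (h (Y * A) (B * X) F).trans ?_
  calc C * ‖Y * A‖ * ‖B * X‖ ≤ C * (‖Y‖ * ‖A‖) * (‖B‖ * ‖X‖) := by
        gcongr <;> exact norm_mul_le _ _
    _ = _ := by ring

/-- Each test involves finitely many matrix elements, so weak convergence suffices. This is the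
lower semicontinuity of the trace norm, by which bounds survive the removal of the regularization.
-/
theorem TraceBound.of_tendsto {κ : Type*} {l : Filter κ} [l.NeBot] {S : κ → E →L[ℂ] E}
    {c : κ → ℝ} (hS : ∀ x y, Filter.Tendsto (fun k => ⟪x, S k y⟫_ℂ) l (nhds ⟪x, T y⟫_ℂ))
    (hc : Filter.Tendsto c l (nhds C)) (h : ∀ᶠ k in l, TraceBound b (S k) (c k)) :
    TraceBound b T C := by
  intro A B F
  have h1 : Filter.Tendsto (fun k => ∑ i ∈ F, ‖⟪b i, B (S k (A (b i)))⟫_ℂ‖) l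
      (nhds (∑ i ∈ F, ‖⟪b i, B (T (A (b i)))⟫_ℂ‖)) := by
    refine tendsto_finsetSum _ fun i _ => Filter.Tendsto.norm ?_
    simp_rw [← ContinuousLinearMap.adjoint_inner_left B]
    exact hS _ _
  exact le_of_tendsto_of_tendsto h1 ((hc.mul_const _).mul_const _) (h.mono fun k hk => hk A B F)

theorem TraceBound.summable (h : TraceBound b T C) (A B : E →L[ℂ] E) :
    Summable fun i => ‖⟪b i, B (T (A (b i)))⟫_ℂ‖ :=
  summable_of_sum_le (fun _ => norm_nonneg _) (h A B)

theorem TraceBound.tsum_norm_le (h : TraceBound b T C) (A B : E →L[ℂ] E) :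
    ∑' i, ‖⟪b i, B (T (A (b i)))⟫_ℂ‖ ≤ C * ‖A‖ * ‖B‖ :=
  Real.tsum_le_of_sum_le (fun _ => norm_nonneg _) (h A B)

end Closure

end TraceBounds

/-! ### Cyclicity of the trace and its exchange with integrals. -/

section Trace

variable {ι E : Type*} [NormedAddCommGroup E] [InnerProductSpace ℂ E] [CompleteSpace E]

theorem HilbertBasis.summable_inner_prod (b : HilbertBasis ι ℂ E) {X : E →L[ℂ] E}
    (hX : ∑' i, ENNReal.ofReal (‖X (b i)‖ ^ 2) ≠ ⊤) :
    Summable fun p : ι × ι => ‖⟪b p.2, X (b p.1)⟫_ℂ‖ ^ 2 := by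
  simp_rw [b.ofReal_norm_sq] at hX
  rw [← ENNReal.tsum_prod] at hX
  have h := ENNReal.summable_toReal hX
  simpa [ENNReal.toReal_ofReal (sq_nonneg _)] using h

/-- Both sides are the same double sum of products of matrix elements, summed in different orders.
Products of two square-summable families are absolutely summable, so the orders may be exchanged. -/
theorem HilbertBasis.tsum_inner_mul_comm (b : HilbertBasis ι ℂ E) {X Y : E →L[ℂ] E}
    (hX : ∑' i, ENNReal.ofReal (‖X (b i)‖ ^ 2) ≠ ⊤)
    (hY : ∑' i, ENNReal.ofReal (‖Y (b i)‖ ^ 2) ≠ ⊤) :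
    ∑' i, ⟪b i, X (Y (b i))⟫_ℂ = ∑' i, ⟪b i, Y (X (b i))⟫_ℂ := by
  have hs : Summable (Function.uncurry fun i j => ⟪b i, X (b j)⟫_ℂ * ⟪b j, Y (b i)⟫_ℂ) := by
    refine Summable.of_norm_bounded (g := fun p : ι × ι =>
      ‖⟪b p.1, X (b p.2)⟫_ℂ‖ ^ 2 + ‖⟪b p.2, Y (b p.1)⟫_ℂ‖ ^ 2) ?_ ?_
    · exact ((Equiv.prodComm ι ι).summable_iff.mpr (b.summable_inner_prod hX)).add
        (b.summable_inner_prod hY)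
    · rintro ⟨i, j⟩
      simp only [Function.uncurry_apply_pair, norm_mul]
      nlinarith [sq_nonneg (‖⟪b i, X (b j)⟫_ℂ‖ - ‖⟪b j, Y (b i)⟫_ℂ‖),
        sq_nonneg (‖⟪b i, X (b j)⟫_ℂ‖), sq_nonneg (‖⟪b j, Y (b i)⟫_ℂ‖)]
  have h1 : ∀ (X Y : E →L[ℂ] E) i, ⟪b i, X (Y (b i))⟫_ℂ =
      ∑' j, ⟪b i, X (b j)⟫_ℂ * ⟪b j, Y (b i)⟫_ℂ := by
    intro X Y i
    rw [← ContinuousLinearMap.adjoint_inner_left, ← b.tsum_inner_mul_inner]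
    simp_rw [ContinuousLinearMap.adjoint_inner_left]
  simp_rw [h1 X Y, h1 Y X]
  rw [← hs.tsum_comm]
  exact tsum_congr fun i => tsum_congr fun j => mul_comm _ _

theorem HilbertBasis.hs_mul_left_ne_top (b : HilbertBasis ι ℂ E) {X : E →L[ℂ] E} (A : E →L[ℂ] E)
    (hX : ∑' i, ENNReal.ofReal (‖X (b i)‖ ^ 2) ≠ ⊤) :
    ∑' i, ENNReal.ofReal (‖(A * X) (b i)‖ ^ 2) ≠ ⊤ :=
  ne_top_of_le_ne_top (ENNReal.mul_ne_top ENNReal.ofReal_ne_top hX) (b.tsum_lmul_le A X)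

theorem HilbertBasis.hs_mul_right_ne_top (b : HilbertBasis ι ℂ E) {X : E →L[ℂ] E} (A : E →L[ℂ] E)
    (hX : ∑' i, ENNReal.ofReal (‖X (b i)‖ ^ 2) ≠ ⊤) :
    ∑' i, ENNReal.ofReal (‖(X * A) (b i)‖ ^ 2) ≠ ⊤ :=
  ne_top_of_le_ne_top (ENNReal.mul_ne_top ENNReal.ofReal_ne_top hX) (b.tsum_rmul_le A X)

/-- With `T = X Y` a product of Hilbert-Schmidt operators, the factors are cycled twice: `(A X) Y`
to `Y (A X)`, then `(Y A) X` to `X (Y A)`. -/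
theorem TraceBound.tsum_mul_comm {b : HilbertBasis ι ℂ E} {T : E →L[ℂ] E} {C : ℝ} (hC : 0 ≤ C)
    (h : TraceBound b T C) (A : E →L[ℂ] E) :
    ∑' i, ⟪b i, A (T (b i))⟫_ℂ = ∑' i, ⟪b i, T (A (b i))⟫_ℂ := by
  obtain ⟨X, Y, rfl, hX, hY⟩ := exists_hs_factorization b T
  have hfin := ne_top_of_le_ne_top ENNReal.ofReal_ne_top (h.tsum_le hC)
  replace hX := ne_top_of_le_ne_top hfin hX
  replace hY := ne_top_of_le_ne_top hfin hY
  have h1 := b.tsum_inner_mul_comm (b.hs_mul_left_ne_top A hX) hY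
  have h2 := b.tsum_inner_mul_comm (b.hs_mul_right_ne_top A hY) hX
  exact h1.trans h2

/-- The integral is understood weakly, because `q ↦ e^{iq·X} T e^{-iq·X}` is only strongly
continuous and need not be measurable in operator norm. -/
theorem TraceBound.of_integral {Q : Type*} [MeasurableSpace Q] {μ : Measure Q}
    {b : HilbertBasis ι ℂ E} {Z : Q → E →L[ℂ] E} {c : Q → ℝ} {J : E →L[ℂ] E}
    (hJ : ∀ x y, ⟪x, J y⟫_ℂ = ∫ q, ⟪x, Z q y⟫_ℂ ∂μ)
    (hm : ∀ x y, AEStronglyMeasurable (fun q => ⟪x, Z q y⟫_ℂ) μ)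
    (hc : Integrable c μ) (hZ : ∀ᵐ q ∂μ, TraceBound b (Z q) (c q)) :
    TraceBound b J (∫ q, c q ∂μ) := by
  intro A B F
  have hB : ∀ x y (T : E →L[ℂ] E), ⟪x, B (T y)⟫_ℂ = ⟪ContinuousLinearMap.adjoint B x, T y⟫_ℂ :=
    fun x y T => (ContinuousLinearMap.adjoint_inner_left B _ _).symm
  have hint : ∀ i ∈ F, Integrable (fun q => ‖⟪b i, B (Z q (A (b i)))⟫_ℂ‖) μ := by
    intro i _
    refine (((hc.mul_const ‖A‖).mul_const ‖B‖).mono' ?_ ?_)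
    · simp_rw [hB]
      exact (hm _ _).norm
    · filter_upwards [hZ] with q hq
      simpa using hq A B {i}
  calc ∑ i ∈ F, ‖⟪b i, B (J (A (b i)))⟫_ℂ‖ ≤ ∑ i ∈ F, ∫ q, ‖⟪b i, B (Z q (A (b i)))⟫_ℂ‖ ∂μ := by
        refine Finset.sum_le_sum fun i _ => ?_
        rw [hB, hJ]
        simp_rw [hB]
        exact norm_integral_le_integral_norm _
    _ = ∫ q, ∑ i ∈ F, ‖⟪b i, B (Z q (A (b i)))⟫_ℂ‖ ∂μ := (integral_finsetSum _ hint).symm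
    _ ≤ ∫ q, c q * ‖A‖ * ‖B‖ ∂μ := by
        refine integral_mono_ae (integrable_finsetSum _ hint)
          ((hc.mul_const ‖A‖).mul_const ‖B‖) ?_
        filter_upwards [hZ] with q hq using hq A B F
    _ = _ := by rw [integral_mul_const, integral_mul_const]

theorem TraceBound.tsum_integral [Countable ι] {Q : Type*} [MeasurableSpace Q] {μ : Measure Q}
    {b : HilbertBasis ι ℂ E} {Z : Q → E →L[ℂ] E} {c : Q → ℝ} {J : E →L[ℂ] E}
    (hJ : ∀ x y, ⟪x, J y⟫_ℂ = ∫ q, ⟪x, Z q y⟫_ℂ ∂μ)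
    (hm : ∀ x y, AEStronglyMeasurable (fun q => ⟪x, Z q y⟫_ℂ) μ)
    (hc : Integrable c μ) (hZ : ∀ᵐ q ∂μ, TraceBound b (Z q) (c q)) (A B : E →L[ℂ] E) :
    ∑' i, ⟪b i, B (J (A (b i)))⟫_ℂ = ∫ q, ∑' i, ⟪b i, B (Z q (A (b i)))⟫_ℂ ∂μ := by
  have hB : ∀ x y (T : E →L[ℂ] E), ⟪x, B (T y)⟫_ℂ = ⟪ContinuousLinearMap.adjoint B x, T y⟫_ℂ :=
    fun x y T => (ContinuousLinearMap.adjoint_inner_left B _ _).symm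
  have hint : ∀ i, Integrable (fun q => ⟪b i, B (Z q (A (b i)))⟫_ℂ) μ := by
    intro i
    refine (((hc.mul_const ‖A‖).mul_const ‖B‖).mono' ?_ ?_)
    · simp_rw [hB]
      exact hm _ _
    · filter_upwards [hZ] with q hq
      simpa using hq A B {i}
  have hs : Summable fun i => ∫ q, ‖⟪b i, B (Z q (A (b i)))⟫_ℂ‖ ∂μ := by
    refine summable_of_sum_le (c := ∫ q, c q * ‖A‖ * ‖B‖ ∂μ)
      (fun i => integral_nonneg fun _ => norm_nonneg _) fun F => ?_
    rw [← integral_finsetSum _ fun i _ => (hint i).norm]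
    refine integral_mono_ae (integrable_finsetSum _ fun i _ => (hint i).norm)
      ((hc.mul_const ‖A‖).mul_const ‖B‖) ?_
    filter_upwards [hZ] with q hq using hq A B F
  rw [← integral_tsum_of_summable_integral_norm hint hs]
  refine tsum_congr fun i => ?_
  rw [hB, hJ]
  simp_rw [hB]

end Trace

/-! ### The Banach space of Hilbert-Schmidt operators and the trace class inside it. -/

section HilbertSchmidtSpace

variable {d : ℕ} {𝒮 : Type*} [NormedAddCommGroup 𝒮] [InnerProductSpace ℂ 𝒮]
  [FiniteDimensional ℂ 𝒮] [CompleteSpace 𝒮]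

theorem isTraceClass_iff {T : POp d 𝒮} :
    IsTraceClass T ↔ ∃ C, 0 ≤ C ∧ TraceBound (siteBasis d 𝒮) T C := by
  constructor
  · intro h
    exact ⟨_, ENNReal.toReal_nonneg, traceBound_of_le _ _ ENNReal.toReal_nonneg
      (ENNReal.ofReal_toReal h.ne).ge⟩
  · rintro ⟨C, hC, h⟩
    exact (h.tsum_le hC).trans_lt ENNReal.ofReal_lt_top

theorem IsTraceClass.traceBound {T : POp d 𝒮} (h : IsTraceClass T) :
    TraceBound (siteBasis d 𝒮) T (traceNorm T).toReal :=
  traceBound_of_le _ _ ENNReal.toReal_nonneg (ENNReal.ofReal_toReal h.ne).ge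

/-- A form of `IsTraceNormBounded` in terms of `TraceBound`. -/
theorem isTraceNormBounded_of_traceBound {V : HSOp d 𝒮 →L[ℂ] HSOp d 𝒮} {C : ℝ} (hC : 0 ≤ C)
    (h : ∀ (S : HSOp d 𝒮) (c : ℝ), 0 ≤ c → TraceBound (siteBasis d 𝒮) (HSOp.op S) c →
      TraceBound (siteBasis d 𝒮) (HSOp.op (V S)) (C * c)) : IsTraceNormBounded V := by
  refine ⟨⟨C, hC⟩, fun S hS => ?_⟩
  refine ((h S _ ENNReal.toReal_nonneg hS.traceBound).tsum_le (by positivity)).trans ?_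
  rw [ENNReal.ofReal_mul hC, ENNReal.ofReal_toReal hS.ne]
  gcongr
  rw [ENNReal.ofReal]
  rw [Real.toNNReal_of_nonneg hC]
  exact le_rfl

theorem opTrace_mul_comm {T : POp d 𝒮} (h : IsTraceClass T) (A : POp d 𝒮) :
    opTrace (A * T) = opTrace (T * A) := by
  obtain ⟨C, hC, h⟩ := isTraceClass_iff.mp h
  exact h.tsum_mul_comm hC A

theorem HSOp.norm_op_le (S : HSOp d 𝒮) : ‖HSOp.op S‖ ≤ ‖S‖ := by
  refine ContinuousLinearMap.opNorm_le_bound _ (norm_nonneg _) fun x => ?_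
  have h : ENNReal.ofReal (‖HSOp.op S x‖ ^ 2) ≤ ENNReal.ofReal ((‖S‖ * ‖x‖) ^ 2) := by
    rw [(siteBasis d 𝒮).ofReal_norm_sq, mul_pow, ENNReal.ofReal_mul (by positivity),
      HSOp.ofReal_norm_sq, (siteBasis d 𝒮).tsum_adjoint, ← ENNReal.tsum_mul_right]
    refine ENNReal.tsum_le_tsum fun i => ?_
    rw [← ContinuousLinearMap.adjoint_inner_left, ← ENNReal.ofReal_mul (by positivity), ← mul_pow]
    exact ENNReal.ofReal_le_ofReal
      (pow_le_pow_left₀ (norm_nonneg _) (norm_inner_le_norm _ _) 2)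
  rw [ENNReal.ofReal_le_ofReal_iff (by positivity)] at h
  exact le_of_sq_le_sq h (by positivity)

/-- A Hilbert-Schmidt operator as a bounded operator, as a continuous linear map. -/
def HSOp.opL : HSOp d 𝒮 →L[ℂ] POp d 𝒮 :=
  LinearMap.mkContinuous HSOp.op 1 fun S => by rw [one_mul]; exact HSOp.norm_op_le S

/-- The operator is the adjoint of `g ↦ (⟨c i, g⟩)ᵢ`, which is bounded by Cauchy-Schwarz in each
component, so no series of columns has to be summed. -/
theorem HilbertBasis.exists_op_of_columns {ι E : Type*} [NormedAddCommGroup E]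
    [InnerProductSpace ℂ E] [CompleteSpace E] (b : HilbertBasis ι ℂ E)
    (c : lp (fun _ : ι => E) 2) : ∃ T : E →L[ℂ] E, ∀ i, T (b i) = c i := by
  have hmem : ∀ g : E, Memℓp (fun i => ⟪c i, g⟫_ℂ) 2 := fun g => by
    refine ((lp.memℓp ((‖g‖ : ℂ) • c)).mono' fun i => ?_)
    rw [lp.coeFn_smul, Pi.smul_apply, norm_smul, Complex.norm_real, norm_norm, mul_comm]
    exact norm_inner_le_norm _ _
  let R : E →L[ℂ] lp (fun _ : ι => ℂ) 2 := LinearMap.mkContinuous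
    { toFun := fun g => ⟨fun i => ⟪c i, g⟫_ℂ, hmem g⟩
      map_add' := fun f g => by
        apply lp.ext; funext i; exact inner_add_right _ _ _
      map_smul' := fun a g => by
        apply lp.ext; funext i; exact inner_smul_right _ _ _ } ‖c‖ (fun g => by
      have h := lp.norm_mono (p := 2) (by norm_num)
        (x := (⟨fun i => ⟪c i, g⟫_ℂ, hmem g⟩ : lp (fun _ : ι => ℂ) 2)) (y := ((‖g‖ : ℂ) • c))
        (fun i => by
          rw [lp.coeFn_smul, Pi.smul_apply, norm_smul, Complex.norm_real, norm_norm, mul_comm]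
          exact norm_inner_le_norm _ _)
      rwa [norm_smul, Complex.norm_real, norm_norm, mul_comm] at h)
  let R' : E →L[ℂ] E := (b.repr.symm.toContinuousLinearEquiv : _ →L[ℂ] E).comp R
  refine ⟨ContinuousLinearMap.adjoint R', fun i => ?_⟩
  refine ext_inner_right ℂ fun g => ?_
  rw [ContinuousLinearMap.adjoint_inner_left, ← b.repr_apply_apply]
  have : R' g = b.repr.symm (R g) := rfl
  rw [this, LinearIsometryEquiv.apply_symm_apply]
  rfl

theorem HSOp.columns_surjective : Function.Surjective (HSOp.columns (d := d) (𝒮 := 𝒮)) := by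
  intro c
  obtain ⟨T, hT⟩ := (siteBasis d 𝒮).exists_op_of_columns c
  have hmem : T ∈ hsSubmodule d 𝒮 := by
    change Memℓp (fun i => T (siteBasis d 𝒮 i)) 2
    simp_rw [hT]
    exact lp.memℓp c
  refine ⟨(⟨T, hmem⟩ : hsSubmodule d 𝒮), ?_⟩
  apply lp.ext
  funext i
  exact hT i

/-- Needed for Bochner integrals of superoperators and for their exponential series. -/
instance : CompleteSpace (HSOp d 𝒮) := by
  let e : HSOp d 𝒮 ≃ₗᵢ[ℂ] lp (fun _ : SiteIdx d 𝒮 => PSpace d 𝒮) 2 :=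
    LinearIsometryEquiv.ofSurjective ⟨HSOp.columns, fun _ => rfl⟩ HSOp.columns_surjective
  exact (completeSpace_congr (e := e.toEquiv) e.isometry.isUniformEmbedding).mpr inferInstance

@[simp] theorem op_hsLeft (A : POp d 𝒮) (S : HSOp d 𝒮) :
    HSOp.op (hsLeft A S) = A * HSOp.op S := rfl

@[simp] theorem op_hsRight (A : POp d 𝒮) (S : HSOp d 𝒮) :
    HSOp.op (hsRight A S) = HSOp.op S * A := rfl

theorem norm_hsLeft_le (A : POp d 𝒮) : ‖hsLeft A‖ ≤ ‖A‖ :=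
  LinearMap.mkContinuous_norm_le _ (norm_nonneg _) _

theorem norm_hsRight_le (A : POp d 𝒮) : ‖hsRight A‖ ≤ ‖A‖ :=
  LinearMap.mkContinuous_norm_le _ (norm_nonneg _) _

end HilbertSchmidtSpace

/-! ### Matrix elements, phases, and averages of wave conjugations. -/

section Kernels

variable {d : ℕ} {𝒮 : Type*} [NormedAddCommGroup 𝒮] [InnerProductSpace ℂ 𝒮]

theorem kernelOf_apply (T : POp d 𝒮) (x y : Fin d → ℤ) (v : 𝒮) :
    kernelOf T x y v = T (lp.single 2 y v) x := rfl

theorem kernelOf_add (T T' : POp d 𝒮) (x y : Fin d → ℤ) :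
    kernelOf (T + T') x y = kernelOf T x y + kernelOf T' x y := by
  ext v; rfl

theorem kernelOf_sub (T T' : POp d 𝒮) (x y : Fin d → ℤ) :
    kernelOf (T - T') x y = kernelOf T x y - kernelOf T' x y := by
  ext v; rfl

theorem kernelOf_neg (T : POp d 𝒮) (x y : Fin d → ℤ) :
    kernelOf (-T) x y = -kernelOf T x y := by
  ext v; rfl

theorem kernelOf_smul (c : ℂ) (T : POp d 𝒮) (x y : Fin d → ℤ) :
    kernelOf (c • T) x y = c • kernelOf T x y := by
  ext v; rfl

theorem hasSum_kernelOf (T : POp d 𝒮) (f : PSpace d 𝒮) (x : Fin d → ℤ) :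
    HasSum (fun z => kernelOf T x z (f z)) (T f x) := by
  have h := lp.hasSum_single (p := 2) (by norm_num) f
  exact (h.mapL T).mapL (lp.evalCLM ℂ (fun _ : Fin d → ℤ => 𝒮) 2 x)

theorem kernelOf_ext {T T' : POp d 𝒮} (h : ∀ x y, kernelOf T x y = kernelOf T' x y) : T = T' := by
  ext f x
  refine (hasSum_kernelOf T f x).unique ?_
  simp_rw [h]
  exact hasSum_kernelOf T' f x

theorem hasSum_kernelOf_mul (A T : POp d 𝒮) (x y : Fin d → ℤ) (v : 𝒮) :
    HasSum (fun z => kernelOf A x z (kernelOf T z y v)) (kernelOf (A * T) x y v) :=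
  hasSum_kernelOf A (T (lp.single 2 y v)) x

@[simp] theorem onSites_apply (B : 𝒮 →L[ℂ] 𝒮) (f : PSpace d 𝒮) (x : Fin d → ℤ) :
    onSites B f x = B (f x) := rfl

theorem norm_onSites (B : 𝒮 →L[ℂ] 𝒮) : ‖(onSites B : POp d 𝒮)‖ ≤ ‖B‖ :=
  LinearMap.mkContinuous_norm_le _ (norm_nonneg _) _

theorem onSites_single (B : 𝒮 →L[ℂ] 𝒮) (y : Fin d → ℤ) (v : 𝒮) :
    (onSites B : POp d 𝒮) (lp.single 2 y v) = lp.single 2 y (B v) := by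
  apply lp.ext
  funext x
  rw [onSites_apply, lp.coeFn_single, lp.coeFn_single]
  by_cases h : x = y
  · subst h; simp
  · simp [h]

theorem kernelOf_onSites_mul (B : 𝒮 →L[ℂ] 𝒮) (T : POp d 𝒮) (x y : Fin d → ℤ) :
    kernelOf (onSites B * T) x y = B * kernelOf T x y := by
  ext v; rfl

theorem kernelOf_mul_onSites (B : 𝒮 →L[ℂ] 𝒮) (T : POp d 𝒮) (x y : Fin d → ℤ) :
    kernelOf (T * onSites B) x y = kernelOf T x y * B := by
  ext v
  change T (onSites B (lp.single 2 y v)) x = T (lp.single 2 y (B v)) x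
  rw [onSites_single]

variable (d) in
/-- `B ↦ 1 ⊗ B` as a continuous linear map. -/
def onSitesL : (𝒮 →L[ℂ] 𝒮) →L[ℂ] POp d 𝒮 :=
  LinearMap.mkContinuous
    { toFun := fun B => (onSites B : POp d 𝒮)
      map_add' := fun A B => by ext f x; rfl
      map_smul' := fun c B => by ext f x; rfl }
    1 fun B => by rw [one_mul]; exact norm_onSites B

theorem adjoint_onSites [CompleteSpace 𝒮] (B : 𝒮 →L[ℂ] 𝒮) :
    ContinuousLinearMap.adjoint (onSites B : POp d 𝒮) =
      onSites (ContinuousLinearMap.adjoint B) := by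
  refine ((ContinuousLinearMap.eq_adjoint_iff _ _).mpr fun f g => ?_).symm
  rw [lp.inner_eq_tsum, lp.inner_eq_tsum]
  refine tsum_congr fun x => ?_
  rw [onSites_apply, onSites_apply, ContinuousLinearMap.adjoint_inner_left]

theorem memlp_phase (θ : (Fin d → ℤ) → ℝ) (f : PSpace d 𝒮) :
    Memℓp (fun x => Complex.exp (Complex.I * θ x) • f x) 2 := by
  refine (lp.memℓp f).mono' fun x => ?_
  rw [norm_smul, mul_comm Complex.I, Complex.norm_exp_ofReal_mul_I, one_mul]

/-- Multiplication by the phases `e^{iθ(x)}`. -/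
def phaseOp (θ : (Fin d → ℤ) → ℝ) : POp d 𝒮 :=
  LinearMap.mkContinuous
    { toFun := fun f => ⟨fun x => Complex.exp (Complex.I * θ x) • f x, memlp_phase θ f⟩
      map_add' := fun f g => by
        apply lp.ext; funext x; exact smul_add _ (f x) (g x)
      map_smul' := fun c f => by
        apply lp.ext; funext x
        change Complex.exp (Complex.I * θ x) • (c • f x) = c • (Complex.exp (Complex.I * θ x) • f x)
        rw [smul_comm] }
    1 fun f => by
      rw [one_mul]
      refine lp.norm_mono (p := 2) (by norm_num) fun x => ?_
      refine le_of_eq ?_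
      change ‖Complex.exp (Complex.I * θ x) • f x‖ = _
      rw [norm_smul, mul_comm Complex.I, Complex.norm_exp_ofReal_mul_I, one_mul]

@[simp] theorem phaseOp_apply (θ : (Fin d → ℤ) → ℝ) (f : PSpace d 𝒮) (x : Fin d → ℤ) :
    phaseOp θ f x = Complex.exp (Complex.I * θ x) • f x := rfl

theorem norm_phaseOp (θ : (Fin d → ℤ) → ℝ) : ‖(phaseOp θ : POp d 𝒮)‖ ≤ 1 :=
  LinearMap.mkContinuous_norm_le _ zero_le_one _

theorem norm_phaseOp_apply_le (θ : (Fin d → ℤ) → ℝ) (f : PSpace d 𝒮) : ‖phaseOp θ f‖ ≤ ‖f‖ :=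
  (ContinuousLinearMap.le_of_opNorm_le (phaseOp θ : POp d 𝒮) (norm_phaseOp θ) f).trans_eq
    (one_mul _)

theorem adjoint_phaseOp [CompleteSpace 𝒮] (θ : (Fin d → ℤ) → ℝ) :
    ContinuousLinearMap.adjoint (phaseOp θ : POp d 𝒮) = phaseOp (-θ) := by
  refine ((ContinuousLinearMap.eq_adjoint_iff _ _).mpr fun f g => ?_).symm
  rw [lp.inner_eq_tsum, lp.inner_eq_tsum]
  refine tsum_congr fun x => ?_
  rw [phaseOp_apply, phaseOp_apply, inner_smul_left, inner_smul_right, ← Complex.exp_conj]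
  simp

theorem phaseOp_single (θ : (Fin d → ℤ) → ℝ) (y : Fin d → ℤ) (v : 𝒮) :
    (phaseOp θ : POp d 𝒮) (lp.single 2 y v) =
      Complex.exp (Complex.I * θ y) • lp.single 2 y v := by
  apply lp.ext
  funext x
  rw [phaseOp_apply, lp.coeFn_smul, Pi.smul_apply, lp.coeFn_single]
  by_cases h : x = y
  · subst h; rfl
  · simp [h]

theorem kernelOf_phase_conj (θ θ' : (Fin d → ℤ) → ℝ) (T : POp d 𝒮) (x y : Fin d → ℤ) :
    kernelOf (phaseOp θ * T * phaseOp θ') x y =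
      (Complex.exp (Complex.I * θ x) * Complex.exp (Complex.I * θ' y)) • kernelOf T x y := by
  ext v
  change Complex.exp (Complex.I * θ x) • (T (phaseOp θ' (lp.single 2 y v)) x) = _
  rw [phaseOp_single, map_smul, mul_smul]
  rfl

/-- The plane wave phases `x ↦ q·x` on the lattice. -/
def latticePhase (q : EuclideanSpace ℝ (Fin d)) (x : Fin d → ℤ) : ℝ := ∑ j, q j * (x j : ℝ)

theorem latticePhase_neg (q : EuclideanSpace ℝ (Fin d)) :
    latticePhase (-q) = -latticePhase q := by
  funext x
  simp [latticePhase]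

theorem continuous_latticePhase (x : Fin d → ℤ) :
    Continuous fun q : EuclideanSpace ℝ (Fin d) => latticePhase q x := by
  unfold latticePhase; fun_prop

/-- The unitary operator `e^{iq·X}`. -/
def planeWave (q : EuclideanSpace ℝ (Fin d)) : POp d 𝒮 := phaseOp (latticePhase q)

/-- Finitely supported vectors give finite sums of continuous scalar phases, and the contractivity
of `planeWave q` makes the approximation uniform in `q`. -/
theorem continuous_planeWave_apply (f : PSpace d 𝒮) :
    Continuous fun q : EuclideanSpace ℝ (Fin d) => planeWave q f := by
  have h := lp.hasSum_single (p := 2) (by norm_num) f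
  have hu : TendstoUniformly (fun (s : Finset (Fin d → ℤ)) (q : EuclideanSpace ℝ (Fin d)) =>
      planeWave q (∑ z ∈ s, lp.single 2 z (f z))) (fun q => planeWave q f) Filter.atTop := by
    rw [Metric.tendstoUniformly_iff]
    intro ε hε
    have h1 := Metric.tendsto_nhds.mp h ε hε
    filter_upwards [h1] with s hs q
    rw [dist_comm, dist_eq_norm, ← map_sub]
    rw [dist_eq_norm] at hs
    exact (norm_phaseOp_apply_le _ _).trans_lt hs
  refine hu.continuous (Filter.Frequently.of_forall fun s => ?_)
  simp_rw [map_sum]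
  refine continuous_finsetSum _ fun z _ => ?_
  simp_rw [planeWave, phaseOp_single]
  have := continuous_latticePhase z
  fun_prop

theorem Continuous.planeWave_apply {g : EuclideanSpace ℝ (Fin d) → PSpace d 𝒮} (hg : Continuous g) :
    Continuous fun q => planeWave q (g q) := by
  rw [continuous_iff_continuousAt]
  intro q₀
  have h1 : Filter.Tendsto (fun q => planeWave q (g q - g q₀)) (nhds q₀) (nhds 0) := by
    refine squeeze_zero_norm (fun q => norm_phaseOp_apply_le _ _) ?_
    have h2 : Continuous fun q => ‖g q - g q₀‖ := by fun_prop
    simpa using h2.tendsto q₀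
  have h2 := (continuous_planeWave_apply (g q₀)).tendsto q₀
  have h3 := h1.add h2
  rw [zero_add] at h3
  refine h3.congr fun q => ?_
  rw [← map_add, sub_add_cancel]

/-- The conjugation `X ↦ e^{iq·X} T e^{-iq·X}`. -/
def waveConj (q : EuclideanSpace ℝ (Fin d)) (T : POp d 𝒮) : POp d 𝒮 :=
  planeWave q * T * planeWave (-q)

theorem waveConj_apply (q : EuclideanSpace ℝ (Fin d)) (T : POp d 𝒮) (f : PSpace d 𝒮) :
    waveConj q T f = planeWave q (T (planeWave (-q) f)) := rfl

theorem norm_waveConj_apply_le (q : EuclideanSpace ℝ (Fin d)) (T : POp d 𝒮) (f : PSpace d 𝒮) :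
    ‖waveConj q T f‖ ≤ ‖T‖ * ‖f‖ :=
  (norm_phaseOp_apply_le _ _).trans
    ((T.le_opNorm _).trans (by gcongr; exact norm_phaseOp_apply_le _ _))

theorem norm_waveConj_le (q : EuclideanSpace ℝ (Fin d)) (T : POp d 𝒮) :
    ‖waveConj q T‖ ≤ ‖T‖ :=
  ContinuousLinearMap.opNorm_le_bound _ (norm_nonneg T) (norm_waveConj_apply_le q T)

theorem continuous_waveConj_apply (T : POp d 𝒮) (f : PSpace d 𝒮) :
    Continuous fun q => waveConj q T f := by
  have h : Continuous fun q : EuclideanSpace ℝ (Fin d) => planeWave (-q) f :=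
    (continuous_planeWave_apply f).comp continuous_neg
  exact (T.continuous.comp h).planeWave_apply

theorem kernelOf_waveConj (q : EuclideanSpace ℝ (Fin d)) (T : POp d 𝒮) (x y : Fin d → ℤ) :
    kernelOf (waveConj q T) x y =
      Complex.exp (Complex.I * (latticePhase q x - latticePhase q y)) • kernelOf T x y := by
  unfold waveConj planeWave
  rw [kernelOf_phase_conj, latticePhase_neg, ← Complex.exp_add]
  congr 2
  simp
  ring

variable [CompleteSpace 𝒮]

theorem adjoint_planeWave (q : EuclideanSpace ℝ (Fin d)) :
    ContinuousLinearMap.adjoint (planeWave q : POp d 𝒮) = planeWave (-q) := by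
  rw [planeWave, adjoint_phaseOp, planeWave, latticePhase_neg]

theorem integrable_smul_waveConj {p : EuclideanSpace ℝ (Fin d) → ℂ} (hp : Integrable p)
    (T : POp d 𝒮) (f : PSpace d 𝒮) : Integrable fun q => p q • waveConj q T f := by
  refine (hp.norm.mul_const (‖T‖ * ‖f‖)).mono'
    (hp.aestronglyMeasurable.smul (continuous_waveConj_apply T f).aestronglyMeasurable)
    (Filter.Eventually.of_forall fun q => ?_)
  rw [norm_smul]
  gcongr
  exact norm_waveConj_apply_le q T f

theorem norm_integral_smul_waveConj_le {p : EuclideanSpace ℝ (Fin d) → ℂ} (hp : Integrable p)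
    (T : POp d 𝒮) (f : PSpace d 𝒮) :
    ‖∫ q, p q • waveConj q T f‖ ≤ (∫ q, ‖p q‖) * ‖T‖ * ‖f‖ := by
  rw [mul_assoc, ← integral_mul_const]
  refine norm_integral_le_of_norm_le (hp.norm.mul_const _) (Filter.Eventually.of_forall fun q => ?_)
  rw [norm_smul]
  gcongr
  exact norm_waveConj_apply_le q T f

/-- The operator `∫ p(q) e^{iq·X} T e^{-iq·X} dq`, for an integrable weight `p`. -/
def waveAvgOp (p : EuclideanSpace ℝ (Fin d) → ℂ) (hp : Integrable p) (T : POp d 𝒮) : POp d 𝒮 :=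
  LinearMap.mkContinuous
    -- The integral is formed vector by vector, since only strong continuity in `q` is at hand.
    { toFun := fun f => ∫ q, p q • waveConj q T f
      map_add' := fun f g => by
        rw [← integral_add (integrable_smul_waveConj hp T f) (integrable_smul_waveConj hp T g)]
        simp_rw [map_add, smul_add]
      map_smul' := fun c f => by
        rw [RingHom.id_apply, ← integral_smul]
        simp_rw [map_smul, smul_comm c] }
    ((∫ q, ‖p q‖) * ‖T‖) (norm_integral_smul_waveConj_le hp T)

theorem waveAvgOp_apply {p : EuclideanSpace ℝ (Fin d) → ℂ} (hp : Integrable p) (T : POp d 𝒮)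
    (f : PSpace d 𝒮) : waveAvgOp p hp T f = ∫ q, p q • waveConj q T f := rfl

theorem norm_waveAvgOp_le {p : EuclideanSpace ℝ (Fin d) → ℂ} (hp : Integrable p) (T : POp d 𝒮) :
    ‖waveAvgOp p hp T‖ ≤ (∫ q, ‖p q‖) * ‖T‖ :=
  LinearMap.mkContinuous_norm_le _
    (mul_nonneg (integral_nonneg fun _ => norm_nonneg _) (norm_nonneg T)) _

/-- The superoperator `T ↦ ∫ p(q) e^{iq·X} T e^{-iq·X} dq`, for an integrable weight `p`. -/
def waveAvg (p : EuclideanSpace ℝ (Fin d) → ℂ) (hp : Integrable p) : POp d 𝒮 →L[ℂ] POp d 𝒮 :=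
  LinearMap.mkContinuous
    { toFun := fun T => waveAvgOp p hp T
      map_add' := fun T T' => by
        ext1 f
        rw [add_apply, waveAvgOp_apply, waveAvgOp_apply, waveAvgOp_apply,
          ← integral_add (integrable_smul_waveConj hp T f) (integrable_smul_waveConj hp T' f)]
        simp_rw [waveConj_apply, add_apply, map_add, smul_add]
      map_smul' := fun c T => by
        ext1 f
        rw [RingHom.id_apply, smul_apply, waveAvgOp_apply, waveAvgOp_apply, ← integral_smul]
        simp_rw [waveConj_apply, smul_apply, map_smul, smul_comm c] }
    (∫ q, ‖p q‖) (norm_waveAvgOp_le hp)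

theorem waveAvg_apply {p : EuclideanSpace ℝ (Fin d) → ℂ} (hp : Integrable p) (T : POp d 𝒮)
    (f : PSpace d 𝒮) : waveAvg p hp T f = ∫ q, p q • waveConj q T f := rfl

theorem norm_waveAvg_le {p : EuclideanSpace ℝ (Fin d) → ℂ} (hp : Integrable p) :
    ‖(waveAvg p hp : POp d 𝒮 →L[ℂ] POp d 𝒮)‖ ≤ ∫ q, ‖p q‖ :=
  LinearMap.mkContinuous_norm_le _ (integral_nonneg fun _ => norm_nonneg _) _

theorem waveAvg_sub {p p' : EuclideanSpace ℝ (Fin d) → ℂ} (hp : Integrable p)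
    (hp' : Integrable p') :
    (waveAvg p hp - waveAvg p' hp' : POp d 𝒮 →L[ℂ] POp d 𝒮) = waveAvg (p - p') (hp.sub hp') := by
  ext1 T
  ext1 f
  rw [sub_apply, sub_apply, waveAvg_apply, waveAvg_apply,
    ← integral_sub (integrable_smul_waveConj hp T f) (integrable_smul_waveConj hp' T f),
    waveAvg_apply]
  simp_rw [Pi.sub_apply, sub_smul]

theorem inner_waveAvg {p : EuclideanSpace ℝ (Fin d) → ℂ} (hp : Integrable p) (T : POp d 𝒮)
    (f g : PSpace d 𝒮) : ⟪f, waveAvg p hp T g⟫_ℂ = ∫ q, ⟪f, (p q • waveConj q T) g⟫_ℂ := by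
  rw [waveAvg_apply, ← integral_inner (integrable_smul_waveConj hp T g)]
  rfl

/-- The Fourier transform `∫ p(q) e^{iq·(x - y)} dq` of a weight. -/
def weightFourier (p : EuclideanSpace ℝ (Fin d) → ℂ) (x y : Fin d → ℤ) : ℂ :=
  ∫ q, p q * Complex.exp (Complex.I * (latticePhase q x - latticePhase q y))

/-- Conjugation by `e^{iq·X}` multiplies the entry at `(x,y)` by `e^{iq·(x-y)}`, so the average is a
Schur multiplier. This second description gives a Hilbert-Schmidt bound by the supremum of the
multiplier, in place of the `L¹` norm of the weight. -/
theorem kernelOf_waveAvg {p : EuclideanSpace ℝ (Fin d) → ℂ} (hp : Integrable p) (T : POp d 𝒮)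
    (x y : Fin d → ℤ) :
    kernelOf (waveAvg p hp T) x y = weightFourier p x y • kernelOf T x y := by
  ext v
  have h : kernelOf (waveAvg p hp T) x y v =
      ∫ q, lp.evalCLM ℂ (fun _ : Fin d → ℤ => 𝒮) 2 x (p q • waveConj q T (lp.single 2 y v)) :=
    (ContinuousLinearMap.integral_comp_comm (lp.evalCLM ℂ (fun _ : Fin d → ℤ => 𝒮) 2 x)
      (integrable_smul_waveConj hp T (lp.single 2 y v))).symm
  rw [h, smul_apply, weightFourier, ← integral_smul_const]
  refine integral_congr_ae (Filter.Eventually.of_forall fun q => ?_)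
  change p q • kernelOf (waveConj q T) x y v = _
  rw [kernelOf_waveConj, smul_apply, smul_smul]

end Kernels

/-! ### Schur multipliers on Hilbert-Schmidt operators, and duality of averages. -/

section HilbertSchmidtMultipliers

variable {d : ℕ} {𝒮 : Type*} [NormedAddCommGroup 𝒮] [InnerProductSpace ℂ 𝒮]
  [FiniteDimensional ℂ 𝒮] [CompleteSpace 𝒮]

theorem siteBasis_apply (i : SiteIdx d 𝒮) :
    siteBasis d 𝒮 i = lp.single 2 i.1 (stdOrthonormalBasis ℂ 𝒮 i.2) := by
  unfold siteBasis
  rw [HilbertBasis.coe_mkOfOrthogonalEqBot]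
  rfl

theorem apply_siteBasis_apply (T : POp d 𝒮) (i : SiteIdx d 𝒮) (x : Fin d → ℤ) :
    T (siteBasis d 𝒮 i) x = kernelOf T x i.1 (stdOrthonormalBasis ℂ 𝒮 i.2) := by
  rw [siteBasis_apply]; rfl

theorem norm_apply_siteBasis_le_of_kernelOf {S T : POp d 𝒮} {c : (Fin d → ℤ) → (Fin d → ℤ) → ℂ}
    {C : ℝ} (hC : 0 ≤ C) (hc : ∀ x y, ‖c x y‖ ≤ C)
    (h : ∀ x y, kernelOf S x y = c x y • kernelOf T x y) (i : SiteIdx d 𝒮) :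
    ‖S (siteBasis d 𝒮 i)‖ ≤ C * ‖T (siteBasis d 𝒮 i)‖ := by
  have h1 : C * ‖T (siteBasis d 𝒮 i)‖ = ‖(C : ℂ) • T (siteBasis d 𝒮 i)‖ := by
    rw [norm_smul, Complex.norm_real, Real.norm_of_nonneg hC]
  rw [h1]
  refine lp.norm_mono (p := 2) (by norm_num) fun x => ?_
  rw [lp.coeFn_smul, Pi.smul_apply, apply_siteBasis_apply, apply_siteBasis_apply, h, smul_apply,
    norm_smul, norm_smul, Complex.norm_real, Real.norm_of_nonneg hC]
  gcongr
  exact hc _ _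

/-- The Hilbert-Schmidt norm is an `ℓ²` norm of matrix elements, so multiplying these by scalars
costs at most the supremum of the scalars. -/
theorem tsum_le_of_kernelOf {S T : POp d 𝒮} {c : (Fin d → ℤ) → (Fin d → ℤ) → ℂ}
    {C : ℝ} (hC : 0 ≤ C) (hc : ∀ x y, ‖c x y‖ ≤ C)
    (h : ∀ x y, kernelOf S x y = c x y • kernelOf T x y) :
    ∑' i, ENNReal.ofReal (‖S (siteBasis d 𝒮 i)‖ ^ 2)
      ≤ ENNReal.ofReal (C ^ 2) * ∑' i, ENNReal.ofReal (‖T (siteBasis d 𝒮 i)‖ ^ 2) := by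
  rw [← ENNReal.tsum_mul_left]
  refine ENNReal.tsum_le_tsum fun i => ?_
  rw [← ENNReal.ofReal_mul (by positivity), ← mul_pow]
  exact ENNReal.ofReal_le_ofReal (pow_le_pow_left₀ (norm_nonneg _)
    (norm_apply_siteBasis_le_of_kernelOf hC hc h i) 2)

theorem norm_weightFourier_le (p : EuclideanSpace ℝ (Fin d) → ℂ) (x y : Fin d → ℤ) :
    ‖weightFourier p x y‖ ≤ ∫ q, ‖p q‖ := by
  refine (norm_integral_le_integral_norm _).trans (le_of_eq ?_)
  congr 1
  funext q
  rw [norm_mul, ← Complex.ofReal_sub, mul_comm Complex.I, Complex.norm_exp_ofReal_mul_I, mul_one]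

theorem waveAvg_mem_hsSubmodule {p : EuclideanSpace ℝ (Fin d) → ℂ} (hp : Integrable p)
    (S : HSOp d 𝒮) : waveAvg p hp (HSOp.op S) ∈ hsSubmodule d 𝒮 :=
  (memlp_two_iff _).mpr (ne_top_of_le_ne_top
    (ENNReal.mul_ne_top ENNReal.ofReal_ne_top ((memlp_two_iff _).mp S.2))
    (tsum_le_of_kernelOf (integral_nonneg fun _ => norm_nonneg _) (norm_weightFourier_le p)
      (kernelOf_waveAvg hp (HSOp.op S))))

/-- The superoperator `waveAvg` on Hilbert-Schmidt operators. -/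
def hsWaveAvg (p : EuclideanSpace ℝ (Fin d) → ℂ) (hp : Integrable p) :
    HSOp d 𝒮 →L[ℂ] HSOp d 𝒮 :=
  LinearMap.mkContinuous
    { toFun := fun S => ⟨waveAvg p hp (HSOp.op S), waveAvg_mem_hsSubmodule hp S⟩
      map_add' := fun S T => HSOp.op_injective (map_add (waveAvg p hp) (HSOp.op S) (HSOp.op T))
      map_smul' := fun c S => HSOp.op_injective (map_smul (waveAvg p hp) c (HSOp.op S)) }
    (∫ q, ‖p q‖) fun S => HSOp.norm_le_of_tsum (integral_nonneg fun _ => norm_nonneg _)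
      (tsum_le_of_kernelOf (integral_nonneg fun _ => norm_nonneg _) (norm_weightFourier_le p)
      (kernelOf_waveAvg hp (HSOp.op S)))

@[simp] theorem op_hsWaveAvg {p : EuclideanSpace ℝ (Fin d) → ℂ} (hp : Integrable p)
    (S : HSOp d 𝒮) : HSOp.op (hsWaveAvg p hp S) = waveAvg p hp (HSOp.op S) := rfl

/-- The decay of correlations in time enters through this bound: the supremum of the Fourier
transform decays, while the `L¹` norm of the weight need not. -/
theorem norm_hsWaveAvg_le {p : EuclideanSpace ℝ (Fin d) → ℂ} (hp : Integrable p) {C : ℝ}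
    (hC : 0 ≤ C) (h : ∀ x y, ‖weightFourier p x y‖ ≤ C) :
    ‖(hsWaveAvg p hp : HSOp d 𝒮 →L[ℂ] HSOp d 𝒮)‖ ≤ C :=
  ContinuousLinearMap.opNorm_le_bound _ hC fun S =>
    HSOp.norm_le_of_tsum hC (tsum_le_of_kernelOf hC h (kernelOf_waveAvg hp (HSOp.op S)))

theorem hsWaveAvg_sub {p p' : EuclideanSpace ℝ (Fin d) → ℂ} (hp : Integrable p)
    (hp' : Integrable p') :
    (hsWaveAvg p hp - hsWaveAvg p' hp' : HSOp d 𝒮 →L[ℂ] HSOp d 𝒮) =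
      hsWaveAvg (p - p') (hp.sub hp') := by
  ext1 S
  apply HSOp.op_injective
  have h := congrArg (fun V : POp d 𝒮 →L[ℂ] POp d 𝒮 => V (HSOp.op S)) (waveAvg_sub hp hp')
  exact h

theorem aestronglyMeasurable_inner_waveConj {p : EuclideanSpace ℝ (Fin d) → ℂ} (hp : Integrable p)
    (T : POp d 𝒮) (f g : PSpace d 𝒮) :
    AEStronglyMeasurable (fun q => ⟪f, (p q • waveConj q T) g⟫_ℂ) := by
  have h := (integrable_smul_waveConj hp T g).aestronglyMeasurable
  exact aestronglyMeasurable_const.inner h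

theorem TraceBound.waveConj {T : POp d 𝒮} {C : ℝ} (hC : 0 ≤ C)
    (h : TraceBound (siteBasis d 𝒮) T C) (q : EuclideanSpace ℝ (Fin d)) :
    TraceBound (siteBasis d 𝒮) (waveConj q T) C := by
  refine (h.conj hC (planeWave q) (planeWave (-q))).mono ?_
  have h1 : ‖(planeWave q : POp d 𝒮)‖ ≤ 1 := norm_phaseOp _
  have h2 : ‖(planeWave (-q) : POp d 𝒮)‖ ≤ 1 := norm_phaseOp _
  calc _ ≤ C * 1 * 1 := by gcongr
    _ = C := by ring

theorem TraceBound.waveAvg {T : POp d 𝒮} {C : ℝ} (hC : 0 ≤ C)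
    (h : TraceBound (siteBasis d 𝒮) T C) {p : EuclideanSpace ℝ (Fin d) → ℂ} (hp : Integrable p) :
    TraceBound (siteBasis d 𝒮) (waveAvg p hp T) ((∫ q, ‖p q‖) * C) := by
  rw [← integral_mul_const]
  exact TraceBound.of_integral (inner_waveAvg hp T) (aestronglyMeasurable_inner_waveConj hp T)
    (hp.norm.mul_const C) (Filter.Eventually.of_forall fun q => (h.waveConj hC q).smul _)

/-- Duality for weighted averages of conjugations with even weight. -/
theorem opTrace_mul_waveAvg {S : POp d 𝒮} (hS : IsTraceClass S) (X : POp d 𝒮)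
    {p : EuclideanSpace ℝ (Fin d) → ℂ} (hp : Integrable p) (hev : ∀ q, p (-q) = p q) :
    opTrace (S * waveAvg p hp X) = opTrace (waveAvg p hp S * X) := by
  obtain ⟨C, hC, h⟩ := isTraceClass_iff.mp hS
  have h1 := TraceBound.tsum_integral (μ := volume) (b := siteBasis d 𝒮) (J := waveAvg p hp S)
    (inner_waveAvg hp S) (aestronglyMeasurable_inner_waveConj hp S)
    (hp.norm.mul_const C) (Filter.Eventually.of_forall fun q => (h.waveConj hC q).smul _) X 1
  have h2 := TraceBound.tsum_integral (μ := volume) (b := siteBasis d 𝒮) (J := S * waveAvg p hp X)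
    (Z := fun q => S * (p q • waveConj q X)) (c := fun q => ‖p q‖ * (C * ‖X‖))
    (fun f g => by
      change ⟪f, S (waveAvg p hp X g)⟫_ℂ = ∫ q, ⟪f, S ((p q • waveConj q X) g)⟫_ℂ
      simp_rw [← ContinuousLinearMap.adjoint_inner_left S]
      exact inner_waveAvg hp X _ _)
    (fun f g => by
      change AEStronglyMeasurable (fun q => ⟪f, S ((p q • waveConj q X) g)⟫_ℂ)
      simp_rw [← ContinuousLinearMap.adjoint_inner_left S]
      exact aestronglyMeasurable_inner_waveConj hp X _ _)
    (hp.norm.mul_const _) (Filter.Eventually.of_forall fun q => by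
      have h3 := (h.conj hC 1 (waveConj q X)).smul (p q)
      rw [one_mul] at h3
      have h4 : S * (p q • waveConj q X) = p q • (S * waveConj q X) := mul_smul_comm _ _ _
      rw [h4]
      refine h3.mono ?_
      have h5 : ‖(1 : POp d 𝒮)‖ ≤ 1 := ContinuousLinearMap.norm_id_le
      have h6 := norm_waveConj_le q X
      calc _ ≤ ‖p q‖ * (C * 1 * ‖X‖) := by gcongr
        _ = _ := by ring) 1 1
  have h3 : opTrace (waveAvg p hp S * X) = ∫ q, p q * opTrace (waveConj q S * X) := by
    refine h1.trans (integral_congr_ae (Filter.Eventually.of_forall fun q => ?_))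
    change ∑' i, ⟪siteBasis d 𝒮 i, p q • (waveConj q S (X (siteBasis d 𝒮 i)))⟫_ℂ = _
    simp_rw [inner_smul_right]
    exact tsum_mul_left
  have h4 : opTrace (S * waveAvg p hp X) = ∫ q, p q * opTrace (S * waveConj q X) := by
    refine h2.trans (integral_congr_ae (Filter.Eventually.of_forall fun q => ?_))
    change ∑' i, ⟪siteBasis d 𝒮 i, S (p q • (waveConj q X (siteBasis d 𝒮 i)))⟫_ℂ = _
    simp_rw [map_smul, inner_smul_right]
    exact tsum_mul_left
  -- Cyclicity moves the conjugation to the other factor with `q` replaced by `-q`; reflecting the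
  -- variable and using that the weight is even restores the original form.
  rw [h3, h4, ← integral_neg_eq_self]
  refine integral_congr_ae (Filter.Eventually.of_forall fun q => ?_)
  simp only [hev]
  congr 1
  have h5 : IsTraceClass (S * (planeWave (-q) * X)) := by
    refine isTraceClass_iff.mpr ⟨C * ‖(1 : POp d 𝒮)‖ * ‖planeWave (-q) * X‖, by positivity, ?_⟩
    simpa using h.conj hC 1 (planeWave (-q) * X)
  have h6 := opTrace_mul_comm h5 (planeWave q)
  rw [show waveConj q S * X = planeWave q * (S * (planeWave (-q) * X)) by
    simp only [waveConj, mul_assoc], h6]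
  simp only [waveConj, mul_assoc, neg_neg]

end HilbertSchmidtMultipliers

/-! ### Chernoff's product formula. -/

section Exponential

open Filter Topology

/-- Telescoping, one factor at a time. The norm of `1` is only assumed to be at most one, which also
covers operators on the trivial space. -/
theorem norm_pow_sub_pow_le {𝔸 : Type*} [NormedRing 𝔸] (h1 : ‖(1 : 𝔸)‖ ≤ 1) {a b : 𝔸} {M : ℝ}
    (ha : ‖a‖ ≤ M) (hb : ‖b‖ ≤ M) (hM : 1 ≤ M) (n : ℕ) :
    ‖a ^ n - b ^ n‖ ≤ n * M ^ n * ‖a - b‖ := by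
  have hpow : ∀ {c : 𝔸}, ‖c‖ ≤ M → ∀ n : ℕ, ‖c ^ n‖ ≤ M ^ n := by
    intro c hc n
    induction n with
    | zero => simpa using h1
    | succ n ih =>
      rw [pow_succ, pow_succ]
      exact (norm_mul_le _ _).trans (by gcongr)
  induction n with
  | zero => simp
  | succ n ih =>
    have e : a ^ (n + 1) - b ^ (n + 1) = a ^ n * (a - b) + (a ^ n - b ^ n) * b := by
      rw [pow_succ, pow_succ]; noncomm_ring
    have hMn : M ^ n ≤ M ^ (n + 1) := pow_le_pow_right₀ hM (Nat.le_succ n)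
    calc ‖a ^ (n + 1) - b ^ (n + 1)‖ ≤ ‖a ^ n‖ * ‖a - b‖ + ‖a ^ n - b ^ n‖ * ‖b‖ := by
          rw [e]
          exact (norm_add_le _ _).trans (add_le_add (norm_mul_le _ _) (norm_mul_le _ _))
      _ ≤ M ^ (n + 1) * ‖a - b‖ + (n * M ^ n * ‖a - b‖) * M := by
          gcongr
          exact (hpow ha n).trans hMn
      _ = ((n + 1 : ℕ) : ℝ) * M ^ (n + 1) * ‖a - b‖ := by push_cast; ring

/-- **Chernoff's product formula** for curves in a Banach algebra. -/
theorem tendsto_pow_exp_of_hasDerivAt {𝔸 : Type*} [NormedRing 𝔸] [NormedAlgebra ℂ 𝔸]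
    [CompleteSpace 𝔸] (h1 : ‖(1 : 𝔸)‖ ≤ 1) {a : ℝ → 𝔸} {x : 𝔸} (ha0 : a 0 = 1)
    (ha : HasDerivAt a x 0) :
    Tendsto (fun n : ℕ => a (1 / ((n : ℝ) + 1)) ^ (n + 1)) atTop (𝓝 (NormedSpace.exp x)) := by
  let _ : NormedAlgebra ℝ 𝔸 := NormedAlgebra.restrictScalars ℝ ℂ 𝔸
  let _ : NormedAlgebra ℚ 𝔸 := NormedAlgebra.restrictScalars ℚ ℝ 𝔸
  -- The extra `1` absorbs the remainder `o(s)`: near `0` the curve is bounded by `1 + |s| R ≤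
  -- e^{|s| R}`, so `n + 1` factors at `s = 1/(n + 1)` stay below `e^R`.
  set R : ℝ := ‖x‖ + 1
  have hR : 0 ≤ R := by positivity
  let b : ℝ → 𝔸 := fun s => NormedSpace.exp (s • x)
  have hb0 : b 0 = 1 := by simp [b]
  have hb : HasDerivAt b x 0 := by
    have := hasDerivAt_exp_smul_const (𝕂 := ℝ) x (0 : ℝ)
    simpa [b] using this
  have hbound : ∀ {c : ℝ → 𝔸}, c 0 = 1 → HasDerivAt c x 0 →
      ∀ᶠ s in 𝓝 (0 : ℝ), ‖c s‖ ≤ 1 + |s| * R := by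
    intro c hc0 hc
    have h2 := (hasDerivAt_iff_isLittleO.mp hc).def (one_pos)
    filter_upwards [h2] with s hs
    rw [sub_zero, hc0, one_mul, Real.norm_eq_abs] at hs
    calc ‖c s‖ = ‖1 + s • x + (c s - 1 - s • x)‖ := by congr 1; abel
      _ ≤ ‖(1 : 𝔸)‖ + ‖s • x‖ + ‖c s - 1 - s • x‖ := norm_add₃_le
      _ ≤ 1 + |s| * ‖x‖ + |s| := by
          gcongr
          rw [norm_smul, Real.norm_eq_abs]
      _ = 1 + |s| * R := by simp only [R]; ring
  have hdiff : (fun s => a s - b s) =o[𝓝 0] fun s : ℝ => s := by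
    have := hasDerivAt_iff_isLittleO.mp (ha.sub hb)
    simpa [ha0, hb0] using this
  have hs : Tendsto (fun n : ℕ => 1 / ((n : ℝ) + 1)) atTop (𝓝 0) :=
    tendsto_one_div_add_atTop_nhds_zero_nat
  rw [tendsto_iff_norm_sub_tendsto_zero]
  have hpow : ∀ n : ℕ, b (1 / ((n : ℝ) + 1)) ^ (n + 1) = NormedSpace.exp x := by
    intro n
    simp only [b]
    rw [← NormedSpace.exp_nsmul, ← Nat.cast_smul_eq_nsmul ℝ, smul_smul]
    have : ((n + 1 : ℕ) : ℝ) * (1 / ((n : ℝ) + 1)) = 1 := by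
      push_cast; field_simp
    rw [this, one_smul]
  have hle : ∀ᶠ n : ℕ in atTop, ‖a (1 / ((n : ℝ) + 1)) ^ (n + 1) - NormedSpace.exp x‖ ≤
      Real.exp R * (‖a (1 / ((n : ℝ) + 1)) - b (1 / ((n : ℝ) + 1))‖ / (1 / ((n : ℝ) + 1))) := by
    filter_upwards [hs.eventually (hbound ha0 ha), hs.eventually (hbound hb0 hb)] with n h3 h4
    have hpos : (0 : ℝ) < 1 / ((n : ℝ) + 1) := by positivity
    rw [abs_of_pos hpos] at h3 h4
    rw [← hpow n]
    refine (norm_pow_sub_pow_le h1 h3 h4 (by nlinarith) (n + 1)).trans ?_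
    have h5 : (1 + 1 / ((n : ℝ) + 1) * R) ^ (n + 1) ≤ Real.exp R := by
      have h6 : 1 + 1 / ((n : ℝ) + 1) * R ≤ Real.exp (1 / ((n : ℝ) + 1) * R) := by
        linarith [Real.add_one_le_exp (1 / ((n : ℝ) + 1) * R)]
      refine (pow_le_pow_left₀ (by positivity) h6 _).trans ?_
      rw [← Real.exp_nat_mul]
      apply le_of_eq
      congr 1
      push_cast
      field_simp
    calc _ ≤ ((n + 1 : ℕ) : ℝ) * Real.exp R *
          ‖a (1 / ((n : ℝ) + 1)) - b (1 / ((n : ℝ) + 1))‖ := by gcongr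
      _ = _ := by push_cast; field_simp
  refine squeeze_zero' (Eventually.of_forall fun _ => norm_nonneg _) hle ?_
  have h7 := ((hdiff.comp_tendsto hs).norm_left.norm_right).tendsto_div_nhds_zero
  have h8 := h7.const_mul (Real.exp R)
  rw [mul_zero] at h8
  refine h8.congr fun n => ?_
  have hpos : (0 : ℝ) < 1 / ((n : ℝ) + 1) := by positivity
  simp only [Function.comp, Real.norm_of_nonneg hpos.le]

end Exponential

/-! ### Positivity, trace norm and trace of exponentials of superoperators. -/

section Semigroup

variable {d : ℕ} {𝒮 : Type*} [NormedAddCommGroup 𝒮] [InnerProductSpace ℂ 𝒮]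
  [FiniteDimensional ℂ 𝒮] [CompleteSpace 𝒮]

open Filter Topology
open scoped ComplexOrder

theorem isPositive_of_tendsto {E : Type*} [NormedAddCommGroup E] [InnerProductSpace ℂ E]
    {κ : Type*} {l : Filter κ} [l.NeBot] {S : κ → E →L[ℂ] E} {T : E →L[ℂ] E}
    (hS : ∀ x, Tendsto (fun k => ⟪S k x, x⟫_ℂ) l (𝓝 ⟪T x, x⟫_ℂ))
    (h : ∀ᶠ k in l, (S k).IsPositive) : T.IsPositive := by
  rw [ContinuousLinearMap.isPositive_iff_complex]
  intro x
  have hre := (Complex.continuous_re.tendsto _).comp (hS x)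
  constructor
  · refine tendsto_nhds_unique_of_eventuallyEq
      ((Complex.continuous_ofReal.tendsto _).comp hre) (hS x) ?_
    filter_upwards [h] with k hk
    exact ((ContinuousLinearMap.isPositive_iff_complex _).mp hk x).1
  · refine ge_of_tendsto hre ?_
    filter_upwards [h] with k hk
    exact ((ContinuousLinearMap.isPositive_iff_complex _).mp hk x).2

theorem HSOp.tendsto_inner {κ : Type*} {l : Filter κ} {S : κ → HSOp d 𝒮} {T : HSOp d 𝒮}
    (h : Tendsto S l (𝓝 T)) (x y : PSpace d 𝒮) :
    Tendsto (fun k => ⟪x, HSOp.op (S k) y⟫_ℂ) l (𝓝 ⟪x, HSOp.op T y⟫_ℂ) := by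
  have h1 : Continuous fun S : HSOp d 𝒮 => ⟪x, HSOp.opL S y⟫_ℂ := by fun_prop
  exact (h1.tendsto T).comp h

theorem HSOp.isPositive_of_tendsto {κ : Type*} {l : Filter κ} [l.NeBot] {S : κ → HSOp d 𝒮}
    {T : HSOp d 𝒮} (h : Tendsto S l (𝓝 T)) (hp : ∀ᶠ k in l, (HSOp.op (S k)).IsPositive) :
    (HSOp.op T).IsPositive := by
  refine _root_.isPositive_of_tendsto (l := l) (S := fun k => HSOp.op (S k)) (fun x => ?_) hp
  have := (Complex.continuous_conj.tendsto _).comp (HSOp.tendsto_inner h x x)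
  simpa [Function.comp_def] using this

theorem IsPositive.mul_mul_adjoint {E : Type*} [NormedAddCommGroup E] [InnerProductSpace ℂ E]
    [CompleteSpace E] {T : E →L[ℂ] E} (hT : T.IsPositive) (A : E →L[ℂ] E) :
    (A * T * ContinuousLinearMap.adjoint A).IsPositive := by
  rw [mul_assoc]
  exact hT.conj_adjoint A

theorem norm_one_clm_le (E : Type*) [NormedAddCommGroup E] [NormedSpace ℂ E] :
    ‖(1 : E →L[ℂ] E)‖ ≤ 1 := ContinuousLinearMap.norm_id_le

/-- A generator `S ↦ K S + S K* + Ψ(S)` with positivity preserving `Ψ` generates a positivity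
preserving semigroup. -/
theorem isPositive_exp_apply {K : POp d 𝒮} {Ψ : HSOp d 𝒮 →L[ℂ] HSOp d 𝒮}
    (hΨ : ∀ S, (HSOp.op S).IsPositive → (HSOp.op (Ψ S)).IsPositive) {t : ℝ} (ht : 0 ≤ t)
    {ρ : HSOp d 𝒮} (hρ : (HSOp.op ρ).IsPositive) :
    (HSOp.op (NormedSpace.exp ((t : ℂ) • (hsLeft K + hsRight (ContinuousLinearMap.adjoint K) + Ψ))
      ρ)).IsPositive := by
  set K' := ContinuousLinearMap.adjoint K
  set G := hsLeft K + hsRight K' + Ψ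
  -- Chosen so that `a s S = (1 + stK) S (1 + stK)* + stΨ(S)`, which is manifestly positive for `s,
  -- t ≥ 0`. The correction `s²t² K S K*` does not affect the derivative `tG` at `s = 0`.
  let a : ℝ → (HSOp d 𝒮 →L[ℂ] HSOp d 𝒮) := fun s =>
    1 + s • ((t : ℂ) • G) + (s ^ 2) • (((t : ℂ) ^ 2) • ((hsLeft K).comp (hsRight K')))
  have ha : HasDerivAt a ((t : ℂ) • G) 0 := by
    have h2 := (((hasDerivAt_id (0 : ℝ)).smul_const ((t : ℂ) • G)).const_add
      (1 : HSOp d 𝒮 →L[ℂ] HSOp d 𝒮)).add (((hasDerivAt_id (0 : ℝ)).pow 2).smul_const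
        (((t : ℂ) ^ 2) • ((hsLeft K).comp (hsRight K'))))
    exact h2.congr_deriv (by simp)
  have h3 := tendsto_pow_exp_of_hasDerivAt (norm_one_clm_le _) (by simp [a]) ha
  have h4 : Tendsto (fun n : ℕ => (a (1 / ((n : ℝ) + 1)) ^ (n + 1)) ρ) atTop
      (𝓝 (NormedSpace.exp ((t : ℂ) • G) ρ)) :=
    ((ContinuousLinearMap.apply ℂ (HSOp d 𝒮) ρ).continuous.tendsto _).comp h3
  have hstep : ∀ s : ℝ, 0 ≤ s → ∀ S, (HSOp.op S).IsPositive → (HSOp.op (a s S)).IsPositive := by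
    intro s hs S hS
    have e : HSOp.op (a s S) = (1 + ((s * t : ℝ) : ℂ) • K) * HSOp.op S *
        ContinuousLinearMap.adjoint (1 + ((s * t : ℝ) : ℂ) • K) +
        ((s * t : ℝ) : ℂ) • HSOp.op (Ψ S) := by
      have e1 : a s S = S + (s : ℂ) • ((t : ℂ) • (hsLeft K S + hsRight K' S + Ψ S)) +
          ((s ^ 2 : ℝ) : ℂ) • (((t : ℂ) ^ 2) • hsLeft K (hsRight K' S)) := rfl
      have e2 : ContinuousLinearMap.adjoint (1 + ((s * t : ℝ) : ℂ) • K) =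
          1 + ((s * t : ℝ) : ℂ) • K' := by
        rw [map_add, map_smulₛₗ, Complex.conj_ofReal]
        congr 1
        exact ContinuousLinearMap.adjoint_id
      rw [e1, e2]
      simp only [map_add, map_smul, op_hsLeft, op_hsRight]
      simp only [mul_add, add_mul, mul_one, one_mul, smul_mul_assoc, mul_smul_comm, smul_add,
        smul_smul, mul_assoc]
      push_cast
      rw [show (s : ℂ) ^ 2 * (t : ℂ) ^ 2 = (s : ℂ) * (t : ℂ) * ((s : ℂ) * (t : ℂ)) by ring]
      abel
    rw [e]
    have h5 : (0 : ℂ) ≤ ((s * t : ℝ) : ℂ) := by exact_mod_cast mul_nonneg hs ht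
    exact (IsPositive.mul_mul_adjoint hS _).add ((hΨ S hS).smul_of_nonneg h5)
  clear_value a
  refine HSOp.isPositive_of_tendsto h4 (Eventually.of_forall fun n => ?_)
  have hpow : ∀ (V : HSOp d 𝒮 →L[ℂ] HSOp d 𝒮),
      (∀ S, (HSOp.op S).IsPositive → (HSOp.op (V S)).IsPositive) →
      ∀ k : ℕ, (HSOp.op ((V ^ k) ρ)).IsPositive := by
    intro V hV k
    induction k with
    | zero => exact hρ
    | succ k ih =>
      have e : (V ^ (k + 1)) ρ = V ((V ^ k) ρ) := by rw [pow_succ']; rfl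
      rw [e]
      exact hV _ ih
  exact hpow _ (hstep _ (by positivity)) _

/-- Lower semicontinuity along the finite partial sums gives the bound; the trace is exchanged with
the series because the double family of diagonal elements is absolutely summable. -/
theorem TraceBound.hasSum {ι E : Type*} [NormedAddCommGroup E] [InnerProductSpace ℂ E]
    [CompleteSpace E] {b : HilbertBasis ι ℂ E} {Z : ℕ → E →L[ℂ] E} {c : ℕ → ℝ} {J : E →L[ℂ] E}
    (hJ : ∀ x y, HasSum (fun n => ⟪x, Z n y⟫_ℂ) ⟪x, J y⟫_ℂ) (hc : Summable c)
    (hZ : ∀ n, TraceBound b (Z n) (c n)) :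
    TraceBound b J (∑' n, c n) ∧ ∑' i, ⟪b i, J (b i)⟫_ℂ = ∑' n, ∑' i, ⟪b i, Z n (b i)⟫_ℂ := by
  constructor
  · refine TraceBound.of_tendsto (l := atTop) (S := fun s : Finset ℕ => ∑ n ∈ s, Z n)
      (c := fun s => ∑ n ∈ s, c n) (fun x y => ?_) hc.hasSum
      (Eventually.of_forall fun s => TraceBound.sum s fun n _ => hZ n)
    refine (hJ x y).congr fun s => ?_
    simp [sum_apply]
  · have hle : ∀ n, ∑' i, ‖⟪b i, Z n (b i)⟫_ℂ‖ ≤ c n * ‖(1 : E →L[ℂ] E)‖ * ‖(1 : E →L[ℂ] E)‖ :=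
      fun n => (hZ n).tsum_norm_le 1 1
    have hs : Summable (Function.uncurry fun (n : ℕ) (i : ι) => ⟪b i, Z n (b i)⟫_ℂ) := by
      rw [← summable_norm_iff]
      rw [summable_prod_of_nonneg (fun _ => norm_nonneg _)]
      refine ⟨fun n => (hZ n).summable 1 1, ?_⟩
      exact Summable.of_nonneg_of_le (fun n => tsum_nonneg fun _ => norm_nonneg _) hle
        ((hc.mul_right _).mul_right _)
    rw [← hs.tsum_comm]
    exact tsum_congr fun i => (hJ _ _).tsum_eq.symm

theorem TraceBound.pow_apply {G : HSOp d 𝒮 →L[ℂ] HSOp d 𝒮} {C : ℝ} (hC : 0 ≤ C)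
    (hG : ∀ (S : HSOp d 𝒮) (c : ℝ), 0 ≤ c → TraceBound (siteBasis d 𝒮) (HSOp.op S) c →
      TraceBound (siteBasis d 𝒮) (HSOp.op (G S)) (C * c)) {S : HSOp d 𝒮} {c : ℝ} (hc : 0 ≤ c)
    (hS : TraceBound (siteBasis d 𝒮) (HSOp.op S) c) (n : ℕ) :
    TraceBound (siteBasis d 𝒮) (HSOp.op ((G ^ n) S)) (C ^ n * c) := by
  induction n with
  | zero => simpa using hS
  | succ n ih =>
    rw [pow_succ', pow_succ', mul_assoc]
    exact hG _ _ (by positivity) ih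

/-- The exponential series is dominated term by term by `(‖t‖ C)ⁿ c / n!`. If `G` annihilates
traces, every term with `n ≥ 1` is a multiple of `G` applied to a trace-class operator, and only the
trace of `S` is left. -/
theorem TraceBound.exp_apply {G : HSOp d 𝒮 →L[ℂ] HSOp d 𝒮} {C : ℝ} (hC : 0 ≤ C)
    (hG : ∀ (S : HSOp d 𝒮) (c : ℝ), 0 ≤ c → TraceBound (siteBasis d 𝒮) (HSOp.op S) c →
      TraceBound (siteBasis d 𝒮) (HSOp.op (G S)) (C * c)) (t : ℂ) {S : HSOp d 𝒮} {c : ℝ}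
    (hc : 0 ≤ c) (hS : TraceBound (siteBasis d 𝒮) (HSOp.op S) c) :
    TraceBound (siteBasis d 𝒮) (HSOp.op (NormedSpace.exp (t • G) S)) (Real.exp (‖t‖ * C) * c) ∧
      ((∀ S : HSOp d 𝒮, IsTraceClass (HSOp.op S) → opTrace (HSOp.op (G S)) = 0) →
        opTrace (HSOp.op (NormedSpace.exp (t • G) S)) = opTrace (HSOp.op S)) := by
  have h1 : HasSum (fun n : ℕ => ((n.factorial : ℂ)⁻¹) • (t • G) ^ n) (NormedSpace.exp (t • G)) :=
    NormedSpace.exp_series_hasSum_exp' (𝕂 := ℂ) (t • G)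
  let Z : ℕ → HSOp d 𝒮 := fun n => (((n.factorial : ℂ)⁻¹) * t ^ n) • (G ^ n) S
  have hZ : ∀ n, TraceBound (siteBasis d 𝒮) (HSOp.op (Z n))
      ((((n.factorial : ℝ)⁻¹) • (‖t‖ * C) ^ n) * c) := by
    intro n
    have := (TraceBound.pow_apply hC hG hc hS n).smul (((n.factorial : ℂ)⁻¹) * t ^ n)
    rw [← map_smul] at this
    refine this.mono (le_of_eq ?_)
    rw [norm_mul, norm_inv, norm_pow, Complex.norm_natCast, smul_eq_mul]
    ring
  have hJ : ∀ x y, HasSum (fun n => ⟪x, HSOp.op (Z n) y⟫_ℂ)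
      ⟪x, HSOp.op (NormedSpace.exp (t • G) S) y⟫_ℂ := by
    intro x y
    have h2 := h1.mapL ((innerSL ℂ x).comp ((ContinuousLinearMap.apply ℂ (PSpace d 𝒮) y).comp
      (HSOp.opL.comp (ContinuousLinearMap.apply ℂ (HSOp d 𝒮) S))))
    have e : (fun n => ⟪x, HSOp.op (Z n) y⟫_ℂ) = fun n : ℕ => ((innerSL ℂ x).comp
        ((ContinuousLinearMap.apply ℂ (PSpace d 𝒮) y).comp
          (HSOp.opL.comp (ContinuousLinearMap.apply ℂ (HSOp d 𝒮) S))))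
        (((n.factorial : ℂ)⁻¹) • (t • G) ^ n) := by
      funext n
      rw [smul_pow, smul_smul]
      rfl
    rw [e]
    exact h2
  have hc' : HasSum (fun n : ℕ => (((n.factorial : ℝ)⁻¹) • (‖t‖ * C) ^ n) * c)
      (Real.exp (‖t‖ * C) * c) := by
    have := NormedSpace.exp_series_hasSum_exp' (𝕂 := ℝ) (‖t‖ * C)
    rw [← Real.exp_eq_exp_ℝ] at this
    exact this.mul_right c
  obtain ⟨h3, h4⟩ := TraceBound.hasSum hJ hc'.summable hZ
  rw [hc'.tsum_eq] at h3
  refine ⟨h3, fun h0 => ?_⟩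
  refine h4.trans ?_
  rw [tsum_eq_single 0]
  · simp [Z, opTrace]
  · intro n hn
    obtain ⟨k, rfl⟩ := Nat.exists_eq_succ_of_ne_zero hn
    have h5 : opTrace (HSOp.op ((G ^ (k + 1)) S)) = 0 := by
      rw [pow_succ']
      exact h0 _ (isTraceClass_iff.mpr ⟨_, by positivity, TraceBound.pow_apply hC hG hc hS k⟩)
    change ∑' i, ⟪siteBasis d 𝒮 i, (((((k + 1).factorial : ℂ)⁻¹) * t ^ (k + 1)) •
      HSOp.op ((G ^ (k + 1)) S)) (siteBasis d 𝒮 i)⟫_ℂ = 0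
    simp_rw [smul_apply, inner_smul_right]
    rw [tsum_mul_left]
    exact mul_eq_zero_of_right _ h5

end Semigroup

/-! ### A Schwarz lemma with constant one for functions with values in a strip. -/

section StripSchwarz

/-- The left side is the Taylor polynomial: `2 cosh a = 2 + 4 sinh²(|a|/2)`, and `sinh x ≥ x` for `x
≥ 0`. -/
theorem two_add_sq_le_exp_add_exp_neg (a : ℝ) : 2 + a ^ 2 ≤ Real.exp a + Real.exp (-a) := by
  have hs : |a| / 2 ≤ Real.sinh (|a| / 2) := Real.self_le_sinh_iff.mpr (by positivity)
  have e3 : Real.exp a + Real.exp (-a) = 2 * Real.cosh |a| := by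
    rw [Real.cosh_abs, Real.cosh_eq]; ring
  have e4 : Real.cosh |a| = 1 + 2 * Real.sinh (|a| / 2) ^ 2 := by
    have := Real.cosh_two_mul (|a| / 2)
    rw [mul_div_cancel₀ |a| two_ne_zero] at this
    rw [this, Real.cosh_sq]; ring
  rw [e3, e4, ← sq_abs a]
  nlinarith [abs_nonneg a]

/-- If `|Im w| ≤ 3/2` and `|tanh (w/2)| ≤ 1/2`, then `|w| ≤ 3/2`. -/
theorem norm_le_of_norm_exp_sub_one_le {w : ℂ} (hw : |w.im| ≤ 3 / 2)
    (h : ‖Complex.exp w - 1‖ ≤ 1 / 2 * ‖Complex.exp w + 1‖) : ‖w‖ ≤ 3 / 2 := by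
  set a := w.re
  set b := w.im
  have hre : (Complex.exp w).re = Real.exp a * Real.cos b := Complex.exp_re w
  have him : (Complex.exp w).im = Real.exp a * Real.sin b := Complex.exp_im w
  have h1 : ‖Complex.exp w - 1‖ ^ 2 ≤ 1 / 4 * ‖Complex.exp w + 1‖ ^ 2 := by
    have := pow_le_pow_left₀ (norm_nonneg _) h 2
    linarith [this, mul_pow (1 / 2 : ℝ) ‖Complex.exp w + 1‖ 2]
  rw [Complex.sq_norm, Complex.sq_norm, Complex.normSq_apply, Complex.normSq_apply] at h1
  simp only [Complex.sub_re, Complex.sub_im, Complex.add_re, Complex.add_im, Complex.one_re,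
    Complex.one_im, hre, him] at h1
  have hE := Real.exp_pos a
  have hcs := Real.sin_sq_add_cos_sq b
  have h2 : 3 * (Real.exp a ^ 2 + 1) ≤ 10 * Real.exp a * Real.cos b := by
    have : Real.exp a ^ 2 * (Real.sin b ^ 2 + Real.cos b ^ 2) = Real.exp a ^ 2 := by
      rw [hcs, mul_one]
    nlinarith
  have hinv : Real.exp a * Real.exp (-a) = 1 := by rw [← Real.exp_add]; simp
  -- The hypothesis says `3 cosh a ≤ 5 cos b` for `w = a + ib`. The hyperbolic cosine is now bounded
  -- below and the cosine above by quadratic polynomials.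
  have h3 : 3 * (Real.exp a + Real.exp (-a)) ≤ 10 * Real.cos b := by
    have hE' := Real.exp_pos (-a)
    have := mul_le_mul_of_nonneg_right h2 hE'.le
    have e1 : 3 * (Real.exp a ^ 2 + 1) * Real.exp (-a) = 3 * (Real.exp a + Real.exp (-a)) := by
      linear_combination 3 * Real.exp a * hinv
    have e2 : 10 * Real.exp a * Real.cos b * Real.exp (-a) = 10 * Real.cos b := by
      linear_combination 10 * Real.cos b * hinv
    linarith
  have h4 := two_add_sq_le_exp_add_exp_neg a
  have hpi := Real.pi_gt_d2
  have hpi' := Real.pi_lt_d2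
  have h5 : Real.cos b ≤ 1 - 2 / Real.pi ^ 2 * b ^ 2 :=
    Real.cos_le_one_sub_mul_cos_sq (hw.trans (by linarith))
  have h6 : (1 : ℝ) / 5 ≤ 2 / Real.pi ^ 2 := by
    rw [div_le_div_iff₀ (by norm_num) (by positivity)]
    nlinarith
  -- The quadratic bounds combine to `3a² + 2b² ≤ 4`, hence `a² + b² ≤ 2`.
  have h7 : a ^ 2 + b ^ 2 ≤ 9 / 4 := by nlinarith [sq_nonneg a, sq_nonneg b]
  have h8 : ‖w‖ ^ 2 = a ^ 2 + b ^ 2 := by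
    rw [Complex.sq_norm, Complex.normSq_apply]; ring
  nlinarith [norm_nonneg w]

/-- A Schwarz lemma for functions with values in a horizontal strip. -/
theorem norm_sub_le_of_abs_im_le {g : ℂ → ℂ} {R q : ℝ} (hR : 0 < R)
    (hg : DifferentiableOn ℂ g (Metric.ball 0 R)) (him : ∀ z ∈ Metric.ball (0 : ℂ) R, |(g z).im| ≤ q)
    (h0 : (g 0).im = 0) {z : ℂ} (hz : ‖z‖ ≤ R / 2) : ‖g z - g 0‖ ≤ q := by
  have hq : 0 ≤ q := (abs_nonneg _).trans (him 0 (by simpa using hR))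
  -- The bound `q` may be zero; a slightly larger `q'` can be used for rescaling.
  refine le_of_forall_gt_imp_ge_of_dense fun q' hq' => ?_
  have hq0 : 0 < q' := hq.trans_lt hq'
  -- The rescaled function has imaginary part at most `3/2 < π/2`, so `tanh (w/2)` maps the disc
  -- into the unit disc. At half the radius the Schwarz lemma bounds it by `1/2`, and
  -- `norm_le_of_norm_exp_sub_one_le` then returns the same constant `3/2`, which cancels.
  set c : ℝ := 3 / (2 * q') with hc
  have hc0 : 0 < c := by positivity
  have hcq : c * q' = 3 / 2 := by rw [hc]; field_simp
  let w : ℂ → ℂ := fun z => c * (g z - g 0)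
  have hw0 : w 0 = 0 := by simp [w]
  have hwim : ∀ z ∈ Metric.ball (0 : ℂ) R, |(w z).im| ≤ 3 / 2 := by
    intro z hz
    have : (w z).im = c * (g z).im := by simp [w, h0]
    rw [this, abs_mul, abs_of_pos hc0, ← hcq]
    gcongr
    exact (him z hz).trans hq'.le
  have hre : ∀ z ∈ Metric.ball (0 : ℂ) R, 0 < (Complex.exp (w z)).re := by
    intro z hz
    rw [Complex.exp_re]
    have h1 := abs_le.mp (hwim z hz)
    have hpi := Real.pi_gt_d2
    exact mul_pos (Real.exp_pos _) (Real.cos_pos_of_mem_Ioo ⟨by linarith, by linarith⟩)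
  have hne : ∀ z ∈ Metric.ball (0 : ℂ) R, Complex.exp (w z) + 1 ≠ 0 := by
    intro z hz h
    have h1 := congrArg Complex.re h
    have h2 := hre z hz
    simp only [Complex.add_re, Complex.one_re, Complex.zero_re] at h1
    linarith
  have hwd : DifferentiableOn ℂ w (Metric.ball 0 R) := (hg.sub_const _).const_mul _
  let F : ℂ → ℂ := fun z => (Complex.exp (w z) - 1) / (Complex.exp (w z) + 1)
  have hF0 : F 0 = 0 := by simp [F, hw0]
  have hFd : DifferentiableOn ℂ F (Metric.ball 0 R) :=
    (hwd.cexp.sub_const _).div (hwd.cexp.add_const _) hne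
  have hmaps : Set.MapsTo F (Metric.ball 0 R) (Metric.closedBall (F 0) 1) := by
    intro z hz
    rw [hF0, mem_closedBall_zero_iff, norm_div, div_le_one (norm_pos_iff.mpr (hne z hz))]
    refine le_of_sq_le_sq ?_ (norm_nonneg _)
    rw [Complex.sq_norm, Complex.sq_norm, Complex.normSq_apply, Complex.normSq_apply]
    have := hre z hz
    simp only [Complex.sub_re, Complex.sub_im, Complex.add_re, Complex.add_im, Complex.one_re,
      Complex.one_im]
    nlinarith
  have hz' : z ∈ Metric.ball (0 : ℂ) R := by
    rw [mem_ball_zero_iff]; linarith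
  have h1 := Complex.dist_le_div_mul_dist_of_mapsTo_ball hFd hmaps hz'
  rw [hF0, dist_zero_right, dist_zero_right, norm_div] at h1
  have h2 : ‖Complex.exp (w z) - 1‖ ≤ 1 / 2 * ‖Complex.exp (w z) + 1‖ := by
    rw [← div_le_iff₀ (norm_pos_iff.mpr (hne z hz'))]
    refine h1.trans ?_
    rw [div_mul_eq_mul_div, div_le_iff₀ hR]
    linarith
  have h3 := norm_le_of_norm_exp_sub_one_le (hwim z hz') h2
  have h4 : ‖w z‖ = c * ‖g z - g 0‖ := by
    simp only [w]
    rw [norm_mul, Complex.norm_real, Real.norm_of_nonneg hc0.le]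
  rw [h4, ← hcq] at h3
  exact le_of_mul_le_mul_left h3 hc0

end StripSchwarz

/-! ### Fourier transform on the lattice and multiplication operators in momentum space. -/

section MomentumMultipliers

variable {d : ℕ} {𝒮 : Type*} [NormedAddCommGroup 𝒮] [InnerProductSpace ℂ 𝒮]

variable (d) in
/-- The Brillouin zone `[-π, π]ᵈ`. -/
def brillouinZone : Set (Fin d → ℝ) := Set.Icc (fun _ => -Real.pi) (fun _ => Real.pi)

variable (d) in
/-- The normalized Lebesgue measure on the Brillouin zone. -/
def momentumMeasure : Measure (Fin d → ℝ) :=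
  ENNReal.ofReal (((2 * Real.pi) ^ d)⁻¹) • volume.restrict (brillouinZone d)

theorem volume_brillouinZone : volume (brillouinZone d) = ENNReal.ofReal ((2 * Real.pi) ^ d) := by
  rw [brillouinZone, Real.volume_Icc_pi]
  simp only [sub_neg_eq_add, Finset.prod_const, Finset.card_univ, Fintype.card_fin]
  rw [ENNReal.ofReal_pow (by positivity), two_mul]

instance : IsProbabilityMeasure (momentumMeasure d) := by
  constructor
  rw [momentumMeasure, Measure.smul_apply, Measure.restrict_apply_univ, volume_brillouinZone,
    smul_eq_mul, ← ENNReal.ofReal_mul (by positivity), inv_mul_cancel₀ (by positivity),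
    ENNReal.ofReal_one]

theorem integral_momentumMeasure {F : Type*} [NormedAddCommGroup F] [NormedSpace ℝ F]
    (f : (Fin d → ℝ) → F) :
    ∫ k, f k ∂(momentumMeasure d) = ((2 * Real.pi) ^ d)⁻¹ • ∫ k in brillouinZone d, f k := by
  rw [momentumMeasure, integral_smul_measure, ENNReal.toReal_ofReal (by positivity)]

/-- The character `e^{ik·n}`. -/
def momentumChar (n : Fin d → ℤ) (k : Fin d → ℝ) : ℂ :=
  Complex.exp (Complex.I * ∑ j, (k j : ℂ) * (n j : ℂ))

theorem continuous_momentumChar (n : Fin d → ℤ) : Continuous (momentumChar n) := by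
  unfold momentumChar; fun_prop

theorem momentumChar_eq (n : Fin d → ℤ) (k : Fin d → ℝ) :
    momentumChar n k = Complex.exp ((∑ j, k j * (n j : ℝ) : ℝ) * Complex.I) := by
  unfold momentumChar
  rw [mul_comm]
  push_cast
  rfl

@[simp] theorem norm_momentumChar (n : Fin d → ℤ) (k : Fin d → ℝ) : ‖momentumChar n k‖ = 1 := by
  rw [momentumChar_eq, Complex.norm_exp_ofReal_mul_I]

theorem conj_momentumChar_mul (n l : Fin d → ℤ) (k : Fin d → ℝ) :
    (starRingEnd ℂ) (momentumChar (-n) k) * momentumChar (-l) k = momentumChar (n - l) k := by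
  unfold momentumChar
  rw [← Complex.exp_conj, ← Complex.exp_add]
  congr 1
  simp only [map_mul, Complex.conj_I, map_sum, Complex.conj_ofReal, Pi.neg_apply, Int.cast_neg,
    map_neg, map_intCast, Pi.sub_apply, Int.cast_sub, mul_neg, Finset.sum_neg_distrib, mul_sub,
    Finset.sum_sub_distrib]
  ring

theorem integral_momentumChar {n : Fin d → ℤ} (hn : n ≠ 0) :
    ∫ k, momentumChar n k ∂(momentumMeasure d) = 0 := by
  rw [integral_momentumMeasure]
  refine smul_eq_zero_of_right _ ?_
  obtain ⟨j, hj⟩ := Function.ne_iff.mp hn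
  have hbox : volume.restrict (brillouinZone d) =
      Measure.pi fun _ : Fin d => volume.restrict (Set.Icc (-Real.pi) Real.pi) := by
    rw [brillouinZone, ← Set.pi_univ_Icc, volume_pi, Measure.restrict_pi_pi]
  have hprod : ∀ k : Fin d → ℝ, momentumChar n k =
      ∏ j, Complex.exp (Complex.I * ((k j : ℂ) * (n j : ℂ))) := by
    intro k
    rw [momentumChar, Finset.mul_sum, Complex.exp_sum]
  simp_rw [hprod]
  rw [hbox, integral_fintype_prod_eq_prod (𝕜 := ℂ)
    (fun (j : Fin d) (x : ℝ) => Complex.exp (Complex.I * ((x : ℂ) * (n j : ℂ))))]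
  refine Finset.prod_eq_zero (Finset.mem_univ j) ?_
  rw [integral_Icc_eq_integral_Ioc, ← intervalIntegral.integral_of_le
    (by linarith [Real.pi_pos])]
  have hc : Complex.I * (n j : ℂ) ≠ 0 := mul_ne_zero Complex.I_ne_zero (by exact_mod_cast hj)
  have he : ∀ x : ℝ, Complex.exp (Complex.I * ((x : ℂ) * (n j : ℂ))) =
      Complex.exp ((Complex.I * (n j : ℂ)) * x) := fun x => by congr 1; ring
  simp_rw [he]
  rw [integral_exp_mul_complex hc]
  refine div_eq_zero_iff.mpr (Or.inl ?_)
  rw [sub_eq_zero]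
  refine Complex.exp_eq_exp_iff_exists_int.mpr ⟨n j, ?_⟩
  push_cast
  ring

theorem memLp_momentumChar_smul (n : Fin d → ℤ) (s : 𝒮) :
    MemLp (fun k => momentumChar n k • s) 2 (momentumMeasure d) := by
  refine MemLp.of_bound (C := ‖s‖) ?_ (Filter.Eventually.of_forall fun k => ?_)
  · exact ((continuous_momentumChar n).smul continuous_const).aestronglyMeasurable
  · rw [norm_smul, norm_momentumChar, one_mul]

theorem inner_toLp_momentumChar (n l : Fin d → ℤ) (s s' : 𝒮) :
    ⟪(memLp_momentumChar_smul (-n) s).toLp _, (memLp_momentumChar_smul (-l) s').toLp _⟫_ℂ =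
      (∫ k, momentumChar (n - l) k ∂(momentumMeasure d)) * ⟪s, s'⟫_ℂ := by
  rw [L2.inner_def, ← integral_mul_const]
  refine integral_congr_ae ?_
  filter_upwards [(memLp_momentumChar_smul (-n) s).coeFn_toLp,
    (memLp_momentumChar_smul (-l) s').coeFn_toLp] with k h1 h2
  rw [h1, h2, inner_smul_left, inner_smul_right, ← mul_assoc, conj_momentumChar_mul]

/-- `s ↦ e^{-ik·n} s`, as an isometry into the momentum space. -/
def momentumMode (n : Fin d → ℤ) : 𝒮 →ₗᵢ[ℂ] Lp 𝒮 2 (momentumMeasure d) :=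
  LinearMap.isometryOfInner
    { toFun := fun s => (memLp_momentumChar_smul (-n) s).toLp _
      map_add' := fun s s' => by
        rw [← MemLp.toLp_add]
        congr 1
        funext k
        exact smul_add _ _ _
      map_smul' := fun c s => by
        rw [RingHom.id_apply, ← MemLp.toLp_const_smul]
        congr 1
        funext k
        exact smul_comm _ _ _ }
    fun s s' => by
      have h := inner_toLp_momentumChar n n s s'
      simpa [momentumChar] using h

theorem momentumMode_apply (n : Fin d → ℤ) (s : 𝒮) :
    momentumMode n s = (memLp_momentumChar_smul (-n) s).toLp _ := rfl

theorem orthogonalFamily_momentumMode :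
    OrthogonalFamily ℂ (fun _ : Fin d → ℤ => 𝒮) momentumMode := by
  intro n l hnl s s'
  rw [momentumMode_apply, momentumMode_apply, inner_toLp_momentumChar,
    integral_momentumChar (sub_ne_zero.mpr hnl), zero_mul]

variable [CompleteSpace 𝒮]

variable (d 𝒮) in
/-- The Fourier transform on the particle space. -/
def momentumTransform : PSpace d 𝒮 →ₗᵢ[ℂ] Lp 𝒮 2 (momentumMeasure d) :=
  (orthogonalFamily_momentumMode (d := d) (𝒮 := 𝒮)).linearIsometry

theorem momentumTransform_single (n : Fin d → ℤ) (s : 𝒮) :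
    momentumTransform d 𝒮 (lp.single 2 n s) = (memLp_momentumChar_smul (-n) s).toLp _ := by
  classical
  have h := (orthogonalFamily_momentumMode (d := d) (𝒮 := 𝒮)).linearIsometry_apply_single
    (i := n) s
  rw [← momentumMode_apply, ← h]
  unfold momentumTransform
  congr!

/-- A bounded continuous symbol. -/
structure MomentumSymbol (d : ℕ) where
  toFun : (Fin d → ℝ) → ℂ
  continuous : Continuous toFun
  bounded : ∃ C, ∀ k, ‖toFun k‖ ≤ C

theorem memLp_symbol_smul (a : MomentumSymbol d) (f : Lp 𝒮 2 (momentumMeasure d)) :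
    MemLp (fun k => a.toFun k • f k) 2 (momentumMeasure d) := by
  obtain ⟨C, hC⟩ := a.bounded
  refine MemLp.of_le_mul (c := C) (Lp.memLp f)
    (a.continuous.aestronglyMeasurable.smul (Lp.memLp f).1)
    (Filter.Eventually.of_forall fun k => ?_)
  rw [norm_smul]
  gcongr
  exact hC k

theorem norm_toLp_symbol_smul_le (a : MomentumSymbol d) {C : ℝ}
    (hC : ∀ k, ‖a.toFun k‖ ≤ C) (f : Lp 𝒮 2 (momentumMeasure d)) :
    ‖(memLp_symbol_smul a f).toLp _‖ ≤ C * ‖f‖ := by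
  refine Lp.norm_le_mul_norm_of_ae_le_mul ?_
  filter_upwards [(memLp_symbol_smul a f).coeFn_toLp] with k hk
  rw [hk, norm_smul]
  gcongr
  exact hC k

/-- Multiplication by a bounded symbol on the momentum space. -/
def symbolMul (a : MomentumSymbol d) :
    Lp 𝒮 2 (momentumMeasure d) →L[ℂ] Lp 𝒮 2 (momentumMeasure d) :=
  LinearMap.mkContinuousOfExistsBound
    { toFun := fun f => (memLp_symbol_smul a f).toLp _
      map_add' := fun f g => by
        apply Lp.ext
        filter_upwards [(memLp_symbol_smul a (f + g)).coeFn_toLp,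
          Lp.coeFn_add ((memLp_symbol_smul a f).toLp _) ((memLp_symbol_smul a g).toLp _),
          (memLp_symbol_smul a f).coeFn_toLp, (memLp_symbol_smul a g).coeFn_toLp,
          Lp.coeFn_add f g] with k h1 h2 h3 h4 h5
        rw [h1, h2, Pi.add_apply, h3, h4, h5, Pi.add_apply, smul_add]
      map_smul' := fun c f => by
        apply Lp.ext
        filter_upwards [(memLp_symbol_smul a (c • f)).coeFn_toLp,
          Lp.coeFn_smul c ((memLp_symbol_smul a f).toLp _),
          (memLp_symbol_smul a f).coeFn_toLp, Lp.coeFn_smul c f] with k h1 h2 h3 h4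
        rw [h1, RingHom.id_apply, h2, Pi.smul_apply, h3, h4, Pi.smul_apply, smul_comm] }
    (by
      obtain ⟨C, hC⟩ := a.bounded
      exact ⟨C, norm_toLp_symbol_smul_le a hC⟩)

theorem symbolMul_apply (a : MomentumSymbol d) (f : Lp 𝒮 2 (momentumMeasure d)) :
    symbolMul a f = (memLp_symbol_smul a f).toLp _ := rfl

/-- The operator on the particle space given by multiplication by a symbol in the momentum
representation. -/
def multOp (a : MomentumSymbol d) : POp d 𝒮 :=
  -- A compression `F* a F`: matrix elements, norm bounds and self-adjointness use only that `F` is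
  -- isometric, not that it is onto.
  (ContinuousLinearMap.adjoint (momentumTransform d 𝒮).toContinuousLinearMap).comp
    ((symbolMul a).comp (momentumTransform d 𝒮).toContinuousLinearMap)

theorem inner_multOp (a : MomentumSymbol d) (f g : PSpace d 𝒮) :
    ⟪f, multOp a g⟫_ℂ = ⟪momentumTransform d 𝒮 f, symbolMul a (momentumTransform d 𝒮 g)⟫_ℂ := by
  rw [multOp, ContinuousLinearMap.comp_apply, ContinuousLinearMap.adjoint_inner_right]
  rfl

theorem norm_multOp_sub_le (a b : MomentumSymbol d) {C : ℝ} (hC0 : 0 ≤ C)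
    (hC : ∀ k, ‖a.toFun k - b.toFun k‖ ≤ C) :
    ‖(multOp a - multOp b : POp d 𝒮)‖ ≤ C := by
  let c : MomentumSymbol d := ⟨fun k => a.toFun k - b.toFun k, a.continuous.sub b.continuous, C, hC⟩
  refine ContinuousLinearMap.opNorm_le_bound _ hC0 fun f => ?_
  set J := (momentumTransform d 𝒮).toContinuousLinearMap
  have h1 : (multOp a - multOp b : POp d 𝒮) f =
      ContinuousLinearMap.adjoint J (symbolMul c (momentumTransform d 𝒮 f)) := by
    have h2 : symbolMul c (momentumTransform d 𝒮 f) =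
        symbolMul a (momentumTransform d 𝒮 f) - symbolMul b (momentumTransform d 𝒮 f) := by
      set g := momentumTransform d 𝒮 f
      rw [symbolMul_apply, symbolMul_apply, symbolMul_apply, ← MemLp.toLp_sub]
      congr 1
      funext k
      exact sub_smul _ _ _
    rw [h2, map_sub]
    rfl
  have hJ : ‖ContinuousLinearMap.adjoint J‖ ≤ 1 := by
    rw [LinearIsometryEquiv.norm_map]
    exact LinearIsometry.norm_toContinuousLinearMap_le _
  rw [h1]
  calc _ ≤ 1 * ‖symbolMul c (momentumTransform d 𝒮 f)‖ :=
        ContinuousLinearMap.le_of_opNorm_le _ hJ _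
    _ ≤ 1 * (C * ‖momentumTransform d 𝒮 f‖) := by
        gcongr
        exact norm_toLp_symbol_smul_le c hC _
    _ = C * ‖f‖ := by rw [one_mul, LinearIsometry.norm_map]

theorem kernelOf_multOp (a : MomentumSymbol d) (x y : Fin d → ℤ) :
    kernelOf (multOp a : POp d 𝒮) x y =
      (∫ k, a.toFun k * momentumChar (x - y) k ∂(momentumMeasure d)) •
        ContinuousLinearMap.id ℂ 𝒮 := by
  classical
  ext s
  refine ext_inner_left ℂ fun s' => ?_
  have h1 : ⟪s', kernelOf (multOp a : POp d 𝒮) x y s⟫_ℂ =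
      ⟪lp.single 2 x s', multOp a (lp.single 2 y s)⟫_ℂ := by
    rw [lp.inner_single_left]; rfl
  rw [h1, inner_multOp, momentumTransform_single, momentumTransform_single, smul_apply,
    ContinuousLinearMap.id_apply, inner_smul_right, L2.inner_def, ← integral_mul_const]
  refine integral_congr_ae ?_
  set f := (memLp_momentumChar_smul (-y) s).toLp _ with hf
  filter_upwards [(memLp_momentumChar_smul (-x) s').coeFn_toLp,
    (memLp_momentumChar_smul (-y) s).coeFn_toLp, (memLp_symbol_smul a f).coeFn_toLp]
    with k h2 h3 h4
  rw [h2, symbolMul_apply, h4, hf, h3, inner_smul_left, inner_smul_right, inner_smul_right,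
    ← conj_momentumChar_mul]
  ring

theorem isSelfAdjoint_multOp (a : MomentumSymbol d) (ha : ∀ k, (a.toFun k).im = 0) :
    IsSelfAdjoint (multOp a : POp d 𝒮) := by
  rw [ContinuousLinearMap.isSelfAdjoint_iff_isSymmetric]
  intro f g
  change ⟪multOp a f, g⟫_ℂ = ⟪f, multOp a g⟫_ℂ
  rw [← inner_conj_symm, inner_multOp, inner_multOp, inner_conj_symm, L2.inner_def, L2.inner_def]
  refine integral_congr_ae ?_
  filter_upwards [(memLp_symbol_smul a (momentumTransform d 𝒮 f)).coeFn_toLp,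
    (memLp_symbol_smul a (momentumTransform d 𝒮 g)).coeFn_toLp] with k h1 h2
  rw [symbolMul_apply, symbolMul_apply, h1, h2, inner_smul_left, inner_smul_right,
    Complex.conj_eq_iff_im.mpr (ha k)]

end MomentumMultipliers

/-! ### Translation invariance of integrals of periodic functions over the Brillouin zone. -/

section PeriodicIntegrals

open scoped Pointwise

variable {d : ℕ}

/-- The `ℝ`-basis of `2π`-multiples of the standard basis vectors. -/
def periodBasis (d : ℕ) : Module.Basis (Fin d) ℝ (Fin d → ℝ) :=
  (Pi.basisFun ℝ (Fin d)).unitsSMul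
    fun _ => Units.mk0 (2 * Real.pi) (mul_ne_zero two_ne_zero Real.pi_ne_zero)

theorem periodBasis_apply (j : Fin d) : periodBasis d j = Pi.single j (2 * Real.pi) := by
  classical
  rw [periodBasis, Module.Basis.unitsSMul_apply, Pi.basisFun_apply]
  ext i
  by_cases h : i = j
  · subst h; simp [Units.smul_def]
  · simp [h]

theorem periodBasis_repr (k : Fin d → ℝ) (j : Fin d) :
    (periodBasis d).repr k j = (2 * Real.pi)⁻¹ * k j := by
  rw [periodBasis, Module.Basis.repr_unitsSMul, Pi.basisFun_repr]
  simp [Units.smul_def]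

theorem exists_int_of_mem_span {z : Fin d → ℝ}
    (hz : z ∈ Submodule.span ℤ (Set.range (periodBasis d))) :
    ∃ n : Fin d → ℤ, ∀ j, z j = 2 * Real.pi * n j := by
  classical
  induction hz using Submodule.span_induction with
  | mem x hx =>
    obtain ⟨i, rfl⟩ := hx
    refine ⟨Pi.single i 1, fun j => ?_⟩
    rw [periodBasis_apply]
    by_cases h : j = i
    · subst h; simp
    · simp [h]
  | zero => exact ⟨0, fun j => by simp⟩
  | add x y _ _ hx hy =>
    obtain ⟨n, hn⟩ := hx
    obtain ⟨l, hl⟩ := hy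
    exact ⟨n + l, fun j => by simp [hn, hl]; ring⟩
  | smul a x _ hx =>
    obtain ⟨n, hn⟩ := hx
    exact ⟨a • n, fun j => by simp [hn]; ring⟩

theorem setIntegral_fundamentalDomain_add {g : (Fin d → ℝ) → ℂ}
    (hg : ∀ (n : Fin d → ℤ) (k : Fin d → ℝ), g (fun j => 2 * Real.pi * n j + k j) = g k)
    (v : Fin d → ℝ) :
    ∫ k in ZSpan.fundamentalDomain (periodBasis d), g (k + v) =
      ∫ k in ZSpan.fundamentalDomain (periodBasis d), g k := by
  have h1 := ZSpan.isAddFundamentalDomain (periodBasis d) volume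
  have h2 : IsAddFundamentalDomain (Submodule.span ℤ (Set.range (periodBasis d)))
      (v +ᵥ ZSpan.fundamentalDomain (periodBasis d)) volume := h1.vadd_of_comm v
  have hpre : (fun k => k + v) ⁻¹' (v +ᵥ ZSpan.fundamentalDomain (periodBasis d)) =
      ZSpan.fundamentalDomain (periodBasis d) := by
    ext k
    rw [Set.mem_preimage, add_comm k v, ← vadd_eq_add, Set.vadd_mem_vadd_set_iff]
  have h3 := (measurePreserving_add_right volume v).setIntegral_preimage_emb
    (measurableEmbedding_addRight v) g (v +ᵥ ZSpan.fundamentalDomain (periodBasis d))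
  rw [hpre] at h3
  rw [h3]
  have hinv : VAddInvariantMeasure (Submodule.span ℤ (Set.range (periodBasis d)))
      (Fin d → ℝ) volume :=
    ⟨fun c s _ => measure_preimage_add volume (c : Fin d → ℝ) s⟩
  refine h2.setIntegral_eq h1 fun γ k => ?_
  obtain ⟨n, hn⟩ := exists_int_of_mem_span γ.2
  rw [← hg n k]
  congr 1
  funext j
  rw [← hn j]
  rfl

/-- Translation by `(π, …, π)` carries the zone to the fundamental domain `[0, 2π)ᵈ` of the period
lattice, up to a null set, where invariance is a property of fundamental domains. -/
theorem setIntegral_brillouinZone_add {g : (Fin d → ℝ) → ℂ}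
    (hg : ∀ (n : Fin d → ℤ) (k : Fin d → ℝ), g (fun j => 2 * Real.pi * n j + k j) = g k)
    (v : Fin d → ℝ) :
    ∫ k in brillouinZone d, g (k + v) = ∫ k in brillouinZone d, g k := by
  let w : Fin d → ℝ := fun _ => Real.pi
  have key : ∀ f : (Fin d → ℝ) → ℂ, ∫ k in brillouinZone d, f (k + w) =
      ∫ k in ZSpan.fundamentalDomain (periodBasis d), f k := by
    intro f
    rw [← (measurePreserving_add_right volume w).setIntegral_preimage_emb
      (measurableEmbedding_addRight w) f (ZSpan.fundamentalDomain (periodBasis d))]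
    refine setIntegral_congr_set ?_
    have h1 := Measure.univ_pi_Ico_ae_eq_Icc (μ := fun _ : Fin d => (volume : Measure ℝ))
      (f := fun _ => -Real.pi) (g := fun _ => Real.pi)
    have h2 : (fun k => k + w) ⁻¹' ZSpan.fundamentalDomain (periodBasis d) =
        Set.pi Set.univ fun _ : Fin d => Set.Ico (-Real.pi) Real.pi := by
      ext k
      simp only [Set.mem_preimage, ZSpan.mem_fundamentalDomain, periodBasis_repr, Set.mem_pi,
        Set.mem_univ, true_implies, Set.mem_Ico, Pi.add_apply, w]
      refine forall_congr' fun j => and_congr ?_ ?_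
      · rw [inv_mul_eq_div, le_div_iff₀ (by positivity)]
        constructor <;> intro h <;> linarith
      · rw [inv_mul_eq_div, div_lt_one (by positivity)]
        constructor <;> intro h <;> linarith
    rw [h2]
    exact h1.symm
  have h3 := key fun k => g (k + (v - w))
  have h4 := key fun k => g (k + (0 - w))
  rw [setIntegral_fundamentalDomain_add hg] at h3 h4
  simp only [add_assoc, add_sub_cancel, add_zero] at h3 h4
  rw [h3, h4]

end PeriodicIntegrals

/-! ### Complex translations of periodic integrals. -/

section ContourShift

variable {d : ℕ}

/-- A function holomorphic in the strip, at `k + ρ + ζ η`. -/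
theorem hasDerivAt_strip {g : (Fin d → ℂ) → ℂ} {δ : ℝ}
    (hg : AnalyticOnNhd ℂ g {p | ∀ j, |(p j).im| ≤ δ}) {p : Fin d → ℂ} {η : Fin d → ℂ} {ζ : ℂ}
    (h : ∀ j, |((p + ζ • η) j).im| ≤ δ) :
    HasDerivAt (fun ζ => g (p + ζ • η)) (fderiv ℂ g (p + ζ • η) η) ζ := by
  have h1 := (hg (p + ζ • η) h).differentiableAt.hasFDerivAt
  have h2 : HasDerivAt (fun ζ : ℂ => p + ζ • η) η ζ := by
    simpa using ((hasDerivAt_id ζ).smul_const η).const_add p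
  exact h1.comp_hasDerivAt ζ h2

/-- The integral of `g(k + ρ + ζη)` over the zone is holomorphic in `ζ` and, by periodicity,
constant on the real axis; so it is constant, and `ζ = i` gives the claim. A single complex variable
along `η` replaces a contour shift in each coordinate. -/
theorem setIntegral_strip_shift {g : (Fin d → ℂ) → ℂ} {δ C : ℝ}
    (hg : AnalyticOnNhd ℂ g {p | ∀ j, |(p j).im| ≤ δ})
    (hC : ∀ p : Fin d → ℂ, (∀ j, |(p j).im| ≤ δ) → ‖g p‖ ≤ C)
    (hper : ∀ (n : Fin d → ℤ) (k : Fin d → ℝ),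
      g (toComplexVec fun j => 2 * Real.pi * n j + k j) = g (toComplexVec k))
    (ρ η : Fin d → ℝ) (hη : ∀ j, 2 * |η j| ≤ δ) :
    ∫ k in brillouinZone d, g (toComplexVec k + (toComplexVec ρ + Complex.I • toComplexVec η)) =
      ∫ k in brillouinZone d, g (toComplexVec k) := by
  -- Half-width `2` puts `i` in the interior, and `2 |η j| ≤ δ` keeps the argument of `g` inside the
  -- strip.
  let U : Set ℂ := {ζ | |ζ.im| < 2}
  have hUopen : IsOpen U := isOpen_lt (Complex.continuous_im.abs) continuous_const
  have hUconv : Convex ℝ U := by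
    have : U = Complex.imLm ⁻¹' Set.Ioo (-2 : ℝ) 2 := by
      ext ζ; simp [U, abs_lt]
    rw [this]
    exact (convex_Ioo _ _).linear_preimage _
  let P : (Fin d → ℝ) → Fin d → ℂ := fun k => toComplexVec k + toComplexVec ρ
  have hP : Continuous P := by
    unfold P toComplexVec; fun_prop
  have hmem : ∀ k : Fin d → ℝ, ∀ ζ ∈ U, ∀ j, |((P k + ζ • toComplexVec η) j).im| ≤ δ := by
    intro k ζ hζ j
    have e : ((P k + ζ • toComplexVec η) j).im = ζ.im * η j := by
      simp [P, toComplexVec]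
    rw [e, abs_mul]
    have hζ' : |ζ.im| < 2 := hζ
    nlinarith [hη j, abs_nonneg (η j)]
  let F : ℂ → ℂ := fun ζ => ∫ k in brillouinZone d, g (P k + ζ • toComplexVec η)
  have hcont : ∀ ζ ∈ U, Continuous fun k => g (P k + ζ • toComplexVec η) := by
    intro ζ hζ
    refine hg.continuousOn.comp_continuous (by fun_prop) fun k => hmem k ζ hζ
  have hdcont : ∀ ζ ∈ U, Continuous fun k => fderiv ℂ g (P k + ζ • toComplexVec η)
      (toComplexVec η) := by
    intro ζ hζ
    have h1 : Continuous fun k => fderiv ℂ g (P k + ζ • toComplexVec η) :=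
      hg.fderiv.continuousOn.comp_continuous (by fun_prop) fun k => hmem k ζ hζ
    exact h1.clm_apply continuous_const
  have hfin : IsFiniteMeasure (volume.restrict (brillouinZone d)) :=
    ⟨by rw [Measure.restrict_apply_univ, volume_brillouinZone]; exact ENNReal.ofReal_lt_top⟩
  have hF : DifferentiableOn ℂ F U := by
    intro ζ₀ hζ₀
    obtain ⟨r, hr, hball⟩ := Metric.isOpen_iff.mp hUopen ζ₀ hζ₀
    have hsub : ∀ ζ ∈ Metric.ball ζ₀ (r / 2), ζ ∈ U := fun ζ hζ =>
      hball (Metric.ball_subset_ball (by linarith) hζ)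
    have h := hasDerivAt_integral_of_dominated_loc_of_deriv_le
      (μ := volume.restrict (brillouinZone d)) (𝕜 := ℂ)
      (F := fun ζ k => g (P k + ζ • toComplexVec η))
      (F' := fun ζ k => fderiv ℂ g (P k + ζ • toComplexVec η) (toComplexVec η))
      (x₀ := ζ₀) (s := Metric.ball ζ₀ (r / 2)) (bound := fun _ => C / (r / 4))
      (Metric.ball_mem_nhds _ (by positivity))
      (by
        filter_upwards [hUopen.mem_nhds hζ₀] with ζ hζ
        exact (hcont ζ hζ).aestronglyMeasurable)
      ((integrable_const C).mono' (hcont ζ₀ hζ₀).aestronglyMeasurable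
        (Filter.Eventually.of_forall fun k => hC _ (hmem k ζ₀ hζ₀)))
      (hdcont ζ₀ hζ₀).aestronglyMeasurable
      -- Cauchy's estimate on circles of radius `r/4`, which lie in the ball of radius `r` because
      -- their centres are within `r/2` of `ζ₀`.
      (Filter.Eventually.of_forall fun k ζ hζ => by
        have hcl : ∀ z ∈ Metric.closedBall ζ (r / 4), z ∈ U := by
          intro z hz
          apply hball
          rw [Metric.mem_ball] at hζ ⊢
          rw [Metric.mem_closedBall] at hz
          linarith [dist_triangle z ζ ζ₀]
        rw [← (hasDerivAt_strip hg (hmem k ζ (hsub ζ hζ))).deriv]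
        refine Complex.norm_deriv_le_of_forall_mem_sphere_norm_le (by positivity) ?_
          fun z hz => hC _ (hmem k z (hcl z (Metric.sphere_subset_closedBall hz)))
        refine DifferentiableOn.diffContOnCl_ball (U := Metric.closedBall ζ (r / 4))
          (fun z hz => ?_) subset_rfl
        exact (hasDerivAt_strip hg (hmem k z (hcl z hz))).differentiableAt.differentiableWithinAt)
      (integrable_const _)
      (Filter.Eventually.of_forall fun k ζ hζ => hasDerivAt_strip hg (hmem k ζ (hsub ζ hζ)))
    exact h.2.differentiableAt.differentiableWithinAt
  have hreal : ∀ x : ℝ, F x = ∫ k in brillouinZone d, g (toComplexVec k) := by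
    intro x
    have h1 := setIntegral_brillouinZone_add (g := fun k => g (toComplexVec k))
      (fun n k => hper n k) (ρ + x • η)
    rw [← h1]
    refine integral_congr_ae (Filter.Eventually.of_forall fun k => ?_)
    change g (P k + (x : ℂ) • toComplexVec η) = g (toComplexVec (k + (ρ + x • η)))
    congr 1
    funext j
    simp [P, toComplexVec, add_assoc]
  have hmemreal : ∀ x : ℝ, (x : ℂ) ∈ U := fun x => by simp [U]
  have heq : Set.EqOn F (fun _ => ∫ k in brillouinZone d, g (toComplexVec k)) U := by
    refine (hF.analyticOnNhd hUopen).eqOn_of_preconnected_of_frequently_eq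
      analyticOnNhd_const hUconv.isPreconnected (z₀ := 0) (by simpa using hmemreal 0) ?_
    have h2 : Filter.Tendsto (fun x : ℝ => (x : ℂ)) (nhdsWithin 0 {0}ᶜ)
        (nhdsWithin 0 {0}ᶜ) := by
      refine tendsto_nhdsWithin_iff.mpr ⟨?_, ?_⟩
      · have := (Complex.continuous_ofReal.tendsto 0).mono_left
          (nhdsWithin_le_nhds (s := ({0}ᶜ : Set ℝ)))
        simpa using this
      · filter_upwards [self_mem_nhdsWithin] with x hx
        simpa using hx
    exact h2.frequently (Filter.Eventually.of_forall hreal).frequently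
  have hI : Complex.I ∈ U := by simp [U]
  refine Eq.trans ?_ (heq hI)
  refine integral_congr_ae (Filter.Eventually.of_forall fun k => ?_)
  simp only [P, add_assoc]

end ContourShift

/-! ### The kinetic energy, its conjugation by exponential weights, and the bound by `q_ε`. -/

section Kinetic

variable {d : ℕ} {𝒮 : Type*} [NormedAddCommGroup 𝒮] [InnerProductSpace ℂ 𝒮] [CompleteSpace 𝒮]
  (m : ParticleReservoir d 𝒮) {δ : ℝ}

theorem opOfKernel_kernelOf (T : POp d 𝒮) {K : (Fin d → ℤ) → (Fin d → ℤ) → (𝒮 →L[ℂ] 𝒮)}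
    (h : ∀ x y, kernelOf T x y = K x y) : opOfKernel K = T := by
  have hex : ∃ T : POp d 𝒮, ∀ x y, kernelOf T x y = K x y := ⟨T, h⟩
  rw [opOfKernel, dif_pos hex]
  exact kernelOf_ext fun x y => (hex.choose_spec x y).trans (h x y).symm

theorem abs_im_le_imNorm (κ : Fin d → ℂ) (j : Fin d) : |(κ j).im| ≤ imNorm κ := by
  rw [imNorm, ← Real.sqrt_sq_eq_abs]
  exact Real.sqrt_le_sqrt (Finset.single_le_sum (f := fun j => (κ j).im ^ 2)
    (fun _ _ => sq_nonneg _) (Finset.mem_univ j))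

/-- The shifted dispersion law `k ↦ ε(k - κ/2)`. -/
def shiftedDisp (κ : Fin d → ℂ) (k : Fin d → ℝ) : ℂ :=
  m.disp (toComplexVec k - (1 / 2 : ℂ) • κ)

variable {m}

theorem abs_im_shift_le {κ : Fin d → ℂ} (hδ : 0 < δ) (hκ : imNorm κ ≤ δ) (k : Fin d → ℝ)
    (j : Fin d) : |((toComplexVec k - (1 / 2 : ℂ) • κ) j).im| ≤ δ := by
  have e : ((toComplexVec k - (1 / 2 : ℂ) • κ) j).im = -(1 / 2) * (κ j).im := by
    simp [toComplexVec]
  rw [e, abs_mul, abs_neg, abs_of_pos (by norm_num : (0 : ℝ) < 1 / 2)]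
  have := (abs_im_le_imNorm κ j).trans hκ
  linarith

/-- The symbol `ε(k - κ/2)`. -/
def kineticSymbol (hdisp : m.AnalyticDispersion δ) (κ : Fin d → ℂ) (hκ : imNorm κ ≤ δ) :
    MomentumSymbol d where
  toFun := shiftedDisp m κ
  continuous := by
    refine hdisp.analytic.continuousOn.comp_continuous ?_
      fun k => abs_im_shift_le hdisp.pos hκ k
    unfold toComplexVec; fun_prop
  bounded := by
    obtain ⟨C, hC⟩ := hdisp.bounded
    exact ⟨C, fun k => hC _ (abs_im_shift_le hdisp.pos hκ k)⟩

theorem period_disp (hdisp : m.AnalyticDispersion δ) (n : Fin d → ℤ) (k : Fin d → ℝ) :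
    m.disp (toComplexVec fun j => 2 * Real.pi * n j + k j) = m.disp (toComplexVec k) :=
  ((hdisp.period (fun j => 2 * Real.pi * n j)).mpr ⟨n, fun _ => rfl⟩ k).symm

/-- The contour shift in the kernel of the kinetic energy. -/
theorem integral_shiftedDisp (hdisp : m.AnalyticDispersion δ) (κ : Fin d → ℂ)
    (hκ : imNorm κ ≤ δ) (n : Fin d → ℤ) :
    ∫ k in brillouinZone d, shiftedDisp m κ k * momentumChar n k =
      Complex.exp (Complex.I / 2 * ∑ j, κ j * (n j : ℂ)) *
        ∫ k in brillouinZone d, shiftedDisp m 0 k * momentumChar n k := by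
  obtain ⟨C, hC⟩ := hdisp.bounded
  let g : (Fin d → ℂ) → ℂ := fun p => m.disp p * Complex.exp (Complex.I * ∑ j, p j * (n j : ℂ))
  have hexp : Differentiable ℂ fun p : Fin d → ℂ =>
      Complex.exp (Complex.I * ∑ j, p j * (n j : ℂ)) := by fun_prop
  have hg : AnalyticOnNhd ℂ g {p | ∀ j, |(p j).im| ≤ δ} := by
    refine hdisp.analytic.mul ?_
    have h1 : AnalyticOnNhd ℂ (fun p : Fin d → ℂ => Complex.I * ∑ j, p j * (n j : ℂ))
        {p | ∀ j, |(p j).im| ≤ δ} := by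
      refine analyticOnNhd_const.mul ?_
      refine Finset.analyticOnNhd_fun_sum _ fun j _ => ?_
      exact AnalyticOnNhd.mul
        (fun p _ => (ContinuousLinearMap.proj (R := ℂ) (φ := fun _ : Fin d => ℂ) j).analyticAt p)
        analyticOnNhd_const
    exact h1.cexp
  have hbound : ∀ p : Fin d → ℂ, (∀ j, |(p j).im| ≤ δ) →
      ‖g p‖ ≤ C * Real.exp (∑ j, δ * |(n j : ℝ)|) := by
    intro p hp
    rw [norm_mul, Complex.norm_exp]
    have hC0 : 0 ≤ C := (norm_nonneg _).trans (hC p hp)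
    gcongr
    · exact hC p hp
    · simp only [Complex.mul_re, Complex.I_re, Complex.I_im, zero_mul, one_mul, zero_sub,
        Complex.im_sum]
      rw [← Finset.sum_neg_distrib]
      refine Finset.sum_le_sum fun j _ => ?_
      simp only [Complex.mul_im, Complex.intCast_re, Complex.intCast_im, mul_zero, zero_add]
      calc -((p j).im * (n j : ℝ)) ≤ |(p j).im * (n j : ℝ)| := neg_le_abs _
        _ ≤ δ * |(n j : ℝ)| := by
            rw [abs_mul]; gcongr; exact hp j
  have hper : ∀ (l : Fin d → ℤ) (k : Fin d → ℝ),
      g (toComplexVec fun j => 2 * Real.pi * l j + k j) = g (toComplexVec k) := by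
    intro l k
    simp only [g]
    rw [period_disp hdisp]
    congr 1
    refine Complex.exp_eq_exp_iff_exists_int.mpr ⟨∑ j, l j * n j, ?_⟩
    simp only [toComplexVec]
    push_cast
    simp only [add_mul, Finset.sum_add_distrib, mul_add, Finset.mul_sum, Finset.sum_mul]
    rw [add_comm]
    congr 1
    exact Finset.sum_congr rfl fun j _ => by ring
  have hη : ∀ j, 2 * |(fun j => -(1 / 2) * (κ j).im : Fin d → ℝ) j| ≤ δ := by
    intro j
    have := (abs_im_le_imNorm κ j).trans hκ
    simp only
    rw [abs_mul, abs_neg, abs_of_pos (by norm_num : (0 : ℝ) < 1 / 2)]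
    linarith
  -- The translation by `-κ/2` is split into a real and an imaginary part; the factor `1/2` is what
  -- makes `2 |η j| ≤ δ` hold.
  have h := setIntegral_strip_shift hg hbound hper (fun j => -(1 / 2) * (κ j).re)
    (fun j => -(1 / 2) * (κ j).im) hη
  have e0 : ∀ k : Fin d → ℝ, shiftedDisp m 0 k * momentumChar n k = g (toComplexVec k) := by
    intro k
    simp only [shiftedDisp, smul_zero, sub_zero, g, momentumChar, toComplexVec]
  have e1 : ∀ k : Fin d → ℝ, shiftedDisp m κ k * momentumChar n k =
      Complex.exp (Complex.I / 2 * ∑ j, κ j * (n j : ℂ)) *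
      g (toComplexVec k + (toComplexVec (fun j => -(1 / 2) * (κ j).re) +
        Complex.I • toComplexVec (fun j => -(1 / 2) * (κ j).im))) := by
    intro k
    have e2 : toComplexVec k + (toComplexVec (fun j => -(1 / 2) * (κ j).re) +
        Complex.I • toComplexVec (fun j => -(1 / 2) * (κ j).im)) =
        toComplexVec k - (1 / 2 : ℂ) • κ := by
      funext j
      simp only [toComplexVec, Pi.add_apply, Pi.smul_apply, Pi.sub_apply, smul_eq_mul]
      push_cast
      linear_combination (-(1 / 2) : ℂ) * (Complex.re_add_im (κ j))
    rw [e2]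
    simp only [g, shiftedDisp, momentumChar]
    rw [mul_left_comm, ← Complex.exp_add]
    congr 2
    simp only [Pi.sub_apply, toComplexVec, Pi.smul_apply, smul_eq_mul, sub_mul,
      Finset.sum_sub_distrib, mul_sub, mul_assoc, ← Finset.mul_sum]
    ring
  simp_rw [e0, e1]
  rw [integral_const_mul, h]

/-- The kinetic energy operator conjugated by the exponential weight. -/
def kineticShift (hdisp : m.AnalyticDispersion δ) (κ : Fin d → ℂ) (hκ : imNorm κ ≤ δ) : POp d 𝒮 :=
  multOp (kineticSymbol hdisp κ hκ)

/-- Conjugating by `e^{iκ·x/2}` in position space amounts to shifting `k` to `k - κ/2` in momentum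
space. In particular the conjugated kernel is that of a bounded operator. -/
theorem kernelOf_kineticShift (hdisp : m.AnalyticDispersion δ) (κ : Fin d → ℂ)
    (hκ : imNorm κ ≤ δ) (x y : Fin d → ℤ) :
    kernelOf (kineticShift hdisp κ hκ) x y =
      Complex.exp (Complex.I / 2 * ∑ j, κ j * ((x j - y j : ℤ) : ℂ)) • m.kineticKernel x y := by
  rw [kineticShift, kernelOf_multOp, integral_momentumMeasure, ParticleReservoir.kineticKernel,
    smul_smul]
  congr 1
  have h := integral_shiftedDisp hdisp κ hκ (x - y)
  change ((2 * Real.pi) ^ d)⁻¹ • ∫ k in brillouinZone d, shiftedDisp m κ k *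
    momentumChar (x - y) k = _
  rw [h, Complex.real_smul, mul_left_comm]
  push_cast
  congr 2
  · simp
  · refine integral_congr_ae (Filter.Eventually.of_forall fun k => ?_)
    simp [shiftedDisp, momentumChar]

theorem imNorm_zero_le (hdisp : m.AnalyticDispersion δ) : imNorm (0 : Fin d → ℂ) ≤ δ := by
  simpa [imNorm] using hdisp.pos.le

theorem kineticOp_eq (hdisp : m.AnalyticDispersion δ) :
    m.kineticOp = kineticShift hdisp 0 (imNorm_zero_le hdisp) := by
  refine opOfKernel_kernelOf _ fun x y => ?_
  rw [kernelOf_kineticShift]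
  simp

theorem kernelOf_kineticOp (hdisp : m.AnalyticDispersion δ) (x y : Fin d → ℤ) :
    kernelOf m.kineticOp x y = m.kineticKernel x y := by
  rw [kineticOp_eq hdisp, kernelOf_kineticShift]
  simp

theorem isSelfAdjoint_kineticOp (hdisp : m.AnalyticDispersion δ) : IsSelfAdjoint m.kineticOp := by
  rw [kineticOp_eq hdisp]
  refine isSelfAdjoint_multOp _ fun k => ?_
  have := hdisp.real k
  simpa [kineticSymbol, shiftedDisp] using this

theorem imNorm_rePart (κ : Fin d → ℂ) : imNorm (rePart κ) = 0 := by
  simp [imNorm, rePart]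

theorem imNorm_rePart_le (hdisp : m.AnalyticDispersion δ) (κ : Fin d → ℂ) :
    imNorm (rePart κ) ≤ δ := by
  rw [imNorm_rePart]; exact hdisp.pos.le

theorem abs_im_disp_le_qDisp (hdisp : m.AnalyticDispersion δ) {γ : ℝ} (hγ : γ ≤ δ)
    {p : Fin d → ℂ} (hp : imNorm p ≤ γ) : |(m.disp p).im| ≤ m.qDisp γ := by
  obtain ⟨C, hC⟩ := hdisp.bounded
  refine le_csSup ⟨C, ?_⟩ ⟨p, hp, rfl⟩
  rintro r ⟨p, hp, rfl⟩
  exact (Complex.abs_im_le_norm _).trans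
    (hC p fun j => (abs_im_le_imNorm p j).trans (hp.trans hγ))

/-- On the complex line through the real point `k - Re κ/2` in the direction `Im κ/|Im κ|`, the
imaginary part of `ε` is at most `q_ε(γ)` on the disc of radius `γ = |Im κ|`. The point `k - κ/2`
sits at `ζ = -iγ/2`, half the radius, where the strip Schwarz lemma gives the constant one. -/
theorem norm_shiftedDisp_sub_le (hdisp : m.AnalyticDispersion δ) (κ : Fin d → ℂ)
    (hκ : imNorm κ ≤ δ) (k : Fin d → ℝ) :
    ‖shiftedDisp m κ k - shiftedDisp m (rePart κ) k‖ ≤ m.qDisp (imNorm κ) := by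
  set γ := imNorm κ with hγ
  have hγ0 : 0 ≤ γ := Real.sqrt_nonneg _
  let p : Fin d → ℝ := fun j => k j - 1 / 2 * (κ j).re
  have hp0 : toComplexVec k - (1 / 2 : ℂ) • rePart κ = toComplexVec p := by
    funext j
    simp [toComplexVec, rePart, p]
  -- If `Im κ = 0` there is no direction to normalize, but then both symbols coincide.
  rcases hγ0.eq_or_lt with h0 | hpos
  · have hκ0 : κ = rePart κ := by
      funext j
      have := abs_im_le_imNorm κ j
      rw [← hγ, ← h0] at this
      have him : (κ j).im = 0 := abs_nonpos_iff.mp this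
      exact Complex.ext (by simp [rePart]) (by simp [rePart, him])
    rw [← hκ0, sub_self, norm_zero]
    exact (abs_nonneg _).trans (abs_im_disp_le_qDisp hdisp hκ (p := 0) (by simpa [imNorm] using hγ0))
  · let η : Fin d → ℂ := toComplexVec fun j => (κ j).im / γ
    let g : ℂ → ℂ := fun ζ => m.disp (toComplexVec p + ζ • η)
    have him : ∀ (ζ : ℂ) (j : Fin d), ((toComplexVec p + ζ • η) j).im = ζ.im * ((κ j).im / γ) := by
      intro ζ j
      simp [toComplexVec, η]
    have hnorm : ∀ ζ : ℂ, imNorm (toComplexVec p + ζ • η) = |ζ.im| := by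
      intro ζ
      have h1 : ∑ j, (κ j).im ^ 2 = γ ^ 2 := by
        rw [hγ, imNorm, Real.sq_sqrt (Finset.sum_nonneg fun _ _ => sq_nonneg _)]
      have h2 : ∑ j, ((toComplexVec p + ζ • η) j).im ^ 2 = ζ.im ^ 2 := by
        simp_rw [him, mul_pow, div_pow]
        rw [← Finset.mul_sum, ← Finset.sum_div, h1, div_self (by positivity), mul_one]
      rw [imNorm, h2, Real.sqrt_sq_eq_abs]
    have hball : ∀ ζ ∈ Metric.ball (0 : ℂ) γ, imNorm (toComplexVec p + ζ • η) ≤ γ := by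
      intro ζ hζ
      rw [hnorm]
      exact (Complex.abs_im_le_norm ζ).trans (mem_ball_zero_iff.mp hζ).le
    have hgd : DifferentiableOn ℂ g (Metric.ball 0 γ) := by
      intro ζ hζ
      exact (hasDerivAt_strip hdisp.analytic fun j =>
        (abs_im_le_imNorm _ j).trans ((hball ζ hζ).trans hκ)).differentiableAt.differentiableWithinAt
    have hg0 : g 0 = shiftedDisp m (rePart κ) k := by
      simp only [g, zero_smul, add_zero, shiftedDisp, hp0]
    have hz : ‖-(Complex.I * (γ / 2 : ℝ))‖ ≤ γ / 2 := by
      rw [norm_neg, norm_mul, Complex.norm_I, one_mul, Complex.norm_real,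
        Real.norm_of_nonneg (by positivity)]
    have hg1 : g (-(Complex.I * (γ / 2 : ℝ))) = shiftedDisp m κ k := by
      simp only [g, shiftedDisp]
      congr 1
      funext j
      simp only [toComplexVec, Pi.add_apply, Pi.smul_apply, Pi.sub_apply, smul_eq_mul, p, η]
      have hγc : (γ : ℂ) ≠ 0 := by exact_mod_cast hpos.ne'
      have := Complex.re_add_im (κ j)
      push_cast
      field_simp
      linear_combination (-1 : ℂ) * this
    have h := norm_sub_le_of_abs_im_le hpos hgd
      (fun ζ hζ => abs_im_disp_le_qDisp hdisp hκ (hball ζ hζ)) (by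
        rw [hg0, shiftedDisp, hp0]; exact hdisp.real p) hz
    rwa [hg0, hg1] at h

theorem norm_kineticShift_sub_le (hdisp : m.AnalyticDispersion δ) (κ : Fin d → ℂ)
    (hκ : imNorm κ ≤ δ) :
    ‖kineticShift hdisp κ hκ - kineticShift hdisp (rePart κ) (imNorm_rePart_le hdisp κ)‖ ≤
      m.qDisp (imNorm κ) :=
  norm_multOp_sub_le _ _ ((norm_nonneg _).trans (norm_shiftedDisp_sub_le hdisp κ hκ 0))
    fun k => norm_shiftedDisp_sub_le hdisp κ hκ k

end Kinetic

/-! ### Conjugation of superoperators by `J_κ`. -/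

section WeightConjugation

variable {d : ℕ} {𝒮 : Type*} [NormedAddCommGroup 𝒮] [InnerProductSpace ℂ 𝒮]
  [FiniteDimensional ℂ 𝒮] [CompleteSpace 𝒮]

theorem jFactor_mul_neg_left (κL κR : Fin d → ℂ) (x y z : Fin d → ℤ) :
    jFactor κL κR x y * jFactor (-κL) (-κR) z y =
      Complex.exp (Complex.I / 2 * ∑ j, κL j * ((x j - z j : ℤ) : ℂ)) := by
  unfold jFactor
  simp only [← Complex.exp_add]
  congr 1
  simp only [Pi.neg_apply, neg_mul, Finset.sum_neg_distrib]
  push_cast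
  simp only [mul_sub, Finset.sum_sub_distrib]
  ring

theorem jFactor_mul_neg_right (κL κR : Fin d → ℂ) (x y z : Fin d → ℤ) :
    jFactor κL κR x y * jFactor (-κL) (-κR) x z =
      Complex.exp (Complex.I / 2 * ∑ j, κR j * ((z j - y j : ℤ) : ℂ)) := by
  unfold jFactor
  simp only [← Complex.exp_add]
  congr 1
  simp only [Pi.neg_apply, neg_mul, Finset.sum_neg_distrib]
  push_cast
  simp only [mul_sub, Finset.sum_sub_distrib]
  ring

/-- Conjugation of a commutator by the exponential weights. -/
theorem isJConj_hsAd {κL κR : Fin d → ℂ} {T TL TR : POp d 𝒮}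
    (hL : ∀ x y, kernelOf TL x y =
      Complex.exp (Complex.I / 2 * ∑ j, κL j * ((x j - y j : ℤ) : ℂ)) • kernelOf T x y)
    (hR : ∀ x y, kernelOf TR x y =
      Complex.exp (Complex.I / 2 * ∑ j, κR j * ((x j - y j : ℤ) : ℂ)) • kernelOf T x y) :
    IsJConj κL κR (hsAd T) (hsLeft TL - hsRight TR) := by
  intro S S' hS x y
  have e1 : HSOp.op ((hsLeft TL - hsRight TR) S) = TL * HSOp.op S - HSOp.op S * TR := rfl
  have e2 : HSOp.op (hsAd T S') = T * HSOp.op S' - HSOp.op S' * T := rfl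
  rw [e1, e2, kernelOf_sub, kernelOf_sub, smul_sub]
  congr 1
  · ext v
    have h1 := hasSum_kernelOf_mul TL (HSOp.op S) x y v
    have h2 := (hasSum_kernelOf_mul T (HSOp.op S') x y v).const_smul (jFactor κL κR x y)
    refine h1.unique ?_
    rw [smul_apply]
    convert h2 using 2 with z
    rw [hS, hL, smul_apply, smul_apply, map_smul, smul_smul, jFactor_mul_neg_left]
  · ext v
    have h1 := hasSum_kernelOf_mul (HSOp.op S) TR x y v
    have h2 := (hasSum_kernelOf_mul (HSOp.op S') T x y v).const_smul (jFactor κL κR x y)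
    refine h1.unique ?_
    rw [smul_apply]
    convert h2 using 2 with z
    rw [hS, hR, smul_apply, smul_apply, map_smul, smul_smul, jFactor_mul_neg_right]

theorem IsJConj.add {κL κR : Fin d → ℂ} {V V' A A' : HSOp d 𝒮 →L[ℂ] HSOp d 𝒮}
    (h : IsJConj κL κR V A) (h' : IsJConj κL κR V' A') : IsJConj κL κR (V + V') (A + A') := by
  intro S S' hS x y
  have e1 : HSOp.op ((A + A') S) = HSOp.op (A S) + HSOp.op (A' S) := rfl
  have e2 : HSOp.op ((V + V') S') = HSOp.op (V S') + HSOp.op (V' S') := rfl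
  rw [e1, e2, kernelOf_add, kernelOf_add, h S S' hS x y, h' S S' hS x y, smul_add]

theorem IsJConj.smul {κL κR : Fin d → ℂ} {V A : HSOp d 𝒮 →L[ℂ] HSOp d 𝒮}
    (h : IsJConj κL κR V A) (c : ℂ) : IsJConj κL κR (c • V) (c • A) := by
  intro S S' hS x y
  have e1 : HSOp.op ((c • A) S) = c • HSOp.op (A S) := rfl
  have e2 : HSOp.op ((c • V) S') = c • HSOp.op (V S') := rfl
  rw [e1, e2, kernelOf_smul, kernelOf_smul, h S S' hS x y, smul_comm]

/-- `V` acts separately on each matrix element. -/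
def ActsEntrywise (V : HSOp d 𝒮 →L[ℂ] HSOp d 𝒮) : Prop :=
  ∀ x y, ∀ (c : ℂ) (S S' : HSOp d 𝒮),
    kernelOf (HSOp.op S') x y = c • kernelOf (HSOp.op S) x y →
      kernelOf (HSOp.op (V S')) x y = c • kernelOf (HSOp.op (V S)) x y

/-- `J_κ` scales each entry by a number, so it passes through `V`, and the factors for `κ` and `-κ`
at the same `(x,y)` cancel. For this reason the dissipative part drops out of `J_κ M J_{-κ} - M`. -/
theorem ActsEntrywise.isJConj {V : HSOp d 𝒮 →L[ℂ] HSOp d 𝒮} (h : ActsEntrywise V)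
    (κL κR : Fin d → ℂ) : IsJConj κL κR V V := by
  intro S S' hS x y
  rw [h x y _ S S' (hS x y), smul_smul]
  have := jFactor_mul_neg_left κL κR x y x
  simp only [sub_self, Int.cast_zero, mul_zero, Finset.sum_const_zero, Complex.exp_zero] at this
  rw [this, one_smul]

end WeightConjugation

/-! ### The Fourier transform of the unit sphere and its radial differential equation. -/

section SphereFourier

open scoped Pointwise

variable {d : ℕ}

/-- The unit sphere of `ℝᵈ`. -/
abbrev UnitSphere (d : ℕ) : Type := Metric.sphere (0 : EuclideanSpace ℝ (Fin d)) 1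

/-- The surface measure of the unit sphere. -/
abbrev surfaceMeasure (d : ℕ) : Measure (UnitSphere d) :=
  (volume : Measure (EuclideanSpace ℝ (Fin d))).toSphere

theorem integral_polar {F : EuclideanSpace ℝ (Fin d) → ℂ} (hd : 0 < d) (hF : Integrable F) :
    ∫ q, F q = ∫ θ : UnitSphere d, ∫ r in Set.Ioi (0 : ℝ),
      ((r ^ (d - 1) : ℝ) : ℂ) * F (r • (θ : EuclideanSpace ℝ (Fin d))) ∂volume
        ∂(surfaceMeasure d) := by
  have : Nonempty (Fin d) := ⟨⟨0, hd⟩⟩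
  let E := EuclideanSpace ℝ (Fin d)
  let μ : Measure E := volume
  have hdim : Module.finrank ℝ E = d := finrank_euclideanSpace_fin
  let g : UnitSphere d × Set.Ioi (0 : ℝ) → ℂ := fun p => F (p.2.1 • p.1.1)
  have hg : ∀ x : ({0}ᶜ : Set E), g (homeomorphUnitSphereProd E x) = F x := by
    intro x
    have hx : ‖(x : E)‖ ≠ 0 := norm_ne_zero_iff.mpr x.2
    simp [g, smul_smul, hx]
  have hmp := μ.measurePreserving_homeomorphUnitSphereProd
  have hint : Integrable g (μ.toSphere.prod (.volumeIoiPow (Module.finrank ℝ E - 1))) := by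
    rw [← hmp.integrable_comp_emb (Homeomorph.measurableEmbedding _)]
    have h1 : g ∘ homeomorphUnitSphereProd E = fun x : ({0}ᶜ : Set E) => F x := funext hg
    rw [h1]
    have h2 := (integrableOn_iff_comap_subtypeVal (μ := μ) (f := F) (s := ({0}ᶜ : Set E))
      (measurableSet_singleton _).compl).mp hF.integrableOn
    exact h2
  calc ∫ q, F q = ∫ x : ({(0)}ᶜ : Set E), F x ∂(μ.comap (↑)) := by
        rw [integral_subtype_comap (measurableSet_singleton _).compl fun x ↦ F x,
          restrict_compl_singleton]
    _ = ∫ p, g p ∂μ.toSphere.prod (.volumeIoiPow (Module.finrank ℝ E - 1)) := by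
        rw [← hmp.integral_comp (Homeomorph.measurableEmbedding _) g]
        exact integral_congr_ae (Filter.Eventually.of_forall fun x => (hg x).symm)
    _ = _ := by
        rw [integral_prod _ hint]
        refine integral_congr_ae (Filter.Eventually.of_forall fun θ => ?_)
        simp only [Measure.volumeIoiPow, ENNReal.ofReal, g, hdim]
        rw [integral_withDensity_eq_integral_smul,
          integral_subtype_comap measurableSet_Ioi
            fun a ↦ Real.toNNReal (a ^ (d - 1)) • F (a • (θ : E)),
          setIntegral_congr_fun measurableSet_Ioi fun x hx ↦ ?_]
        · rw [NNReal.smul_def, Real.coe_toNNReal _ (pow_nonneg (le_of_lt hx) _),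
            Complex.real_smul]
        · exact (measurable_subtype_coe.pow_const _).real_toNNReal

/-- The action of a linear isometry on the unit sphere. -/
def sphereMap (L : EuclideanSpace ℝ (Fin d) ≃ₗᵢ[ℝ] EuclideanSpace ℝ (Fin d)) (θ : UnitSphere d) :
    UnitSphere d :=
  ⟨L θ, by simp⟩

theorem continuous_sphereMap (L : EuclideanSpace ℝ (Fin d) ≃ₗᵢ[ℝ] EuclideanSpace ℝ (Fin d)) :
    Continuous (sphereMap L) :=
  (L.continuous.comp continuous_subtype_val).subtype_mk _

theorem map_sphereMap (L : EuclideanSpace ℝ (Fin d) ≃ₗᵢ[ℝ] EuclideanSpace ℝ (Fin d)) :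
    (surfaceMeasure d).map (sphereMap L) = surfaceMeasure d := by
  ext s hs
  rw [Measure.map_apply (continuous_sphereMap L).measurable hs,
    Measure.toSphere_apply' _ ((continuous_sphereMap L).measurable hs),
    Measure.toSphere_apply' _ hs]
  congr 1
  have hset : Set.Ioo (0 : ℝ) 1 • ((↑) '' (sphereMap L ⁻¹' s) : Set (EuclideanSpace ℝ (Fin d))) =
      L ⁻¹' (Set.Ioo (0 : ℝ) 1 • ((↑) '' s)) := by
    ext q
    simp only [Set.mem_smul, Set.mem_image, Set.mem_preimage]
    constructor
    · rintro ⟨a, ha, _, ⟨θ, hθ, rfl⟩, rfl⟩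
      exact ⟨a, ha, _, ⟨_, hθ, rfl⟩, by simp [sphereMap]⟩
    · rintro ⟨a, ha, _, ⟨θ, hθ, rfl⟩, h⟩
      refine ⟨a, ha, _, ⟨sphereMap L.symm θ, ?_, rfl⟩, ?_⟩
      · convert hθ
        ext1
        simp [sphereMap]
      · apply L.injective
        simp [sphereMap, ← h]
  rw [hset]
  exact L.measurePreserving.measure_preimage_equiv (f := L.toHomeomorph.toMeasurableEquiv) _

/-- `∫ cos(θ·v) dσ(θ)` over the unit sphere. -/
def sphereCos (v : EuclideanSpace ℝ (Fin d)) : ℝ :=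
  ∫ θ : UnitSphere d, Real.cos ⟪(θ : EuclideanSpace ℝ (Fin d)), v⟫_ℝ ∂(surfaceMeasure d)

/-- The reflection in the hyperplane orthogonal to `v - w` maps `v` to `w` and preserves the surface
measure. -/
theorem integral_sphere_eq_of_norm_eq {v w : EuclideanSpace ℝ (Fin d)} (h : ‖v‖ = ‖w‖)
    {G : Type*} [NormedAddCommGroup G] [NormedSpace ℝ G] {f : ℝ → G} (hf : Continuous f) :
    ∫ θ : UnitSphere d, f ⟪(θ : EuclideanSpace ℝ (Fin d)), v⟫_ℝ ∂(surfaceMeasure d) =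
      ∫ θ : UnitSphere d, f ⟪(θ : EuclideanSpace ℝ (Fin d)), w⟫_ℝ ∂(surfaceMeasure d) := by
  let L := (Submodule.span ℝ {v - w})ᗮ.reflection
  have hL : L v = w := Submodule.reflection_sub h
  have hc : ∀ u : EuclideanSpace ℝ (Fin d),
      Continuous fun θ : UnitSphere d => f ⟪(θ : EuclideanSpace ℝ (Fin d)), u⟫_ℝ :=
    fun u => hf.comp (by fun_prop)
  conv_rhs => rw [← map_sphereMap L]
  rw [integral_map (continuous_sphereMap L).aemeasurable (hc w).aestronglyMeasurable]
  refine integral_congr_ae (Filter.Eventually.of_forall fun θ => ?_)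
  have : ⟪(sphereMap L θ : EuclideanSpace ℝ (Fin d)), w⟫_ℝ =
      ⟪(θ : EuclideanSpace ℝ (Fin d)), v⟫_ℝ := by
    rw [← hL]
    exact L.inner_map_map _ _
  simp only [this]

/-- Averaging over `v` and `-v` removes the sine. -/
theorem integral_sphere_exp (v : EuclideanSpace ℝ (Fin d)) :
    ∫ θ : UnitSphere d, Complex.exp (Complex.I * (⟪(θ : EuclideanSpace ℝ (Fin d)), v⟫_ℝ : ℝ))
      ∂(surfaceMeasure d) = sphereCos v := by
  have h := integral_sphere_eq_of_norm_eq (norm_neg v)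
    (f := fun x : ℝ => Complex.exp (Complex.I * x)) (by fun_prop)
  have hi : ∀ w : EuclideanSpace ℝ (Fin d), Integrable (fun θ : UnitSphere d =>
      Complex.exp (Complex.I * (⟪(θ : EuclideanSpace ℝ (Fin d)), w⟫_ℝ : ℝ)))
      (surfaceMeasure d) := fun w =>
    Continuous.integrable_of_hasCompactSupport (by fun_prop) (HasCompactSupport.of_compactSpace _)
  have h2 : (2 : ℂ) * ∫ θ : UnitSphere d,
      Complex.exp (Complex.I * (⟪(θ : EuclideanSpace ℝ (Fin d)), v⟫_ℝ : ℝ))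
      ∂(surfaceMeasure d) = 2 * sphereCos v := by
    conv_lhs => rw [two_mul]; lhs; rw [← h]
    rw [← integral_add (hi _) (hi _), sphereCos, ← integral_complex_ofReal,
      ← integral_const_mul]
    refine integral_congr_ae (Filter.Eventually.of_forall fun θ => ?_)
    simp only [inner_neg_right, Complex.ofReal_neg, Complex.ofReal_cos, Complex.cos]
    rw [mul_comm Complex.I, mul_comm Complex.I]
    ring
  exact mul_left_cancel₀ two_ne_zero h2

theorem abs_sphereCos_le (v : EuclideanSpace ℝ (Fin d)) :
    |sphereCos v| ≤ (surfaceMeasure d).real Set.univ := by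
  have h := norm_integral_le_of_norm_le_const (μ := surfaceMeasure d)
    (f := fun θ : UnitSphere d => Real.cos ⟪(θ : EuclideanSpace ℝ (Fin d)), v⟫_ℝ) (C := 1)
    (Filter.Eventually.of_forall fun θ => Real.abs_cos_le_one _)
  simpa [sphereCos] using h

theorem hasDerivAt_integral_sphere {F F' : ℝ → UnitSphere d → ℝ} (hF : ∀ a, Continuous (F a))
    (hF' : ∀ a, Continuous (F' a)) (hd : ∀ a θ, HasDerivAt (fun a => F a θ) (F' a θ) a) {C : ℝ}
    (hb : ∀ a θ, |F' a θ| ≤ C) (a : ℝ) :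
    HasDerivAt (fun a => ∫ θ, F a θ ∂(surfaceMeasure d)) (∫ θ, F' a θ ∂(surfaceMeasure d)) a :=
  (hasDerivAt_integral_of_dominated_loc_of_deriv_le (s := Set.univ) (bound := fun _ => C)
    Filter.univ_mem
    (Filter.Eventually.of_forall fun b => (hF b).aestronglyMeasurable)
    ((hF a).integrable_of_hasCompactSupport (HasCompactSupport.of_compactSpace _))
    (hF' a).aestronglyMeasurable
    (Filter.Eventually.of_forall fun θ b _ => hb b θ) (integrable_const C)
    (Filter.Eventually.of_forall fun θ b _ => hd b θ)).2

theorem abs_coord_le (θ : UnitSphere d) (i : Fin d) :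
    |(θ : EuclideanSpace ℝ (Fin d)) i| ≤ 1 := by
  have h := PiLp.norm_apply_le (θ : EuclideanSpace ℝ (Fin d)) i
  simpa using h

theorem sum_sq_coord (θ : UnitSphere d) : ∑ i, (θ : EuclideanSpace ℝ (Fin d)) i ^ 2 = 1 := by
  have h := EuclideanSpace.real_norm_sq_eq (θ : EuclideanSpace ℝ (Fin d))
  rw [← h]
  simp

/-- `∫ θᵢⁿ cos(r θᵢ) dσ(θ)`. -/
def coordCos (i : Fin d) (n : ℕ) (r : ℝ) : ℝ :=
  ∫ θ : UnitSphere d, (θ : EuclideanSpace ℝ (Fin d)) i ^ n *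
    Real.cos (r * (θ : EuclideanSpace ℝ (Fin d)) i) ∂(surfaceMeasure d)

/-- `∫ θᵢⁿ sin(r θᵢ) dσ(θ)`. -/
def coordSin (i : Fin d) (n : ℕ) (r : ℝ) : ℝ :=
  ∫ θ : UnitSphere d, (θ : EuclideanSpace ℝ (Fin d)) i ^ n *
    Real.sin (r * (θ : EuclideanSpace ℝ (Fin d)) i) ∂(surfaceMeasure d)

theorem continuous_coord (i : Fin d) :
    Continuous fun θ : UnitSphere d => (θ : EuclideanSpace ℝ (Fin d)) i := by fun_prop

theorem hasDerivAt_coordCos (i : Fin d) (n : ℕ) (r : ℝ) :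
    HasDerivAt (coordCos i n) (-coordSin i (n + 1) r) r := by
  have hc := continuous_coord i
  have h := hasDerivAt_integral_sphere (d := d)
    (F := fun r θ => (θ : EuclideanSpace ℝ (Fin d)) i ^ n *
      Real.cos (r * (θ : EuclideanSpace ℝ (Fin d)) i))
    (F' := fun r θ => -((θ : EuclideanSpace ℝ (Fin d)) i ^ (n + 1) *
      Real.sin (r * (θ : EuclideanSpace ℝ (Fin d)) i))) (C := 1)
    (fun a => by fun_prop) (fun a => by fun_prop)
    (fun a θ => by
      have h1 := ((hasDerivAt_id a).mul_const ((θ : EuclideanSpace ℝ (Fin d)) i)).cos.const_mul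
        ((θ : EuclideanSpace ℝ (Fin d)) i ^ n)
      exact h1.congr_deriv (by simp only [id]; ring))
    (fun a θ => by
      rw [abs_neg, abs_mul, abs_pow]
      exact mul_le_one₀ (pow_le_one₀ (abs_nonneg _) (abs_coord_le θ i)) (abs_nonneg _)
        (Real.abs_sin_le_one _)) r
  rw [integral_neg] at h
  exact h

theorem hasDerivAt_coordSin (i : Fin d) (n : ℕ) (r : ℝ) :
    HasDerivAt (coordSin i n) (coordCos i (n + 1) r) r := by
  have hc := continuous_coord i
  exact hasDerivAt_integral_sphere (d := d)
    (F := fun r θ => (θ : EuclideanSpace ℝ (Fin d)) i ^ n *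
      Real.sin (r * (θ : EuclideanSpace ℝ (Fin d)) i))
    (F' := fun r θ => ((θ : EuclideanSpace ℝ (Fin d)) i ^ (n + 1) *
      Real.cos (r * (θ : EuclideanSpace ℝ (Fin d)) i))) (C := 1)
    (fun a => by fun_prop) (fun a => by fun_prop)
    (fun a θ => by
      have h1 := ((hasDerivAt_id a).mul_const ((θ : EuclideanSpace ℝ (Fin d)) i)).sin.const_mul
        ((θ : EuclideanSpace ℝ (Fin d)) i ^ n)
      exact h1.congr_deriv (by simp only [id]; ring))
    (fun a θ => by
      rw [abs_mul, abs_pow]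
      exact mul_le_one₀ (pow_le_one₀ (abs_nonneg _) (abs_coord_le θ i)) (abs_nonneg _)
        (Real.abs_cos_le_one _)) r

theorem sphereCos_eq_coordCos (i : Fin d) (v : EuclideanSpace ℝ (Fin d)) :
    sphereCos v = coordCos i 0 ‖v‖ := by
  have hn : ‖v‖ = ‖EuclideanSpace.single i ‖v‖‖ := by simp
  rw [sphereCos, integral_sphere_eq_of_norm_eq hn Real.continuous_cos, coordCos]
  refine integral_congr_ae (Filter.Eventually.of_forall fun θ => ?_)
  simp [EuclideanSpace.inner_single_right]

/-- The infinitesimal form of the rotation invariance in the plane of two coordinates. -/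
theorem integral_sphere_rotation {i j : Fin d} (hij : i ≠ j) (r : ℝ) :
    ∫ θ : UnitSphere d, (r ^ 2 * (θ : EuclideanSpace ℝ (Fin d)) j ^ 2 *
        Real.cos (r * (θ : EuclideanSpace ℝ (Fin d)) i) -
      r * (θ : EuclideanSpace ℝ (Fin d)) i *
        Real.sin (r * (θ : EuclideanSpace ℝ (Fin d)) i)) ∂(surfaceMeasure d) = 0 := by
  have hci := continuous_coord i
  have hcj := continuous_coord j
  -- `A α θ` is the inner product of `θ` with a vector of length `|r|` turned by the angle `α` from
  -- axis `i` towards axis `j`; `B` is its derivative, and `-A` that of `B`. The integral of `cos (A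
  -- α θ)` does not depend on `α`, and its second derivative at `α = 0` is, up to sign, the claimed
  -- integral.
  let A : ℝ → UnitSphere d → ℝ := fun α θ =>
    r * (Real.cos α * (θ : EuclideanSpace ℝ (Fin d)) i +
      Real.sin α * (θ : EuclideanSpace ℝ (Fin d)) j)
  let B : ℝ → UnitSphere d → ℝ := fun α θ =>
    r * (-Real.sin α * (θ : EuclideanSpace ℝ (Fin d)) i +
      Real.cos α * (θ : EuclideanSpace ℝ (Fin d)) j)
  have hA : ∀ α θ, HasDerivAt (fun α => A α θ) (B α θ) α := fun α θ =>
    (((Real.hasDerivAt_cos α).mul_const _).add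
      ((Real.hasDerivAt_sin α).mul_const _)).const_mul r
  have hB : ∀ α θ, HasDerivAt (fun α => B α θ) (-A α θ) α := fun α θ => by
    have h := (((Real.hasDerivAt_sin α).neg.mul_const ((θ : EuclideanSpace ℝ (Fin d)) i)).add
      ((Real.hasDerivAt_cos α).mul_const ((θ : EuclideanSpace ℝ (Fin d)) j))).const_mul r
    exact h.congr_deriv (by simp only [A]; ring)
  have hAc : ∀ α, Continuous (A α) := fun α => by unfold A; fun_prop
  have hBc : ∀ α, Continuous (B α) := fun α => by unfold B; fun_prop
  have hbd : ∀ a b x y : ℝ, |a| ≤ 1 → |b| ≤ 1 → |x| ≤ 1 → |y| ≤ 1 →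
      |r * (a * x + b * y)| ≤ 2 * |r| := by
    intro a b x y ha hb hx hy
    rw [abs_mul, mul_comm 2]
    refine mul_le_mul_of_nonneg_left ?_ (abs_nonneg r)
    calc |a * x + b * y| ≤ |a| * |x| + |b| * |y| := by
          rw [← abs_mul, ← abs_mul]; exact abs_add_le _ _
      _ ≤ 1 * 1 + 1 * 1 := by gcongr
      _ = 2 := by norm_num
  have hAb : ∀ α θ, |A α θ| ≤ 2 * |r| := fun α θ =>
    hbd _ _ _ _ (Real.abs_cos_le_one α) (Real.abs_sin_le_one α) (abs_coord_le θ i)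
      (abs_coord_le θ j)
  have hBb : ∀ α θ, |B α θ| ≤ 2 * |r| := fun α θ =>
    hbd _ _ _ _ (by rw [abs_neg]; exact Real.abs_sin_le_one α) (Real.abs_cos_le_one α)
      (abs_coord_le θ i) (abs_coord_le θ j)
  have h1 : ∀ α, HasDerivAt (fun α => ∫ θ, Real.cos (A α θ) ∂(surfaceMeasure d))
      (∫ θ, -Real.sin (A α θ) * B α θ ∂(surfaceMeasure d)) α :=
    hasDerivAt_integral_sphere (C := 1 * (2 * |r|)) (fun a => by have := hAc a; fun_prop)
      (fun a => by have := hAc a; have := hBc a; fun_prop)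
      (fun a θ => (hA a θ).cos)
      (fun a θ => by
        rw [abs_mul, abs_neg]
        gcongr
        · exact Real.abs_sin_le_one _
        · exact hBb a θ)
  have h2 := hasDerivAt_integral_sphere (d := d)
    (F := fun α θ => -Real.sin (A α θ) * B α θ)
    (F' := fun α θ => -(Real.cos (A α θ) * B α θ) * B α θ + -Real.sin (A α θ) * -A α θ)
    (C := (1 * (2 * |r|)) * (2 * |r|) + 1 * (2 * |r|))
    (fun a => by have := hAc a; have := hBc a; fun_prop)
    (fun a => by have := hAc a; have := hBc a; fun_prop)
    (fun a θ => (hA a θ).sin.neg.mul (hB a θ))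
    (fun a θ => by
      refine (abs_add_le _ _).trans (add_le_add ?_ ?_)
      · rw [abs_mul, abs_neg, abs_mul]
        gcongr
        · exact Real.abs_cos_le_one _
        · exact hBb a θ
        · exact hBb a θ
      · rw [abs_mul, abs_neg, abs_neg]
        gcongr
        · exact Real.abs_sin_le_one _
        · exact hAb a θ) 0
  have hconst : ∀ α, ∫ θ, Real.cos (A α θ) ∂(surfaceMeasure d) =
      ∫ θ, Real.cos (A 0 θ) ∂(surfaceMeasure d) := by
    intro α
    let v : ℝ → EuclideanSpace ℝ (Fin d) := fun α =>
      EuclideanSpace.single i (r * Real.cos α) + EuclideanSpace.single j (r * Real.sin α)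
    have hv : ∀ α θ, A α θ = ⟪(θ : EuclideanSpace ℝ (Fin d)), v α⟫_ℝ := by
      intro α θ
      simp only [A, v, inner_add_right, EuclideanSpace.inner_single_right]
      simp
      ring
    have hn : ∀ α, ‖v α‖ ^ 2 = r ^ 2 := by
      intro α
      have ho : ⟪(EuclideanSpace.single i (r * Real.cos α) : EuclideanSpace ℝ (Fin d)),
          EuclideanSpace.single j (r * Real.sin α)⟫_ℝ = 0 := by
        simp [EuclideanSpace.inner_single_right, hij.symm]
      have := norm_add_sq_eq_norm_sq_add_norm_sq_real ho
      simp only [v, sq]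
      rw [this]
      simp only [PiLp.norm_single, Real.norm_eq_abs, abs_mul_abs_self]
      linear_combination r ^ 2 * Real.sin_sq_add_cos_sq α
    simp only [hv]
    refine integral_sphere_eq_of_norm_eq ?_ Real.continuous_cos
    have := (hn α).trans (hn 0).symm
    exact (pow_left_inj₀ (norm_nonneg _) (norm_nonneg _) two_ne_zero).mp this
  have h3 : ∀ α, ∫ θ, -Real.sin (A α θ) * B α θ ∂(surfaceMeasure d) = 0 := by
    intro α
    have h := h1 α
    rw [funext hconst] at h
    exact h.unique (hasDerivAt_const α _)
  rw [funext h3] at h2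
  have h4 := h2.unique (hasDerivAt_const 0 _)
  rw [← neg_eq_zero, ← integral_neg, ← h4]
  refine integral_congr_ae (Filter.Eventually.of_forall fun θ => ?_)
  simp [A, B]
  ring

/-- Summing the rotation identity over the `d - 1` coordinates other than `i`, with `∑_{j ≠ i} θⱼ² =
1 - θᵢ²`, gives `g'' + ((d-1)/r) g' + g = 0` for `g = coordCos i 0`, as `g' = -coordSin i 1` and
`g'' = -coordCos i 2`. -/
theorem coordCos_ode (i : Fin d) (r : ℝ) (hr : r ≠ 0) :
    r * (coordCos i 0 r - coordCos i 2 r) = ((d - 1 : ℕ) : ℝ) * coordSin i 1 r := by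
  have hc := fun k : Fin d => continuous_coord k
  have hint : ∀ f : UnitSphere d → ℝ, Continuous f → Integrable f (surfaceMeasure d) :=
    fun f hf => hf.integrable_of_hasCompactSupport (HasCompactSupport.of_compactSpace _)
  have h1 : ∑ j ∈ Finset.univ.erase i, ∫ θ : UnitSphere d,
      (r ^ 2 * (θ : EuclideanSpace ℝ (Fin d)) j ^ 2 *
        Real.cos (r * (θ : EuclideanSpace ℝ (Fin d)) i) -
      r * (θ : EuclideanSpace ℝ (Fin d)) i *
        Real.sin (r * (θ : EuclideanSpace ℝ (Fin d)) i)) ∂(surfaceMeasure d) = 0 :=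
    Finset.sum_eq_zero fun j hj => integral_sphere_rotation (Finset.ne_of_mem_erase hj).symm r
  rw [← integral_finsetSum _ fun j _ => hint _ (by have := hc i; have := hc j; fun_prop)] at h1
  have h2 : r ^ 2 * (coordCos i 0 r - coordCos i 2 r) -
      ((d - 1 : ℕ) : ℝ) * (r * coordSin i 1 r) = 0 := by
    rw [← h1, coordCos, coordCos, coordSin, ← integral_sub, ← integral_const_mul,
      ← integral_const_mul, ← integral_const_mul, ← integral_sub]
    · refine integral_congr_ae (Filter.Eventually.of_forall fun θ => ?_)
      have hs := sum_sq_coord θ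
      rw [← Finset.add_sum_erase _ _ (Finset.mem_univ i)] at hs
      simp only
      rw [Finset.sum_sub_distrib, ← Finset.sum_mul, ← Finset.mul_sum, Finset.sum_const,
        Finset.card_erase_of_mem (Finset.mem_univ i), Finset.card_univ, Fintype.card_fin,
        nsmul_eq_mul, eq_sub_of_add_eq' hs]
      ring
    all_goals exact hint _ (by have := hc i; fun_prop)
  apply mul_left_cancel₀ hr
  linear_combination h2

end SphereFourier

/-! ### Decay of the Fourier transform of the sphere by an energy estimate. -/

section BesselDecay

/-- Energy bound for `g'' + (k/r) g' + g = 0`, written as the system `g' = -s`, `s' = h`,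
`r (g - h) = k s`. -/
theorem exists_pow_mul_sq_le_of_ode {g s h : ℝ → ℝ} {k : ℕ} (hk : 3 ≤ k)
    (hg : ∀ r, HasDerivAt g (-s r) r) (hs : ∀ r, HasDerivAt s (h r) r)
    (hode : ∀ r, r ≠ 0 → r * (g r - h r) = k * s r) {B : ℝ} (hB : ∀ r, |g r| ≤ B) :
    ∃ C : ℝ, ∀ r, 0 ≤ r → r ^ 3 * g r ^ 2 ≤ C := by
  have hk' : (3 : ℝ) ≤ k := by exact_mod_cast hk
  -- The substitution `u = r^{k/2} g` removes the first-order term: `u'' + (1 - c/r²) u = 0`. Below,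
  -- `A = r^{-k/2} u'` and `E = u'² + (1 - c/r²) u²`.
  set c : ℝ := (k / 2 : ℝ) ^ 2 - k / 2 with hc
  have hc0 : 0 ≤ c := by rw [hc]; nlinarith
  let A : ℝ → ℝ := fun r => -s r + k / 2 * g r / r
  let E : ℝ → ℝ := fun r => r ^ k * (A r ^ 2 + (1 - c / r ^ 2) * g r ^ 2)
  -- One has `E' = (2c/r³) u²`. Where `1 - c/r² ≥ 1/2` this is at most `(4c/r³) E`, and the
  -- exponential is the integrating factor that makes `H` nonincreasing.
  let H : ℝ → ℝ := fun r => E r * Real.exp (2 * c / r ^ 2)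
  have hh : ∀ r, r ≠ 0 → h r = g r - k * s r / r := by
    intro r hr
    have := hode r hr
    field_simp
    linarith
  have hA : ∀ r, r ≠ 0 → HasDerivAt A (-(1 - c / r ^ 2) * g r - k * A r / (2 * r)) r := by
    intro r hr
    have h1 := (hs r).neg.add ((((hg r).const_mul ((k : ℝ) / 2))).div (hasDerivAt_id r) hr)
    refine h1.congr_deriv ?_
    simp only [A, id, hh r hr, hc]
    field_simp
    ring
  have hE : ∀ r, r ≠ 0 → HasDerivAt E (r ^ k * (2 * c / r ^ 3 * g r ^ 2)) r := by
    intro r hr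
    have h0 : HasDerivAt (fun r : ℝ => 1 - c / r ^ 2) (2 * c / r ^ 3) r := by
      have := ((hasDerivAt_const r c).div ((hasDerivAt_id r).pow 2)
        (pow_ne_zero 2 hr)).const_sub 1
      refine this.congr_deriv ?_
      simp only [id, Pi.pow_apply]
      field_simp
      ring
    have h1 := (hasDerivAt_pow k r).mul (((hA r hr).pow 2).add (h0.mul ((hg r).pow 2)))
    refine h1.congr_deriv ?_
    have hp : r ^ k = r ^ (k - 1) * r := by
      rw [← pow_succ]; congr 1; omega
    have hsA : s r = k / 2 * g r / r - A r := by simp only [A]; ring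
    simp only [Pi.add_apply, Pi.mul_apply, Pi.pow_apply]
    rw [hp, hsA]
    generalize A r = a
    field_simp
    ring
  have hH : ∀ r, r ≠ 0 → HasDerivAt H (Real.exp (2 * c / r ^ 2) * r ^ k * (2 * c / r ^ 3 *
      (g r ^ 2 - 2 * (A r ^ 2 + (1 - c / r ^ 2) * g r ^ 2)))) r := by
    intro r hr
    have h0 : HasDerivAt (fun r : ℝ => 2 * c / r ^ 2) (-(4 * c / r ^ 3)) r := by
      have := (hasDerivAt_const r (2 * c)).div ((hasDerivAt_id r).pow 2) (pow_ne_zero 2 hr)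
      refine this.congr_deriv ?_
      simp only [id, Pi.pow_apply]
      field_simp
      ring
    refine ((hE r hr).mul h0.exp).congr_deriv ?_
    simp only [E]
    field_simp
    ring
  have hk0 : (0 : ℝ) < k := by linarith
  have hhalf : ∀ r : ℝ, (k : ℝ) ≤ r → 1 / 2 ≤ 1 - c / r ^ 2 := by
    intro r hr
    have hr0 : 0 < r := hk0.trans_le hr
    have : c / r ^ 2 ≤ 1 / 2 := by
      rw [div_le_iff₀ (by positivity), hc]
      nlinarith
    linarith
  have hanti : AntitoneOn H (Set.Ici (k : ℝ)) := by
    refine antitoneOn_of_deriv_nonpos (convex_Ici _)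
      (fun r hr => (hH r (hk0.trans_le hr).ne').continuousAt.continuousWithinAt)
      (fun r hr => ?_) (fun r hr => ?_)
    · rw [interior_Ici] at hr
      exact (hH r (hk0.trans hr).ne').differentiableAt.differentiableWithinAt
    · rw [interior_Ici] at hr
      have hr0 : 0 < r := hk0.trans hr
      rw [(hH r hr0.ne').deriv]
      have h1 := hhalf r (le_of_lt hr)
      have h2 : g r ^ 2 - 2 * (A r ^ 2 + (1 - c / r ^ 2) * g r ^ 2) ≤ 0 := by
        nlinarith [sq_nonneg (A r), sq_nonneg (g r)]
      exact mul_nonpos_of_nonneg_of_nonpos (by positivity)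
        (mul_nonpos_of_nonneg_of_nonpos (by positivity) h2)
  refine ⟨max (2 * H k) ((k : ℝ) ^ 3 * B ^ 2), fun r hr => ?_⟩
  by_cases hrk : (k : ℝ) ≤ r
  · refine le_max_of_le_left ?_
    have hr0 : 0 < r := hk0.trans_le hrk
    have h1 := hanti (Set.self_mem_Ici) hrk hrk
    have h2 := hhalf r hrk
    have h3 : r ^ 3 ≤ r ^ k := pow_le_pow_right₀ (by linarith) hk
    have h4 : r ^ 3 * g r ^ 2 ≤ 2 * E r := by
      calc r ^ 3 * g r ^ 2 ≤ r ^ k * g r ^ 2 := by gcongr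
        _ ≤ r ^ k * (2 * (A r ^ 2 + (1 - c / r ^ 2) * g r ^ 2)) := by
            refine mul_le_mul_of_nonneg_left ?_ (by positivity)
            nlinarith [sq_nonneg (A r), sq_nonneg (g r)]
        _ = 2 * E r := by simp only [E]; ring
    have hE0 : 0 ≤ E r := by
      have : 0 ≤ r ^ 3 * g r ^ 2 := by positivity
      linarith
    have h5 : E r ≤ H r := by
      refine le_mul_of_one_le_right hE0 (Real.one_le_exp (by positivity))
    linarith
  · refine le_max_of_le_right ?_
    have hB0 : 0 ≤ B := (abs_nonneg _).trans (hB 0)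
    have h1 : g r ^ 2 ≤ B ^ 2 := by
      rw [← sq_abs]
      exact pow_le_pow_left₀ (abs_nonneg _) (hB r) 2
    have h2 : r ≤ k := (not_le.mp hrk).le
    gcongr

/-- The energy estimate bounds `r^{(d-1)/2} g` for large `r`, and only the power `3/2`, available
for `d ≥ 4`, is kept. It exceeds `1`, so it is integrable in time at infinity, and it is below `2`,
so `|ω|^{-3/2}` is integrable at `0` against a density vanishing there linearly. -/
theorem exists_abs_sphereCos_le {d : ℕ} (hd : 4 ≤ d) :
    ∃ C : ℝ, 0 ≤ C ∧ ∀ v : EuclideanSpace ℝ (Fin d), v ≠ 0 →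
      |sphereCos v| ≤ C * ‖v‖ ^ (-(3 / 2) : ℝ) := by
  let i : Fin d := ⟨0, by omega⟩
  obtain ⟨C, hC⟩ := exists_pow_mul_sq_le_of_ode (g := coordCos i 0) (s := coordSin i 1)
    (h := coordCos i 2) (k := d - 1) (by omega) (hasDerivAt_coordCos i 0)
    (hasDerivAt_coordSin i 1) (fun r hr => coordCos_ode i r hr)
    (B := (surfaceMeasure d).real Set.univ) (fun r => by
      have h := abs_sphereCos_le (EuclideanSpace.single i r)
      have h2 : coordCos i 0 r = sphereCos (EuclideanSpace.single i r) := by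
        rw [sphereCos, coordCos]
        refine integral_congr_ae (Filter.Eventually.of_forall fun θ => ?_)
        simp [EuclideanSpace.inner_single_right]
      rwa [h2])
  have hC0 : 0 ≤ C := by simpa using hC 0 le_rfl
  refine ⟨Real.sqrt C, Real.sqrt_nonneg _, fun v hv => ?_⟩
  have hv0 : 0 < ‖v‖ := norm_pos_iff.mpr hv
  have h1 := hC ‖v‖ hv0.le
  rw [sphereCos_eq_coordCos i]
  refine abs_le_of_sq_le_sq ?_ (by positivity)
  rw [mul_pow, Real.sq_sqrt hC0, ← Real.rpow_natCast (‖v‖ ^ _), ← Real.rpow_mul hv0.le]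
  have : (-(3 / 2) : ℝ) * ((2 : ℕ) : ℝ) = -((3 : ℕ) : ℝ) := by norm_num
  rw [this, Real.rpow_neg hv0.le, Real.rpow_natCast, ← div_eq_mul_inv,
    le_div_iff₀ (by positivity)]
  linarith

end BesselDecay

/-! ### Contour shifts for functions that are integrable on the lines of a strip. -/

section StripFourier

open Filter Topology

theorem frequently_lt_of_lintegral_ne_top {A : ℝ → ℝ≥0∞} (hA : ∫⁻ r, A r ≠ ⊤) {ε : ℝ≥0∞}
    (hε : ε ≠ 0) : ∃ᶠ r in atTop, A r < ε := by
  intro h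
  obtain ⟨R, hR⟩ := eventually_atTop.mp h
  refine hA (top_le_iff.mp ?_)
  calc (⊤ : ℝ≥0∞) = ∫⁻ _ in Set.Ici R, ε := by
        rw [setLIntegral_const, Real.volume_Ici, ENNReal.mul_top hε]
    _ ≤ ∫⁻ r in Set.Ici R, A r :=
        setLIntegral_mono' measurableSet_Ici fun r hr => not_lt.mp (hR r hr)
    _ ≤ ∫⁻ r, A r := setLIntegral_le_lintegral _ _

/-- Clamping the imaginary part gives a function continuous on the whole plane, hence the joint
measurability needed for Tonelli's theorem. -/
theorem continuous_strip_clamp {f : ℂ → ℂ} {δ : ℝ} (hδ : 0 ≤ δ)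
    (hf : ContinuousOn f {z | |z.im| ≤ δ}) :
    Continuous fun p : ℝ × ℝ => f (p.1 + (max (-δ) (min δ p.2) : ℝ) * Complex.I) := by
  refine hf.comp_continuous (by fun_prop) fun p => ?_
  simp [abs_le, hδ]

theorem continuous_strip_line {f : ℂ → ℂ} {δ χ : ℝ} (hχ : |χ| ≤ δ)
    (hf : ContinuousOn f {z | |z.im| ≤ δ}) :
    Continuous fun x : ℝ => f (x + χ * Complex.I) :=
  hf.comp_continuous (by fun_prop) fun x => by simpa using hχ

/-- Cauchy's theorem on rectangles. No pointwise decay is assumed, but by Tonelli the integral of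
`‖f‖` over the vertical side at abscissa `R` is integrable in `R`; hence both sides together are
arbitrarily small for suitable large `R`, while the horizontal integrals converge. -/
theorem integral_strip_eq {f : ℂ → ℂ} {δ : ℝ} {C : ℝ≥0}
    (hf : AnalyticOnNhd ℂ f {z | |z.im| ≤ δ})
    (hC : ∀ χ : ℝ, |χ| ≤ δ → ∫⁻ x : ℝ, ‖f (x + χ * Complex.I)‖ₑ ≤ C) {χ : ℝ} (hχ : |χ| ≤ δ) :
    ∫ x : ℝ, f x = ∫ x : ℝ, f (x + χ * Complex.I) := by
  have hδ : 0 ≤ δ := (abs_nonneg χ).trans hχ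
  have hint : ∀ χ : ℝ, |χ| ≤ δ → Integrable fun x : ℝ => f (x + χ * Complex.I) := fun χ hχ =>
    ⟨(continuous_strip_line hχ hf.continuousOn).aestronglyMeasurable,
      (hC χ hχ).trans_lt ENNReal.coe_lt_top⟩
  let V : ℝ → ℝ≥0∞ := fun R => ∫⁻ y in Set.uIoc 0 χ, ‖f (R + y * Complex.I)‖ₑ
  have hmem : ∀ y ∈ Set.uIcc 0 χ, |y| ≤ δ := by
    intro y hy
    rcases Set.mem_uIcc.mp hy with h | h
    · rw [abs_of_nonneg h.1]; exact h.2.trans ((le_abs_self χ).trans hχ)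
    · rw [abs_of_nonpos h.2]; linarith [neg_abs_le χ]
  have hVint : ∫⁻ R, V R ≤ C * volume (Set.uIoc 0 χ) := by
    have hcl := continuous_strip_clamp hδ hf.continuousOn
    have hV : ∀ R, V R = ∫⁻ y in Set.uIoc 0 χ,
        ‖f ((R : ℂ) + (max (-δ) (min δ y) : ℝ) * Complex.I)‖ₑ := by
      intro R
      refine setLIntegral_congr_fun measurableSet_uIoc fun y hy => ?_
      have h := abs_le.mp (hmem y (Set.uIoc_subset_uIcc hy))
      rw [min_eq_right h.2, max_eq_right h.1]
    simp_rw [hV]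
    rw [lintegral_lintegral_swap]
    · calc _ ≤ ∫⁻ _ in Set.uIoc 0 χ, (C : ℝ≥0∞) := by
            refine setLIntegral_mono' measurableSet_uIoc fun y hy => ?_
            have h := abs_le.mp (hmem y (Set.uIoc_subset_uIcc hy))
            rw [min_eq_right h.2, max_eq_right h.1]
            exact hC y (hmem y (Set.uIoc_subset_uIcc hy))
        _ = _ := setLIntegral_const _ _
    · exact hcl.enorm.measurable.aemeasurable
  have hA : ∫⁻ R, (V R + V (-R)) ≠ ⊤ := by
    have hVfin : ∫⁻ R, V R ≠ ⊤ := by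
      refine ne_top_of_le_ne_top ?_ hVint
      refine ENNReal.mul_ne_top ENNReal.coe_ne_top ?_
      rw [Set.uIoc, Real.volume_Ioc]
      exact ENNReal.ofReal_ne_top
    have hVm : Measurable V := by
      have hcl := continuous_strip_clamp hδ hf.continuousOn
      have hV : V = fun R : ℝ => ∫⁻ y in Set.uIoc 0 χ,
          ‖f ((R : ℂ) + (max (-δ) (min δ y) : ℝ) * Complex.I)‖ₑ := by
        funext R
        refine setLIntegral_congr_fun measurableSet_uIoc fun y hy => ?_
        have h := abs_le.mp (hmem y (Set.uIoc_subset_uIcc hy))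
        rw [min_eq_right h.2, max_eq_right h.1]
      rw [hV]
      exact Measurable.lintegral_prod_right' hcl.enorm.measurable
    rw [lintegral_add_left hVm]
    refine ENNReal.add_ne_top.mpr ⟨hVfin, ?_⟩
    have h := (Measure.measurePreserving_neg (volume : Measure ℝ)).lintegral_comp hVm
    rwa [h]
  let D : ℝ → ℂ := fun R =>
    (∫ x in (-R)..R, f x) - ∫ x in (-R)..R, f (x + χ * Complex.I)
  have hD : Tendsto D atTop (𝓝 ((∫ x : ℝ, f x) - ∫ x : ℝ, f (x + χ * Complex.I))) := by
    have h0 := hint 0 (by simpa using hδ)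
    simp only [Complex.ofReal_zero, zero_mul, add_zero] at h0
    exact (intervalIntegral_tendsto_integral h0 tendsto_neg_atTop_atBot tendsto_id).sub
      (intervalIntegral_tendsto_integral (hint χ hχ) tendsto_neg_atTop_atBot tendsto_id)
  have hDV : ∀ R, ‖D R‖ₑ ≤ V R + V (-R) := by
    intro R
    have h := Complex.integral_boundary_rect_eq_zero_of_differentiableOn f (-R : ℂ)
      (R + χ * Complex.I) (by
        intro z hz
        have hz2 := (Complex.mem_reProdIm.mp hz).2
        simp only [Complex.neg_im, Complex.ofReal_im, neg_zero, Complex.add_im, Complex.mul_im,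
          Complex.ofReal_re, Complex.I_im, mul_one, Complex.I_re, mul_zero, add_zero, zero_add]
          at hz2
        exact (hf z (hmem _ hz2)).differentiableAt.differentiableWithinAt)
    simp only [Complex.neg_im, Complex.ofReal_im, neg_zero, Complex.add_im, Complex.mul_im,
      Complex.ofReal_re, Complex.I_im, mul_one, Complex.I_re, mul_zero, add_zero, zero_add,
      Complex.neg_re, Complex.add_re, Complex.mul_re, sub_zero, Complex.ofReal_zero,
      zero_mul, smul_eq_mul, Complex.ofReal_neg] at h
    have hDR : D R = Complex.I * (∫ y in (0 : ℝ)..χ, f (-R + y * Complex.I)) -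
        Complex.I * ∫ y in (0 : ℝ)..χ, f (R + y * Complex.I) := by
      simp only [D]
      linear_combination h
    have hb : ∀ r : ℝ, ‖∫ y in (0 : ℝ)..χ, f (r + y * Complex.I)‖ₑ ≤ V r := by
      intro r
      have h1 : ‖∫ y in (0 : ℝ)..χ, f (r + y * Complex.I)‖ₑ =
          ‖∫ y in Set.uIoc 0 χ, f (r + y * Complex.I)‖ₑ := by
        rw [enorm_eq_iff_norm_eq]
        exact intervalIntegral.norm_intervalIntegral_eq _ _ _ _
      rw [h1]
      exact enorm_integral_le_lintegral_enorm _
    have hI : ‖Complex.I‖ₑ = 1 := by rw [← ofReal_norm]; simp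
    rw [hDR, add_comm]
    refine (enorm_sub_le).trans (add_le_add ?_ ?_)
    · rw [enorm_mul, hI, one_mul]
      have := hb (-R)
      simpa using this
    · rw [enorm_mul, hI, one_mul]
      exact hb R
  rw [← sub_eq_zero, ← norm_le_zero_iff]
  refine le_of_forall_pos_le_add fun ε hε => ?_
  have hfr := frequently_lt_of_lintegral_ne_top hA (ε := ENNReal.ofReal ε)
    (by simpa using hε)
  refine le_of_tendsto_of_frequently hD.norm (hfr.mono fun R hR => ?_)
  have := (hDV R).trans hR.le
  rw [zero_add, ← ENNReal.ofReal_le_ofReal_iff hε.le, ofReal_norm]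
  exact this

/-- The contour is moved to height `δ` or `-δ`, according to the sign of `s`, so that the
exponential contributes `e^{-δ|s|}`. -/
theorem norm_integral_strip_mul_exp_le {G : ℂ → ℂ} {δ : ℝ} {C : ℝ≥0} (hδ : 0 ≤ δ)
    (hG : AnalyticOnNhd ℂ G {z | |z.im| ≤ δ})
    (hC : ∀ χ : ℝ, |χ| ≤ δ → ∫⁻ x : ℝ, ‖G (x + χ * Complex.I)‖ₑ ≤ C) (s : ℝ) :
    ‖∫ x : ℝ, G x * Complex.exp (Complex.I * (x * s))‖ ≤ C * Real.exp (-(δ * |s|)) := by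
  have hnorm : ∀ x χ : ℝ, ‖Complex.exp (Complex.I * ((x + χ * Complex.I) * s))‖ =
      Real.exp (-(χ * s)) := by
    intro x χ
    rw [Complex.norm_exp]
    congr 1
    simp
  let f : ℂ → ℂ := fun z => G z * Complex.exp (Complex.I * (z * s))
  have hf : AnalyticOnNhd ℂ f {z | |z.im| ≤ δ} := by
    refine hG.mul fun z _ => ?_
    have : Differentiable ℂ fun z : ℂ => Complex.exp (Complex.I * (z * s)) := by fun_prop
    exact this.analyticAt z
  have hfC : ∀ χ : ℝ, |χ| ≤ δ → ∫⁻ x : ℝ, ‖f (x + χ * Complex.I)‖ₑ ≤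
      C * ENNReal.ofReal (Real.exp (-(χ * s))) := by
    intro χ hχ
    have h1 : ∀ x : ℝ, ‖f (x + χ * Complex.I)‖ₑ =
        ‖G (x + χ * Complex.I)‖ₑ * ENNReal.ofReal (Real.exp (-(χ * s))) := by
      intro x
      simp only [f]
      rw [enorm_mul, ← ofReal_norm (Complex.exp _), hnorm]
    simp_rw [h1]
    rw [lintegral_mul_const' _ _ ENNReal.ofReal_ne_top]
    gcongr
    exact hC χ hχ
  let χ : ℝ := if 0 ≤ s then δ else -δ
  have hχ : |χ| ≤ δ := by
    simp only [χ]; split_ifs <;> simp [abs_of_nonneg hδ]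
  have hχs : χ * s = δ * |s| := by
    simp only [χ]; split_ifs with h
    · rw [abs_of_nonneg h]
    · rw [abs_of_neg (not_le.mp h)]; ring
  have h := integral_strip_eq (C := C * (Real.exp (δ * |s|)).toNNReal) hf (fun χ hχ => by
    refine (hfC χ hχ).trans ?_
    rw [ENNReal.coe_mul]
    change _ ≤ (C : ℝ≥0∞) * ENNReal.ofReal _
    gcongr
    calc -(χ * s) ≤ |χ * s| := neg_le_abs _
      _ = |χ| * |s| := abs_mul _ _
      _ ≤ δ * |s| := by gcongr) hχ
  change ‖∫ x : ℝ, f x‖ ≤ _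
  rw [h]
  have h2 := (enorm_integral_le_lintegral_enorm (μ := volume)
    fun x : ℝ => f (x + χ * Complex.I)).trans (hfC χ hχ)
  rw [hχs, ← ofReal_norm, ← ENNReal.ofReal_coe_nnreal,
    ← ENNReal.ofReal_mul (by positivity),
    ENNReal.ofReal_le_ofReal_iff (by positivity)] at h2
  exact h2

end StripFourier

/-! ### The correlation function as a superposition of one-dimensional Fourier transforms. -/

section Correlation

open Filter Topology

/-- Near `0` the bound `G = O(ω)` leaves the integrable singularity `|ω|^{-1/2}`; elsewhere the
power is bounded. -/
theorem integrable_mul_abs_rpow {G : ℝ → ℂ} (hG : Integrable G)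
    (h0 : G =O[𝓝 0] fun ω => ω) :
    Integrable fun ω => ‖G ω‖ * |ω| ^ (-(3 / 2) : ℝ) := by
  obtain ⟨M, hM⟩ := h0.bound
  obtain ⟨r, hr, hball⟩ := Metric.eventually_nhds_iff.mp hM
  have hM' : ∀ ω : ℝ, |ω| < r → ‖G ω‖ ≤ max M 0 * |ω| := by
    intro ω hω
    have h1 := hball (y := ω) (by simpa using hω)
    rw [Real.norm_eq_abs] at h1
    exact h1.trans (mul_le_mul_of_nonneg_right (le_max_left _ _) (abs_nonneg _))
  let u : ℝ → ℝ := (Set.Ioc 0 r).indicator fun x => x ^ (-(1 / 2) : ℝ)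
  have hu : Integrable u := by
    rw [integrable_indicator_iff measurableSet_Ioc]
    exact (intervalIntegrable_iff_integrableOn_Ioc_of_le hr.le).mp
      (intervalIntegral.intervalIntegrable_rpow' (by norm_num))
  have hu0 : ∀ x, 0 ≤ u x := fun x =>
    Set.indicator_nonneg (fun y hy => Real.rpow_nonneg hy.1.le _) x
  have hbound : Integrable fun ω => max M 0 * (u ω + u (-ω)) + r ^ (-(3 / 2) : ℝ) * ‖G ω‖ :=
    ((hu.add hu.comp_neg).const_mul _).add (hG.norm.const_mul _)
  refine hbound.mono' ?_ (Eventually.of_forall fun ω => ?_)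
  · refine hG.norm.aestronglyMeasurable.mul ?_
    exact (measurable_id.abs.pow_const _).aestronglyMeasurable
  · have hp : 0 ≤ ‖G ω‖ * |ω| ^ (-(3 / 2) : ℝ) := by positivity
    rw [Real.norm_of_nonneg hp]
    have hM0 : 0 ≤ max M 0 := le_max_right _ _
    have hrp : 0 ≤ r ^ (-(3 / 2) : ℝ) := Real.rpow_nonneg hr.le _
    by_cases hω : |ω| < r
    · rcases eq_or_ne ω 0 with rfl | hne
      · have h1 := hM' 0 (by simpa using hr)
        simp only [abs_zero, mul_zero] at h1
        have h2 : ‖G 0‖ = 0 := le_antisymm h1 (norm_nonneg _)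
        rw [h2, zero_mul]
        have := hu0 0
        have := hu0 (-0)
        positivity
      · have hpos : 0 < |ω| := abs_pos.mpr hne
        have h3 : |ω| ^ (-(1 / 2) : ℝ) ≤ u ω + u (-ω) := by
          rcases lt_or_gt_of_ne hne with h | h
          · have : u (-ω) = |ω| ^ (-(1 / 2) : ℝ) := by
              rw [abs_of_neg h] at hω ⊢
              exact Set.indicator_of_mem (Set.mem_Ioc.mpr ⟨by linarith, hω.le⟩) _
            rw [this]
            linarith [hu0 ω]
          · have : u ω = |ω| ^ (-(1 / 2) : ℝ) := by
              rw [abs_of_pos h] at hω ⊢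
              exact Set.indicator_of_mem (Set.mem_Ioc.mpr ⟨h, hω.le⟩) _
            rw [this]
            linarith [hu0 (-ω)]
        have h4 : |ω| * |ω| ^ (-(3 / 2) : ℝ) = |ω| ^ (-(1 / 2) : ℝ) := by
          conv_lhs => lhs; rw [← Real.rpow_one |ω|]
          rw [← Real.rpow_add hpos]
          norm_num
        calc ‖G ω‖ * |ω| ^ (-(3 / 2) : ℝ) ≤ (max M 0 * |ω|) * |ω| ^ (-(3 / 2) : ℝ) := by
              gcongr; exact hM' ω hω
          _ = max M 0 * |ω| ^ (-(1 / 2) : ℝ) := by rw [mul_assoc, h4]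
          _ ≤ max M 0 * (u ω + u (-ω)) := by gcongr
          _ ≤ _ := le_add_of_nonneg_right (by positivity)
    · have h1 : |ω| ^ (-(3 / 2) : ℝ) ≤ r ^ (-(3 / 2) : ℝ) :=
        Real.rpow_le_rpow_of_nonpos hr (not_lt.mp hω) (by norm_num)
      have := hu0 ω
      have := hu0 (-ω)
      calc ‖G ω‖ * |ω| ^ (-(3 / 2) : ℝ) ≤ ‖G ω‖ * r ^ (-(3 / 2) : ℝ) := by gcongr
        _ = r ^ (-(3 / 2) : ℝ) * ‖G ω‖ := mul_comm _ _
        _ ≤ _ := le_add_of_nonneg_left (by positivity)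

/-- The Fourier transform of a radial density, symmetrized by a full-line density `G`: if
`r ^ (d - 1) P₁(r) = G(r)` and `r ^ (d - 1) P₂(r) = G(-r)`, then it is a superposition of the
one-dimensional Fourier transforms of `G`. -/
theorem integral_radial_eq_sphere {d : ℕ} (hd : 0 < d) {P₁ P₂ : ℝ → ℝ} {G : ℝ → ℂ}
    (hP₁ : Integrable fun q : EuclideanSpace ℝ (Fin d) => P₁ ‖q‖)
    (hP₂ : Integrable fun q : EuclideanSpace ℝ (Fin d) => P₂ ‖q‖) (hG : Integrable G)
    (h₁ : ∀ r : ℝ, 0 < r → ((r ^ (d - 1) * P₁ r : ℝ) : ℂ) = G r)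
    (h₂ : ∀ r : ℝ, 0 < r → ((r ^ (d - 1) * P₂ r : ℝ) : ℂ) = G (-r))
    (t : ℝ) (v : EuclideanSpace ℝ (Fin d)) :
    ∫ q : EuclideanSpace ℝ (Fin d), ((P₁ ‖q‖ : ℂ) * Complex.exp (Complex.I * (t * ‖q‖ : ℝ)) +
        (P₂ ‖q‖ : ℂ) * Complex.exp (-(Complex.I * (t * ‖q‖ : ℝ)))) *
          Complex.exp (Complex.I * (⟪q, v⟫_ℝ : ℝ)) =
      ∫ θ : UnitSphere d, ∫ ω : ℝ, G ω * Complex.exp (Complex.I *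
        (ω * (t + ⟪(θ : EuclideanSpace ℝ (Fin d)), v⟫_ℝ : ℝ))) ∂volume ∂(surfaceMeasure d) := by
  let E := EuclideanSpace ℝ (Fin d)
  have hbdd : ∀ (P : ℝ → ℝ), Integrable (fun q : E => P ‖q‖) → ∀ φ : E → ℝ, Continuous φ →
      Integrable fun q : E => (P ‖q‖ : ℂ) * Complex.exp (Complex.I * (φ q : ℝ)) := by
    intro P hP φ hφ
    refine (hP.ofReal (𝕜 := ℂ)).mul_bdd (c := 1) (by fun_prop) (Eventually.of_forall fun q => ?_)
    rw [mul_comm, Complex.norm_exp_ofReal_mul_I]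
  have i1 := hbdd P₁ hP₁ (fun q => t * ‖q‖ + ⟪q, v⟫_ℝ) (by fun_prop)
  have i2 := hbdd P₂ hP₂ (fun q => -(t * ‖q‖) + ⟪q, v⟫_ℝ) (by fun_prop)
  have i3 := hbdd P₂ hP₂ (fun q => -(t * ‖q‖ + ⟪q, v⟫_ℝ)) (by fun_prop)
  -- Reflecting `q` in the second term turns its phase into the negative of the first, so that in
  -- polar coordinates the two terms are the parts `ω = r` and `ω = -r` of one integral over the
  -- line.
  have hstep : ∫ q : E, ((P₁ ‖q‖ : ℂ) * Complex.exp (Complex.I * (t * ‖q‖ : ℝ)) +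
        (P₂ ‖q‖ : ℂ) * Complex.exp (-(Complex.I * (t * ‖q‖ : ℝ)))) *
          Complex.exp (Complex.I * (⟪q, v⟫_ℝ : ℝ)) =
      ∫ q : E, ((P₁ ‖q‖ : ℂ) * Complex.exp (Complex.I * (t * ‖q‖ + ⟪q, v⟫_ℝ : ℝ)) +
        (P₂ ‖q‖ : ℂ) * Complex.exp (Complex.I * (-(t * ‖q‖ + ⟪q, v⟫_ℝ) : ℝ))) := by
    rw [integral_add i1 i3, ← integral_neg_eq_self (fun q : E => (P₂ ‖q‖ : ℂ) *
      Complex.exp (Complex.I * (-(t * ‖q‖ + ⟪q, v⟫_ℝ) : ℝ)))]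
    simp only [norm_neg, inner_neg_left]
    rw [← integral_add i1]
    · refine integral_congr_ae (Eventually.of_forall fun q => ?_)
      simp only [add_mul, mul_assoc, ← Complex.exp_add]
      push_cast
      ring_nf
    · refine i2.congr (Eventually.of_forall fun q => ?_)
      simp only
      congr 4
      ring
  refine hstep.trans ((integral_polar hd (i1.add i3)).trans ?_)
  refine integral_congr_ae (Eventually.of_forall fun θ => ?_)
  simp only [Pi.add_apply]
  set a : ℝ := t + ⟪(θ : EuclideanSpace ℝ (Fin d)), v⟫_ℝ with ha
  have hGi : Integrable fun ω : ℝ => G ω * Complex.exp (Complex.I * (ω * a : ℂ)) := by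
    refine hG.mul_bdd (c := 1) (by fun_prop) (Eventually.of_forall fun ω => ?_)
    rw [mul_comm, ← Complex.ofReal_mul, Complex.norm_exp_ofReal_mul_I]
  have hsplit : ∫ ω : ℝ, G ω * Complex.exp (Complex.I * (ω * a : ℂ)) =
      ∫ r in Set.Ioi (0 : ℝ), (G r * Complex.exp (Complex.I * (r * a : ℂ)) +
        G (-r) * Complex.exp (Complex.I * ((-r : ℝ) * a : ℂ))) := by
    rw [integral_add hGi.integrableOn hGi.comp_neg.integrableOn,
      integral_comp_neg_Ioi (f := fun ω : ℝ => G ω * Complex.exp (Complex.I * (ω * a : ℂ))),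
      neg_zero, add_comm, ← setIntegral_univ, ← Set.Iic_union_Ioi (a := (0 : ℝ)),
      setIntegral_union (Set.Iic_disjoint_Ioi le_rfl) measurableSet_Ioi hGi.integrableOn
        hGi.integrableOn]
  rw [hsplit]
  refine setIntegral_congr_fun measurableSet_Ioi fun r hr => ?_
  have hr' : (0 : ℝ) < r := hr
  have hn : ‖r • (θ : EuclideanSpace ℝ (Fin d))‖ = r := by
    rw [norm_smul, Real.norm_of_nonneg hr'.le]; simp
  rw [hn, ← h₁ r hr', ← h₂ r hr', mul_add, inner_smul_left, ha]
  push_cast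
  simp only [conj_trivial]
  ring_nf

end Correlation

/-! ### Decay inside and outside the light cone. -/

section CorrelationDecay

open Filter Topology

theorem abs_inner_sphere_le {d : ℕ} (θ : UnitSphere d) (v : EuclideanSpace ℝ (Fin d)) :
    |⟪(θ : EuclideanSpace ℝ (Fin d)), v⟫_ℝ| ≤ ‖v‖ := by
  have h := abs_real_inner_le_norm (θ : EuclideanSpace ℝ (Fin d)) v
  simpa using h

/-- Inside the light cone the superposition of exponentially decaying functions decays. -/
theorem norm_integral_sphere_le_of_exp_decay {d : ℕ} {ψ : ℝ → ℂ} {C δ t : ℝ} (hC : 0 ≤ C)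
    (hδ : 0 ≤ δ) (hψ : ∀ s, ‖ψ s‖ ≤ C * Real.exp (-(δ * |s|)))
    {v : EuclideanSpace ℝ (Fin d)} (hv : ‖v‖ ≤ t / 2) :
    ‖∫ θ : UnitSphere d, ψ (t + ⟪(θ : EuclideanSpace ℝ (Fin d)), v⟫_ℝ) ∂(surfaceMeasure d)‖ ≤
      C * Real.exp (-(δ * (t / 2))) * (surfaceMeasure d).real Set.univ := by
  refine norm_integral_le_of_norm_le_const (Eventually.of_forall fun θ => (hψ _).trans ?_)
  have h1 := abs_le.mp (abs_inner_sphere_le θ v)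
  have h2 : t / 2 ≤ |t + ⟪(θ : EuclideanSpace ℝ (Fin d)), v⟫_ℝ| :=
    le_trans (by linarith) (le_abs_self _)
  gcongr

/-- Integrating over the sphere before the frequency produces `sphereCos (ω • v)`, whose decay
splits into `|ω|^{-3/2} ‖v‖^{-3/2}`; the first factor is absorbed by `G`. -/
theorem norm_integral_sphere_le_of_sphereCos {d : ℕ} {G : ℝ → ℂ} (hG : Integrable G)
    (hG' : Integrable fun ω => ‖G ω‖ * |ω| ^ (-(3 / 2) : ℝ)) {C : ℝ}
    (hS : ∀ v : EuclideanSpace ℝ (Fin d), v ≠ 0 → |sphereCos v| ≤ C * ‖v‖ ^ (-(3 / 2) : ℝ))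
    (t : ℝ) {v : EuclideanSpace ℝ (Fin d)} (hv : v ≠ 0) :
    ‖∫ θ : UnitSphere d, ∫ ω : ℝ, G ω * Complex.exp (Complex.I *
        (ω * (t + ⟪(θ : EuclideanSpace ℝ (Fin d)), v⟫_ℝ : ℝ))) ∂volume ∂(surfaceMeasure d)‖ ≤
      C * (∫ ω, ‖G ω‖ * |ω| ^ (-(3 / 2) : ℝ)) * ‖v‖ ^ (-(3 / 2) : ℝ) := by
  have hint : Integrable (Function.uncurry fun (θ : UnitSphere d) (ω : ℝ) => G ω *
      Complex.exp (Complex.I * (ω * (t + ⟪(θ : EuclideanSpace ℝ (Fin d)), v⟫_ℝ : ℝ))))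
      ((surfaceMeasure d).prod volume) := by
    refine (hG.comp_snd (surfaceMeasure d)).mul_bdd (c := 1) (by fun_prop)
      (Eventually.of_forall fun p => ?_)
    rw [mul_comm, ← Complex.ofReal_mul, Complex.norm_exp_ofReal_mul_I]
  rw [integral_integral_swap hint]
  have hinner : ∀ ω : ℝ, ∫ θ : UnitSphere d, G ω * Complex.exp (Complex.I *
      (ω * (t + ⟪(θ : EuclideanSpace ℝ (Fin d)), v⟫_ℝ : ℝ))) ∂(surfaceMeasure d) =
      G ω * Complex.exp (Complex.I * (ω * t)) * sphereCos (ω • v) := by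
    intro ω
    rw [← integral_sphere_exp, ← integral_const_mul]
    refine integral_congr_ae (Eventually.of_forall fun θ => ?_)
    simp only
    rw [mul_assoc, ← Complex.exp_add, inner_smul_right]
    push_cast
    ring_nf
  simp_rw [hinner]
  have hbd : ∀ᵐ ω : ℝ, ‖G ω * Complex.exp (Complex.I * (ω * t)) * sphereCos (ω • v)‖ ≤
      C * ‖v‖ ^ (-(3 / 2) : ℝ) * (‖G ω‖ * |ω| ^ (-(3 / 2) : ℝ)) := by
    have h0 : ∀ᵐ ω : ℝ, ω ≠ 0 := by
      rw [ae_iff]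
      simp
    filter_upwards [h0] with ω hω
    have h1 := hS (ω • v) (smul_ne_zero hω hv)
    rw [norm_smul, Real.norm_eq_abs, Real.mul_rpow (abs_nonneg _) (norm_nonneg _)] at h1
    rw [norm_mul, norm_mul, mul_comm Complex.I, ← Complex.ofReal_mul,
      Complex.norm_exp_ofReal_mul_I, mul_one, Complex.norm_real, Real.norm_eq_abs]
    calc ‖G ω‖ * |sphereCos (ω • v)| ≤
        ‖G ω‖ * (C * (|ω| ^ (-(3 / 2) : ℝ) * ‖v‖ ^ (-(3 / 2) : ℝ))) := by gcongr
      _ = _ := by ring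
  refine (norm_integral_le_of_norm_le (hG'.const_mul _) hbd).trans (le_of_eq ?_)
  rw [integral_const_mul]
  ring

end CorrelationDecay

/-! ### Spectral densities of the reservoir and uniform decay of its correlations. -/

namespace ParticleReservoir

open Filter Topology

variable {d : ℕ} {𝒮 : Type*} [NormedAddCommGroup 𝒮] [InnerProductSpace ℂ 𝒮] [CompleteSpace 𝒮]
  (m : ParticleReservoir d 𝒮) {δ : ℝ}

/-- The radial spectral density of emission, `|φ|² (1 + T_β)`. -/
def emission (r : ℝ) : ℝ := ‖m.ff r‖ ^ 2 * (1 + (Real.exp (m.β * r) - 1)⁻¹)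

/-- The radial spectral density of absorption, `|φ|² T_β`. -/
def absorption (r : ℝ) : ℝ := ‖m.ff r‖ ^ 2 * (Real.exp (m.β * r) - 1)⁻¹

/-- The momentum density of the correlation function of the field at time difference `t`. -/
def corrDensity (t : ℝ) (q : EuclideanSpace ℝ (Fin d)) : ℂ :=
  (m.emission ‖q‖ : ℂ) * Complex.exp (Complex.I * (t * ‖q‖ : ℝ)) +
    (m.absorption ‖q‖ : ℂ) * Complex.exp (-(Complex.I * (t * ‖q‖ : ℝ)))

variable {m}

theorem thermal_nonneg {r : ℝ} (hr : 0 ≤ r) : 0 ≤ (Real.exp (m.β * r) - 1)⁻¹ :=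
  inv_nonneg.mpr (sub_nonneg.mpr (Real.one_le_exp (mul_nonneg m.β_pos.le hr)))

theorem emission_nonneg {r : ℝ} (hr : 0 ≤ r) : 0 ≤ m.emission r :=
  mul_nonneg (sq_nonneg _) (add_nonneg zero_le_one (thermal_nonneg hr))

theorem absorption_nonneg {r : ℝ} (hr : 0 ≤ r) : 0 ≤ m.absorption r :=
  mul_nonneg (sq_nonneg _) (thermal_nonneg hr)

/-- With `pow_mul_absorption`: emission and absorption are the positive and negative frequency
halves of the single analytic function `ψ̂`. -/
theorem pow_mul_emission {r : ℝ} (hr : 0 < r) :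
    r ^ (d - 1) * m.emission r = m.effFormFactor r := by
  have h1 : 1 < Real.exp (m.β * r) := Real.one_lt_exp_iff.mpr (mul_pos m.β_pos hr)
  rw [effFormFactor, abs_of_pos hr, if_pos hr.le, emission, neg_mul, Real.exp_neg]
  have h2 : Real.exp (m.β * r) - 1 ≠ 0 := by linarith
  have h3 : 1 - (Real.exp (m.β * r))⁻¹ ≠ 0 := by
    have := inv_lt_one_of_one_lt₀ h1
    linarith
  have h4 : 1 / (1 - (Real.exp (m.β * r))⁻¹) = 1 + (Real.exp (m.β * r) - 1)⁻¹ := by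
    field_simp
    ring
  rw [h4]
  ring

theorem pow_mul_absorption {r : ℝ} (hr : 0 < r) :
    r ^ (d - 1) * m.absorption r = m.effFormFactor (-r) := by
  rw [effFormFactor, abs_neg, abs_of_pos hr, if_neg (by linarith), absorption, neg_mul_neg,
    one_div]
  ring

theorem corrDensity_neg (t : ℝ) (q : EuclideanSpace ℝ (Fin d)) :
    m.corrDensity t (-q) = m.corrDensity t q := by
  simp [corrDensity]

theorem star_corrDensity (t : ℝ) (q : EuclideanSpace ℝ (Fin d)) :
    (starRingEnd ℂ) (m.corrDensity t q) = m.corrDensity (-t) q := by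
  simp only [corrDensity, map_add, map_mul, Complex.conj_ofReal, ← Complex.exp_conj, map_neg,
    Complex.conj_I]
  push_cast
  ring_nf

theorem norm_corrDensity_le (t : ℝ) (q : EuclideanSpace ℝ (Fin d)) :
    ‖m.corrDensity t q‖ ≤ m.emission ‖q‖ + m.absorption ‖q‖ := by
  refine (norm_add_le _ _).trans (le_of_eq ?_)
  rw [norm_mul, norm_mul, Complex.norm_real, Complex.norm_real,
    Real.norm_of_nonneg (emission_nonneg (norm_nonneg q)),
    Real.norm_of_nonneg (absorption_nonneg (norm_nonneg q)), mul_comm Complex.I,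
    Complex.norm_exp_ofReal_mul_I, ← neg_mul, ← Complex.ofReal_neg,
    Complex.norm_exp_ofReal_mul_I, mul_one, mul_one]

theorem latticePhase_sub (q : EuclideanSpace ℝ (Fin d)) (x y : Fin d → ℤ) :
    latticePhase q x - latticePhase q y =
      ⟪q, WithLp.toLp 2 fun j => ((x j : ℝ) - (y j : ℝ))⟫_ℝ := by
  simp only [latticePhase, ← Finset.sum_sub_distrib, PiLp.inner_apply]
  refine Finset.sum_congr rfl fun j _ => ?_
  simp
  ring

theorem integrable_emission_absorption (hd : 4 ≤ d) (hff : m.AnalyticFormFactor δ) :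
    Integrable (fun q : EuclideanSpace ℝ (Fin d) => m.emission ‖q‖) ∧
      Integrable (fun q : EuclideanSpace ℝ (Fin d) => m.absorption ‖q‖) := by
  obtain ⟨G, hGa, hGeq, hG0, C, hC⟩ := hff.extension
  have : Nonempty (Fin d) := ⟨⟨0, by omega⟩⟩
  have hcont : Continuous fun ω : ℝ => G ω := by
    have := continuous_strip_line (χ := 0) (by simpa using hff.pos.le) hGa.continuousOn
    simpa using this
  have hGi : Integrable fun ω : ℝ => G ω := by
    have := hC 0 (by simpa using hff.pos.le)
    simp only [Complex.ofReal_zero, zero_mul, add_zero] at this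
    exact ⟨hcont.aestronglyMeasurable, this.trans_lt ENNReal.coe_lt_top⟩
  have hdim : Module.finrank ℝ (EuclideanSpace ℝ (Fin d)) = d := finrank_euclideanSpace_fin
  constructor
  · rw [integrable_fun_norm_addHaar (μ := (volume : Measure (EuclideanSpace ℝ (Fin d))))
      (f := m.emission), hdim]
    refine (hGi.re.integrableOn (s := Set.Ioi 0)).congr_fun (fun r hr => ?_) measurableSet_Ioi
    have hr' : 0 < r := hr
    simp only [smul_eq_mul]
    rw [pow_mul_emission hr', hGeq r hr'.ne']
    simp
  · rw [integrable_fun_norm_addHaar (μ := (volume : Measure (EuclideanSpace ℝ (Fin d))))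
      (f := m.absorption), hdim]
    refine (hGi.comp_neg.re.integrableOn (s := Set.Ioi 0)).congr_fun (fun r hr => ?_)
      measurableSet_Ioi
    have hr' : 0 < r := hr
    simp only [smul_eq_mul]
    rw [pow_mul_absorption hr', hGeq (-r) (by linarith)]
    simp

theorem integrable_corrDensity (hd : 4 ≤ d) (hff : m.AnalyticFormFactor δ) (t : ℝ) :
    Integrable (m.corrDensity t) := by
  obtain ⟨h1, h2⟩ := integrable_emission_absorption hd hff
  refine ((h1.ofReal (𝕜 := ℂ)).mul_bdd (c := 1) (by fun_prop) (Eventually.of_forall fun q => ?_)).add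
    ((h2.ofReal (𝕜 := ℂ)).mul_bdd (c := 1) (by fun_prop) (Eventually.of_forall fun q => ?_))
  · rw [mul_comm Complex.I, Complex.norm_exp_ofReal_mul_I]
  · rw [mul_comm Complex.I, ← neg_mul, ← Complex.ofReal_neg, Complex.norm_exp_ofReal_mul_I]

/-- Dominated convergence. Continuity of the weight in `L¹` makes the averaging superoperators
continuous in operator norm as functions of time. -/
theorem tendsto_integral_norm_corrDensity_sub (hd : 4 ≤ d) (hff : m.AnalyticFormFactor δ)
    (t₀ : ℝ) :
    Tendsto (fun t => ∫ q, ‖m.corrDensity t q - m.corrDensity t₀ q‖) (𝓝 t₀) (𝓝 0) := by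
  obtain ⟨h1, h2⟩ := integrable_emission_absorption hd hff
  have h := tendsto_integral_filter_of_dominated_convergence (μ := volume) (l := 𝓝 t₀)
    (F := fun t q => ‖m.corrDensity t q - m.corrDensity t₀ q‖) (f := fun _ => 0)
    (fun q : EuclideanSpace ℝ (Fin d) => 2 * (m.emission ‖q‖ + m.absorption ‖q‖))
    (Eventually.of_forall fun t => ((integrable_corrDensity hd hff t).sub
      (integrable_corrDensity hd hff t₀)).norm.aestronglyMeasurable)
    (Eventually.of_forall fun t => Eventually.of_forall fun q => by
      rw [norm_norm]
      refine (norm_sub_le _ _).trans ?_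
      have := norm_corrDensity_le (m := m) t q
      have := norm_corrDensity_le (m := m) t₀ q
      linarith)
    ((h1.add h2).const_mul 2)
    (Eventually.of_forall fun q => by
      have hc : Continuous fun t => ‖m.corrDensity t q - m.corrDensity t₀ q‖ := by
        unfold corrDensity; fun_prop
      have := hc.tendsto t₀
      simpa using this)
  simpa using h

/-- The correlation function of the field decays in time, uniformly in space. -/
theorem exists_decay_bound (hd : 4 ≤ d) (hff : m.AnalyticFormFactor δ) :
    ∃ b : ℝ → ℝ, IntegrableOn b (Set.Ioi 0) ∧ (∀ t, 0 ≤ b t) ∧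
      ∀ t, 0 < t → ∀ x y, ‖weightFourier (m.corrDensity t) x y‖ ≤ b t := by
  obtain ⟨i1, i2⟩ := integrable_emission_absorption hd hff
  obtain ⟨G, hGa, hGeq, hG0, C, hC⟩ := hff.extension
  have hcont : Continuous fun ω : ℝ => G ω := by
    have := continuous_strip_line (χ := 0) (by simpa using hff.pos.le) hGa.continuousOn
    simpa using this
  have hGi : Integrable fun ω : ℝ => G ω := by
    have := hC 0 (by simpa using hff.pos.le)
    simp only [Complex.ofReal_zero, zero_mul, add_zero] at this
    exact ⟨hcont.aestronglyMeasurable, this.trans_lt ENNReal.coe_lt_top⟩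
  have hGO : (fun ω : ℝ => G ω) =O[𝓝 0] fun ω => ω := by
    have h1 := (hGa 0 (by simpa using hff.pos.le)).differentiableAt.isBigO_sub
    simp only [hG0, sub_zero] at h1
    have h2 : Tendsto (fun ω : ℝ => (ω : ℂ)) (𝓝 0) (𝓝 0) := by
      have := Complex.continuous_ofReal.tendsto 0
      simpa using this
    have h3 := h1.comp_tendsto h2
    refine h3.trans (Asymptotics.IsBigO.of_bound 1 (Eventually.of_forall fun ω => ?_))
    simp
  have hG' := integrable_mul_abs_rpow hGi hGO
  obtain ⟨K, hK, hS⟩ := exists_abs_sphereCos_le hd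
  set N : ℝ := ∫ q : EuclideanSpace ℝ (Fin d), (m.emission ‖q‖ + m.absorption ‖q‖)
  have hN : 0 ≤ N := integral_nonneg fun q =>
    add_nonneg (emission_nonneg (norm_nonneg q)) (absorption_nonneg (norm_nonneg q))
  set σ : ℝ := (surfaceMeasure d).real Set.univ
  set J : ℝ := ∫ ω : ℝ, ‖G ω‖ * |ω| ^ (-(3 / 2) : ℝ)
  have hJ : 0 ≤ J := integral_nonneg fun ω => by positivity
  let e : ℝ → ℝ := fun t => C * Real.exp (-(δ * (t / 2))) * σ
  let p : ℝ → ℝ := fun t => K * J * |t / 2| ^ (-(3 / 2) : ℝ)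
  have he : IntegrableOn e (Set.Ioi 1) := by
    have := (exp_neg_integrableOn_Ioi 1 (half_pos hff.pos)).const_mul (C * σ)
    refine this.congr (Eventually.of_forall fun t => ?_)
    simp only [e]
    ring_nf
  have hp : IntegrableOn p (Set.Ioi 1) := by
    have := (integrableOn_Ioi_rpow_of_lt (a := -(3 / 2)) (by norm_num)
      zero_lt_one).const_mul (K * J * (1 / 2 : ℝ) ^ (-(3 / 2) : ℝ))
    refine IntegrableOn.congr_fun this (fun t ht => ?_) measurableSet_Ioi
    have ht0 : (0 : ℝ) < t := zero_lt_one.trans ht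
    simp only [p]
    rw [abs_of_pos (by positivity), div_eq_mul_one_div t 2,
      Real.mul_rpow ht0.le (by norm_num)]
    ring
  -- Short times use the trivial bound. Later, `e` covers separations up to `t/2`, where every `t +
  -- θ·v` is at least `t/2`, and `p` covers larger ones through the decay of the sphere transform.
  refine ⟨fun t => if t ≤ 1 then N else e t + p t, ?_, fun t => ?_, fun t ht x y => ?_⟩
  · rw [← Set.Ioc_union_Ioi_eq_Ioi zero_le_one]
    refine IntegrableOn.union ?_ ?_
    · have h0 : IntegrableOn (fun _ : ℝ => N) (Set.Ioc 0 1) :=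
        integrableOn_const (by simp)
      exact h0.congr_fun (fun t ht => (if_pos ht.2).symm) measurableSet_Ioc
    · exact (he.add hp).congr_fun (fun t ht => (if_neg (not_le.mpr ht)).symm) measurableSet_Ioi
  · simp only [e, p]
    split_ifs
    · exact hN
    · positivity
  · simp only
    split_ifs with h1
    · refine (norm_weightFourier_le _ x y).trans (integral_mono
        (integrable_corrDensity hd hff t).norm (i1.add i2) fun q => norm_corrDensity_le t q)
    · have hkey := integral_radial_eq_sphere (d := d) (by omega) i1 i2 hGi
        (fun r hr => by rw [pow_mul_emission hr, hGeq r hr.ne'])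
        (fun r hr => by
          rw [pow_mul_absorption hr, hGeq (-r) (by linarith)]) t
        (WithLp.toLp 2 fun j => ((x j : ℝ) - (y j : ℝ)))
      rw [weightFourier]
      simp only [← Complex.ofReal_sub, latticePhase_sub, corrDensity]
      rw [hkey]
      by_cases hv : ‖(WithLp.toLp 2 fun j => ((x j : ℝ) - (y j : ℝ)) :
          EuclideanSpace ℝ (Fin d))‖ ≤ t / 2
      · refine (norm_integral_sphere_le_of_exp_decay (ψ := fun s => ∫ ω : ℝ, G ω *
          Complex.exp (Complex.I * (ω * s))) C.2 hff.pos.le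
          (norm_integral_strip_mul_exp_le hff.pos.le hGa hC) hv).trans ?_
        exact le_add_of_nonneg_right (by positivity)
      · have hv' := not_le.mp hv
        have hv0 : (WithLp.toLp 2 fun j => ((x j : ℝ) - (y j : ℝ)) :
            EuclideanSpace ℝ (Fin d)) ≠ 0 := by
          intro h
          rw [h, norm_zero] at hv'
          linarith
        refine (norm_integral_sphere_le_of_sphereCos hGi hG' hS t hv0).trans ?_
        refine le_trans ?_ (le_add_of_nonneg_left (by positivity))
        simp only [p]
        rw [abs_of_pos (by positivity)]
        refine mul_le_mul_of_nonneg_left ?_ (by positivity)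
        exact Real.rpow_le_rpow_of_nonpos (by positivity) hv'.le (by norm_num)

end ParticleReservoir

/-! ### Wick's rule for two letters. -/

section ThermalPairs

variable {d : ℕ}

theorem FreeAlgebra.basisFreeMonoid_pair {X : Type*} (a b : X) :
    FreeAlgebra.basisFreeMonoid ℂ X (FreeMonoid.of a * FreeMonoid.of b) =
      FreeAlgebra.ι ℂ a * FreeAlgebra.ι ℂ b := by
  apply FreeAlgebra.equivMonoidAlgebraFreeMonoid.injective
  have h1 : ∀ x : X, FreeAlgebra.equivMonoidAlgebraFreeMonoid (FreeAlgebra.ι ℂ x) =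
      MonoidAlgebra.single (FreeMonoid.of x) 1 := by
    intro x
    simp [FreeAlgebra.equivMonoidAlgebraFreeMonoid, MonoidAlgebra.of]
  have h2 : FreeAlgebra.equivMonoidAlgebraFreeMonoid (FreeAlgebra.ι ℂ a * FreeAlgebra.ι ℂ b) =
      MonoidAlgebra.single (FreeMonoid.of a * FreeMonoid.of b) (1 : ℂ) := by
    rw [map_mul, h1, h1, MonoidAlgebra.single_mul_single, one_mul]
  rw [h2, FreeAlgebra.basisFreeMonoid, Module.Basis.map_apply]
  exact AlgEquiv.apply_symm_apply _ _

/-- The transposition is the only fixed-point-free involution of two points. -/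
theorem wickMonomial_pair (β : ℝ) (a b : FieldSym d) : wickMonomial β [a, b] = twoPoint β a b := by
  classical
  have h : ∀ π : Equiv.Perm (Fin 2), (∀ i, π (π i) = i ∧ π i ≠ i) ↔ π = Equiv.swap 0 1 := by
    decide
  have h' : ∀ π : Equiv.Perm (Fin [a, b].length), (∀ i, π (π i) = i ∧ π i ≠ i) ↔
      π = (Equiv.swap 0 1 : Equiv.Perm (Fin 2)) := h
  rw [wickMonomial]
  simp only [h']
  rw [Finset.sum_filter, Finset.sum_ite_eq' Finset.univ, if_pos (Finset.mem_univ _)]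
  have hf : (Finset.univ.filter fun i : Fin 2 => i < (Equiv.swap 0 1 : Equiv.Perm (Fin 2)) i) =
      {0} := by decide
  calc _ = ∏ i ∈ Finset.univ.filter
        (fun i : Fin 2 => i < (Equiv.swap 0 1 : Equiv.Perm (Fin 2)) i),
        twoPoint β ([a, b].get i) ([a, b].get ((Equiv.swap 0 1 : Equiv.Perm (Fin 2)) i)) := by
        refine Finset.prod_congr ?_ fun _ _ => rfl
        ext i
        simp only [Finset.mem_filter]
    _ = twoPoint β a b := by rw [hf, Finset.prod_singleton]; rfl

theorem thermalState_pair (β : ℝ) (a b : FieldSym d) :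
    thermalState β (FreeAlgebra.ι ℂ a * FreeAlgebra.ι ℂ b) = twoPoint β a b := by
  rw [← FreeAlgebra.basisFreeMonoid_pair, thermalState, Module.Basis.constr_basis,
    ← wickMonomial_pair]
  rfl

end ThermalPairs

/-! ### Correlations of the site fields and the explicit memory kernel. -/

namespace ParticleReservoir

open Filter Topology

variable {d : ℕ} {𝒮 : Type*} [NormedAddCommGroup 𝒮] [InnerProductSpace ℂ 𝒮] [CompleteSpace 𝒮]
  {m : ParticleReservoir d 𝒮} {δ : ℝ}

theorem siteFormFactor_apply (x : Fin d → ℤ) (q : EuclideanSpace ℝ (Fin d)) :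
    (m.siteFormFactor x).1 q =
      Complex.exp (-(Complex.I * latticePhase q x)) * star (m.ff ‖q‖) := by
  change Complex.exp (Complex.I * ((-∑ j, q j * (x j : ℝ) : ℝ) : ℂ)) * _ = _
  rw [← latticePhase]
  push_cast
  rw [mul_neg]

theorem freeEvolve_apply (t : ℝ) (f : OneParticle d) (q : EuclideanSpace ℝ (Fin d)) :
    (freeEvolve t f).1 q = Complex.exp (Complex.I * (t * ‖q‖ : ℝ)) * f.1 q := rfl

theorem integrable_phase_mul {P : EuclideanSpace ℝ (Fin d) → ℝ} (hP : Integrable P)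
    {θ : EuclideanSpace ℝ (Fin d) → ℝ} (hθ : Continuous θ) :
    Integrable fun q => (P q : ℂ) * Complex.exp (Complex.I * θ q) := by
  refine (hP.ofReal (𝕜 := ℂ)).mul_bdd (c := 1) (by fun_prop) (Eventually.of_forall fun q => ?_)
  rw [mul_comm Complex.I, Complex.norm_exp_ofReal_mul_I]

/-- The two terms of the thermal correlation of the field, in terms of `corrDensity`. -/
theorem weightFourier_corrDensity (hd : 4 ≤ d) (hff : m.AnalyticFormFactor δ) (t : ℝ)
    (x y : Fin d → ℤ) :
    weightFourier (m.corrDensity t) x y =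
      (∫ q : EuclideanSpace ℝ (Fin d), (m.emission ‖q‖ : ℂ) * Complex.exp (Complex.I *
        (t * ‖q‖ + (latticePhase q x - latticePhase q y) : ℝ))) +
      ∫ q : EuclideanSpace ℝ (Fin d), (m.absorption ‖q‖ : ℂ) * Complex.exp (Complex.I *
        (-(t * ‖q‖) + (latticePhase q y - latticePhase q x) : ℝ)) := by
  obtain ⟨i1, i2⟩ := integrable_emission_absorption hd hff
  have hcx := continuous_latticePhase (d := d) x
  have hcy := continuous_latticePhase (d := d) y
  rw [← integral_neg_eq_self (fun q : EuclideanSpace ℝ (Fin d) => (m.absorption ‖q‖ : ℂ) *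
    Complex.exp (Complex.I * (-(t * ‖q‖) + (latticePhase q y - latticePhase q x) : ℝ))),
    ← integral_add (integrable_phase_mul i1 (by fun_prop)), weightFourier]
  · refine integral_congr_ae (Eventually.of_forall fun q => ?_)
    simp only [corrDensity, add_mul, mul_assoc, ← Complex.exp_add, norm_neg, latticePhase_neg,
      Pi.neg_apply]
    push_cast
    ring_nf
  · simp only [norm_neg, latticePhase_neg, Pi.neg_apply]
    exact integrable_phase_mul (P := fun q => m.absorption ‖q‖) i2 (by fun_prop)

theorem norm_sq_eq_mul_star (z : ℂ) : ((‖z‖ ^ 2 : ℝ) : ℂ) = z * star z := by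
  have h := Complex.mul_conj' z
  push_cast
  exact h.symm

theorem twoPoint_ann_cre {f g : OneParticle d} {a b : EuclideanSpace ℝ (Fin d) → ℝ}
    (hf : ∀ q, f.1 q = Complex.exp (Complex.I * a q) * star (m.ff ‖q‖))
    (hg : ∀ q, g.1 q = Complex.exp (Complex.I * b q) * star (m.ff ‖q‖)) :
    twoPoint m.β (FieldSym.ann f) (FieldSym.cre g) =
      ∫ q, (m.emission ‖q‖ : ℂ) * Complex.exp (Complex.I * (b q - a q : ℝ)) := by
  refine integral_congr_ae (Eventually.of_forall fun q => ?_)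
  have e : Complex.exp (Complex.I * (b q - a q : ℝ)) =
      (starRingEnd ℂ) (Complex.exp (Complex.I * a q)) * Complex.exp (Complex.I * b q) := by
    rw [← Complex.exp_conj, ← Complex.exp_add, map_mul, Complex.conj_I, Complex.conj_ofReal]
    push_cast
    ring_nf
  simp only [hf, hg, e, map_mul, emission, thermalDensity, Complex.ofReal_mul,
    norm_sq_eq_mul_star, Complex.star_def, Complex.conj_conj, Complex.ofReal_add,
    Complex.ofReal_one]
  ring

theorem twoPoint_cre_ann {f g : OneParticle d} {a b : EuclideanSpace ℝ (Fin d) → ℝ}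
    (hf : ∀ q, f.1 q = Complex.exp (Complex.I * a q) * star (m.ff ‖q‖))
    (hg : ∀ q, g.1 q = Complex.exp (Complex.I * b q) * star (m.ff ‖q‖)) :
    twoPoint m.β (FieldSym.cre f) (FieldSym.ann g) =
      ∫ q, (m.absorption ‖q‖ : ℂ) * Complex.exp (Complex.I * (a q - b q : ℝ)) := by
  refine integral_congr_ae (Eventually.of_forall fun q => ?_)
  have e : Complex.exp (Complex.I * (a q - b q : ℝ)) =
      (starRingEnd ℂ) (Complex.exp (Complex.I * b q)) * Complex.exp (Complex.I * a q) := by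
    rw [← Complex.exp_conj, ← Complex.exp_add, map_mul, Complex.conj_I, Complex.conj_ofReal]
    push_cast
    ring_nf
  simp only [hf, hg, e, map_mul, absorption, thermalDensity, Complex.ofReal_mul,
    norm_sq_eq_mul_star, Complex.star_def, Complex.conj_conj]
  ring

theorem siteFormFactor_eq_phase (x : Fin d → ℤ) (q : EuclideanSpace ℝ (Fin d)) :
    (m.siteFormFactor x).1 q =
      Complex.exp (Complex.I * (-latticePhase q x : ℝ)) * star (m.ff ‖q‖) := by
  rw [siteFormFactor_apply]
  push_cast
  rw [mul_neg]

theorem freeEvolve_siteFormFactor_eq_phase (t : ℝ) (x : Fin d → ℤ)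
    (q : EuclideanSpace ℝ (Fin d)) :
    (freeEvolve t (m.siteFormFactor x)).1 q =
      Complex.exp (Complex.I * (t * ‖q‖ - latticePhase q x : ℝ)) * star (m.ff ‖q‖) := by
  rw [freeEvolve_apply, siteFormFactor_apply, ← mul_assoc, ← Complex.exp_add]
  push_cast
  ring_nf

theorem reservoirEvolve_siteField (t : ℝ) (x : Fin d → ℤ) :
    reservoirEvolve t (m.siteField x) =
      FreeAlgebra.ι ℂ (FieldSym.ann (freeEvolve t (m.siteFormFactor x))) +
        FreeAlgebra.ι ℂ (FieldSym.cre (freeEvolve t (m.siteFormFactor x))) := by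
  simp [siteField, reservoirEvolve, map_add]

theorem twoPoint_ann_ann (β : ℝ) (f g : OneParticle d) :
    twoPoint β (FieldSym.ann f) (FieldSym.ann g) = 0 := rfl

theorem twoPoint_cre_cre (β : ℝ) (f g : OneParticle d) :
    twoPoint β (FieldSym.cre f) (FieldSym.cre g) = 0 := rfl

theorem thermalState_siteField_mul_evolve (hd : 4 ≤ d) (hff : m.AnalyticFormFactor δ) (t : ℝ)
    (x y : Fin d → ℤ) :
    thermalState m.β (m.siteField x * reservoirEvolve t (m.siteField y)) =
      weightFourier (m.corrDensity t) x y := by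
  rw [reservoirEvolve_siteField, siteField, weightFourier_corrDensity hd hff]
  simp only [add_mul, mul_add, map_add, thermalState_pair, twoPoint_ann_ann, twoPoint_cre_cre,
    zero_add, add_zero]
  rw [twoPoint_ann_cre (siteFormFactor_eq_phase x) (freeEvolve_siteFormFactor_eq_phase t y),
    twoPoint_cre_ann (siteFormFactor_eq_phase x) (freeEvolve_siteFormFactor_eq_phase t y),
    add_comm]
  congr 1 <;>
  · refine integral_congr_ae (Eventually.of_forall fun q => ?_)
    simp only
    congr 4
    ring

theorem thermalState_evolve_mul_siteField (hd : 4 ≤ d) (hff : m.AnalyticFormFactor δ) (t : ℝ)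
    (x y : Fin d → ℤ) :
    thermalState m.β (reservoirEvolve t (m.siteField x) * m.siteField y) =
      weightFourier (m.corrDensity (-t)) x y := by
  rw [reservoirEvolve_siteField, siteField, weightFourier_corrDensity hd hff]
  simp only [add_mul, mul_add, map_add, thermalState_pair, twoPoint_ann_ann, twoPoint_cre_cre,
    zero_add, add_zero]
  rw [twoPoint_ann_cre (freeEvolve_siteFormFactor_eq_phase t x) (siteFormFactor_eq_phase y),
    twoPoint_cre_ann (freeEvolve_siteFormFactor_eq_phase t x) (siteFormFactor_eq_phase y),
    add_comm]
  congr 1 <;>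
  · refine integral_congr_ae (Eventually.of_forall fun q => ?_)
    simp only
    congr 4
    ring

theorem weightFourier_self (p : EuclideanSpace ℝ (Fin d) → ℂ) (x : Fin d → ℤ) :
    weightFourier p x x = ∫ q, p q := by
  simp [weightFourier]

theorem condExpect_tmul (B : 𝒮 →L[ℂ] 𝒮) (R : FieldAlg d) :
    m.condExpect (B ⊗ₜ[ℂ] R) = thermalState m.β R • B := by
  simp [condExpect]

/-- Of the four terms of the double commutator, the two with both fields on the same side of `S`
carry the correlation at zero separation; the other two carry it at separation `x - y`. -/
theorem lHatKernel_eq (hd : 4 ≤ d) (hff : m.AnalyticFormFactor δ) (t : ℝ) (S : POp d 𝒮)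
    (x y : Fin d → ℤ) :
    m.lHatKernel t S x y =
      -(weightFourier (m.corrDensity t) x x • (m.W * m.internalEvolve t (m.W * kernelOf S x y)) -
        weightFourier (m.corrDensity t) x y • (m.W * m.internalEvolve t (kernelOf S x y * m.W)) -
        (weightFourier (m.corrDensity (-t)) x y •
            (m.internalEvolve t (m.W * kernelOf S x y) * m.W) -
          weightFourier (m.corrDensity (-t)) y y •
            (m.internalEvolve t (kernelOf S x y * m.W) * m.W))) := by
  simp only [lHatKernel, adCoupling, freeHeisenberg, map_sub, TensorProduct.map_tmul,
    Algebra.TensorProduct.tmul_mul_tmul, mul_one, one_mul, mul_sub, sub_mul, condExpect_tmul,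
    AlgHom.toLinearMap_apply, thermalState_siteField_mul_evolve hd hff,
    thermalState_evolve_mul_siteField hd hff]

end ParticleReservoir

/-! ### Two-sided multiplication by operators on the internal space. -/

section Sandwich

set_option maxSynthPendingDepth 3

variable {d : ℕ} {𝒮 : Type*} [NormedAddCommGroup 𝒮] [InnerProductSpace ℂ 𝒮] [CompleteSpace 𝒮]

/-- The superoperator `T ↦ (1 ⊗ A) T (1 ⊗ B)`. -/
def sandwich (A B : 𝒮 →L[ℂ] 𝒮) : POp d 𝒮 →L[ℂ] POp d 𝒮 :=
  ContinuousLinearMap.mulLeftRight ℂ (POp d 𝒮) (onSitesL d A) (onSitesL d B)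

theorem sandwich_apply (A B : 𝒮 →L[ℂ] 𝒮) (T : POp d 𝒮) :
    sandwich A B T = onSites A * T * onSites B := by
  simp only [sandwich, ContinuousLinearMap.mulLeftRight_apply]
  rfl

theorem kernelOf_sandwich (A B : 𝒮 →L[ℂ] 𝒮) (T : POp d 𝒮) (x y : Fin d → ℤ) :
    kernelOf (sandwich A B T) x y = A * kernelOf T x y * B := by
  rw [sandwich_apply, kernelOf_mul_onSites, kernelOf_onSites_mul]

theorem norm_sandwich_le (A B : 𝒮 →L[ℂ] 𝒮) :
    ‖(sandwich A B : POp d 𝒮 →L[ℂ] POp d 𝒮)‖ ≤ ‖A‖ * ‖B‖ := by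
  refine ContinuousLinearMap.opNorm_le_bound _ (by positivity) fun T => ?_
  rw [sandwich_apply]
  calc ‖onSites A * T * onSites B‖ ≤ ‖(onSites A : POp d 𝒮)‖ * ‖T‖ * ‖(onSites B : POp d 𝒮)‖ :=
        (norm_mul_le _ _).trans (by gcongr; exact norm_mul_le _ _)
    _ ≤ ‖A‖ * ‖T‖ * ‖B‖ := by gcongr <;> exact norm_onSites _
    _ = _ := by ring

theorem Continuous.sandwich {X : Type*} [TopologicalSpace X] {f g : X → 𝒮 →L[ℂ] 𝒮}
    (hf : Continuous f) (hg : Continuous g) :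
    Continuous fun t => (sandwich (f t) (g t) : POp d 𝒮 →L[ℂ] POp d 𝒮) := by
  unfold _root_.sandwich
  exact (((ContinuousLinearMap.mulLeftRight ℂ (POp d 𝒮)).continuous.comp
    ((onSitesL d).continuous.comp hf)).clm_apply ((onSitesL d).continuous.comp hg))

variable [FiniteDimensional ℂ 𝒮]

/-- The superoperator `T ↦ (1 ⊗ A) T (1 ⊗ B)` on the Hilbert-Schmidt operators. -/
def hsSandwich (A B : 𝒮 →L[ℂ] 𝒮) : HSOp d 𝒮 →L[ℂ] HSOp d 𝒮 :=
  (hsLeft (onSites A)).comp (hsRight (onSites B))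

theorem op_hsSandwich (A B : 𝒮 →L[ℂ] 𝒮) (T : HSOp d 𝒮) :
    HSOp.op (hsSandwich A B T) = sandwich A B (HSOp.op T) := by
  rw [sandwich_apply, mul_assoc]
  rfl

theorem norm_hsSandwich_le (A B : 𝒮 →L[ℂ] 𝒮) :
    ‖(hsSandwich A B : HSOp d 𝒮 →L[ℂ] HSOp d 𝒮)‖ ≤ ‖A‖ * ‖B‖ := by
  refine (ContinuousLinearMap.opNorm_comp_le _ _).trans ?_
  gcongr
  · exact (norm_hsLeft_le _).trans (norm_onSites _)
  · exact (norm_hsRight_le _).trans (norm_onSites _)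

variable (d 𝒮) in
/-- `A ↦ (S ↦ A S)` as a continuous linear map. -/
def hsLeftL : POp d 𝒮 →L[ℂ] HSOp d 𝒮 →L[ℂ] HSOp d 𝒮 :=
  LinearMap.mkContinuous
    { toFun := hsLeft
      map_add' := fun A B => by ext1 S; exact HSOp.op_injective (add_mul A B (HSOp.op S))
      map_smul' := fun c A => by
        ext1 S; exact HSOp.op_injective (smul_mul_assoc c A (HSOp.op S)) }
    1 fun A => by rw [one_mul]; exact norm_hsLeft_le A

variable (d 𝒮) in
/-- `A ↦ (S ↦ S A)` as a continuous linear map. -/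
def hsRightL : POp d 𝒮 →L[ℂ] HSOp d 𝒮 →L[ℂ] HSOp d 𝒮 :=
  LinearMap.mkContinuous
    { toFun := hsRight
      map_add' := fun A B => by ext1 S; exact HSOp.op_injective (mul_add (HSOp.op S) A B)
      map_smul' := fun c A => by
        ext1 S; exact HSOp.op_injective (mul_smul_comm c (HSOp.op S) A) }
    1 fun A => by rw [one_mul]; exact norm_hsRight_le A

theorem hsLeftL_apply (A : POp d 𝒮) : hsLeftL d 𝒮 A = hsLeft A := rfl

theorem hsRightL_apply (A : POp d 𝒮) : hsRightL d 𝒮 A = hsRight A := rfl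

theorem Continuous.hsSandwich {X : Type*} [TopologicalSpace X] {f g : X → 𝒮 →L[ℂ] 𝒮}
    (hf : Continuous f) (hg : Continuous g) :
    Continuous fun t => (hsSandwich (f t) (g t) : HSOp d 𝒮 →L[ℂ] HSOp d 𝒮) := by
  have h1 : Continuous fun t => hsLeftL d 𝒮 (onSitesL d (f t)) := by fun_prop
  have h2 : Continuous fun t => hsRightL d 𝒮 (onSitesL d (g t)) := by fun_prop
  exact h1.clm_comp h2

theorem TraceBound.sandwich {T : POp d 𝒮} {C : ℝ} (hC : 0 ≤ C)
    (h : TraceBound (siteBasis d 𝒮) T C) {A B : 𝒮 →L[ℂ] 𝒮} (hA : ‖A‖ ≤ 1) (hB : ‖B‖ ≤ 1) :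
    TraceBound (siteBasis d 𝒮) (sandwich A B T) C := by
  rw [sandwich_apply]
  refine (h.conj hC _ _).mono ?_
  have h1 := (norm_onSites (d := d) A).trans hA
  have h2 := (norm_onSites (d := d) B).trans hB
  calc C * ‖(onSites A : POp d 𝒮)‖ * ‖(onSites B : POp d 𝒮)‖ ≤ C * 1 * 1 := by gcongr
    _ = C := by ring

theorem waveAvg_sandwich {p : EuclideanSpace ℝ (Fin d) → ℂ} (hp : Integrable p)
    (A B : 𝒮 →L[ℂ] 𝒮) (T : POp d 𝒮) :
    waveAvg p hp (sandwich A B T) = sandwich A B (waveAvg p hp T) := by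
  refine kernelOf_ext fun x y => ?_
  rw [kernelOf_waveAvg, kernelOf_sandwich, kernelOf_sandwich, kernelOf_waveAvg, mul_smul_comm,
    smul_mul_assoc]

theorem IsTraceClass.sandwich {T : POp d 𝒮} (hT : IsTraceClass T) (A B : 𝒮 →L[ℂ] 𝒮) :
    IsTraceClass (sandwich A B T) := by
  obtain ⟨C, hC, h⟩ := isTraceClass_iff.mp hT
  rw [sandwich_apply]
  exact isTraceClass_iff.mpr ⟨_, by positivity, h.conj hC _ _⟩

theorem IsTraceClass.mul_right {T : POp d 𝒮} (hT : IsTraceClass T) (A : POp d 𝒮) :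
    IsTraceClass (T * A) := by
  obtain ⟨C, hC, h⟩ := isTraceClass_iff.mp hT
  have := h.conj hC 1 A
  rw [one_mul] at this
  exact isTraceClass_iff.mpr ⟨_, by positivity, this⟩

theorem IsTraceClass.waveAvg {T : POp d 𝒮} (hT : IsTraceClass T)
    {p : EuclideanSpace ℝ (Fin d) → ℂ} (hp : Integrable p) : IsTraceClass (waveAvg p hp T) := by
  obtain ⟨C, hC, h⟩ := isTraceClass_iff.mp hT
  exact isTraceClass_iff.mpr ⟨_, mul_nonneg (integral_nonneg fun _ => norm_nonneg _) hC,
    h.waveAvg hC hp⟩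

theorem opTrace_mul_sandwich {S : POp d 𝒮} (hS : IsTraceClass S) (A B : 𝒮 →L[ℂ] 𝒮)
    (X : POp d 𝒮) : opTrace (S * sandwich A B X) = opTrace (sandwich B A S * X) := by
  rw [sandwich_apply, sandwich_apply]
  have h := opTrace_mul_comm (hS.mul_right (onSites A * X)) (onSites B)
  simp only [mul_assoc] at h ⊢
  exact h.symm

theorem opTrace_mul_waveAvg_sandwich {S : POp d 𝒮} (hS : IsTraceClass S) (A B : 𝒮 →L[ℂ] 𝒮)
    (X : POp d 𝒮) {p : EuclideanSpace ℝ (Fin d) → ℂ} (hp : Integrable p)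
    (hev : ∀ q, p (-q) = p q) :
    opTrace (S * waveAvg p hp (sandwich A B X)) =
      opTrace (waveAvg p hp (sandwich B A S) * X) := by
  rw [opTrace_mul_waveAvg hS _ hp hev, opTrace_mul_sandwich (hS.waveAvg hp), waveAvg_sandwich]

theorem IsTraceClass.summable {T : POp d 𝒮} (hT : IsTraceClass T) :
    Summable fun i => ⟪siteBasis d 𝒮 i, T (siteBasis d 𝒮 i)⟫_ℂ := by
  obtain ⟨C, hC, h⟩ := isTraceClass_iff.mp hT
  exact (h.summable 1 1).of_norm

theorem opTrace_add {S T : POp d 𝒮} (hS : IsTraceClass S) (hT : IsTraceClass T) :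
    opTrace (S + T) = opTrace S + opTrace T := by
  unfold opTrace
  rw [← hS.summable.tsum_add hT.summable]
  simp

theorem opTrace_smul (c : ℂ) (T : POp d 𝒮) : opTrace (c • T) = c * opTrace T := by
  unfold opTrace
  rw [← tsum_mul_left]
  simp

theorem opTrace_neg (T : POp d 𝒮) : opTrace (-T) = -opTrace T := by
  simpa using opTrace_smul (-1) T

theorem IsTraceClass.smul {T : POp d 𝒮} (hT : IsTraceClass T) (c : ℂ) : IsTraceClass (c • T) := by
  obtain ⟨C, hC, h⟩ := isTraceClass_iff.mp hT
  exact isTraceClass_iff.mpr ⟨_, by positivity, h.smul c⟩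

theorem IsTraceClass.sub {S T : POp d 𝒮} (hS : IsTraceClass S) (hT : IsTraceClass T) :
    IsTraceClass (S - T) := by
  obtain ⟨C, hC, h⟩ := isTraceClass_iff.mp hS
  obtain ⟨C', hC', h'⟩ := isTraceClass_iff.mp hT
  exact isTraceClass_iff.mpr ⟨_, by positivity, h.sub h'⟩

theorem opTrace_sub {S T : POp d 𝒮} (hS : IsTraceClass S) (hT : IsTraceClass T) :
    opTrace (S - T) = opTrace S - opTrace T := by
  unfold opTrace
  rw [← hS.summable.tsum_sub hT.summable]
  simp

end Sandwich

/-! ### The memory kernel on bounded and on Hilbert-Schmidt operators. -/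

namespace ParticleReservoir

set_option maxSynthPendingDepth 3

open Filter Topology

variable {d : ℕ} {𝒮 : Type*} [NormedAddCommGroup 𝒮] [InnerProductSpace ℂ 𝒮] [CompleteSpace 𝒮]
  {m : ParticleReservoir d 𝒮} {δ : ℝ}

variable (m) in
/-- The unitary `e^{itY}`. -/
def evolve (t : ℝ) : 𝒮 →L[ℂ] 𝒮 := NormedSpace.exp ((Complex.I * t) • m.Y)

theorem evolve_neg (t : ℝ) : m.evolve (-t) = NormedSpace.exp ((-(Complex.I * t)) • m.Y) := by
  simp [evolve]

theorem evolve_neg_mul (t : ℝ) : m.evolve (-t) * m.evolve t = 1 := by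
  have hc : Commute ((-(Complex.I * t)) • m.Y) ((Complex.I * t) • m.Y) :=
    ((Commute.refl m.Y).smul_left _).smul_right _
  let _ : NormedAlgebra ℚ (𝒮 →L[ℂ] 𝒮) := NormedAlgebra.restrictScalars ℚ ℂ _
  rw [evolve_neg, evolve, ← NormedSpace.exp_add_of_commute hc]
  simp

theorem star_evolve (t : ℝ) : star (m.evolve t) = m.evolve (-t) := by
  rw [evolve_neg, evolve, NormedSpace.star_exp, star_smul, m.isSelfAdjoint_Y.star_eq]
  simp

theorem norm_evolve_le (t : ℝ) : ‖m.evolve t‖ ≤ 1 := by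
  have h : ‖star (m.evolve t) * m.evolve t‖ = ‖m.evolve t‖ * ‖m.evolve t‖ :=
    CStarRing.norm_star_mul_self
  rw [star_evolve, evolve_neg_mul] at h
  have h1 : ‖(1 : 𝒮 →L[ℂ] 𝒮)‖ ≤ 1 := ContinuousLinearMap.norm_id_le
  nlinarith [norm_nonneg (m.evolve t)]

theorem continuous_evolve : Continuous m.evolve := by
  unfold evolve
  let _ : NormedAlgebra ℚ (𝒮 →L[ℂ] 𝒮) := NormedAlgebra.restrictScalars ℚ ℂ _
  exact NormedSpace.exp_continuous.comp (by fun_prop)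

theorem internalEvolve_apply (t : ℝ) (B : 𝒮 →L[ℂ] 𝒮) :
    m.internalEvolve t B = m.evolve t * B * m.evolve (-t) := by
  rw [evolve_neg, mul_assoc]
  rfl

theorem weightFourier_corrDensity_neg (t : ℝ) (x y : Fin d → ℤ) :
    weightFourier (m.corrDensity (-t)) x y =
      (starRingEnd ℂ) (weightFourier (m.corrDensity t) y x) := by
  rw [weightFourier, weightFourier, ← integral_conj]
  refine integral_congr_ae (Eventually.of_forall fun q => ?_)
  simp only [map_mul, star_corrDensity, ← Complex.exp_conj, Complex.conj_I, map_sub,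
    Complex.conj_ofReal]
  ring_nf

variable (m) in
/-- The constant `∫ (|φ|² (1 + 2 T_β))`, which bounds the correlation functions. -/
def corrBound : ℝ := ∫ q : EuclideanSpace ℝ (Fin d), (m.emission ‖q‖ + m.absorption ‖q‖)

theorem corrBound_nonneg : 0 ≤ m.corrBound := integral_nonneg fun q =>
  add_nonneg (emission_nonneg (norm_nonneg q)) (absorption_nonneg (norm_nonneg q))

theorem integral_norm_corrDensity_le (hd : 4 ≤ d) (hff : m.AnalyticFormFactor δ) (t : ℝ) :
    ∫ q, ‖m.corrDensity t q‖ ≤ m.corrBound := by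
  obtain ⟨i1, i2⟩ := integrable_emission_absorption hd hff
  exact integral_mono (integrable_corrDensity hd hff t).norm (i1.add i2)
    fun q => norm_corrDensity_le t q

variable (m) in
/-- The reservoir correlation function at a fixed site. -/
def corr (t : ℝ) : ℂ := ∫ q, m.corrDensity t q

theorem norm_corr_le (hd : 4 ≤ d) (hff : m.AnalyticFormFactor δ) (t : ℝ) :
    ‖m.corr t‖ ≤ m.corrBound :=
  (norm_integral_le_integral_norm _).trans (integral_norm_corrDensity_le hd hff t)

theorem continuous_corr (hd : 4 ≤ d) (hff : m.AnalyticFormFactor δ) : Continuous m.corr := by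
  rw [continuous_iff_continuousAt]
  intro t₀
  rw [ContinuousAt, tendsto_iff_norm_sub_tendsto_zero]
  refine squeeze_zero (fun _ => norm_nonneg _) (fun t => ?_)
    (tendsto_integral_norm_corrDensity_sub hd hff t₀)
  rw [corr, corr, ← integral_sub (integrable_corrDensity hd hff t)
    (integrable_corrDensity hd hff t₀)]
  exact norm_integral_le_integral_norm _

variable (hd : 4 ≤ d) (hff : m.AnalyticFormFactor δ)

/-- The superoperator `X ↦ ∫ p_t(q) e^{iq·X} X e^{-iq·X} dq` for the correlation density `p_t`. -/
def corrAvg (t : ℝ) : POp d 𝒮 →L[ℂ] POp d 𝒮 :=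
  waveAvg (m.corrDensity t) (integrable_corrDensity hd hff t)

theorem norm_corrAvg_le (t : ℝ) : ‖corrAvg hd hff t‖ ≤ m.corrBound :=
  (norm_waveAvg_le _).trans (integral_norm_corrDensity_le hd hff t)

theorem continuous_corrAvg : Continuous (corrAvg hd hff) := by
  rw [continuous_iff_continuousAt]
  intro t₀
  refine (tendsto_iff_norm_sub_tendsto_zero (E := POp d 𝒮 →L[ℂ] POp d 𝒮)).mpr ?_
  refine squeeze_zero (fun _ => norm_nonneg _) (fun t => ?_)
    (tendsto_integral_norm_corrDensity_sub hd hff t₀)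
  rw [corrAvg, corrAvg, waveAvg_sub]
  exact norm_waveAvg_le _

/-- The operator `L̂⋆(t)` on the bounded operators. -/
def memoryStar (t : ℝ) : POp d 𝒮 →L[ℂ] POp d 𝒮 :=
  -(m.corr t • sandwich (m.W * m.evolve t * m.W) (m.evolve (-t)) -
    (corrAvg hd hff t).comp (sandwich (m.W * m.evolve t) (m.W * m.evolve (-t))) -
    ((corrAvg hd hff (-t)).comp (sandwich (m.evolve t * m.W) (m.evolve (-t) * m.W)) -
      m.corr (-t) • sandwich (m.evolve t) (m.W * m.evolve (-t) * m.W)))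

theorem kernelOf_memoryStar (t : ℝ) (S : POp d 𝒮) (x y : Fin d → ℤ) :
    kernelOf (memoryStar hd hff t S) x y = m.lHatKernel t S x y := by
  rw [lHatKernel_eq hd hff, memoryStar]
  simp only [neg_apply, sub_apply, smul_apply, ContinuousLinearMap.comp_apply, kernelOf_neg,
    kernelOf_sub, kernelOf_smul, corrAvg, kernelOf_waveAvg, kernelOf_sandwich,
    internalEvolve_apply, weightFourier_self, corr, mul_assoc]

theorem norm_mul_le_one {A B : 𝒮 →L[ℂ] 𝒮} (hA : ‖A‖ ≤ 1) (hB : ‖B‖ ≤ 1) : ‖A * B‖ ≤ 1 :=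
  (norm_mul_le _ _).trans (mul_le_one₀ hA (norm_nonneg _) hB)

theorem norm_sandwich_le_one {A B : 𝒮 →L[ℂ] 𝒮} (hA : ‖A‖ ≤ 1) (hB : ‖B‖ ≤ 1) :
    ‖(sandwich A B : POp d 𝒮 →L[ℂ] POp d 𝒮)‖ ≤ 1 :=
  (norm_sandwich_le A B).trans (mul_le_one₀ hA (norm_nonneg _) hB)

/-- On bounded operators only the `L¹` norms of the weights are available, so the bound is constant
in `t` and yields a Laplace transform for `Re z > 0` only. -/
theorem norm_memoryStar_le (t : ℝ) : ‖memoryStar hd hff t‖ ≤ 4 * m.corrBound := by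
  have hW := m.norm_W_le
  have hu := norm_evolve_le (m := m)
  have hN := corrBound_nonneg (m := m)
  rw [memoryStar]
  refine (norm_neg (_ : POp d 𝒮 →L[ℂ] POp d 𝒮)).trans_le ?_
  have h1 : ‖m.corr t • (sandwich (m.W * m.evolve t * m.W) (m.evolve (-t)) :
      POp d 𝒮 →L[ℂ] POp d 𝒮)‖ ≤ m.corrBound * 1 := by
    rw [norm_smul]
    gcongr
    · exact norm_corr_le hd hff t
    · exact norm_sandwich_le_one (norm_mul_le_one (norm_mul_le_one hW (hu t)) hW) (hu _)
  have h2 : ‖(corrAvg hd hff t).comp (sandwich (m.W * m.evolve t) (m.W * m.evolve (-t)))‖ ≤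
      m.corrBound * 1 := by
    refine (ContinuousLinearMap.opNorm_comp_le _ _).trans ?_
    gcongr
    · exact norm_corrAvg_le hd hff t
    · exact norm_sandwich_le_one (norm_mul_le_one hW (hu t)) (norm_mul_le_one hW (hu _))
  have h3 : ‖(corrAvg hd hff (-t)).comp (sandwich (m.evolve t * m.W) (m.evolve (-t) * m.W))‖ ≤
      m.corrBound * 1 := by
    refine (ContinuousLinearMap.opNorm_comp_le _ _).trans ?_
    gcongr
    · exact norm_corrAvg_le hd hff (-t)
    · exact norm_sandwich_le_one (norm_mul_le_one (hu t) hW) (norm_mul_le_one (hu _) hW)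
  have h4 : ‖m.corr (-t) • (sandwich (m.evolve t) (m.W * m.evolve (-t) * m.W) :
      POp d 𝒮 →L[ℂ] POp d 𝒮)‖ ≤ m.corrBound * 1 := by
    rw [norm_smul]
    gcongr
    · exact norm_corr_le hd hff (-t)
    · exact norm_sandwich_le_one (hu t) (norm_mul_le_one (norm_mul_le_one hW (hu _)) hW)
  refine (norm_sub_le _ _).trans ?_
  have h5 := norm_sub_le (m.corr t • (sandwich (m.W * m.evolve t * m.W) (m.evolve (-t)) :
      POp d 𝒮 →L[ℂ] POp d 𝒮))
    ((corrAvg hd hff t).comp (sandwich (m.W * m.evolve t) (m.W * m.evolve (-t))))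
  have h6 := norm_sub_le
    ((corrAvg hd hff (-t)).comp (sandwich (m.evolve t * m.W) (m.evolve (-t) * m.W)))
    (m.corr (-t) • (sandwich (m.evolve t) (m.W * m.evolve (-t) * m.W) :
      POp d 𝒮 →L[ℂ] POp d 𝒮))
  linarith

theorem continuous_memoryStar : Continuous (memoryStar hd hff) := by
  have hu := continuous_evolve (m := m)
  have hu' : Continuous fun t => m.evolve (-t) := hu.comp continuous_neg
  have hc := continuous_corr hd hff
  have hc' : Continuous fun t => m.corr (-t) := hc.comp continuous_neg
  have hA := continuous_corrAvg hd hff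
  have hA' : Continuous fun t => corrAvg hd hff (-t) := hA.comp continuous_neg
  unfold memoryStar
  refine Continuous.neg (Continuous.sub (Continuous.sub ?_ ?_) (Continuous.sub ?_ ?_))
  · exact hc.smul (Continuous.sandwich (by fun_prop) hu')
  · exact hA.clm_comp (Continuous.sandwich (by fun_prop) (by fun_prop))
  · exact hA'.clm_comp (Continuous.sandwich (by fun_prop) (by fun_prop))
  · exact hc'.smul (Continuous.sandwich hu (by fun_prop))

theorem norm_exp_neg_mul (t : ℝ) (z : ℂ) :
    ‖Complex.exp (-(t * z))‖ = Real.exp (-(t * z.re)) := by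
  rw [Complex.norm_exp]; simp

theorem integrableOn_exp_neg_mul {z : ℂ} (hz : 0 < z.re) :
    IntegrableOn (fun t : ℝ => Real.exp (-(t * z.re))) (Set.Ioi 0) := by
  refine (exp_neg_integrableOn_Ioi 0 hz).congr_fun (fun t _ => ?_) measurableSet_Ioi
  simp only
  ring_nf

theorem laplaceIntegrable_of_bounded {F : Type*} [NormedAddCommGroup F] [NormedSpace ℂ F]
    {V : ℝ → F} (hV : Continuous V) {C : ℝ} (hC : ∀ t, ‖V t‖ ≤ C) {z : ℂ} (hz : 0 < z.re) :
    LaplaceIntegrable V z := by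
  refine ((integrableOn_exp_neg_mul hz).mul_const C).mono'
    (Continuous.aestronglyMeasurable (by fun_prop)) (Eventually.of_forall fun t => ?_)
  rw [norm_smul, norm_exp_neg_mul]
  gcongr
  exact hC t

theorem laplaceIntegrable_memoryStar {z : ℂ} (hz : 0 < z.re) :
    LaplaceIntegrable (memoryStar hd hff) z :=
  laplaceIntegrable_of_bounded (continuous_memoryStar hd hff) (norm_memoryStar_le hd hff) hz

variable [FiniteDimensional ℂ 𝒮]

/-- `corrAvg` on the Hilbert-Schmidt operators. -/
def hsCorrAvg (t : ℝ) : HSOp d 𝒮 →L[ℂ] HSOp d 𝒮 :=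
  hsWaveAvg (m.corrDensity t) (integrable_corrDensity hd hff t)

theorem op_hsCorrAvg (t : ℝ) (S : HSOp d 𝒮) :
    HSOp.op (hsCorrAvg hd hff t S) = corrAvg hd hff t (HSOp.op S) := rfl

theorem continuous_hsCorrAvg : Continuous (hsCorrAvg hd hff) := by
  rw [continuous_iff_continuousAt]
  intro t₀
  rw [ContinuousAt, tendsto_iff_norm_sub_tendsto_zero]
  refine squeeze_zero (fun _ => norm_nonneg _) (fun t => ?_)
    (tendsto_integral_norm_corrDensity_sub hd hff t₀)
  rw [hsCorrAvg, hsCorrAvg, hsWaveAvg_sub]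
  exact norm_hsWaveAvg_le _ (integral_nonneg fun _ => norm_nonneg _) (norm_weightFourier_le _)

/-- The predual of `L̂⋆(t)`, on the Hilbert-Schmidt operators. -/
def memory (t : ℝ) : HSOp d 𝒮 →L[ℂ] HSOp d 𝒮 :=
  -(m.corr t • hsSandwich (m.evolve (-t)) (m.W * m.evolve t * m.W) -
    (hsCorrAvg hd hff t).comp (hsSandwich (m.W * m.evolve (-t)) (m.W * m.evolve t)) -
    ((hsCorrAvg hd hff (-t)).comp (hsSandwich (m.evolve (-t) * m.W) (m.evolve t * m.W)) -
      m.corr (-t) • hsSandwich (m.W * m.evolve (-t) * m.W) (m.evolve t)))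

theorem op_memory (t : ℝ) (S : HSOp d 𝒮) :
    HSOp.op (memory hd hff t S) =
      -(m.corr t • sandwich (m.evolve (-t)) (m.W * m.evolve t * m.W) (HSOp.op S) -
        corrAvg hd hff t (sandwich (m.W * m.evolve (-t)) (m.W * m.evolve t) (HSOp.op S)) -
        (corrAvg hd hff (-t)
            (sandwich (m.evolve (-t) * m.W) (m.evolve t * m.W) (HSOp.op S)) -
          m.corr (-t) • sandwich (m.W * m.evolve (-t) * m.W) (m.evolve t) (HSOp.op S))) := by
  simp only [memory, neg_apply, sub_apply, smul_apply, ContinuousLinearMap.comp_apply, map_neg,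
    map_sub, map_smul, op_hsCorrAvg, op_hsSandwich]

theorem continuous_memory : Continuous (memory hd hff) := by
  have hu := continuous_evolve (m := m)
  have hu' : Continuous fun t => m.evolve (-t) := hu.comp continuous_neg
  have hc := continuous_corr hd hff
  have hc' : Continuous fun t => m.corr (-t) := hc.comp continuous_neg
  have hA := continuous_hsCorrAvg hd hff
  have hA' : Continuous fun t => hsCorrAvg hd hff (-t) := hA.comp continuous_neg
  unfold memory
  refine Continuous.neg (Continuous.sub (Continuous.sub ?_ ?_) (Continuous.sub ?_ ?_))
  · exact hc.smul (Continuous.hsSandwich hu' (by fun_prop))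
  · exact hA.clm_comp (Continuous.hsSandwich (by fun_prop) (by fun_prop))
  · exact hA'.clm_comp (Continuous.hsSandwich (by fun_prop) (by fun_prop))
  · exact hc'.smul (Continuous.hsSandwich (by fun_prop) hu)

theorem norm_hsSandwich_le_one {A B : 𝒮 →L[ℂ] 𝒮} (hA : ‖A‖ ≤ 1) (hB : ‖B‖ ≤ 1) :
    ‖(hsSandwich A B : HSOp d 𝒮 →L[ℂ] HSOp d 𝒮)‖ ≤ 1 :=
  (norm_hsSandwich_le A B).trans (mul_le_one₀ hA (norm_nonneg _) hB)

/-- Here all four terms are controlled by the supremum of the correlation function at time `t`; the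
correlation at `-t` is the complex conjugate with the sites exchanged. `exists_decay_bound` provides
an integrable `b`, which opens the way to `Re z = 0`. -/
theorem norm_memory_le {t b : ℝ} (hb : ∀ x y, ‖weightFourier (m.corrDensity t) x y‖ ≤ b) :
    ‖memory hd hff t‖ ≤ 4 * b := by
  have hW := m.norm_W_le
  have hu := norm_evolve_le (m := m)
  have hb0 : 0 ≤ b := (norm_nonneg _).trans (hb 0 0)
  have hb' : ∀ x y, ‖weightFourier (m.corrDensity (-t)) x y‖ ≤ b := fun x y => by
    rw [weightFourier_corrDensity_neg, RCLike.norm_conj]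
    exact hb y x
  have hc : ‖m.corr t‖ ≤ b := by
    have := hb 0 0
    rwa [weightFourier_self] at this
  have hc' : ‖m.corr (-t)‖ ≤ b := by
    have := hb' 0 0
    rwa [weightFourier_self] at this
  rw [memory, norm_neg]
  have h1 : ‖m.corr t • (hsSandwich (m.evolve (-t)) (m.W * m.evolve t * m.W) :
      HSOp d 𝒮 →L[ℂ] HSOp d 𝒮)‖ ≤ b * 1 := by
    rw [norm_smul]
    gcongr
    exact norm_hsSandwich_le_one (hu _) (norm_mul_le_one (norm_mul_le_one hW (hu t)) hW)
  have h2 : ‖(hsCorrAvg hd hff t).comp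
      (hsSandwich (m.W * m.evolve (-t)) (m.W * m.evolve t))‖ ≤ b * 1 := by
    refine (ContinuousLinearMap.opNorm_comp_le _ _).trans ?_
    gcongr
    · exact norm_hsWaveAvg_le _ hb0 hb
    · exact norm_hsSandwich_le_one (norm_mul_le_one hW (hu _)) (norm_mul_le_one hW (hu _))
  have h3 : ‖(hsCorrAvg hd hff (-t)).comp
      (hsSandwich (m.evolve (-t) * m.W) (m.evolve t * m.W))‖ ≤ b * 1 := by
    refine (ContinuousLinearMap.opNorm_comp_le _ _).trans ?_
    gcongr
    · exact norm_hsWaveAvg_le _ hb0 hb'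
    · exact norm_hsSandwich_le_one (norm_mul_le_one (hu _) hW) (norm_mul_le_one (hu _) hW)
  have h4 : ‖m.corr (-t) • (hsSandwich (m.W * m.evolve (-t) * m.W) (m.evolve t) :
      HSOp d 𝒮 →L[ℂ] HSOp d 𝒮)‖ ≤ b * 1 := by
    rw [norm_smul]
    gcongr
    exact norm_hsSandwich_le_one (norm_mul_le_one (norm_mul_le_one hW (hu _)) hW) (hu t)
  refine (norm_sub_le _ _).trans ?_
  have h5 := norm_sub_le (m.corr t • (hsSandwich (m.evolve (-t)) (m.W * m.evolve t * m.W) :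
      HSOp d 𝒮 →L[ℂ] HSOp d 𝒮))
    ((hsCorrAvg hd hff t).comp (hsSandwich (m.W * m.evolve (-t)) (m.W * m.evolve t)))
  have h6 := norm_sub_le
    ((hsCorrAvg hd hff (-t)).comp (hsSandwich (m.evolve (-t) * m.W) (m.evolve t * m.W)))
    (m.corr (-t) • (hsSandwich (m.W * m.evolve (-t) * m.W) (m.evolve t) :
      HSOp d 𝒮 →L[ℂ] HSOp d 𝒮))
  linarith

theorem TraceBound.memory (t : ℝ) {S : HSOp d 𝒮} {c : ℝ} (hc : 0 ≤ c)
    (h : TraceBound (siteBasis d 𝒮) (HSOp.op S) c) :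
    TraceBound (siteBasis d 𝒮) (HSOp.op (memory hd hff t S)) (4 * m.corrBound * c) := by
  have hW := m.norm_W_le
  have hu := norm_evolve_le (m := m)
  have hN := corrBound_nonneg (m := m)
  have hs : ∀ (t : ℝ) {A B : 𝒮 →L[ℂ] 𝒮}, ‖A‖ ≤ 1 → ‖B‖ ≤ 1 → TraceBound (siteBasis d 𝒮)
      (m.corr t • sandwich A B (HSOp.op S)) (m.corrBound * c) := fun t A B hA hB =>
    ((h.sandwich hc hA hB).smul (m.corr t)).mono (by gcongr; exact norm_corr_le hd hff t)
  have ha : ∀ (t : ℝ) {A B : 𝒮 →L[ℂ] 𝒮}, ‖A‖ ≤ 1 → ‖B‖ ≤ 1 → TraceBound (siteBasis d 𝒮)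
      (corrAvg hd hff t (sandwich A B (HSOp.op S))) (m.corrBound * c) := fun t A B hA hB =>
    ((h.sandwich hc hA hB).waveAvg hc (integrable_corrDensity hd hff t)).mono
      (by gcongr; exact integral_norm_corrDensity_le hd hff t)
  rw [op_memory]
  refine TraceBound.mono (((((hs t (hu _) (norm_mul_le_one (norm_mul_le_one hW (hu t)) hW)).sub
    (ha t (norm_mul_le_one hW (hu _)) (norm_mul_le_one hW (hu _)))).sub
    ((ha (-t) (norm_mul_le_one (hu _) hW) (norm_mul_le_one (hu _) hW)).sub
    (hs (-t) (norm_mul_le_one (norm_mul_le_one hW (hu _)) hW) (hu t)))))).neg ?_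
  exact le_of_eq (by ring)

theorem memoryStar_apply (t : ℝ) (X : POp d 𝒮) :
    memoryStar hd hff t X =
      -(m.corr t • sandwich (m.W * m.evolve t * m.W) (m.evolve (-t)) X -
        corrAvg hd hff t (sandwich (m.W * m.evolve t) (m.W * m.evolve (-t)) X) -
        (corrAvg hd hff (-t) (sandwich (m.evolve t * m.W) (m.evolve (-t) * m.W) X) -
          m.corr (-t) • sandwich (m.evolve t) (m.W * m.evolve (-t) * m.W) X)) := rfl

/-- Under the trace pairing a sandwich is transposed by exchanging its two factors, and an average
is its own transpose because `corrDensity t` is even in `q`. -/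
theorem opTrace_mul_memoryStar (t : ℝ) {S : HSOp d 𝒮} (hS : IsTraceClass (HSOp.op S))
    (X : POp d 𝒮) :
    opTrace (HSOp.op S * memoryStar hd hff t X) = opTrace (HSOp.op (memory hd hff t S) * X) := by
  rw [op_memory, memoryStar_apply]
  generalize HSOp.op S = T at hS
  have hl : ∀ (c : ℂ) (A B : 𝒮 →L[ℂ] 𝒮), IsTraceClass (c • (sandwich A B T * X)) :=
    fun c A B => ((hS.sandwich A B).mul_right X).smul c
  have ha : ∀ (t : ℝ) (A B : 𝒮 →L[ℂ] 𝒮),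
      IsTraceClass (corrAvg hd hff t (sandwich A B T) * X) := fun t A B =>
    ((hS.sandwich A B).waveAvg _).mul_right X
  have hr : ∀ Z : POp d 𝒮, IsTraceClass (T * Z) := fun Z => hS.mul_right Z
  have hw : ∀ (t : ℝ) (A B : 𝒮 →L[ℂ] 𝒮),
      opTrace (T * corrAvg hd hff t (sandwich A B X)) =
        opTrace (corrAvg hd hff t (sandwich B A T) * X) := fun t A B =>
    opTrace_mul_waveAvg_sandwich hS A B X _ (corrDensity_neg t)
  have hs : ∀ (c : ℂ) (A B : 𝒮 →L[ℂ] 𝒮),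
      opTrace (c • (T * sandwich A B X)) = opTrace (c • (sandwich B A T * X)) := fun c A B => by
    rw [opTrace_smul, opTrace_smul, opTrace_mul_sandwich hS]
  have four : ∀ a b c e : POp d 𝒮, IsTraceClass a → IsTraceClass b → IsTraceClass c →
      IsTraceClass e → opTrace (-(a - b - (c - e))) =
        -(opTrace a - opTrace b - (opTrace c - opTrace e)) := fun a b c e h1 h2 h3 h4 => by
    rw [opTrace_neg, opTrace_sub (h1.sub h2) (h3.sub h4), opTrace_sub h1 h2, opTrace_sub h3 h4]
  rw [mul_neg, mul_sub, mul_sub, mul_sub, mul_smul_comm, mul_smul_comm, neg_mul, sub_mul, sub_mul,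
    sub_mul, smul_mul_assoc, smul_mul_assoc]
  rw [four _ _ _ _ ((hr _).smul _) (hr _) (hr _) ((hr _).smul _),
    four _ _ _ _ (hl _ _ _) (ha _ _ _) (ha _ _ _) (hl _ _ _), hs, hs, hw, hw]

end ParticleReservoir

/-! ### The trace of a product with a Bochner integral. -/

section TraceIntegral

variable {ι E : Type*} [NormedAddCommGroup E] [InnerProductSpace ℂ E] [CompleteSpace E]

theorem TraceBound.tsum_mul_integral [Countable ι] {Q : Type*} [MeasurableSpace Q] {μ : Measure Q}
    {b : HilbertBasis ι ℂ E} {T : E →L[ℂ] E} {C : ℝ} (hC : 0 ≤ C) (hT : TraceBound b T C)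
    {Z : Q → E →L[ℂ] E} (hZ : Integrable Z μ) :
    ∑' i, ⟪b i, (T * ∫ q, Z q ∂μ) (b i)⟫_ℂ = ∫ q, ∑' i, ⟪b i, (T * Z q) (b i)⟫_ℂ ∂μ := by
  have hint : ∀ y : E, Integrable (fun q => Z q y) μ := fun y =>
    (ContinuousLinearMap.apply ℂ E y).integrable_comp hZ
  have happ : ∀ y : E, (∫ q, Z q ∂μ) y = ∫ q, Z q y ∂μ := fun y =>
    ((ContinuousLinearMap.apply ℂ E y).integral_comp_comm hZ).symm
  have e : ∀ (x y : E) (X : E →L[ℂ] E), ⟪x, (T * X) y⟫_ℂ =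
      ⟪ContinuousLinearMap.adjoint T x, X y⟫_ℂ := fun x y X =>
    (ContinuousLinearMap.adjoint_inner_left T (X y) x).symm
  have hJ : ∀ x y : E, ⟪x, (T * ∫ q, Z q ∂μ) y⟫_ℂ = ∫ q, ⟪x, (T * Z q) y⟫_ℂ ∂μ := by
    intro x y
    simp_rw [e]
    rw [happ, integral_inner (hint y)]
  have hm : ∀ x y : E, AEStronglyMeasurable (fun q => ⟪x, (T * Z q) y⟫_ℂ) μ := by
    intro x y
    simp_rw [e]
    exact aestronglyMeasurable_const.inner (hint y).aestronglyMeasurable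
  have hb : ∀ q, TraceBound b (T * Z q) (C * ‖Z q‖) := fun q => by
    have h3 := hT.conj hC 1 (Z q)
    rw [one_mul] at h3
    refine h3.mono (mul_le_mul_of_nonneg_right ?_ (norm_nonneg _))
    exact mul_le_of_le_one_right hC (norm_one_clm_le _)
  exact TraceBound.tsum_integral hJ hm (hZ.norm.const_mul C) (Filter.Eventually.of_forall hb) 1 1

end TraceIntegral

/-! ### Integrals of superoperators and closure properties of entrywise action. -/

section SuperoperatorIntegrals

set_option maxSynthPendingDepth 3

variable {d : ℕ} {𝒮 : Type*} [NormedAddCommGroup 𝒮] [InnerProductSpace ℂ 𝒮] [CompleteSpace 𝒮]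
  [FiniteDimensional ℂ 𝒮] {Q : Type*} [MeasurableSpace Q] {μ : Measure Q}
  {V : Q → HSOp d 𝒮 →L[ℂ] HSOp d 𝒮}

/-- The value `V S` applied to a vector, as a continuous linear map of the superoperator `V`. -/
def evalSuper (S : HSOp d 𝒮) (y : PSpace d 𝒮) : (HSOp d 𝒮 →L[ℂ] HSOp d 𝒮) →L[ℂ] PSpace d 𝒮 :=
  (ContinuousLinearMap.apply ℂ (PSpace d 𝒮) y).comp
    (HSOp.opL.comp (ContinuousLinearMap.apply ℂ (HSOp d 𝒮) S))

theorem op_integral_apply (hV : Integrable V μ) (S : HSOp d 𝒮) (y : PSpace d 𝒮) :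
    HSOp.op ((∫ q, V q ∂μ) S) y = ∫ q, HSOp.op (V q S) y ∂μ :=
  ((evalSuper S y).integral_comp_comm hV).symm

theorem integrable_op_apply (hV : Integrable V μ) (S : HSOp d 𝒮) (y : PSpace d 𝒮) :
    Integrable (fun q => HSOp.op (V q S) y) μ :=
  (evalSuper S y).integrable_comp hV

theorem inner_op_integral (hV : Integrable V μ) (S : HSOp d 𝒮) (x y : PSpace d 𝒮) :
    ⟪x, HSOp.op ((∫ q, V q ∂μ) S) y⟫_ℂ = ∫ q, ⟪x, HSOp.op (V q S) y⟫_ℂ ∂μ := by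
  rw [op_integral_apply hV, integral_inner (integrable_op_apply hV S y)]

theorem kernelOf_integral (hV : Integrable V μ) (S : HSOp d 𝒮) (x y : Fin d → ℤ) (v : 𝒮) :
    kernelOf (HSOp.op ((∫ q, V q ∂μ) S)) x y v = ∫ q, kernelOf (HSOp.op (V q S)) x y v ∂μ := by
  rw [kernelOf_apply, op_integral_apply hV]
  exact ((lp.evalCLM ℂ (fun _ : Fin d → ℤ => 𝒮) 2 x).integral_comp_comm
    (integrable_op_apply hV S (lp.single 2 y v))).symm

theorem ActsEntrywise.integral (hV : Integrable V μ) (h : ∀ q, ActsEntrywise (V q)) :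
    ActsEntrywise (∫ q, V q ∂μ) := by
  intro x y c S S' hS
  ext v
  rw [kernelOf_integral hV, smul_apply, kernelOf_integral hV, ← integral_smul]
  refine integral_congr_ae (Filter.Eventually.of_forall fun q => ?_)
  simp only [h q x y c S S' hS, smul_apply]

theorem ActsEntrywise.add {V V' : HSOp d 𝒮 →L[ℂ] HSOp d 𝒮} (h : ActsEntrywise V)
    (h' : ActsEntrywise V') : ActsEntrywise (V + V') := by
  intro x y c S S' hS
  rw [add_apply, add_apply, map_add, map_add, kernelOf_add, kernelOf_add, h x y c S S' hS,
    h' x y c S S' hS, smul_add]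

theorem ActsEntrywise.smul {V : HSOp d 𝒮 →L[ℂ] HSOp d 𝒮} (h : ActsEntrywise V) (a : ℂ) :
    ActsEntrywise (a • V) := by
  intro x y c S S' hS
  rw [smul_apply, smul_apply, map_smul, map_smul, kernelOf_smul, kernelOf_smul, h x y c S S' hS,
    smul_comm]

theorem ActsEntrywise.neg {V : HSOp d 𝒮 →L[ℂ] HSOp d 𝒮} (h : ActsEntrywise V) :
    ActsEntrywise (-V) := by
  simpa using h.smul (-1)

theorem ActsEntrywise.sub {V V' : HSOp d 𝒮 →L[ℂ] HSOp d 𝒮} (h : ActsEntrywise V)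
    (h' : ActsEntrywise V') : ActsEntrywise (V - V') := by
  rw [sub_eq_add_neg]
  exact h.add h'.neg

theorem ActsEntrywise.sum {ι : Type*} (s : Finset ι) {V : ι → HSOp d 𝒮 →L[ℂ] HSOp d 𝒮}
    (h : ∀ i ∈ s, ActsEntrywise (V i)) : ActsEntrywise (∑ i ∈ s, V i) := by
  classical
  induction s using Finset.induction_on with
  | empty => intro x y c S S' _; ext v; simp [kernelOf]
  | insert a s ha ih =>
    rw [Finset.sum_insert ha]
    exact (h a (Finset.mem_insert_self a s)).add
      (ih fun i hi => h i (Finset.mem_insert_of_mem hi))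

theorem ActsEntrywise.comp {V V' : HSOp d 𝒮 →L[ℂ] HSOp d 𝒮} (h : ActsEntrywise V)
    (h' : ActsEntrywise V') : ActsEntrywise (V.comp V') :=
  fun x y c S S' hS => h x y c _ _ (h' x y c S S' hS)

theorem actsEntrywise_hsSandwich (A B : 𝒮 →L[ℂ] 𝒮) :
    ActsEntrywise (hsSandwich A B : HSOp d 𝒮 →L[ℂ] HSOp d 𝒮) := by
  intro x y c S S' hS
  rw [op_hsSandwich, op_hsSandwich, kernelOf_sandwich, kernelOf_sandwich, hS, mul_smul_comm,
    smul_mul_assoc]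

theorem actsEntrywise_hsWaveAvg {p : EuclideanSpace ℝ (Fin d) → ℂ} (hp : Integrable p) :
    ActsEntrywise (hsWaveAvg p hp : HSOp d 𝒮 →L[ℂ] HSOp d 𝒮) := by
  intro x y c S S' hS
  rw [op_hsWaveAvg, op_hsWaveAvg, kernelOf_waveAvg, kernelOf_waveAvg, hS, smul_comm]

theorem opTrace_mul_integral {T : POp d 𝒮} {C : ℝ} (hC : 0 ≤ C)
    (hT : TraceBound (siteBasis d 𝒮) T C) {Z : Q → POp d 𝒮} (hZ : Integrable Z μ) :
    opTrace (T * ∫ q, Z q ∂μ) = ∫ q, opTrace (T * Z q) ∂μ :=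
  TraceBound.tsum_mul_integral hC hT hZ

end SuperoperatorIntegrals

/-! ### The Laplace transform of the memory kernel. -/

namespace ParticleReservoir

set_option maxSynthPendingDepth 3

open Filter Topology

variable {d : ℕ} {𝒮 : Type*} [NormedAddCommGroup 𝒮] [InnerProductSpace ℂ 𝒮] [CompleteSpace 𝒮]
  [FiniteDimensional ℂ 𝒮] {m : ParticleReservoir d 𝒮} {δ : ℝ}
  (hd : 4 ≤ d) (hff : m.AnalyticFormFactor δ)

/-- The Laplace transform `L(z)` of the memory kernel, on the Hilbert-Schmidt operators. -/
def relaxation (z : ℂ) : HSOp d 𝒮 →L[ℂ] HSOp d 𝒮 := laplaceTransform (memory hd hff) z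

theorem exists_memory_bound :
    ∃ b : ℝ → ℝ, IntegrableOn b (Set.Ioi 0) ∧ (∀ t, 0 ≤ b t) ∧
      ∀ t, 0 < t → ‖memory hd hff t‖ ≤ b t := by
  obtain ⟨b, hb, hb0, h⟩ := exists_decay_bound hd hff
  exact ⟨fun t => 4 * b t, hb.const_mul 4, fun t => mul_nonneg zero_le_four (hb0 t),
    fun t ht => norm_memory_le hd hff (h t ht)⟩

theorem norm_exp_smul_memory_le {b : ℝ → ℝ} (h : ∀ t, 0 < t → ‖memory hd hff t‖ ≤ b t) {z : ℂ}
    (hz : 0 ≤ z.re) {t : ℝ} (ht : 0 < t) :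
    ‖Complex.exp (-(t * z)) • memory hd hff t‖ ≤ b t := by
  rw [norm_smul, norm_exp_neg_mul]
  have h1 : Real.exp (-(t * z.re)) ≤ 1 := by
    rw [Real.exp_le_one_iff]
    have := mul_nonneg ht.le hz
    linarith
  calc Real.exp (-(t * z.re)) * ‖memory hd hff t‖ ≤ 1 * b t := by
        gcongr
        exact h t ht
    _ = b t := one_mul _

theorem continuous_exp_smul_memory (z : ℂ) :
    Continuous fun t : ℝ => Complex.exp (-(t * z)) • memory hd hff t := by
  have := continuous_memory hd hff
  fun_prop

theorem laplaceIntegrable_memory {z : ℂ} (hz : 0 ≤ z.re) :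
    LaplaceIntegrable (memory hd hff) z := by
  obtain ⟨b, hb, hb0, h⟩ := exists_memory_bound hd hff
  refine Integrable.mono' hb (continuous_exp_smul_memory hd hff z).aestronglyMeasurable ?_
  refine (ae_restrict_iff' measurableSet_Ioi).mpr (Eventually.of_forall fun t ht => ?_)
  exact norm_exp_smul_memory_le hd hff h hz ht

/-- Dominated convergence: for `Re z ≥ 0` the integrable bound on the memory kernel dominates the
integrand for all `z` at once, including the imaginary axis. -/
theorem continuousOn_relaxation : ContinuousOn (relaxation hd hff) {z : ℂ | 0 ≤ z.re} := by
  obtain ⟨b, hb, hb0, h⟩ := exists_memory_bound hd hff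
  refine continuousOn_of_dominated (bound := b) (fun z _ =>
    (continuous_exp_smul_memory hd hff z).aestronglyMeasurable) (fun z hz => ?_) hb
    (Eventually.of_forall fun t => Continuous.continuousOn ?_)
  · refine (ae_restrict_iff' measurableSet_Ioi).mpr (Eventually.of_forall fun t ht => ?_)
    exact norm_exp_smul_memory_le hd hff h hz ht
  · fun_prop

theorem exists_norm_relaxation_le :
    ∃ C : ℝ, ∀ z : ℂ, 0 ≤ z.re → ‖relaxation hd hff z‖ ≤ C := by
  obtain ⟨b, hb, hb0, h⟩ := exists_memory_bound hd hff
  refine ⟨∫ t in Set.Ioi 0, b t, fun z hz => norm_integral_le_of_norm_le hb ?_⟩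
  refine (ae_restrict_iff' measurableSet_Ioi).mpr (Eventually.of_forall fun t ht => ?_)
  exact norm_exp_smul_memory_le hd hff h hz ht

theorem actsEntrywise_memory (t : ℝ) : ActsEntrywise (memory hd hff t) :=
  ((((actsEntrywise_hsSandwich _ _).smul _).sub
    ((actsEntrywise_hsWaveAvg _).comp (actsEntrywise_hsSandwich _ _))).sub
    (((actsEntrywise_hsWaveAvg _).comp (actsEntrywise_hsSandwich _ _)).sub
      ((actsEntrywise_hsSandwich _ _).smul _))).neg

theorem actsEntrywise_relaxation {z : ℂ} (hz : 0 ≤ z.re) :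
    ActsEntrywise (relaxation hd hff z) :=
  ActsEntrywise.integral (laplaceIntegrable_memory hd hff hz)
    fun t => (actsEntrywise_memory hd hff t).smul _

theorem inner_op_relaxation {z : ℂ} (hz : 0 ≤ z.re) (S : HSOp d 𝒮) (x y : PSpace d 𝒮) :
    ⟪x, HSOp.op (relaxation hd hff z S) y⟫_ℂ = ∫ t in Set.Ioi (0 : ℝ),
      ⟪x, (Complex.exp (-(t * z)) • HSOp.op (memory hd hff t S)) y⟫_ℂ :=
  inner_op_integral (laplaceIntegrable_memory hd hff hz) S x y

/-- In trace norm the memory kernel has a bound that is constant in time, so integrability comes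
from `e^{-t Re z}` alone. -/
theorem TraceBound.relaxation {z : ℂ} (hz : 0 < z.re) {S : HSOp d 𝒮} {c : ℝ} (hc : 0 ≤ c)
    (h : TraceBound (siteBasis d 𝒮) (HSOp.op S) c) :
    TraceBound (siteBasis d 𝒮) (HSOp.op (relaxation hd hff z S))
      (∫ t in Set.Ioi (0 : ℝ), Real.exp (-(t * z.re)) * (4 * m.corrBound * c)) := by
  refine TraceBound.of_integral (inner_op_relaxation hd hff hz.le S) (fun x y => ?_)
    ((integrableOn_exp_neg_mul hz).mul_const _) (Eventually.of_forall fun t => ?_)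
  · have h1 := (integrable_op_apply (laplaceIntegrable_memory hd hff hz.le) S
      y).aestronglyMeasurable
    exact aestronglyMeasurable_const.inner h1
  · rw [← norm_exp_neg_mul]
    exact (TraceBound.memory hd hff t hc h).smul _

theorem isTraceNormBounded_relaxation {z : ℂ} (hz : 0 < z.re) :
    IsTraceNormBounded (relaxation hd hff z) := by
  have hN := corrBound_nonneg (m := m)
  refine isTraceNormBounded_of_traceBound
    (C := (∫ t in Set.Ioi (0 : ℝ), Real.exp (-(t * z.re))) * (4 * m.corrBound))
    (mul_nonneg (integral_nonneg fun t => (Real.exp_pos _).le) (by positivity))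
    fun S c hc h => ?_
  refine (TraceBound.relaxation hd hff hz hc h).mono (le_of_eq ?_)
  rw [integral_mul_const]
  ring

theorem opTrace_relaxation_mul {z : ℂ} (hz : 0 < z.re) {S : HSOp d 𝒮} {C : ℝ} (hC : 0 ≤ C)
    (h : TraceBound (siteBasis d 𝒮) (HSOp.op S) C) (X : POp d 𝒮) :
    opTrace (HSOp.op (relaxation hd hff z S) * X) = ∫ t in Set.Ioi (0 : ℝ),
      opTrace ((Complex.exp (-(t * z)) • HSOp.op (memory hd hff t S)) * X) :=
  TraceBound.tsum_integral (b := siteBasis d 𝒮) (inner_op_relaxation hd hff hz.le S)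
    (fun x y => aestronglyMeasurable_const.inner (integrable_op_apply
      (laplaceIntegrable_memory hd hff hz.le) S y).aestronglyMeasurable)
    ((integrableOn_exp_neg_mul hz).mul_const (4 * m.corrBound * C))
    (Eventually.of_forall fun t => by
      rw [← norm_exp_neg_mul]
      exact (TraceBound.memory hd hff t hC h).smul _) X 1

theorem isDualOf_relaxation {z : ℂ} (hz : 0 < z.re) :
    IsDualOf (relaxation hd hff z) (laplaceTransform (memoryStar hd hff) z) := by
  intro S hS X
  obtain ⟨C, hC, h⟩ := isTraceClass_iff.mp hS
  have hLi := laplaceIntegrable_memoryStar hd hff hz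
  have happ : laplaceTransform (memoryStar hd hff) z X =
      ∫ t in Set.Ioi (0 : ℝ), Complex.exp (-(t * z)) • memoryStar hd hff t X :=
    ((ContinuousLinearMap.apply ℂ (POp d 𝒮) X).integral_comp_comm hLi).symm
  have hint : Integrable (fun t : ℝ => Complex.exp (-(t * z)) • memoryStar hd hff t X)
      (volume.restrict (Set.Ioi 0)) :=
    (ContinuousLinearMap.apply ℂ (POp d 𝒮) X).integrable_comp hLi
  rw [happ, opTrace_mul_integral hC h hint, opTrace_relaxation_mul hd hff hz hC h]
  refine integral_congr_ae (Eventually.of_forall fun t => ?_)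
  simp only
  rw [mul_smul_comm, smul_mul_assoc, opTrace_smul, opTrace_smul,
    opTrace_mul_memoryStar hd hff t hS]

end ParticleReservoir

/-! ### Composition and linearity of sandwiches. -/

section SandwichAlgebra

set_option maxSynthPendingDepth 3

variable {d : ℕ} {𝒮 : Type*} [NormedAddCommGroup 𝒮] [InnerProductSpace ℂ 𝒮] [CompleteSpace 𝒮]
  [FiniteDimensional ℂ 𝒮]

theorem hsSandwich_comp (A B C D : 𝒮 →L[ℂ] 𝒮) :
    (hsSandwich A B : HSOp d 𝒮 →L[ℂ] HSOp d 𝒮).comp (hsSandwich C D) =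
      hsSandwich (A * C) (D * B) := by
  ext1 S
  refine HSOp.op_injective (kernelOf_ext fun x y => ?_)
  rw [ContinuousLinearMap.comp_apply, op_hsSandwich, op_hsSandwich, op_hsSandwich,
    kernelOf_sandwich, kernelOf_sandwich, kernelOf_sandwich]
  simp only [mul_assoc]

theorem hsSandwich_comp_hsWaveAvg (A B : 𝒮 →L[ℂ] 𝒮) {p : EuclideanSpace ℝ (Fin d) → ℂ}
    (hp : Integrable p) :
    (hsSandwich A B : HSOp d 𝒮 →L[ℂ] HSOp d 𝒮).comp (hsWaveAvg p hp) =
      (hsWaveAvg p hp).comp (hsSandwich A B) := by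
  ext1 S
  refine HSOp.op_injective ?_
  rw [ContinuousLinearMap.comp_apply, ContinuousLinearMap.comp_apply, op_hsSandwich, op_hsWaveAvg,
    op_hsWaveAvg, op_hsSandwich, waveAvg_sandwich]

theorem hsSandwich_smul_left (c : ℂ) (A B : 𝒮 →L[ℂ] 𝒮) :
    (hsSandwich (c • A) B : HSOp d 𝒮 →L[ℂ] HSOp d 𝒮) = c • hsSandwich A B := by
  ext1 S
  refine HSOp.op_injective (kernelOf_ext fun x y => ?_)
  rw [smul_apply, map_smul, kernelOf_smul, op_hsSandwich, op_hsSandwich, kernelOf_sandwich,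
    kernelOf_sandwich, smul_mul_assoc, smul_mul_assoc]

theorem hsSandwich_smul_right (c : ℂ) (A B : 𝒮 →L[ℂ] 𝒮) :
    (hsSandwich A (c • B) : HSOp d 𝒮 →L[ℂ] HSOp d 𝒮) = c • hsSandwich A B := by
  ext1 S
  refine HSOp.op_injective (kernelOf_ext fun x y => ?_)
  rw [smul_apply, map_smul, kernelOf_smul, op_hsSandwich, op_hsSandwich, kernelOf_sandwich,
    kernelOf_sandwich, mul_smul_comm]

variable (d) in
/-- `A ↦ (S ↦ (1 ⊗ A) S (1 ⊗ B))` as a linear map. -/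
def hsSandwichLeft (B : 𝒮 →L[ℂ] 𝒮) : (𝒮 →L[ℂ] 𝒮) →ₗ[ℂ] HSOp d 𝒮 →L[ℂ] HSOp d 𝒮 where
  toFun A := hsSandwich A B
  map_add' A A' := by
    ext1 S
    refine HSOp.op_injective (kernelOf_ext fun x y => ?_)
    rw [add_apply, map_add, kernelOf_add, op_hsSandwich, op_hsSandwich, op_hsSandwich,
      kernelOf_sandwich, kernelOf_sandwich, kernelOf_sandwich, add_mul, add_mul]
  map_smul' c A := hsSandwich_smul_left c A B

variable (d) in
/-- `B ↦ (S ↦ (1 ⊗ A) S (1 ⊗ B))` as a linear map. -/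
def hsSandwichRight (A : 𝒮 →L[ℂ] 𝒮) : (𝒮 →L[ℂ] 𝒮) →ₗ[ℂ] HSOp d 𝒮 →L[ℂ] HSOp d 𝒮 where
  toFun B := hsSandwich A B
  map_add' B B' := by
    ext1 S
    refine HSOp.op_injective (kernelOf_ext fun x y => ?_)
    rw [add_apply, map_add, kernelOf_add, op_hsSandwich, op_hsSandwich, op_hsSandwich,
      kernelOf_sandwich, kernelOf_sandwich, kernelOf_sandwich, mul_add]
  map_smul' c B := hsSandwich_smul_right c A B

theorem hsSandwich_sum_left {ι : Type*} (s : Finset ι) (A : ι → 𝒮 →L[ℂ] 𝒮) (B : 𝒮 →L[ℂ] 𝒮) :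
    (hsSandwich (∑ i ∈ s, A i) B : HSOp d 𝒮 →L[ℂ] HSOp d 𝒮) = ∑ i ∈ s, hsSandwich (A i) B :=
  map_sum (hsSandwichLeft d B) A s

theorem hsSandwich_sum_right {ι : Type*} (s : Finset ι) (A : 𝒮 →L[ℂ] 𝒮) (B : ι → 𝒮 →L[ℂ] 𝒮) :
    (hsSandwich A (∑ i ∈ s, B i) : HSOp d 𝒮 →L[ℂ] HSOp d 𝒮) = ∑ i ∈ s, hsSandwich A (B i) :=
  map_sum (hsSandwichRight d A) B s

theorem hsSandwich_zero_left (B : 𝒮 →L[ℂ] 𝒮) :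
    (hsSandwich 0 B : HSOp d 𝒮 →L[ℂ] HSOp d 𝒮) = 0 := map_zero (hsSandwichLeft d B)

theorem hsSandwich_zero_right (A : 𝒮 →L[ℂ] 𝒮) :
    (hsSandwich A 0 : HSOp d 𝒮 →L[ℂ] HSOp d 𝒮) = 0 := map_zero (hsSandwichRight d A)

end SandwichAlgebra

/-! ### Projection of the memory kernel on the Bohr frequencies. -/

namespace ParticleReservoir

set_option maxSynthPendingDepth 3

variable {d : ℕ} {𝒮 : Type*} [NormedAddCommGroup 𝒮] [InnerProductSpace ℂ 𝒮] [CompleteSpace 𝒮]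
  [FiniteDimensional ℂ 𝒮] {m : ParticleReservoir d 𝒮} {δ : ℝ}

variable (m) in
theorem isSymmetric_Y : (m.Y : 𝒮 →ₗ[ℂ] 𝒮).IsSymmetric := m.isSelfAdjoint_Y.isSymmetric

theorem conj_level (e : m.Level) : (starRingEnd ℂ) e.val = e.val :=
  m.isSymmetric_Y.conj_eigenvalue_eq_self e.2

theorem levelProj_mul_self (e : m.Level) : m.levelProj e * m.levelProj e = m.levelProj e :=
  (Submodule.isIdempotentElem_starProjection _).eq

theorem levelProj_mul_of_ne {e e' : m.Level} (h : e ≠ e') :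
    m.levelProj e * m.levelProj e' = 0 :=
  Submodule.IsOrtho.starProjection_comp_starProjection
    (m.isSymmetric_Y.orthogonalFamily_eigenspaces'.isOrtho h)

theorem star_levelProj (e : m.Level) : star (m.levelProj e) = m.levelProj e :=
  (isSelfAdjoint_starProjection _).star_eq

variable (m) in
theorem sum_levelProj : ∑ e, m.levelProj e = 1 := by
  ext v
  rw [sum_apply]
  refine m.isSymmetric_Y.orthogonalFamily_eigenspaces'.sum_projection_of_mem_iSup v ?_
  have h := m.isSymmetric_Y.orthogonalComplement_iSup_eigenspaces_eq_bot'
  rw [Submodule.orthogonal_eq_bot_iff] at h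
  rw [h]
  trivial

theorem norm_levelProj_le (e : m.Level) : ‖m.levelProj e‖ ≤ 1 :=
  Submodule.starProjection_norm_le _

theorem Y_mul_levelProj (e : m.Level) : m.Y * m.levelProj e = e.val • m.levelProj e := by
  ext v
  exact Module.End.mem_eigenspace_iff.mp (Submodule.starProjection_apply_mem _ v)

theorem evolve_mul_levelProj (t : ℝ) (e : m.Level) :
    m.evolve t * m.levelProj e = Complex.exp (Complex.I * t * e.val) • m.levelProj e := by
  have h1 : ∀ n : ℕ, ((Complex.I * t) • m.Y) ^ n * m.levelProj e =
      (Complex.I * t * e.val) ^ n • m.levelProj e := by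
    intro n
    induction n with
    | zero => simp
    | succ n ih =>
      rw [pow_succ, mul_assoc, smul_mul_assoc, Y_mul_levelProj, smul_smul, mul_smul_comm, ih,
        smul_smul, pow_succ, mul_comm]
  have h2 := (NormedSpace.exp_series_hasSum_exp' (𝕂 := ℂ) ((Complex.I * t) • m.Y)).mul_right
    (m.levelProj e)
  have h3 := (NormedSpace.exp_series_hasSum_exp' (𝕂 := ℂ) (Complex.I * t * e.val)).smul_const
    (m.levelProj e)
  rw [← Complex.exp_eq_exp_ℂ] at h3
  simp only [smul_mul_assoc, h1, smul_smul] at h2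
  exact h2.unique h3

theorem levelProj_mul_evolve (t : ℝ) (e : m.Level) :
    m.levelProj e * m.evolve t = Complex.exp (Complex.I * t * e.val) • m.levelProj e := by
  have h := congrArg star (evolve_mul_levelProj (m := m) (-t) e)
  rw [star_mul, star_levelProj, star_evolve, neg_neg, star_smul, star_levelProj] at h
  rw [h, RCLike.star_def, ← Complex.exp_conj, map_mul, map_mul, conj_level, Complex.conj_I,
    Complex.conj_ofReal]
  congr 2
  push_cast
  ring

open Classical in
theorem sum_bohrFreqs {M : Type*} [AddCommMonoid M]
    (f : m.Level × m.Level → m.Level × m.Level → M) :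
    ∑ a ∈ m.bohrFreqs, ∑ p : m.Level × m.Level with p.1.val - p.2.val = a,
        ∑ q : m.Level × m.Level with q.1.val - q.2.val = a, f p q =
      ∑ p : m.Level × m.Level, ∑ q : m.Level × m.Level,
        if q.1.val - q.2.val = p.1.val - p.2.val then f p q else 0 := by
  rw [← Finset.sum_fiberwise_of_maps_to (s := Finset.univ) (t := m.bohrFreqs)
    (g := fun p : m.Level × m.Level => p.1.val - p.2.val)
    (fun p _ => Finset.mem_image_of_mem _ (Finset.mem_univ p))]
  refine Finset.sum_congr rfl fun a _ => Finset.sum_congr rfl fun p hp => ?_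
  rw [(Finset.mem_filter.mp hp).2, Finset.sum_filter]

open Classical in
theorem bohrProj_eq (a : ℂ) : m.bohrProj a =
    ∑ p : m.Level × m.Level with p.1.val - p.2.val = a,
      hsSandwich (m.levelProj p.1) (m.levelProj p.2) := rfl

open Classical in
theorem sum_bohrProj_hsSandwich (c : ℂ → ℂ) (A B : 𝒮 →L[ℂ] 𝒮) :
    ∑ a ∈ m.bohrFreqs, c a • (m.bohrProj a).comp ((hsSandwich A B).comp (m.bohrProj a)) =
      ∑ p : m.Level × m.Level, ∑ q : m.Level × m.Level,
        if q.1.val - q.2.val = p.1.val - p.2.val then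
          c (p.1.val - p.2.val) • hsSandwich (m.levelProj q.1 * A * m.levelProj p.1)
            (m.levelProj p.2 * B * m.levelProj q.2)
        else 0 := by
  rw [← sum_bohrFreqs fun p q => c (p.1.val - p.2.val) •
    hsSandwich (m.levelProj q.1 * A * m.levelProj p.1) (m.levelProj p.2 * B * m.levelProj q.2)]
  refine Finset.sum_congr rfl fun a _ => ?_
  rw [bohrProj_eq, ContinuousLinearMap.comp_finsetSum, ContinuousLinearMap.comp_finsetSum,
    Finset.smul_sum]
  refine Finset.sum_congr rfl fun p hp => ?_
  rw [ContinuousLinearMap.finsetSum_comp, Finset.smul_sum, (Finset.mem_filter.mp hp).2]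
  refine Finset.sum_congr rfl fun q _ => ?_
  rw [hsSandwich_comp, hsSandwich_comp, mul_assoc (m.levelProj q.1)]

open Classical in
variable (m) in
/-- The component `∑_{e - e' = a} 1_e(Y) W 1_{e'}(Y)` of the coupling matrix which raises the energy
by `a`. -/
def jumpOp (a : ℂ) : 𝒮 →L[ℂ] 𝒮 :=
  ∑ p : m.Level × m.Level with p.1.val - p.2.val = a, m.levelProj p.1 * m.W * m.levelProj p.2

open Classical in
theorem star_jumpOp (a : ℂ) : star (m.jumpOp a) =
    ∑ p : m.Level × m.Level with p.1.val - p.2.val = a,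
      m.levelProj p.2 * m.W * m.levelProj p.1 := by
  rw [jumpOp, star_sum]
  refine Finset.sum_congr rfl fun p _ => ?_
  rw [star_mul, star_mul, star_levelProj, star_levelProj, m.isSelfAdjoint_W.star_eq, mul_assoc]

open Classical in
-- A relabelling: the left and right levels having equal differences before and after, `q₁ - q₂ = p₁
-- - p₂`, is the same as equal transition energies on the two sides, `q₁ - p₁ = q₂ - p₂`. Grouping
-- by the transition energy produces the jump operators.
theorem sum_jumpOp (c : ℂ → ℂ) :
    ∑ p : m.Level × m.Level, ∑ q : m.Level × m.Level,
        (if q.1.val - q.2.val = p.1.val - p.2.val then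
          c (q.1.val - p.1.val) • (hsSandwich (m.levelProj q.1 * m.W * m.levelProj p.1)
            (m.levelProj p.2 * m.W * m.levelProj q.2) : HSOp d 𝒮 →L[ℂ] HSOp d 𝒮)
        else 0) =
      ∑ a ∈ m.bohrFreqs, c a • hsSandwich (m.jumpOp a) (star (m.jumpOp a)) := by
  have h : ∀ a, c a • (hsSandwich (m.jumpOp a) (star (m.jumpOp a)) : HSOp d 𝒮 →L[ℂ] HSOp d 𝒮) =
      ∑ p : m.Level × m.Level with p.1.val - p.2.val = a,
        ∑ q : m.Level × m.Level with q.1.val - q.2.val = a, c (p.1.val - p.2.val) •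
          hsSandwich (m.levelProj p.1 * m.W * m.levelProj p.2)
            (m.levelProj q.2 * m.W * m.levelProj q.1) := fun a => by
    rw [star_jumpOp, jumpOp, hsSandwich_sum_left, Finset.smul_sum]
    refine Finset.sum_congr rfl fun p hp => ?_
    rw [hsSandwich_sum_right, Finset.smul_sum, (Finset.mem_filter.mp hp).2]
  rw [Finset.sum_congr rfl fun a _ => h a, sum_bohrFreqs fun p q => c (p.1.val - p.2.val) •
          (hsSandwich (m.levelProj p.1 * m.W * m.levelProj p.2)
            (m.levelProj q.2 * m.W * m.levelProj q.1) : HSOp d 𝒮 →L[ℂ] HSOp d 𝒮)]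
  rw [← Fintype.sum_prod_type', ← Fintype.sum_prod_type']
  refine Fintype.sum_equiv
    { toFun := fun r => ((r.2.1, r.1.1), (r.2.2, r.1.2))
      invFun := fun r => ((r.1.2, r.2.2), (r.1.1, r.2.1))
      left_inv := fun _ => rfl
      right_inv := fun _ => rfl } _ _ fun r => ?_
  refine if_congr ?_ rfl rfl
  change r.2.1.val - r.2.2.val = r.1.1.val - r.1.2.val ↔
    r.2.2.val - r.1.2.val = r.2.1.val - r.1.1.val
  constructor <;> intro h <;> linear_combination -h

open Classical in
-- A function of `Y` on the left leaves the left level unchanged, and equality of the Bohr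
-- frequencies then forces the right level to be unchanged as well. What survives is a
-- block-diagonal operator acting from the right.
theorem sum_bohrProj_evolve_left (t : ℝ) (B : 𝒮 →L[ℂ] 𝒮) :
    ∑ a ∈ m.bohrFreqs, Complex.exp (Complex.I * t * a) •
        (m.bohrProj a).comp ((hsSandwich (m.evolve (-t)) B).comp (m.bohrProj a)) =
      hsSandwich 1 (∑ e, Complex.exp (-(Complex.I * t * e.val)) •
        (m.levelProj e * B * m.levelProj e)) := by
  rw [sum_bohrProj_hsSandwich fun a => Complex.exp (Complex.I * t * a), ← m.sum_levelProj,
    hsSandwich_sum_left, Fintype.sum_prod_type]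
  refine Finset.sum_congr rfl fun e _ => ?_
  rw [hsSandwich_sum_right]
  refine Finset.sum_congr rfl fun e' _ => ?_
  rw [Finset.sum_eq_single (e, e')]
  · rw [if_pos rfl, levelProj_mul_evolve, smul_mul_assoc, levelProj_mul_self, hsSandwich_smul_left,
      hsSandwich_smul_right, smul_smul, ← Complex.exp_add]
    congr 2
    push_cast
    ring
  · rintro ⟨q1, q2⟩ _ hq
    split_ifs with h
    · have hne : q1 ≠ e := by
        rintro rfl
        have h0 : q2.val = e'.val := by simpa using h
        have h' : q2 = e' := Subtype.ext h0
        exact hq (by rw [h'])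
      rw [levelProj_mul_evolve, smul_mul_assoc, levelProj_mul_of_ne hne, smul_zero,
        hsSandwich_zero_left, smul_zero]
    · rfl
  · simp

open Classical in
theorem sum_bohrProj_evolve_right (t : ℝ) (A : 𝒮 →L[ℂ] 𝒮) :
    ∑ a ∈ m.bohrFreqs, Complex.exp (Complex.I * t * a) •
        (m.bohrProj a).comp ((hsSandwich A (m.evolve t)).comp (m.bohrProj a)) =
      hsSandwich (∑ e, Complex.exp (Complex.I * t * e.val) •
        (m.levelProj e * A * m.levelProj e)) 1 := by
  rw [sum_bohrProj_hsSandwich fun a => Complex.exp (Complex.I * t * a), ← m.sum_levelProj,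
    hsSandwich_sum_left, Fintype.sum_prod_type]
  refine Finset.sum_congr rfl fun e _ => ?_
  rw [hsSandwich_sum_right]
  refine Finset.sum_congr rfl fun e' _ => ?_
  rw [Finset.sum_eq_single (e, e')]
  · rw [if_pos rfl, levelProj_mul_evolve, smul_mul_assoc, levelProj_mul_self, hsSandwich_smul_left,
      hsSandwich_smul_right, smul_smul, ← Complex.exp_add]
    congr 2
    ring
  · rintro ⟨q1, q2⟩ _ hq
    split_ifs with h
    · have hne : e' ≠ q2 := by
        rintro rfl
        have h0 : q1.val = e.val := by simpa using h
        have h' : q1 = e := Subtype.ext h0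
        exact hq (by rw [h'])
      rw [levelProj_mul_evolve, smul_mul_assoc, levelProj_mul_of_ne hne, smul_zero,
        hsSandwich_zero_right, smul_zero]
    · rfl
  · simp

open Classical in
-- The evolution contributes `e^{-itp₁}` on the left and `e^{itq₂}` on the right. With
-- `e^{it(p₁-p₂)}` this makes `e^{it(q₂-p₂)}`, which is the phase of the transition energy `q₁ -
-- p₁`.
theorem sum_bohrProj_inner (t : ℝ) :
    ∑ a ∈ m.bohrFreqs, Complex.exp (Complex.I * t * a) • (m.bohrProj a).comp
        ((hsSandwich (m.W * m.evolve (-t)) (m.W * m.evolve t)).comp (m.bohrProj a)) =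
      ∑ a ∈ m.bohrFreqs, Complex.exp (Complex.I * t * a) •
        hsSandwich (m.jumpOp a) (star (m.jumpOp a)) := by
  rw [sum_bohrProj_hsSandwich fun a => Complex.exp (Complex.I * t * a),
    ← sum_jumpOp fun a => Complex.exp (Complex.I * t * a)]
  refine Finset.sum_congr rfl fun p _ => Finset.sum_congr rfl fun q _ => ?_
  split_ifs with h
  · rw [← mul_assoc, mul_assoc _ (m.evolve (-t)), evolve_mul_levelProj, mul_smul_comm, ← mul_assoc,
      mul_assoc _ (m.evolve t), evolve_mul_levelProj, mul_smul_comm, hsSandwich_smul_left,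
      hsSandwich_smul_right, smul_smul, smul_smul, ← Complex.exp_add, ← Complex.exp_add]
    congr 2
    push_cast
    linear_combination -(Complex.I * t) * h
  · rfl

open Classical in
theorem sum_bohrProj_outer (t : ℝ) :
    ∑ a ∈ m.bohrFreqs, Complex.exp (Complex.I * t * a) • (m.bohrProj a).comp
        ((hsSandwich (m.evolve (-t) * m.W) (m.evolve t * m.W)).comp (m.bohrProj a)) =
      ∑ a ∈ m.bohrFreqs, Complex.exp (-(Complex.I * t * a)) •
        hsSandwich (m.jumpOp a) (star (m.jumpOp a)) := by
  rw [sum_bohrProj_hsSandwich fun a => Complex.exp (Complex.I * t * a),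
    ← sum_jumpOp fun a => Complex.exp (-(Complex.I * t * a))]
  refine Finset.sum_congr rfl fun p _ => Finset.sum_congr rfl fun q _ => ?_
  split_ifs with h
  · rw [← mul_assoc (m.levelProj q.1), levelProj_mul_evolve, smul_mul_assoc, smul_mul_assoc,
      ← mul_assoc (m.levelProj p.2), levelProj_mul_evolve, smul_mul_assoc, smul_mul_assoc,
      hsSandwich_smul_left, hsSandwich_smul_right, smul_smul, smul_smul, ← Complex.exp_add,
      ← Complex.exp_add]
    congr 2
    push_cast
    ring
  · rfl

variable (m) in
/-- The operator `∑_e e^{ite} 1_e(Y) W e^{-itY} W 1_e(Y)`. -/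
def driftOp (t : ℝ) : 𝒮 →L[ℂ] 𝒮 :=
  ∑ e, Complex.exp (Complex.I * t * e.val) •
    (m.levelProj e * (m.W * m.evolve (-t) * m.W) * m.levelProj e)

theorem star_driftOp (t : ℝ) : star (m.driftOp t) =
    ∑ e, Complex.exp (-(Complex.I * t * e.val)) •
      (m.levelProj e * (m.W * m.evolve t * m.W) * m.levelProj e) := by
  rw [driftOp, star_sum]
  refine Finset.sum_congr rfl fun e _ => ?_
  rw [star_smul, star_mul, star_mul, star_mul, star_mul, star_levelProj, m.isSelfAdjoint_W.star_eq,
    star_evolve, neg_neg, RCLike.star_def, ← Complex.exp_conj, map_mul, map_mul, conj_level,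
    Complex.conj_I, Complex.conj_ofReal]
  simp only [neg_mul, mul_assoc]

variable (hd : 4 ≤ d) (hff : m.AnalyticFormFactor δ)

theorem bohrProj_comp_hsWaveAvg (a : ℂ) {p : EuclideanSpace ℝ (Fin d) → ℂ} (hp : Integrable p) :
    (m.bohrProj a).comp (hsWaveAvg p hp) = (hsWaveAvg p hp).comp (m.bohrProj a) := by
  classical
  rw [bohrProj_eq, ContinuousLinearMap.finsetSum_comp, ContinuousLinearMap.comp_finsetSum]
  exact Finset.sum_congr rfl fun _ _ => hsSandwich_comp_hsWaveAvg _ _ hp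

/-- The gain part of the secular approximation of the memory kernel at time `t`. -/
def gain (t : ℝ) : HSOp d 𝒮 →L[ℂ] HSOp d 𝒮 :=
  ∑ a ∈ m.bohrFreqs, (Complex.exp (Complex.I * t * a) • hsCorrAvg hd hff t +
    Complex.exp (-(Complex.I * t * a)) • hsCorrAvg hd hff (-t)).comp
      (hsSandwich (m.jumpOp a) (star (m.jumpOp a)))

theorem gain_eq (t : ℝ) :
    gain hd hff t = (hsCorrAvg hd hff t).comp (∑ a ∈ m.bohrFreqs,
      Complex.exp (Complex.I * t * a) • hsSandwich (m.jumpOp a) (star (m.jumpOp a))) +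
      (hsCorrAvg hd hff (-t)).comp (∑ a ∈ m.bohrFreqs,
      Complex.exp (-(Complex.I * t * a)) • hsSandwich (m.jumpOp a) (star (m.jumpOp a))) := by
  rw [gain, ContinuousLinearMap.comp_finsetSum, ContinuousLinearMap.comp_finsetSum,
    ← Finset.sum_add_distrib]
  refine Finset.sum_congr rfl fun a _ => ?_
  rw [ContinuousLinearMap.add_comp, ContinuousLinearMap.comp_smul, ContinuousLinearMap.comp_smul,
    ContinuousLinearMap.smul_comp, ContinuousLinearMap.smul_comp]

theorem comp_four_comp {E : Type*} [NormedAddCommGroup E] [NormedSpace ℂ E] {P H H' A B C D : E →L[ℂ] E}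
    (h : P.comp H = H.comp P) (h' : P.comp H' = H'.comp P) (c a b : ℂ) :
    c • P.comp ((-(a • A - H.comp B - (H'.comp C - b • D))).comp P) =
      H.comp (c • P.comp (B.comp P)) + H'.comp (c • P.comp (C.comp P)) -
        a • (c • P.comp (A.comp P)) - b • (c • P.comp (D.comp P)) := by
  have e : ∀ X, H (P X) = P (H X) := fun X => (congrArg (fun V : E →L[ℂ] E => V X) h).symm
  have e' : ∀ X, H' (P X) = P (H' X) := fun X => (congrArg (fun V : E →L[ℂ] E => V X) h').symm
  ext1 S
  simp only [neg_apply, add_apply, sub_apply, smul_apply,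
    ContinuousLinearMap.comp_apply, map_neg, map_sub, map_smul, e, e']
  module

/-- The Lindblad structure appears at each time, before integration: a gain term built from `V S V*`
with jump operators `V`, and two one-sided losses that are adjoint to each other because `corr (-t)`
is the conjugate of `corr t`. -/
theorem sum_bohrProj_memory (t : ℝ) :
    ∑ a ∈ m.bohrFreqs, Complex.exp (Complex.I * t * a) •
        (m.bohrProj a).comp ((memory hd hff t).comp (m.bohrProj a)) =
      gain hd hff t - m.corr t • hsSandwich 1 (star (m.driftOp t)) -
        m.corr (-t) • hsSandwich (m.driftOp t) 1 := by
  rw [gain_eq, star_driftOp, ← sum_bohrProj_evolve_left, driftOp, ← sum_bohrProj_evolve_right,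
    ← sum_bohrProj_inner, ← sum_bohrProj_outer, ContinuousLinearMap.comp_finsetSum,
    ContinuousLinearMap.comp_finsetSum, Finset.smul_sum, Finset.smul_sum,
    ← Finset.sum_add_distrib, ← Finset.sum_sub_distrib, ← Finset.sum_sub_distrib]
  exact Finset.sum_congr rfl fun a _ =>
    comp_four_comp (bohrProj_comp_hsWaveAvg a _) (bohrProj_comp_hsWaveAvg a _) _ _ _

end ParticleReservoir

/-! ### Averages with nonnegative weight. -/

section WaveAvgPositivity

variable {d : ℕ} {𝒮 : Type*} [NormedAddCommGroup 𝒮] [InnerProductSpace ℂ 𝒮] [CompleteSpace 𝒮]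

/-- The quadratic form of the average is the integral of the quadratic forms of unitary conjugates
of `T` against a nonnegative weight. -/
theorem isPositive_waveAvg {p : EuclideanSpace ℝ (Fin d) → ℝ} (h0 : ∀ q, 0 ≤ p q)
    (hp : Integrable fun q => (p q : ℂ)) {T : POp d 𝒮} (hT : T.IsPositive) :
    (waveAvg (fun q => (p q : ℂ)) hp T).IsPositive := by
  have h1 : ∀ q (x : PSpace d 𝒮), ⟪x, ((p q : ℂ) • waveConj q T) x⟫_ℂ =
      ((p q * (⟪planeWave (-q) x, T (planeWave (-q) x)⟫_ℂ).re : ℝ) : ℂ) := by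
    intro q x
    have h2 : ⟪x, planeWave q (T (planeWave (-q) x))⟫_ℂ =
        ⟪planeWave (-q) x, T (planeWave (-q) x)⟫_ℂ := by
      rw [← ContinuousLinearMap.adjoint_inner_left, adjoint_planeWave]
    have h3 : ((⟪planeWave (-q) x, T (planeWave (-q) x)⟫_ℂ).re : ℂ) =
        ⟪planeWave (-q) x, T (planeWave (-q) x)⟫_ℂ :=
      Complex.ext rfl (Complex.nonneg_iff.mp (hT.inner_nonneg_right (planeWave (-q) x))).2
    rw [smul_apply, inner_smul_right, waveConj_apply, h2, Complex.ofReal_mul, h3]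
  rw [ContinuousLinearMap.isPositive_iff_complex]
  intro x
  have h4 : ⟪x, waveAvg (fun q => (p q : ℂ)) hp T x⟫_ℂ =
      ((∫ q, p q * (⟪planeWave (-q) x, T (planeWave (-q) x)⟫_ℂ).re : ℝ) : ℂ) := by
    rw [inner_waveAvg, ← integral_complex_ofReal]
    exact integral_congr_ae (Filter.Eventually.of_forall fun q => h1 q x)
  have h5 : ⟪waveAvg (fun q => (p q : ℂ)) hp T x, x⟫_ℂ =
      ((∫ q, p q * (⟪planeWave (-q) x, T (planeWave (-q) x)⟫_ℂ).re : ℝ) : ℂ) := by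
    rw [← inner_conj_symm, h4, Complex.conj_ofReal]
  rw [h5]
  refine ⟨by simp, ?_⟩
  simp only [RCLike.re_eq_complex_re, Complex.ofReal_re]
  exact integral_nonneg fun q => mul_nonneg (h0 q)
    (Complex.nonneg_iff.mp (hT.inner_nonneg_right (planeWave (-q) x))).1

end WaveAvgPositivity

/-! ### Lorentzian regularization of the transition rates. -/

theorem integral_exp_neg_mul_cos {ε : ℝ} (hε : 0 < ε) (c : ℝ) :
    ∫ t in Set.Ioi (0 : ℝ), Complex.exp (-(t * ε)) *
      (Complex.exp (Complex.I * t * c) + Complex.exp (-(Complex.I * t * c))) =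
      ((2 * ε / (ε ^ 2 + c ^ 2) : ℝ) : ℂ) := by
  have h : ∀ s : ℂ, s.re = 0 → IntegrableOn (fun t : ℝ => Complex.exp ((-ε + s) * t)) (Set.Ioi 0) ∧
      ∫ t in Set.Ioi (0 : ℝ), Complex.exp ((-ε + s) * t) = 1 / (ε - s) := by
    intro s hs
    have hre : (-(ε : ℂ) + s).re < 0 := by simp [hs, hε]
    refine ⟨integrableOn_exp_mul_complex_Ioi hre 0, ?_⟩
    rw [integral_exp_mul_complex_Ioi hre]
    have : (ε : ℂ) - s ≠ 0 := by
      intro h0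
      have := congrArg Complex.re h0
      simp [hs] at this
      exact hε.ne' this
    have h2 : -(ε : ℂ) + s ≠ 0 := by
      intro h0
      apply this
      linear_combination -h0
    simp only [Complex.ofReal_zero, mul_zero, Complex.exp_zero]
    field_simp
    ring
  obtain ⟨i1, e1⟩ := h (Complex.I * c) (by simp)
  obtain ⟨i2, e2⟩ := h (-(Complex.I * c)) (by simp)
  have e3 : ∀ t : ℝ, Complex.exp (-(t * ε)) *
      (Complex.exp (Complex.I * t * c) + Complex.exp (-(Complex.I * t * c))) =
      Complex.exp ((-ε + Complex.I * c) * t) + Complex.exp ((-ε + -(Complex.I * c)) * t) := by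
    intro t
    rw [mul_add, ← Complex.exp_add, ← Complex.exp_add]
    ring_nf
  simp_rw [e3]
  rw [integral_add i1 i2, e1, e2]
  have hd : ((ε : ℂ) - Complex.I * c) * (ε - -(Complex.I * c)) = ((ε ^ 2 + c ^ 2 : ℝ) : ℂ) := by
    push_cast
    linear_combination -(c : ℂ) ^ 2 * Complex.I_sq
  have hpos : ((ε ^ 2 + c ^ 2 : ℝ) : ℂ) ≠ 0 := by
    rw [Complex.ofReal_ne_zero]
    positivity
  have hn := hd ▸ hpos
  rw [div_add_div _ _ (left_ne_zero_of_mul hn) (right_ne_zero_of_mul hn), hd, Complex.ofReal_div]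
  congr 1
  push_cast
  ring

namespace ParticleReservoir

set_option maxSynthPendingDepth 3

open Filter Topology

variable {d : ℕ} {𝒮 : Type*} [NormedAddCommGroup 𝒮] [InnerProductSpace ℂ 𝒮] [CompleteSpace 𝒮]
  {m : ParticleReservoir d 𝒮} {δ : ℝ}

variable (m) in
/-- The rate, regularized at time scale `1 / ε`, at which a transition of frequency `a` happens
together with a momentum transfer `q`. -/
def transitionRate (ε a : ℝ) (q : EuclideanSpace ℝ (Fin d)) : ℝ :=
  m.emission ‖q‖ * (2 * ε / (ε ^ 2 + (a + ‖q‖) ^ 2)) +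
    m.absorption ‖q‖ * (2 * ε / (ε ^ 2 + (a - ‖q‖) ^ 2))

theorem transitionRate_nonneg {ε : ℝ} (hε : 0 ≤ ε) (a : ℝ) (q : EuclideanSpace ℝ (Fin d)) :
    0 ≤ m.transitionRate ε a q :=
  add_nonneg (mul_nonneg (emission_nonneg (norm_nonneg q)) (by positivity))
    (mul_nonneg (absorption_nonneg (norm_nonneg q)) (by positivity))

theorem integrable_mul_lorentzian {P : EuclideanSpace ℝ (Fin d) → ℝ} (hP : Integrable P) {ε : ℝ}
    (hε : 0 < ε) {c : EuclideanSpace ℝ (Fin d) → ℝ} (hc : Continuous c) :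
    Integrable fun q => P q * (2 * ε / (ε ^ 2 + c q ^ 2)) := by
  have hne : ∀ q, ε ^ 2 + c q ^ 2 ≠ 0 := fun q => by positivity
  refine hP.mul_bdd (c := 2 / ε)
    (Continuous.aestronglyMeasurable (by fun_prop (disch := exact hne))) ?_
  refine Eventually.of_forall fun q => ?_
  rw [Real.norm_of_nonneg (by positivity), div_le_div_iff₀ (by positivity) hε]
  nlinarith [sq_nonneg (c q)]

theorem integrable_transitionRate (hd : 4 ≤ d) (hff : m.AnalyticFormFactor δ) {ε : ℝ} (hε : 0 < ε)
    (a : ℝ) : Integrable fun q => (m.transitionRate ε a q : ℂ) := by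
  obtain ⟨i1, i2⟩ := integrable_emission_absorption hd hff
  exact ((integrable_mul_lorentzian i1 hε (by fun_prop)).add
    (integrable_mul_lorentzian i2 hε (by fun_prop))).ofReal

variable (m) in
/-- The density of the gain term at frequency `a` and time `t`. -/
def gainDensity (a t : ℝ) (q : EuclideanSpace ℝ (Fin d)) : ℂ :=
  Complex.exp (Complex.I * t * a) * m.corrDensity t q +
    Complex.exp (-(Complex.I * t * a)) * m.corrDensity (-t) q

/-- The contributions of `t` and `-t` pair up to cosines in the frequencies `a + |q|` and `a - |q|`
with nonnegative coefficients, which is why the Laplace transform at `ε > 0` is nonnegative. -/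
theorem gainDensity_eq (a t : ℝ) (q : EuclideanSpace ℝ (Fin d)) :
    m.gainDensity a t q = m.emission ‖q‖ * (Complex.exp (Complex.I * t * (a + ‖q‖ : ℝ)) +
        Complex.exp (-(Complex.I * t * (a + ‖q‖ : ℝ)))) +
      m.absorption ‖q‖ * (Complex.exp (Complex.I * t * (a - ‖q‖ : ℝ)) +
        Complex.exp (-(Complex.I * t * (a - ‖q‖ : ℝ)))) := by
  have e : ∀ u v : ℂ, Complex.exp u * Complex.exp v = Complex.exp (u + v) := fun u v =>
    (Complex.exp_add u v).symm
  simp only [gainDensity, corrDensity, mul_add, mul_left_comm (Complex.exp _) (m.emission _ : ℂ),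
    mul_left_comm (Complex.exp _) (m.absorption _ : ℂ), e]
  push_cast
  ring_nf

theorem integrable_exp_mul_phase_prod {P : EuclideanSpace ℝ (Fin d) → ℝ} (hP : Integrable P)
    {ε : ℝ} (hε : 0 < ε) {c θ : EuclideanSpace ℝ (Fin d) → ℝ} (hc : Continuous c)
    (hθ : Continuous θ) :
    Integrable (fun r : ℝ × EuclideanSpace ℝ (Fin d) => Complex.exp (-(r.1 * ε)) *
      (P r.2 * (Complex.exp (Complex.I * r.1 * c r.2) + Complex.exp (-(Complex.I * r.1 * c r.2))) *
        Complex.exp (Complex.I * θ r.2))) ((volume.restrict (Set.Ioi 0)).prod volume) := by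
  have h1 : Integrable (fun t : ℝ => Complex.exp (-(t * ε))) (volume.restrict (Set.Ioi 0)) := by
    have h := integrableOn_exp_mul_complex_Ioi (a := -(ε : ℂ)) (by simpa using hε) 0
    refine h.congr (Eventually.of_forall fun t => ?_)
    simp only
    ring_nf
  have h2 := h1.mul_prod (hP.ofReal (𝕜 := ℂ))
  have h3 := h2.mul_bdd (c := 2) (g := fun r : ℝ × EuclideanSpace ℝ (Fin d) =>
    (Complex.exp (Complex.I * r.1 * c r.2) + Complex.exp (-(Complex.I * r.1 * c r.2))) *
        Complex.exp (Complex.I * θ r.2)) (Continuous.aestronglyMeasurable (by fun_prop))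
    (Eventually.of_forall fun r => ?_)
  · refine h3.congr (Eventually.of_forall fun r => ?_)
    simp only [RCLike.ofReal_eq_complex_ofReal]
    ring
  · have n1 : ∀ s : ℝ, ‖Complex.exp (Complex.I * s)‖ = 1 := fun s => by
      rw [mul_comm, Complex.norm_exp_ofReal_mul_I]
    have n2 : ‖Complex.exp (Complex.I * r.1 * c r.2)‖ = 1 := by
      rw [← n1 (r.1 * c r.2)]
      push_cast
      ring_nf
    have n3 : ‖Complex.exp (-(Complex.I * r.1 * c r.2))‖ = 1 := by
      rw [← n1 (-(r.1 * c r.2))]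
      push_cast
      ring_nf
    rw [norm_mul, n1, mul_one]
    refine (norm_add_le _ _).trans ?_
    rw [n2, n3]
    norm_num

theorem integral_exp_mul_phase_prod {P : EuclideanSpace ℝ (Fin d) → ℝ} (hP : Integrable P)
    {ε : ℝ} (hε : 0 < ε) {c θ : EuclideanSpace ℝ (Fin d) → ℝ} (hc : Continuous c)
    (hθ : Continuous θ) :
    ∫ t in Set.Ioi (0 : ℝ), ∫ q, Complex.exp (-(t * ε)) *
      (P q * (Complex.exp (Complex.I * t * c q) + Complex.exp (-(Complex.I * t * c q))) *
        Complex.exp (Complex.I * θ q)) =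
      ∫ q, ((P q * (2 * ε / (ε ^ 2 + c q ^ 2)) : ℝ) : ℂ) * Complex.exp (Complex.I * θ q) := by
  rw [integral_integral_swap (integrable_exp_mul_phase_prod hP hε hc hθ)]
  refine integral_congr_ae (Eventually.of_forall fun q => ?_)
  simp only
  rw [Complex.ofReal_mul, ← integral_exp_neg_mul_cos hε, ← integral_const_mul,
    ← integral_mul_const]
  refine integral_congr_ae (Eventually.of_forall fun t => ?_)
  simp only
  ring

/-- For `ε > 0` the factor `e^{-tε}` allows the time and momentum integrals to be exchanged, and the
time integral of each cosine is a Lorentzian. -/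
theorem integral_exp_mul_weightFourier (hd : 4 ≤ d) (hff : m.AnalyticFormFactor δ) {ε : ℝ}
    (hε : 0 < ε) (a : ℝ) (x y : Fin d → ℤ) :
    ∫ t in Set.Ioi (0 : ℝ), Complex.exp (-(t * ε)) * weightFourier (m.gainDensity a t) x y =
      weightFourier (fun q => (m.transitionRate ε a q : ℂ)) x y := by
  obtain ⟨i1, i2⟩ := integrable_emission_absorption hd hff
  have hθ : Continuous fun q : EuclideanSpace ℝ (Fin d) => latticePhase q x - latticePhase q y := by
    unfold latticePhase
    fun_prop
  have c1 : Continuous fun q : EuclideanSpace ℝ (Fin d) => a + ‖q‖ := by fun_prop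
  have c2 : Continuous fun q : EuclideanSpace ℝ (Fin d) => a - ‖q‖ := by fun_prop
  have j1 := integrable_exp_mul_phase_prod i1 hε c1 hθ
  have j2 := integrable_exp_mul_phase_prod i2 hε c2 hθ
  have r1 := integrable_phase_mul (integrable_mul_lorentzian i1 hε c1) hθ
  have r2 := integrable_phase_mul (integrable_mul_lorentzian i2 hε c2) hθ
  have e1 := integral_exp_mul_phase_prod i1 hε c1 hθ
  have e2 := integral_exp_mul_phase_prod i2 hε c2 hθ
  have hr : weightFourier (fun q => (m.transitionRate ε a q : ℂ)) x y =
      ∫ q, ((((m.emission ‖q‖ * (2 * ε / (ε ^ 2 + (a + ‖q‖) ^ 2)) : ℝ) : ℂ) *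
        Complex.exp (Complex.I * (latticePhase q x - latticePhase q y : ℝ))) +
        (((m.absorption ‖q‖ * (2 * ε / (ε ^ 2 + (a - ‖q‖) ^ 2)) : ℝ) : ℂ) *
        Complex.exp (Complex.I * (latticePhase q x - latticePhase q y : ℝ)))) := by
    refine integral_congr_ae (Eventually.of_forall fun q => ?_)
    simp only [transitionRate, Complex.ofReal_add, Complex.ofReal_sub]
    ring
  rw [hr, integral_add r1 r2, ← e1, ← e2, ← integral_add j1.integral_prod_left j2.integral_prod_left]
  have hae1 := j1.prod_right_ae
  have hae2 := j2.prod_right_ae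
  refine integral_congr_ae ?_
  filter_upwards [hae1, hae2] with t h1 h2
  rw [← integral_add h1 h2, weightFourier, ← integral_const_mul]
  refine integral_congr_ae (Eventually.of_forall fun q => ?_)
  simp only [gainDensity_eq, Complex.ofReal_sub]
  ring

end ParticleReservoir

/-! ### Composition with a fixed operator under the integral. -/

section IntegralComp

variable {E : Type*} [NormedAddCommGroup E] [NormedSpace ℂ E] [CompleteSpace E] {Q : Type*}
  [MeasurableSpace Q] {μ : Measure Q} {V : Q → E →L[ℂ] E}

theorem integrable_clm_comp (hV : Integrable V μ) (B : E →L[ℂ] E) :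
    Integrable (fun q => (V q).comp B) μ :=
  ((ContinuousLinearMap.compL ℂ E E E).flip B).integrable_comp hV

theorem integral_clm_comp (hV : Integrable V μ) (B : E →L[ℂ] E) :
    ∫ q, (V q).comp B ∂μ = (∫ q, V q ∂μ).comp B :=
  ((ContinuousLinearMap.compL ℂ E E E).flip B).integral_comp_comm hV

theorem neg_integral_add {f g h : Q → E} (hf : Integrable f μ) (hg : Integrable g μ)
    (hh : Integrable h μ) :
    -(∫ q, f q ∂μ) + -(∫ q, g q ∂μ) + ∫ q, h q ∂μ = ∫ q, (-f q + -g q + h q) ∂μ := by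
  have e1 := integral_add (hf.neg.add hg.neg) hh
  have e2 := integral_add hf.neg hg.neg
  rw [← integral_neg, ← integral_neg]
  exact (e1.trans (congrArg (· + _) e2)).symm

end IntegralComp

/-! ### Lindblad form of the regularized dissipator. -/

namespace ParticleReservoir

set_option maxSynthPendingDepth 3

open Filter Topology

variable {d : ℕ} {𝒮 : Type*} [NormedAddCommGroup 𝒮] [InnerProductSpace ℂ 𝒮] [CompleteSpace 𝒮]
  [FiniteDimensional ℂ 𝒮] {m : ParticleReservoir d 𝒮} {δ : ℝ}

theorem re_neg_I_mul_bohr {a : ℂ} (ha : a ∈ m.bohrFreqs) : (-Complex.I * a).re = 0 := by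
  classical
  obtain ⟨p, _, rfl⟩ := Finset.mem_image.mp ha
  have h1 := Complex.conj_eq_iff_im.mp (conj_level p.1)
  have h2 := Complex.conj_eq_iff_im.mp (conj_level p.2)
  simp [h1, h2]

theorem bohr_eq_re {a : ℂ} (ha : a ∈ m.bohrFreqs) : a = (a.re : ℂ) := by
  have h := re_neg_I_mul_bohr ha
  refine Complex.ext rfl ?_
  simpa using h

variable (hd : 4 ≤ d) (hff : m.AnalyticFormFactor δ)

/-- The secular approximation `∑_a 1_a(ad(Y)) L(ε - ia) 1_a(ad(Y))` of the dissipative part of the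
generator, regularized by `ε`. -/
def dissipator (ε : ℝ) : HSOp d 𝒮 →L[ℂ] HSOp d 𝒮 :=
  ∑ a ∈ m.bohrFreqs,
    (m.bohrProj a).comp ((relaxation hd hff (ε + -Complex.I * a)).comp (m.bohrProj a))

/-- Bohr frequencies are real, so `-ia` lies on the imaginary axis, up to which `relaxation` is
continuous; it is approached from the right half plane. -/
theorem tendsto_dissipator :
    Tendsto (dissipator hd hff) (𝓝[>] 0) (𝓝 (dissipator hd hff 0)) := by
  refine tendsto_finsetSum _ fun a ha => ?_
  have h1 : Tendsto (fun ε : ℝ => (ε : ℂ) + -Complex.I * a) (𝓝[>] 0)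
      (𝓝[{z : ℂ | 0 ≤ z.re}] (((0 : ℝ) : ℂ) + -Complex.I * a)) := by
    refine tendsto_nhdsWithin_iff.mpr ⟨?_, ?_⟩
    · have h2 : Continuous fun ε : ℝ => (ε : ℂ) + -Complex.I * a := by fun_prop
      exact (h2.tendsto 0).mono_left nhdsWithin_le_nhds
    · filter_upwards [self_mem_nhdsWithin] with ε hε
      have : (0 : ℝ) < ε := hε
      change 0 ≤ ((ε : ℂ) + -Complex.I * a).re
      rw [Complex.add_re, re_neg_I_mul_bohr ha]
      simpa using this.le
  have h2 := (continuousOn_relaxation hd hff (((0 : ℝ) : ℂ) + -Complex.I * a) (by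
    change 0 ≤ (((0 : ℝ) : ℂ) + -Complex.I * a).re
    rw [Complex.add_re, re_neg_I_mul_bohr ha]
    simp)).tendsto.comp h1
  have h3 : Continuous fun V : HSOp d 𝒮 →L[ℂ] HSOp d 𝒮 =>
      (m.bohrProj a).comp (V.comp (m.bohrProj a)) := by fun_prop
  exact (h3.tendsto _).comp h2

theorem generator_relaxation :
    m.generator (relaxation hd hff) = (-Complex.I) • hsAd m.kineticOp + dissipator hd hff 0 := by
  simp [generator, dissipator]

theorem dissipator_eq_integral {ε : ℝ} (hε : 0 ≤ ε) :
    dissipator hd hff ε = ∫ t in Set.Ioi (0 : ℝ), Complex.exp (-(t * ε)) •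
      ∑ a ∈ m.bohrFreqs, Complex.exp (Complex.I * t * a) •
        (m.bohrProj a).comp ((memory hd hff t).comp (m.bohrProj a)) := by
  have hz : ∀ a ∈ m.bohrFreqs, 0 ≤ ((ε : ℂ) + -Complex.I * a).re := fun a ha => by
    rw [Complex.add_re, re_neg_I_mul_bohr ha]
    simpa using hε
  let T : ℂ → (HSOp d 𝒮 →L[ℂ] HSOp d 𝒮) →L[ℂ] (HSOp d 𝒮 →L[ℂ] HSOp d 𝒮) := fun a =>
    (ContinuousLinearMap.compL ℂ _ _ _ (m.bohrProj a)).comp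
      ((ContinuousLinearMap.compL ℂ _ _ _).flip (m.bohrProj a))
  have hT : ∀ a V, T a V = (m.bohrProj a).comp (V.comp (m.bohrProj a)) := fun a V => rfl
  have h1 : ∀ a ∈ m.bohrFreqs, Integrable (fun t : ℝ =>
      Complex.exp (-(t * ((ε : ℂ) + -Complex.I * a))) • (m.bohrProj a).comp
        ((memory hd hff t).comp (m.bohrProj a))) (volume.restrict (Set.Ioi 0)) := fun a ha => by
    have := (T a).integrable_comp (laplaceIntegrable_memory hd hff (hz a ha))
    simpa only [hT, ContinuousLinearMap.smul_comp, ContinuousLinearMap.comp_smul] using this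
  have h2 : ∀ t : ℝ, Complex.exp (-(t * ε)) •
      ∑ a ∈ m.bohrFreqs, Complex.exp (Complex.I * t * a) •
        (m.bohrProj a).comp ((memory hd hff t).comp (m.bohrProj a)) =
      ∑ a ∈ m.bohrFreqs, Complex.exp (-(t * ((ε : ℂ) + -Complex.I * a))) •
        (m.bohrProj a).comp ((memory hd hff t).comp (m.bohrProj a)) := fun t => by
    rw [Finset.smul_sum]
    refine Finset.sum_congr rfl fun a _ => ?_
    rw [smul_smul, ← Complex.exp_add]
    congr 2
    ring
  simp_rw [h2]
  rw [integral_finsetSum _ h1, dissipator]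
  refine Finset.sum_congr rfl fun a ha => ?_
  rw [← hT, relaxation, laplaceTransform,
    ← (T a).integral_comp_comm (laplaceIntegrable_memory hd hff (hz a ha))]
  simp only [hT, ContinuousLinearMap.smul_comp, ContinuousLinearMap.comp_smul]

theorem norm_exp_I_mul_bohr {a : ℂ} (ha : a ∈ m.bohrFreqs) (t : ℝ) :
    ‖Complex.exp (Complex.I * t * a)‖ = 1 := by
  rw [bohr_eq_re ha, mul_assoc, ← Complex.ofReal_mul, mul_comm, Complex.norm_exp_ofReal_mul_I]

variable (m) in
/-- The non-hermitian Hamiltonian of the regularized dissipator. -/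
def driftIntegral (ε : ℝ) : 𝒮 →L[ℂ] 𝒮 :=
  -laplaceTransform (fun t => m.corr (-t) • m.driftOp t) (ε : ℂ)

theorem continuous_driftOp : Continuous m.driftOp := by
  have h1 := continuous_evolve (m := m)
  have h2 : Continuous fun t => m.evolve (-t) := h1.comp continuous_neg
  unfold driftOp
  fun_prop

theorem norm_driftOp_le (t : ℝ) : ‖m.driftOp t‖ ≤ Fintype.card m.Level := by
  refine (norm_sum_le _ _).trans ?_
  have h : ∀ e ∈ Finset.univ, ‖Complex.exp (Complex.I * t * e.val) •
      (m.levelProj e * (m.W * m.evolve (-t) * m.W) * m.levelProj e)‖ ≤ 1 := fun e _ => by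
    have he : e.val = (e.val.re : ℂ) := (Complex.conj_eq_iff_re.mp (conj_level e)).symm
    rw [norm_smul, he, mul_assoc Complex.I, ← Complex.ofReal_mul, mul_comm Complex.I,
      Complex.norm_exp_ofReal_mul_I, one_mul]
    exact norm_mul_le_one (norm_mul_le_one (norm_levelProj_le e)
      (norm_mul_le_one (norm_mul_le_one m.norm_W_le (norm_evolve_le _)) m.norm_W_le))
      (norm_levelProj_le e)
  refine (Finset.sum_le_sum h).trans (le_of_eq ?_)
  simp

theorem laplaceIntegrable_drift (hd : 4 ≤ d) (hff : m.AnalyticFormFactor δ) {ε : ℝ} (hε : 0 < ε) :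
    LaplaceIntegrable (fun t => m.corr (-t) • m.driftOp t) (ε : ℂ) := by
  have h1 := continuous_corr hd hff
  have h2 : Continuous fun t => m.corr (-t) := h1.comp continuous_neg
  have h3 := continuous_driftOp (m := m)
  refine laplaceIntegrable_of_bounded (C := m.corrBound * Fintype.card m.Level) (by fun_prop)
    (fun t => ?_) (by simpa using hε)
  rw [norm_smul]
  exact mul_le_mul (norm_corr_le hd hff _) (norm_driftOp_le t) (norm_nonneg _) corrBound_nonneg

theorem conj_corr (t : ℝ) : (starRingEnd ℂ) (m.corr t) = m.corr (-t) := by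
  rw [corr, ← integral_conj]
  simp_rw [star_corrDensity]
  rfl

theorem star_driftIntegral {ε : ℝ} :
    star (m.driftIntegral ε) =
      -laplaceTransform (fun t => m.corr t • star (m.driftOp t)) (ε : ℂ) := by
  rw [driftIntegral, star_neg]
  congr 1
  have h := (starL' ℝ : (𝒮 →L[ℂ] 𝒮) ≃L[ℝ] (𝒮 →L[ℂ] 𝒮)).integral_comp_comm
    (μ := volume.restrict (Set.Ioi 0))
    (fun t : ℝ => Complex.exp (-(t * (ε : ℂ))) • m.corr (-t) • m.driftOp t)
  simp only [starL'_apply] at h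
  refine h.symm.trans (integral_congr_ae (Eventually.of_forall fun t => ?_))
  simp only [star_smul, RCLike.star_def, conj_corr, ← Complex.exp_conj, neg_neg, map_neg, map_mul,
    Complex.conj_ofReal]

/-- The decay of the correlation at zero separation makes the bound uniform in `ε`. -/
theorem exists_norm_driftIntegral_le (hd : 4 ≤ d) (hff : m.AnalyticFormFactor δ) :
    ∃ C : ℝ, 0 ≤ C ∧ ∀ ε, 0 < ε → ‖m.driftIntegral ε‖ ≤ C := by
  obtain ⟨b, hb, hb0, h⟩ := exists_decay_bound hd hff
  refine ⟨∫ t in Set.Ioi 0, b t * Fintype.card m.Level,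
    integral_nonneg fun t => mul_nonneg (hb0 t) (Nat.cast_nonneg _), fun ε hε => ?_⟩
  rw [driftIntegral, norm_neg]
  refine norm_integral_le_of_norm_le (hb.mul_const _) ?_
  refine (ae_restrict_iff' measurableSet_Ioi).mpr (Eventually.of_forall fun t ht => ?_)
  have ht' : (0 : ℝ) < t := ht
  have h1 : Real.exp (-(t * ε)) ≤ 1 := by
    rw [Real.exp_le_one_iff]
    have := mul_pos ht' hε
    linarith
  have h2 : ‖m.corr (-t)‖ ≤ b t := by
    rw [← conj_corr, RCLike.norm_conj]
    have := h t ht' 0 0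
    rwa [weightFourier_self] at this
  rw [norm_smul, norm_smul, norm_exp_neg_mul, Complex.ofReal_re]
  calc Real.exp (-(t * ε)) * (‖m.corr (-t)‖ * ‖m.driftOp t‖) ≤
        1 * (b t * Fintype.card m.Level) := by
        refine mul_le_mul h1 (mul_le_mul h2 (norm_driftOp_le t) (norm_nonneg _) (hb0 t))
          (by positivity) zero_le_one
    _ = _ := one_mul _

/-- The regularized gain part of the dissipator. -/
def gainIntegral {ε : ℝ} (hε : 0 < ε) : HSOp d 𝒮 →L[ℂ] HSOp d 𝒮 :=
  ∑ a ∈ m.bohrFreqs, (hsWaveAvg (fun q => (m.transitionRate ε a.re q : ℂ))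
    (integrable_transitionRate hd hff hε a.re)).comp (hsSandwich (m.jumpOp a) (star (m.jumpOp a)))

/-- The gain superoperator at frequency `a` and time `t`. -/
def gainAvg (a : ℂ) (t : ℝ) : HSOp d 𝒮 →L[ℂ] HSOp d 𝒮 :=
  Complex.exp (Complex.I * t * a) • hsCorrAvg hd hff t +
    Complex.exp (-(Complex.I * t * a)) • hsCorrAvg hd hff (-t)

theorem laplaceIntegrable_gainAvg {a : ℂ} (ha : a ∈ m.bohrFreqs) {ε : ℝ} (hε : 0 < ε) :
    LaplaceIntegrable (gainAvg hd hff a) (ε : ℂ) := by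
  have h1 := continuous_hsCorrAvg hd hff
  have h2 : Continuous fun t => hsCorrAvg hd hff (-t) := h1.comp continuous_neg
  have h3 : ∀ t, ‖hsCorrAvg hd hff t‖ ≤ m.corrBound := fun t =>
    norm_hsWaveAvg_le _ corrBound_nonneg fun x y =>
      (norm_weightFourier_le _ x y).trans (integral_norm_corrDensity_le hd hff t)
  refine laplaceIntegrable_of_bounded (C := m.corrBound + m.corrBound) ?_ (fun t => ?_)
    (by simpa using hε)
  · unfold gainAvg
    fun_prop
  · refine (norm_add_le _ _).trans (add_le_add ?_ ?_)
    · rw [norm_smul, norm_exp_I_mul_bohr ha, one_mul]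
      exact h3 t
    · have h4 : -(Complex.I * (t : ℂ) * a) = Complex.I * ((-t : ℝ) : ℂ) * a := by
        push_cast
        ring
      rw [norm_smul, h4, norm_exp_I_mul_bohr ha, one_mul]
      exact h3 (-t)

theorem weightFourier_gainDensity (hd : 4 ≤ d) (hff : m.AnalyticFormFactor δ) (a t : ℝ)
    (x y : Fin d → ℤ) :
    weightFourier (m.gainDensity a t) x y =
      Complex.exp (Complex.I * t * a) * weightFourier (m.corrDensity t) x y +
        Complex.exp (-(Complex.I * t * a)) * weightFourier (m.corrDensity (-t)) x y := by
  have hi : ∀ t, Integrable fun q => m.corrDensity t q *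
      Complex.exp (Complex.I * (latticePhase q x - latticePhase q y)) := fun t => by
    refine (integrable_corrDensity hd hff t).mul_bdd (c := 1)
      (Continuous.aestronglyMeasurable (by unfold latticePhase; fun_prop))
      (Eventually.of_forall fun q => ?_)
    rw [← Complex.ofReal_sub, mul_comm Complex.I, Complex.norm_exp_ofReal_mul_I]
  rw [weightFourier, weightFourier, weightFourier, ← integral_const_mul, ← integral_const_mul,
    ← integral_add ((hi t).const_mul _) ((hi (-t)).const_mul _)]
  refine integral_congr_ae (Eventually.of_forall fun q => ?_)
  simp only [gainDensity]
  ring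

theorem kernelOf_gainAvg {a : ℂ} (ha : a ∈ m.bohrFreqs) (t : ℝ) (S : HSOp d 𝒮) (x y : Fin d → ℤ) :
    kernelOf (HSOp.op (gainAvg hd hff a t S)) x y =
      weightFourier (m.gainDensity a.re t) x y • kernelOf (HSOp.op S) x y := by
  have hw := weightFourier_gainDensity hd hff a.re t x y
  rw [← bohr_eq_re ha] at hw
  rw [hw, gainAvg, add_apply, smul_apply, smul_apply, map_add, map_smul, map_smul, kernelOf_add,
    kernelOf_smul, kernelOf_smul, hsCorrAvg, hsCorrAvg, op_hsWaveAvg, op_hsWaveAvg,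
    kernelOf_waveAvg, kernelOf_waveAvg, add_smul, smul_smul, smul_smul]

/-- One side is a Bochner integral over time, the other a weak integral over momentum. They are
compared through matrix elements, on which both are scalar multipliers. -/
theorem laplaceTransform_gainAvg {a : ℂ} (ha : a ∈ m.bohrFreqs) {ε : ℝ} (hε : 0 < ε) :
    laplaceTransform (gainAvg hd hff a) (ε : ℂ) =
      hsWaveAvg (fun q => (m.transitionRate ε a.re q : ℂ))
        (integrable_transitionRate hd hff hε a.re) := by
  ext1 S
  refine HSOp.op_injective (kernelOf_ext fun x y => ?_)
  rw [op_hsWaveAvg, kernelOf_waveAvg, ← integral_exp_mul_weightFourier hd hff hε]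
  ext v
  rw [laplaceTransform, kernelOf_integral (laplaceIntegrable_gainAvg hd hff ha hε), smul_apply,
    ← integral_smul_const]
  refine integral_congr_ae (Eventually.of_forall fun t => ?_)
  simp only [smul_apply, map_smul, kernelOf_smul, kernelOf_gainAvg hd hff ha, smul_smul]

theorem hsSandwich_one_right (A : 𝒮 →L[ℂ] 𝒮) :
    (hsSandwich A 1 : HSOp d 𝒮 →L[ℂ] HSOp d 𝒮) = (hsLeftL d 𝒮).comp (onSitesL d) A := by
  ext1 S
  exact congrArg (hsLeft (onSites A)) (HSOp.op_injective (mul_one (HSOp.op S)))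

theorem hsSandwich_one_left (A : 𝒮 →L[ℂ] 𝒮) :
    (hsSandwich 1 A : HSOp d 𝒮 →L[ℂ] HSOp d 𝒮) = (hsRightL d 𝒮).comp (onSitesL d) A := by
  ext1 S
  exact HSOp.op_injective (one_mul (HSOp.op S * onSites A))

theorem laplaceIntegrable_star_drift (hd : 4 ≤ d) (hff : m.AnalyticFormFactor δ) {ε : ℝ}
    (hε : 0 < ε) : LaplaceIntegrable (fun t => m.corr t • star (m.driftOp t)) (ε : ℂ) := by
  have h1 := continuous_corr hd hff
  have h3 := continuous_driftOp (m := m)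
  refine laplaceIntegrable_of_bounded (C := m.corrBound * Fintype.card m.Level) (by fun_prop)
    (fun t => ?_) (by simpa using hε)
  rw [norm_smul, norm_star]
  exact mul_le_mul (norm_corr_le hd hff _) (norm_driftOp_le t) (norm_nonneg _) corrBound_nonneg

theorem integrable_gainAvg_comp {ε : ℝ} (hε : 0 < ε) {a : ℂ} (ha : a ∈ m.bohrFreqs) :
    Integrable (fun t : ℝ => (Complex.exp (-(t * (ε : ℂ))) • gainAvg hd hff a t).comp
      (hsSandwich (m.jumpOp a) (star (m.jumpOp a)))) (volume.restrict (Set.Ioi 0)) :=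
  integrable_clm_comp (laplaceIntegrable_gainAvg hd hff ha hε) _

theorem gainIntegral_eq_integral {ε : ℝ} (hε : 0 < ε) :
    gainIntegral hd hff hε = ∫ t in Set.Ioi (0 : ℝ), ∑ a ∈ m.bohrFreqs,
      (Complex.exp (-(t * (ε : ℂ))) • gainAvg hd hff a t).comp
        (hsSandwich (m.jumpOp a) (star (m.jumpOp a))) := by
  rw [integral_finsetSum _ fun a ha => integrable_gainAvg_comp hd hff hε ha, gainIntegral]
  refine Finset.sum_congr rfl fun a ha => ?_
  rw [← laplaceTransform_gainAvg hd hff ha hε,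
    integral_clm_comp (laplaceIntegrable_gainAvg hd hff ha hε), laplaceTransform]

/-- The form `K S + S K* + Ψ(S)` required by `isPositive_exp_apply`. It is established for `ε > 0`
only, where the gain weights are integrable functions of `q`. -/
theorem dissipator_eq {ε : ℝ} (hε : 0 < ε) :
    dissipator hd hff ε = hsLeft (onSites (m.driftIntegral ε)) +
      hsRight (ContinuousLinearMap.adjoint (onSites (m.driftIntegral ε))) +
        gainIntegral hd hff hε := by
  have hg : ∀ a ∈ m.bohrFreqs, Integrable (fun t : ℝ => (Complex.exp (-(t * (ε : ℂ))) •
      gainAvg hd hff a t).comp (hsSandwich (m.jumpOp a) (star (m.jumpOp a))))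
      (volume.restrict (Set.Ioi 0)) := fun a ha => integrable_gainAvg_comp hd hff hε ha
  have hl := laplaceIntegrable_drift hd hff hε
  have hr := laplaceIntegrable_star_drift hd hff hε
  have el : hsLeft (onSites (m.driftIntegral ε)) = -∫ t in Set.Ioi (0 : ℝ),
      (hsLeftL d 𝒮).comp (onSitesL d) (Complex.exp (-(t * (ε : ℂ))) • m.corr (-t) •
        m.driftOp t) := by
    rw [ContinuousLinearMap.integral_comp_comm _ hl, ← map_neg]
    rfl
  have er : hsRight (ContinuousLinearMap.adjoint (onSites (m.driftIntegral ε))) =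
      -∫ t in Set.Ioi (0 : ℝ), (hsRightL d 𝒮).comp (onSitesL d)
        (Complex.exp (-(t * (ε : ℂ))) • m.corr t • star (m.driftOp t)) := by
    rw [ContinuousLinearMap.integral_comp_comm _ hr, ← map_neg, adjoint_onSites,
      ← ContinuousLinearMap.star_eq_adjoint, star_driftIntegral]
    rfl
  have il := ((hsLeftL d 𝒮).comp (onSitesL d)).integrable_comp hl
  have ir := ((hsRightL d 𝒮).comp (onSitesL d)).integrable_comp hr
  rw [el, er, gainIntegral_eq_integral, dissipator_eq_integral hd hff hε.le]
  refine Eq.trans ?_ (neg_integral_add il ir (integrable_finsetSum _ hg)).symm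
  refine integral_congr_ae (Eventually.of_forall fun t => ?_)
  simp only [sum_bohrProj_memory, hsSandwich_one_left, hsSandwich_one_right, map_smul, gain,
    ContinuousLinearMap.smul_comp, ← Finset.smul_sum]
  rw [show ∑ a ∈ m.bohrFreqs, (Complex.exp (Complex.I * t * a) • hsCorrAvg hd hff t +
      Complex.exp (-(Complex.I * t * a)) • hsCorrAvg hd hff (-t)).comp
      (hsSandwich (m.jumpOp a) (star (m.jumpOp a))) = ∑ a ∈ m.bohrFreqs,
      (gainAvg hd hff a t).comp (hsSandwich (m.jumpOp a) (star (m.jumpOp a))) from rfl]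
  module

end ParticleReservoir

/-! ### The internal trace at a site. -/

section SiteTrace

set_option maxSynthPendingDepth 3

variable {d : ℕ} {𝒮 : Type*} [NormedAddCommGroup 𝒮] [InnerProductSpace ℂ 𝒮] [CompleteSpace 𝒮]
  [FiniteDimensional ℂ 𝒮]

/-- The trace over `𝒮` of the diagonal matrix element at the site `x`. -/
def siteTrace (T : POp d 𝒮) (x : Fin d → ℤ) : ℂ :=
  LinearMap.trace ℂ 𝒮 (kernelOf T x x : 𝒮 →ₗ[ℂ] 𝒮)

theorem siteTrace_eq_sum (T : POp d 𝒮) (x : Fin d → ℤ) :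
    siteTrace T x = ∑ j, ⟪siteBasis d 𝒮 (x, j), T (siteBasis d 𝒮 (x, j))⟫_ℂ := by
  rw [siteTrace, LinearMap.trace_eq_sum_inner _ (stdOrthonormalBasis ℂ 𝒮)]
  refine Finset.sum_congr rfl fun j _ => ?_
  rw [siteBasis_apply, lp.inner_single_left]
  rfl

theorem opTrace_eq_zero {T : POp d 𝒮} (hT : IsTraceClass T) (h : ∀ x, siteTrace T x = 0) :
    opTrace T = 0 := by
  rw [opTrace, hT.summable.tsum_prod]
  simp only [tsum_fintype, ← siteTrace_eq_sum, h, tsum_zero]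

theorem siteTrace_integral {Q : Type*} [MeasurableSpace Q] {μ : Measure Q}
    {V : Q → HSOp d 𝒮 →L[ℂ] HSOp d 𝒮} (hV : Integrable V μ) (S : HSOp d 𝒮) (x : Fin d → ℤ)
    (h : ∀ q, siteTrace (HSOp.op (V q S)) x = 0) :
    siteTrace (HSOp.op ((∫ q, V q ∂μ) S)) x = 0 := by
  rw [siteTrace_eq_sum]
  simp_rw [inner_op_integral hV]
  rw [← integral_finsetSum _ fun j _ =>
    (integrable_op_apply hV S (siteBasis d 𝒮 (x, j))).const_inner _]
  simp_rw [← siteTrace_eq_sum, h, integral_zero]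

theorem siteTrace_add (T T' : POp d 𝒮) (x : Fin d → ℤ) :
    siteTrace (T + T') x = siteTrace T x + siteTrace T' x := by
  simp [siteTrace_eq_sum, Finset.sum_add_distrib]

theorem siteTrace_smul (c : ℂ) (T : POp d 𝒮) (x : Fin d → ℤ) :
    siteTrace (c • T) x = c * siteTrace T x := by
  simp [siteTrace_eq_sum, Finset.mul_sum]

theorem siteTrace_neg (T : POp d 𝒮) (x : Fin d → ℤ) : siteTrace (-T) x = -siteTrace T x := by
  simpa using siteTrace_smul (-1) T x

theorem siteTrace_sub (T T' : POp d 𝒮) (x : Fin d → ℤ) :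
    siteTrace (T - T') x = siteTrace T x - siteTrace T' x := by
  rw [sub_eq_add_neg, siteTrace_add, siteTrace_neg, sub_eq_add_neg]

theorem siteTrace_sum {ι : Type*} (s : Finset ι) (T : ι → POp d 𝒮) (x : Fin d → ℤ) :
    siteTrace (∑ i ∈ s, T i) x = ∑ i ∈ s, siteTrace (T i) x := by
  simp only [siteTrace_eq_sum, sum_apply, inner_sum]
  exact Finset.sum_comm

theorem siteTrace_waveAvg {p : EuclideanSpace ℝ (Fin d) → ℂ} (hp : Integrable p) (T : POp d 𝒮)
    (x : Fin d → ℤ) : siteTrace (waveAvg p hp T) x = (∫ q, p q) * siteTrace T x := by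
  rw [siteTrace, kernelOf_waveAvg, ParticleReservoir.weightFourier_self]
  exact map_smul (LinearMap.trace ℂ 𝒮) _ _

theorem siteTrace_sandwich (A B : 𝒮 →L[ℂ] 𝒮) (T : POp d 𝒮) (x : Fin d → ℤ) :
    siteTrace (sandwich A B T) x =
      LinearMap.trace ℂ 𝒮 ((B * A * kernelOf T x x : 𝒮 →L[ℂ] 𝒮) : 𝒮 →ₗ[ℂ] 𝒮) := by
  rw [siteTrace, kernelOf_sandwich, mul_assoc B]
  exact LinearMap.trace_mul_comm ℂ ((A * kernelOf T x x : 𝒮 →L[ℂ] 𝒮) : 𝒮 →ₗ[ℂ] 𝒮)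
    (B : 𝒮 →ₗ[ℂ] 𝒮)

theorem TraceBound.hsAd {S : HSOp d 𝒮} {c : ℝ} (hc : 0 ≤ c)
    (h : TraceBound (siteBasis d 𝒮) (HSOp.op S) c) (A : POp d 𝒮) :
    TraceBound (siteBasis d 𝒮) (HSOp.op (hsAd A S)) (2 * ‖A‖ * c) := by
  have h1 := (norm_one_clm_le (PSpace d 𝒮))
  have e : HSOp.op (_root_.hsAd A S) = A * HSOp.op S * 1 - 1 * HSOp.op S * A := by
    rw [mul_one, one_mul]
    rfl
  rw [e]
  refine ((h.conj hc A 1).sub (h.conj hc 1 A)).mono ?_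
  have h2 : c * ‖A‖ * ‖(1 : POp d 𝒮)‖ ≤ c * ‖A‖ * 1 := by gcongr
  have h3 : c * ‖(1 : POp d 𝒮)‖ * ‖A‖ ≤ c * 1 * ‖A‖ := by gcongr
  linarith

theorem opTrace_hsAd {S : HSOp d 𝒮} (hS : IsTraceClass (HSOp.op S)) (A : POp d 𝒮) :
    opTrace (HSOp.op (hsAd A S)) = 0 := by
  obtain ⟨c, hc, h⟩ := isTraceClass_iff.mp hS
  have h1 : IsTraceClass (A * HSOp.op S) := by
    have := h.conj hc A 1
    rw [mul_one] at this
    exact isTraceClass_iff.mpr ⟨_, by positivity, this⟩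
  have e : HSOp.op (hsAd A S) = A * HSOp.op S - HSOp.op S * A := rfl
  rw [e, opTrace_sub h1 (hS.mul_right A), opTrace_mul_comm hS, sub_self]

end SiteTrace

/-! ### Vanishing trace, positivity of the gain, and uniform trace-norm bounds. -/

namespace ParticleReservoir

set_option maxSynthPendingDepth 3

open Filter Topology

variable {d : ℕ} {𝒮 : Type*} [NormedAddCommGroup 𝒮] [InnerProductSpace ℂ 𝒮] [CompleteSpace 𝒮]
  [FiniteDimensional ℂ 𝒮] {m : ParticleReservoir d 𝒮} {δ : ℝ}
  (hd : 4 ≤ d) (hff : m.AnalyticFormFactor δ)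

/-- On the diagonal an average reduces to multiplication by `corr`, and cyclicity of the trace over
the internal space cancels the terms with `corr t` against each other, and likewise those with `corr
(-t)`. Working site by site needs no trace-class property, so the identity passes to the integral at
`Re z = 0`. -/
theorem siteTrace_memory (t : ℝ) (S : HSOp d 𝒮) (x : Fin d → ℤ) :
    siteTrace (HSOp.op (memory hd hff t S)) x = 0 := by
  rw [op_memory]
  simp only [siteTrace_neg, siteTrace_sub, siteTrace_smul, corrAvg, siteTrace_waveAvg,
    siteTrace_sandwich, mul_assoc, corr]
  ring

theorem siteTrace_relaxation {z : ℂ} (hz : 0 ≤ z.re) (S : HSOp d 𝒮) (x : Fin d → ℤ) :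
    siteTrace (HSOp.op (relaxation hd hff z S)) x = 0 :=
  siteTrace_integral (laplaceIntegrable_memory hd hff hz) S x fun t => by
    rw [smul_apply, map_smul, siteTrace_smul, siteTrace_memory, mul_zero]

open Classical in
theorem sum_levelProj_mul (a : ℂ) :
    ∑ p : m.Level × m.Level with p.1.val - p.2.val = a, m.levelProj p.2 * m.levelProj p.1 =
      if a = 0 then 1 else 0 := by
  rw [Finset.sum_filter, Fintype.sum_prod_type]
  have h : ∀ e : m.Level, (∑ e' : m.Level, if e.val - e'.val = a then
      m.levelProj e' * m.levelProj e else 0) = if a = 0 then m.levelProj e else 0 := fun e => by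
    rw [Finset.sum_eq_single e]
    · rw [sub_self, levelProj_mul_self]
      exact if_congr eq_comm rfl rfl
    · intro e' _ he
      rw [levelProj_mul_of_ne he, ite_self]
    · simp
  simp only [h]
  split_ifs
  · exact m.sum_levelProj
  · simp

/-- By cyclicity and completeness of the level projections, the projection on frequency `a`
preserves the internal trace if `a = 0` and annihilates it otherwise. -/
theorem siteTrace_bohrProj (a : ℂ) (S : HSOp d 𝒮) (x : Fin d → ℤ)
    (h : siteTrace (HSOp.op S) x = 0) : siteTrace (HSOp.op (m.bohrProj a S)) x = 0 := by
  classical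
  rw [bohrProj_eq, sum_apply, map_sum, siteTrace_sum]
  simp only [op_hsSandwich, siteTrace_sandwich]
  have e : ∑ p : m.Level × m.Level with p.1.val - p.2.val = a,
      LinearMap.trace ℂ 𝒮 ((m.levelProj p.2 * m.levelProj p.1 * kernelOf (HSOp.op S) x x :
        𝒮 →L[ℂ] 𝒮) : 𝒮 →ₗ[ℂ] 𝒮) =
      LinearMap.trace ℂ 𝒮 (((∑ p : m.Level × m.Level with p.1.val - p.2.val = a,
        m.levelProj p.2 * m.levelProj p.1) * kernelOf (HSOp.op S) x x :
        𝒮 →L[ℂ] 𝒮) : 𝒮 →ₗ[ℂ] 𝒮) := by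
    rw [Finset.sum_mul, ← map_sum]
    congr 1
    ext v
    simp
  rw [e, sum_levelProj_mul]
  split_ifs
  · rw [one_mul]
    exact h
  · rw [zero_mul]
    exact map_zero _

theorem siteTrace_dissipator (S : HSOp d 𝒮) (x : Fin d → ℤ) :
    siteTrace (HSOp.op (dissipator hd hff 0 S)) x = 0 := by
  rw [dissipator, sum_apply, map_sum, siteTrace_sum]
  refine Finset.sum_eq_zero fun a ha => siteTrace_bohrProj a _ x ?_
  refine siteTrace_relaxation hd hff ?_ _ x
  rw [Complex.add_re, re_neg_I_mul_bohr ha]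
  simp

theorem isPositive_gainIntegral {ε : ℝ} (hε : 0 < ε) {S : HSOp d 𝒮}
    (hS : (HSOp.op S).IsPositive) : (HSOp.op (gainIntegral hd hff hε S)).IsPositive := by
  rw [gainIntegral, sum_apply, map_sum]
  refine ContinuousLinearMap.isPositive_sum _ fun a _ => ?_
  rw [ContinuousLinearMap.comp_apply, op_hsWaveAvg, op_hsSandwich, sandwich_apply,
    ContinuousLinearMap.star_eq_adjoint, ← adjoint_onSites]
  exact isPositive_waveAvg (transitionRate_nonneg hε.le a.re) _ (IsPositive.mul_mul_adjoint hS _)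

/-- The rate is nonnegative, so its `L¹` norm is its Fourier transform at zero separation; this is a
Laplace integral of correlations at a single site, bounded by `2 ∫ b` for all `ε` and `a`.
Positivity thus converts decay of correlations into an `L¹` bound. -/
theorem exists_integral_transitionRate_le (hd : 4 ≤ d) (hff : m.AnalyticFormFactor δ) :
    ∃ C : ℝ, 0 ≤ C ∧ ∀ ε, 0 < ε → ∀ a, ∫ q, ‖(m.transitionRate ε a q : ℂ)‖ ≤ C := by
  obtain ⟨b, hb, hb0, h⟩ := exists_decay_bound hd hff
  refine ⟨∫ t in Set.Ioi 0, 2 * b t,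
    integral_nonneg fun t => mul_nonneg zero_le_two (hb0 t), fun ε hε a => ?_⟩
  have e1 : (((∫ q, ‖(m.transitionRate ε a q : ℂ)‖) : ℝ) : ℂ) =
      weightFourier (fun q => (m.transitionRate ε a q : ℂ)) 0 0 := by
    rw [weightFourier_self, ← integral_complex_ofReal]
    refine integral_congr_ae (Eventually.of_forall fun q => ?_)
    simp only [Complex.norm_real, Real.norm_of_nonneg (transitionRate_nonneg hε.le a q)]
  have e2 := congrArg norm e1
  rw [Complex.norm_real, Real.norm_of_nonneg (integral_nonneg fun _ => norm_nonneg _),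
    ← integral_exp_mul_weightFourier hd hff hε] at e2
  rw [e2]
  refine norm_integral_le_of_norm_le (hb.const_mul 2) ?_
  refine (ae_restrict_iff' measurableSet_Ioi).mpr (Eventually.of_forall fun t ht => ?_)
  have ht' : (0 : ℝ) < t := ht
  have h1 : Real.exp (-(t * ε)) ≤ 1 := by
    rw [Real.exp_le_one_iff]
    have := mul_pos ht' hε
    linarith
  have h2 := h t ht' 0 0
  have h3 : ‖weightFourier (m.corrDensity (-t)) 0 0‖ ≤ b t := by
    rw [weightFourier_corrDensity_neg, RCLike.norm_conj]
    exact h2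
  have n1 : ∀ s : ℝ, ‖Complex.exp (Complex.I * s * a)‖ = 1 := fun s => by
    rw [mul_assoc, ← Complex.ofReal_mul, mul_comm, Complex.norm_exp_ofReal_mul_I]
  have n2 : ‖Complex.exp (-(Complex.I * t * a))‖ = 1 := by
    rw [← n1 (-t)]
    push_cast
    ring_nf
  have h4 : ‖weightFourier (m.gainDensity a t) 0 0‖ ≤ 2 * b t := by
    rw [weightFourier_gainDensity hd hff]
    refine (norm_add_le _ _).trans ?_
    rw [norm_mul, norm_mul, n1, n2]
    linarith
  rw [norm_mul, norm_exp_neg_mul, Complex.ofReal_re]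
  calc Real.exp (-(t * ε)) * ‖weightFourier (m.gainDensity a t) 0 0‖ ≤ 1 * (2 * b t) :=
        mul_le_mul h1 h4 (norm_nonneg _) zero_le_one
    _ = _ := one_mul _

theorem exists_traceBound_gainIntegral :
    ∃ C : ℝ, 0 ≤ C ∧ ∀ (ε : ℝ) (hε : 0 < ε) (S : HSOp d 𝒮) (c : ℝ), 0 ≤ c →
      TraceBound (siteBasis d 𝒮) (HSOp.op S) c →
        TraceBound (siteBasis d 𝒮) (HSOp.op (gainIntegral hd hff hε S)) (C * c) := by
  obtain ⟨C, hC, h⟩ := exists_integral_transitionRate_le hd hff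
  refine ⟨∑ a ∈ m.bohrFreqs, C * (‖(onSites (m.jumpOp a) : POp d 𝒮)‖ *
    ‖(onSites (star (m.jumpOp a)) : POp d 𝒮)‖),
    Finset.sum_nonneg fun a _ => by positivity, fun ε hε S c hc hS => ?_⟩
  rw [gainIntegral, sum_apply, map_sum, Finset.sum_mul]
  refine TraceBound.sum _ fun a _ => ?_
  rw [ContinuousLinearMap.comp_apply, op_hsWaveAvg, op_hsSandwich, sandwich_apply]
  refine ((hS.conj hc _ _).waveAvg (by positivity) _).mono ?_
  rw [mul_assoc C, mul_assoc c, mul_comm c]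
  exact mul_le_mul_of_nonneg_right (h ε hε a.re) (by positivity)

/-- `isTraceNormBounded_relaxation` covers only `Re z > 0`, not the operators `L(-ia)` one by one.
Their secular sum, regularized by `ε`, has a bound uniform in `ε` thanks to its Lindblad form, and
lower semicontinuity of the trace norm takes it to `ε = 0`. -/
theorem exists_traceBound_dissipator :
    ∃ C : ℝ, 0 ≤ C ∧ ∀ (S : HSOp d 𝒮) (c : ℝ), 0 ≤ c →
      TraceBound (siteBasis d 𝒮) (HSOp.op S) c →
        TraceBound (siteBasis d 𝒮) (HSOp.op (dissipator hd hff 0 S)) (C * c) := by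
  obtain ⟨C, hC, h⟩ := exists_traceBound_gainIntegral hd hff
  obtain ⟨D, hD, h'⟩ := exists_norm_driftIntegral_le (m := m) hd hff
  refine ⟨D + D + C, by positivity, fun S c hc hS => ?_⟩
  have h1 : Tendsto (fun ε => dissipator hd hff ε S) (𝓝[>] 0) (𝓝 (dissipator hd hff 0 S)) :=
    ((ContinuousLinearMap.apply ℂ (HSOp d 𝒮) S).continuous.tendsto _).comp
      (tendsto_dissipator hd hff)
  refine TraceBound.of_tendsto (fun x y => HSOp.tendsto_inner h1 x y) tendsto_const_nhds ?_
  filter_upwards [self_mem_nhdsWithin] with ε hε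
  have hε' : 0 < ε := hε
  set K : POp d 𝒮 := onSites (m.driftIntegral ε)
  have hK : ‖K‖ ≤ D := (norm_onSites _).trans (h' ε hε')
  have hK' : ‖ContinuousLinearMap.adjoint K‖ ≤ D := (LinearIsometryEquiv.norm_map _ K).trans_le hK
  have e : HSOp.op (dissipator hd hff ε S) = K * HSOp.op S * 1 +
      1 * HSOp.op S * ContinuousLinearMap.adjoint K + HSOp.op (gainIntegral hd hff hε' S) := by
    rw [dissipator_eq hd hff hε', mul_one, one_mul]
    rfl
  rw [e]
  have h1 := norm_one_clm_le (PSpace d 𝒮)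
  refine (((hS.conj hc K 1).add (hS.conj hc 1 _)).add (h ε hε' S c hc hS)).mono ?_
  have h2 : c * ‖K‖ * ‖(1 : POp d 𝒮)‖ ≤ c * D * 1 := by gcongr
  have h3 : c * ‖(1 : POp d 𝒮)‖ * ‖ContinuousLinearMap.adjoint K‖ ≤ c * 1 * D := by gcongr
  linarith

end ParticleReservoir

/-! ### The generator and the semigroup. -/

namespace ParticleReservoir

set_option maxSynthPendingDepth 3

open Filter Topology
open scoped ComplexOrder

variable {d : ℕ} {𝒮 : Type*} [NormedAddCommGroup 𝒮] [InnerProductSpace ℂ 𝒮] [CompleteSpace 𝒮]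
  [FiniteDimensional ℂ 𝒮] {m : ParticleReservoir d 𝒮} {δ δ' : ℝ}
  (hd : 4 ≤ d) (hff : m.AnalyticFormFactor δ)

theorem actsEntrywise_dissipator : ActsEntrywise (dissipator hd hff 0) := by
  classical
  have h : ∀ a, ActsEntrywise (m.bohrProj a) := fun a => by
    rw [bohrProj_eq]
    exact ActsEntrywise.sum _ fun _ _ => actsEntrywise_hsSandwich _ _
  refine ActsEntrywise.sum _ fun a ha => (h a).comp (ActsEntrywise.comp ?_ (h a))
  refine actsEntrywise_relaxation hd hff ?_
  rw [Complex.add_re, re_neg_I_mul_bohr ha]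
  simp

theorem isJConj_hsAd_kineticOp (hdisp : m.AnalyticDispersion δ') {κL κR : Fin d → ℂ}
    (hL : imNorm κL ≤ δ') (hR : imNorm κR ≤ δ') :
    IsJConj κL κR (hsAd m.kineticOp)
      (hsLeft (kineticShift hdisp κL hL) - hsRight (kineticShift hdisp κR hR)) :=
  isJConj_hsAd
    (fun x y => by rw [kernelOf_kineticShift, kernelOf_kineticOp hdisp])
    (fun x y => by rw [kernelOf_kineticShift, kernelOf_kineticOp hdisp])

theorem isJConj_generator (hdisp : m.AnalyticDispersion δ') {κL κR : Fin d → ℂ}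
    (hL : imNorm κL ≤ δ') (hR : imNorm κR ≤ δ') :
    IsJConj κL κR (m.generator (relaxation hd hff))
      ((-Complex.I) • (hsLeft (kineticShift hdisp κL hL) - hsRight (kineticShift hdisp κR hR)) +
        dissipator hd hff 0) := by
  rw [generator_relaxation]
  exact ((isJConj_hsAd_kineticOp hdisp hL hR).smul _).add
    ((actsEntrywise_dissipator hd hff).isJConj κL κR)

theorem norm_hsLeft_sub_hsRight_sub_le (A A' B B' : POp d 𝒮) :
    ‖(hsLeft A - hsRight B) - (hsLeft A' - hsRight B')‖ ≤ ‖A - A'‖ + ‖B - B'‖ := by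
  have e : (hsLeft A - hsRight B) - (hsLeft A' - hsRight B') =
      hsLeft (A - A') - hsRight (B - B') := by
    rw [← hsLeftL_apply, ← hsLeftL_apply, ← hsLeftL_apply, ← hsRightL_apply, ← hsRightL_apply,
      ← hsRightL_apply, map_sub, map_sub]
    abel
  rw [e]
  exact (norm_sub_le _ _).trans (add_le_add (norm_hsLeft_le _) (norm_hsRight_le _))

/-- The dissipator occurs unchanged in all conjugates, so differences involve only left and right
multiplication by shifted kinetic energies. -/
theorem exists_isJConj_generator (hdisp : m.AnalyticDispersion δ') {κL κR : Fin d → ℂ}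
    (hL : imNorm κL ≤ δ') (hR : imNorm κR ≤ δ') :
    ∃ A A₀ D : HSOp d 𝒮 →L[ℂ] HSOp d 𝒮,
      IsJConj κL κR (m.generator (relaxation hd hff)) A ∧
      IsJConj (rePart κL) (rePart κR) (m.generator (relaxation hd hff)) A₀ ∧
      IsJConj κL κR (hsAd m.kineticOp) D ∧
      A - m.generator (relaxation hd hff) = (-Complex.I) • (D - hsAd m.kineticOp) ∧
      ‖A - A₀‖ ≤ m.qDisp (imNorm κL) + m.qDisp (imNorm κR) ∧
      (rePart κL = 0 → rePart κR = 0 →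
        ‖A - m.generator (relaxation hd hff)‖ ≤ m.qDisp (imNorm κL) + m.qDisp (imNorm κR)) := by
  have hL0 := imNorm_rePart_le hdisp κL
  have hR0 := imNorm_rePart_le hdisp κR
  have hle : ‖((-Complex.I) • (hsLeft (kineticShift hdisp κL hL) -
      hsRight (kineticShift hdisp κR hR)) + dissipator hd hff 0) -
      ((-Complex.I) • (hsLeft (kineticShift hdisp (rePart κL) hL0) -
      hsRight (kineticShift hdisp (rePart κR) hR0)) + dissipator hd hff 0)‖ ≤
      m.qDisp (imNorm κL) + m.qDisp (imNorm κR) := by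
    rw [add_sub_add_right_eq_sub, ← smul_sub, norm_smul, norm_neg, Complex.norm_I, one_mul]
    exact (norm_hsLeft_sub_hsRight_sub_le _ _ _ _).trans (add_le_add
      (norm_kineticShift_sub_le hdisp κL hL) (norm_kineticShift_sub_le hdisp κR hR))
  refine ⟨_, _, _, isJConj_generator hd hff hdisp hL hR, isJConj_generator hd hff hdisp hL0 hR0,
    isJConj_hsAd_kineticOp hdisp hL hR, ?_, hle, fun h1 h2 => ?_⟩
  · rw [generator_relaxation, add_sub_add_right_eq_sub, ← smul_sub]
  · have h3 : m.generator (relaxation hd hff) =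
        (-Complex.I) • (hsLeft (kineticShift hdisp (rePart κL) hL0) -
          hsRight (kineticShift hdisp (rePart κR) hR0)) + dissipator hd hff 0 := by
      simp only [h1, h2]
      rw [generator_relaxation, ← kineticOp_eq hdisp, hsAd]
    rwa [← h3] at hle

theorem exists_traceBound_generator :
    ∃ C : ℝ, 0 ≤ C ∧ ∀ (S : HSOp d 𝒮) (c : ℝ), 0 ≤ c →
      TraceBound (siteBasis d 𝒮) (HSOp.op S) c →
        TraceBound (siteBasis d 𝒮) (HSOp.op (m.generator (relaxation hd hff) S)) (C * c) := by
  obtain ⟨C, hC, h⟩ := exists_traceBound_dissipator hd hff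
  refine ⟨2 * ‖m.kineticOp‖ + C, by positivity, fun S c hc hS => ?_⟩
  rw [generator_relaxation, add_apply, smul_apply, map_add, map_smul]
  refine (((hS.hsAd hc m.kineticOp).smul (-Complex.I)).add (h S c hc hS)).mono ?_
  rw [norm_neg, Complex.norm_I]
  exact le_of_eq (by ring)

theorem opTrace_generator {S : HSOp d 𝒮} (hS : IsTraceClass (HSOp.op S)) :
    opTrace (HSOp.op (m.generator (relaxation hd hff) S)) = 0 := by
  obtain ⟨C, hC, h⟩ := exists_traceBound_dissipator hd hff
  obtain ⟨c, hc, hS'⟩ := isTraceClass_iff.mp hS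
  have h1 : IsTraceClass (HSOp.op (dissipator hd hff 0 S)) :=
    isTraceClass_iff.mpr ⟨_, mul_nonneg hC hc, h S c hc hS'⟩
  have h2 : IsTraceClass (HSOp.op (hsAd m.kineticOp S)) :=
    isTraceClass_iff.mpr ⟨_, by positivity, hS'.hsAd hc m.kineticOp⟩
  rw [generator_relaxation, add_apply, smul_apply, map_add, map_smul,
    opTrace_add (h2.smul _) h1, opTrace_smul, opTrace_hsAd hS, mul_zero, zero_add]
  exact opTrace_eq_zero h1 (siteTrace_dissipator hd hff S)

/-- The generator of the semigroup `Λ_t`. -/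
def markovGenerator (lam : ℝ) : HSOp d 𝒮 →L[ℂ] HSOp d 𝒮 :=
  (-Complex.I) • hsAd (onSites m.Y) + ((lam : ℂ) ^ 2) • m.generator (relaxation hd hff)

theorem markovSemigroup_eq (lam t : ℝ) :
    m.markovSemigroup (relaxation hd hff) lam t =
      NormedSpace.exp ((t : ℂ) • markovGenerator hd hff lam) := rfl

theorem exists_traceBound_markovGenerator (lam : ℝ) :
    ∃ C : ℝ, 0 ≤ C ∧ ∀ (S : HSOp d 𝒮) (c : ℝ), 0 ≤ c →
      TraceBound (siteBasis d 𝒮) (HSOp.op S) c →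
        TraceBound (siteBasis d 𝒮) (HSOp.op (markovGenerator hd hff lam S)) (C * c) := by
  obtain ⟨C, hC, h⟩ := exists_traceBound_generator hd hff
  refine ⟨2 * ‖(onSites m.Y : POp d 𝒮)‖ + ‖(lam : ℂ) ^ 2‖ * C, by positivity,
    fun S c hc hS => ?_⟩
  rw [markovGenerator, add_apply, smul_apply, smul_apply, map_add, map_smul, map_smul]
  refine (((hS.hsAd hc (onSites m.Y)).smul (-Complex.I)).add
    ((h S c hc hS).smul ((lam : ℂ) ^ 2))).mono ?_
  rw [norm_neg, Complex.norm_I]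
  exact le_of_eq (by ring)

theorem opTrace_markovGenerator (lam : ℝ) {S : HSOp d 𝒮} (hS : IsTraceClass (HSOp.op S)) :
    opTrace (HSOp.op (markovGenerator hd hff lam S)) = 0 := by
  obtain ⟨C, hC, h⟩ := exists_traceBound_generator hd hff
  obtain ⟨c, hc, hS'⟩ := isTraceClass_iff.mp hS
  have h1 : IsTraceClass (HSOp.op (m.generator (relaxation hd hff) S)) :=
    isTraceClass_iff.mpr ⟨_, mul_nonneg hC hc, h S c hc hS'⟩
  have h2 : IsTraceClass (HSOp.op (hsAd (onSites m.Y) S)) :=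
    isTraceClass_iff.mpr ⟨_, by positivity, hS'.hsAd hc (onSites m.Y)⟩
  rw [markovGenerator, add_apply, smul_apply, smul_apply, map_add, map_smul, map_smul,
    opTrace_add (h2.smul _) (h1.smul _), opTrace_smul, opTrace_smul, opTrace_hsAd hS,
    opTrace_generator hd hff hS, mul_zero, mul_zero, zero_add]

theorem markovSemigroup_comp (L : ℂ → HSOp d 𝒮 →L[ℂ] HSOp d 𝒮) (lam t₁ t₂ : ℝ) :
    (m.markovSemigroup L lam t₁).comp (m.markovSemigroup L lam t₂) =
      m.markovSemigroup L lam (t₁ + t₂) := by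
  let _ : NormedAlgebra ℚ (HSOp d 𝒮 →L[ℂ] HSOp d 𝒮) := NormedAlgebra.restrictScalars ℚ ℂ _
  rw [markovSemigroup, markovSemigroup, markovSemigroup, Complex.ofReal_add, add_smul]
  exact (NormedSpace.exp_add_of_commute
    (((Commute.refl _).smul_left (t₁ : ℂ)).smul_right (t₂ : ℂ))).symm

/-- The generator of the semigroup with the regularized dissipator. -/
def regularGenerator (lam ε : ℝ) : HSOp d 𝒮 →L[ℂ] HSOp d 𝒮 :=
  (-Complex.I) • hsAd (onSites m.Y) +
    ((lam : ℂ) ^ 2) • ((-Complex.I) • hsAd m.kineticOp + dissipator hd hff ε)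

variable (m) in
/-- The non-hermitian Hamiltonian, times `-i`, of the regularized generator. -/
def effectiveHamiltonian (lam ε : ℝ) : POp d 𝒮 :=
  (-Complex.I) • onSites m.Y +
    ((lam : ℂ) ^ 2) • ((-Complex.I) • m.kineticOp + onSites (m.driftIntegral ε))

/-- For self-adjoint `H` the commutator `-i ad(H)` has the form `K S + S K*` with `K = -iH`; this
absorbs `Y` and `ε(P)` into the effective Hamiltonian. -/
theorem regularGenerator_eq (hdisp : m.AnalyticDispersion δ') (lam : ℝ) {ε : ℝ} (hε : 0 < ε) :
    regularGenerator hd hff lam ε = hsLeft (m.effectiveHamiltonian lam ε) +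
      hsRight (ContinuousLinearMap.adjoint (m.effectiveHamiltonian lam ε)) +
        ((lam : ℂ) ^ 2) • gainIntegral hd hff hε := by
  have h1 : ContinuousLinearMap.adjoint m.kineticOp = m.kineticOp :=
    (isSelfAdjoint_kineticOp hdisp).star_eq
  have h2 : ContinuousLinearMap.adjoint (onSites m.Y : POp d 𝒮) = onSites m.Y := by
    rw [adjoint_onSites]
    exact congrArg onSites m.isSelfAdjoint_Y.star_eq
  have h3 : ContinuousLinearMap.adjoint (m.effectiveHamiltonian lam ε) =
      Complex.I • onSites m.Y + ((lam : ℂ) ^ 2) • (Complex.I • m.kineticOp +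
        ContinuousLinearMap.adjoint (onSites (m.driftIntegral ε))) := by
    rw [effectiveHamiltonian, map_add, map_smulₛₗ, map_smulₛₗ, map_add, map_smulₛₗ, h1, h2]
    simp
  rw [h3, regularGenerator, dissipator_eq hd hff hε, effectiveHamiltonian, hsAd, hsAd]
  simp only [← hsLeftL_apply, ← hsRightL_apply, map_add, map_smul]
  module

theorem tendsto_regularGenerator (lam : ℝ) :
    Tendsto (regularGenerator hd hff lam) (𝓝[>] 0) (𝓝 (markovGenerator hd hff lam)) := by
  have h : Continuous fun V : HSOp d 𝒮 →L[ℂ] HSOp d 𝒮 => (-Complex.I) • hsAd (onSites m.Y) +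
      ((lam : ℂ) ^ 2) • ((-Complex.I) • hsAd m.kineticOp + V) := by fun_prop
  have h1 := (h.tendsto _).comp (tendsto_dissipator hd hff)
  rw [← generator_relaxation] at h1
  exact h1

/-- Positivity is preserved for every `ε > 0` by `isPositive_exp_apply`, and it passes to `ε = 0`
because the generators converge in norm and the exponential is continuous. -/
theorem isPositive_markovSemigroup (hdisp : m.AnalyticDispersion δ') (lam : ℝ) {t : ℝ}
    (ht : 0 ≤ t) {ρ : HSOp d 𝒮} (hρ : (HSOp.op ρ).IsPositive) :
    (HSOp.op (m.markovSemigroup (relaxation hd hff) lam t ρ)).IsPositive := by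
  rw [markovSemigroup_eq]
  have h1 : Tendsto (fun ε => NormedSpace.exp ((t : ℂ) • regularGenerator hd hff lam ε) ρ)
      (𝓝[>] 0) (𝓝 (NormedSpace.exp ((t : ℂ) • markovGenerator hd hff lam) ρ)) := by
    let _ : NormedAlgebra ℚ (HSOp d 𝒮 →L[ℂ] HSOp d 𝒮) := NormedAlgebra.restrictScalars ℚ ℂ _
    have h2 : Continuous fun V : HSOp d 𝒮 →L[ℂ] HSOp d 𝒮 => NormedSpace.exp ((t : ℂ) • V) :=
      NormedSpace.exp_continuous.comp (by fun_prop)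
    have h3 : Continuous fun V : HSOp d 𝒮 →L[ℂ] HSOp d 𝒮 => NormedSpace.exp ((t : ℂ) • V) ρ :=
      (ContinuousLinearMap.apply ℂ (HSOp d 𝒮) ρ).continuous.comp h2
    exact (h3.tendsto _).comp (tendsto_regularGenerator hd hff lam)
  refine HSOp.isPositive_of_tendsto h1 ?_
  filter_upwards [self_mem_nhdsWithin] with ε hε
  rw [regularGenerator_eq hd hff hdisp lam hε]
  refine isPositive_exp_apply (fun S hS => ?_) ht hρ
  rw [smul_apply, map_smul]
  have h0 : (0 : ℂ) ≤ (lam : ℂ) ^ 2 := by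
    rw [← Complex.ofReal_pow]
    exact Complex.zero_le_real.mpr (sq_nonneg lam)
  exact (isPositive_gainIntegral hd hff hε hS).smul_of_nonneg h0

end ParticleReservoir

theorem proposition4p1 {d : ℕ} (hd : 4 ≤ d) {𝒮 : Type*} [NormedAddCommGroup 𝒮]
    [InnerProductSpace ℂ 𝒮] [CompleteSpace 𝒮] [FiniteDimensional ℂ 𝒮]
    (m : ParticleReservoir d 𝒮) (δε δR : ℝ)
    (hdisp : m.AnalyticDispersion δε) (hff : m.AnalyticFormFactor δR) :
    -- `ε(P)` is a bounded operator
    (∀ x y, kernelOf m.kineticOp x y = m.kineticKernel x y) ∧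
    ∃ (Lhat : ℝ → (POp d 𝒮 →L[ℂ] POp d 𝒮)) (L : ℂ → (HSOp d 𝒮 →L[ℂ] HSOp d 𝒮)),
      -- `Lhat` is the family `L̂⋆(t)` and its Laplace transform exists for `Re z > 0`
      (∀ (t : ℝ) (S : POp d 𝒮) (x y : Fin d → ℤ),
        kernelOf (Lhat t S) x y = m.lHatKernel t S x y) ∧
      (∀ z : ℂ, 0 < z.re → LaplaceIntegrable Lhat z) ∧
      -- for `Re z > 0`, `L z` is the dual of the Laplace transform, acting on trace-class operators
      (∀ z : ℂ, 0 < z.re →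
        IsTraceNormBounded (L z) ∧ IsDualOf (L z) (laplaceTransform Lhat z)) ∧
      -- continuous continuation to `Re z ≥ 0`
      ContinuousOn L {z : ℂ | 0 ≤ z.re} ∧
      -- bounds on the conjugated operators `J_κ L(z) J_{-κ} = L(z)`
      (∀ κL κR : Fin d → ℂ, ∃ A : ℂ → (HSOp d 𝒮 →L[ℂ] HSOp d 𝒮),
        (∀ z : ℂ, 0 ≤ z.re → IsJConj κL κR (L z) (A z) ∧ A z = L z) ∧
        ∃ C : ℝ, ∀ z : ℂ, 0 ≤ z.re → ‖A z‖ ≤ C) ∧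
      -- `M`, a bounded operator on `B₂` by its type, is bounded on `B₁`
      IsTraceNormBounded (m.generator L) ∧
      -- conjugation of `M`: with `A = J_κ M J_{-κ}`, `A₀ = J_{Re κ} M J_{-Re κ}` (a unitary
      -- conjugation), and `D = J_κ ad(ε(P)) J_{-κ}`
      (∀ κL κR : Fin d → ℂ, imNorm κL ≤ δε → imNorm κR ≤ δε →
        ∃ A A₀ D : HSOp d 𝒮 →L[ℂ] HSOp d 𝒮,
          IsJConj κL κR (m.generator L) A ∧
          IsJConj (rePart κL) (rePart κR) (m.generator L) A₀ ∧
          IsJConj κL κR (hsAd m.kineticOp) D ∧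
          A - m.generator L = (-Complex.I) • (D - hsAd m.kineticOp) ∧
          ‖A - A₀‖ ≤ m.qDisp (imNorm κL) + m.qDisp (imNorm κR) ∧
          (rePart κL = 0 → rePart κR = 0 →
            ‖A - m.generator L‖ ≤ m.qDisp (imNorm κL) + m.qDisp (imNorm κR))) ∧
      -- `Λ_t` is a quantum dynamical semigroup
      ∀ lam : ℝ,
        (∀ t₁ t₂ : ℝ, 0 ≤ t₁ → 0 ≤ t₂ →
          (m.markovSemigroup L lam t₁).comp (m.markovSemigroup L lam t₂) =
            m.markovSemigroup L lam (t₁ + t₂)) ∧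
        (∀ t : ℝ, 0 ≤ t → IsTraceNormBounded (m.markovSemigroup L lam t)) ∧
        ∀ (t : ℝ) (ρ : HSOp d 𝒮), 0 ≤ t → IsTraceClass (HSOp.op ρ) → (HSOp.op ρ).IsPositive →
          (HSOp.op (m.markovSemigroup L lam t ρ)).IsPositive ∧
          opTrace (HSOp.op (m.markovSemigroup L lam t ρ)) = opTrace (HSOp.op ρ) := by
  -- The extension to `Re z = 0` is given by the same Laplace integral as for `Re z > 0`, and `J_κ
  -- L(z) J_{-κ}` is witnessed by `L(z)` itself.
  refine ⟨kernelOf_kineticOp hdisp, ParticleReservoir.memoryStar hd hff,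
    ParticleReservoir.relaxation hd hff, ParticleReservoir.kernelOf_memoryStar hd hff,
    fun z hz => ParticleReservoir.laplaceIntegrable_memoryStar hd hff hz,
    fun z hz => ⟨ParticleReservoir.isTraceNormBounded_relaxation hd hff hz,
      ParticleReservoir.isDualOf_relaxation hd hff hz⟩,
    ParticleReservoir.continuousOn_relaxation hd hff, fun κL κR =>
      ⟨ParticleReservoir.relaxation hd hff, fun z hz =>
        ⟨(ParticleReservoir.actsEntrywise_relaxation hd hff hz).isJConj κL κR, rfl⟩,
        ParticleReservoir.exists_norm_relaxation_le hd hff⟩, ?_,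
    fun κL κR hL hR => ParticleReservoir.exists_isJConj_generator hd hff hdisp hL hR,
    fun lam => ⟨fun t₁ t₂ _ _ => ParticleReservoir.markovSemigroup_comp _ lam t₁ t₂,
      fun t _ => ?_, fun t ρ ht hρ hpos =>
        ⟨ParticleReservoir.isPositive_markovSemigroup hd hff hdisp lam ht hpos, ?_⟩⟩⟩
  · obtain ⟨C, hC, h⟩ := ParticleReservoir.exists_traceBound_generator hd hff
    exact isTraceNormBounded_of_traceBound hC h
  · obtain ⟨C, hC, h⟩ := ParticleReservoir.exists_traceBound_markovGenerator hd hff lam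
    exact isTraceNormBounded_of_traceBound (Real.exp_pos _).le
      fun S c hc hS => (TraceBound.exp_apply hC h (t : ℂ) hc hS).1
  · obtain ⟨C, hC, h⟩ := ParticleReservoir.exists_traceBound_markovGenerator hd hff lam
    obtain ⟨c, hc, hρ'⟩ := isTraceClass_iff.mp hρ
    exact (TraceBound.exp_apply hC h (t : ℂ) hc hρ').2
      fun S hS => ParticleReservoir.opTrace_markovGenerator hd hff lam hS
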